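/- **Setting.** Let $\Bbbk$ be a field of characteristic $0$ and $Q$ a finite quiver with set of vertices $Q_0$, set of arrows $Q_1$ and paths $e_i$ $(i\in Q_0)$ of length $0$. Unadorned $\otimes$ and $\operatorname{Hom}$ are over $\Bbbk Q_0$, respectively over $\Bbbk Q_0\otimes_\Bbbk \Bbbk Q_0^{\mathrm{op}}$. Let $I\subset \Bbbk Q$ be a two-sided ideal, $A=\Bbbk Q/I$, and let $\prec$ be an admissible order on the set of paths (a well-order compatible with left and right concatenation for which a path is at least as large as each of its subpaths). Let $R=\{(s,\varphi_s)\}_{s\in S}$ be a reduction system satisfying $(\diamond)$ for $I$: $S$ is a set of paths of length $\ge 2$, none a proper subpath of another; each $\varphi_s$ is a linear combination of paths parallel to $s$ that are irreducible (i.e. have no subpath in $S$); $I=\langle s-\varphi_s\rangle_{s\in S}$; and every path is reduction unique (every infinite sequence of reductions, where a basic reduction replaces one path $qsr$ by $q\varphi_s r$, becomes stationary on it, and all irreducible results of reductions of it coincide). Assume that $R$ comes from a noncommutative Gröbner basis: $\{s-\varphi_s\}_{s\in S}$ is a (reduced) Gröbner basis of $I$ for $\prec$ and $s$ is the largest path in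 $s-\varphi_s$. Let $\mathrm{Irr}_S$ be the set of irreducible paths and identify $\operatorname{Hom}(\Bbbk S,A)=\operatorname{Hom}(\Bbbk S,\Bbbk\,\mathrm{Irr}_S)$ via the basis $\mathrm{Irr}_S$ of $A$. Let $\operatorname{Hom}(\Bbbk S,A)_\prec$ be the subspace of those $\widetilde\varphi$ for which $\widetilde\varphi_s$ is a combination of paths $\prec s$, for all $s\in S$. Assume $N=\dim \operatorname{Hom}(\Bbbk S,A)_\prec<\infty$ and fix a basis $b_1,\dots,b_N$. For $\psi\in\operatorname{Hom}(\Bbbk S,\Bbbk\,\mathrm{Irr}_S)$ put $R_\psi=\{(s,\psi_s)\}$ and $A_\psi=\Bbbk Q/\langle s-\psi_s\rangle$, and let $$V_\prec=\{\widetilde\varphi\in\operatorname{Hom}(\Bbbk S,A)_\prec \mid R_{\varphi+\widetilde\varphi}\ \text{is reduction unique}\}.$$ Let $\mathrm{MC}\subset\operatorname{Hom}(\Bbbk S,\Bbbk\,\mathrm{Irr}_S)$ be the set of all $\psi$ with $R_\psi$ reduction unique. For $\psi,\psi'\in \mathrm{MC}$ let $G(\psi,\psi')$ be the set of $\Bbbk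 Q_0$-bimodule automorphisms $T$ of $\Bbbk\,\mathrm{Irr}_S$ with $T(e_i)=e_i$ for all $i$ and $T(\mathrm{red}^{(\infty)}_{\psi'}(p))=\mathrm{red}^{(\infty)}_{\psi}(T(p_1)\cdots T(p_m))$ for all paths $p=p_1\cdots p_m$ $(p_i\in Q_1)$, where $\mathrm{red}^{(\infty)}$ is iterated right-most reduction; $R_\psi$ and $R_{\psi'}$ are called equivalent if $G(\psi,\psi')\ne\emptyset$. Let $P_\bullet$, $P_n=A\otimes\Bbbk S_n\otimes A$ (with $S_0=Q_0$, $S_1=Q_1$, $S_2=S$, and $S_{n+2}$ the set of $n$-ambiguities), with differential $\partial_\bullet$ and homotopy $\rho_\bullet$, be the Chouhy–Solotar bimodule resolution of $A$ given by $R$: $\rho_{-1}(a)=a\otimes1$, $\partial_0(a\otimes b)=ab$, $\partial_n(1\otimes w\otimes1)=(\mathrm{id}-\rho_{n-2}\partial_{n-1})\delta_n(1\otimes w\otimes1)$ and $\rho_{n-1}=\sum_{i\ge0}\gamma_{n-1}(\delta_n\gamma_{n-1}-\partial_n\gamma_{n-1})^i$. Here $\delta_n(1\otimes w\otimes 1)$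 is the sum of all $\pi(q)\otimes w'\otimes\pi(r)$ with $w=qw'r$, $w'\in S_{n-1}$, if $n$ is even, and the term with the right-most minus the term with the left-most such $w'$ if $n$ is odd; and $\gamma_{n-1}$ is left $A$-linear with $\gamma_{n-1}(1\otimes w\otimes\pi(u))=(-1)^n\sum_{wu=qw'r,\,w'\in S_n}\pi(q)\otimes w'\otimes\pi(r)$ for $u\in\mathrm{Irr}_S$. Let $F_n\colon P_n\to\mathrm{Bar}_n$, $G_n\colon\mathrm{Bar}_n\to P_n$, $h_n\colon\mathrm{Bar}_n\to\mathrm{Bar}_{n+1}$ be the homotopy retract to the normalized $\Bbbk Q_0$-relative bar resolution $(\mathrm{Bar}_\bullet,d_\bullet)$ given by $F_0=G_0=\mathrm{id}$, $F_n(a\otimes w\otimes b)=(-1)^nF_{n-1}\partial_n(a\otimes w\otimes 1)\otimes b$, $G_n(y\otimes b)=\rho_{n-1}G_{n-1}d_n(y\otimes1)\,b$, $h_0=0$, $h_n(y\otimes b)=\bigl(h_{n-1}(y)+(-1)^{n+1}F_nG_n(y\otimes 1)\bigr)\otimes b$ (with $A\to A/\Bbbk Q_0$ applied to the last factor where needed),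 and let $F^n,G^n,h^n$ be the dual maps on cochains. Let $\mathbf p(Q,R)$ be the $L_\infty[1]$ algebra on $\operatorname{Hom}(\Bbbk S_{\bullet+2},A)$ obtained from the shifted Hochschild complex by homotopy transfer along these maps. On $\operatorname{Hom}(\Bbbk S,A)$ its unary bracket is $f\mapsto f\circ\partial_3$, and for $n\ge2$ $$\langle f_1,\dots,f_n\rangle=\sum_{\{Y,Z\}}F^3[G_Y,G_Z],\qquad G_{\{i\}}=G^2(f_i),\qquad G_X=\sum_{\{Y,Z\}}h^2[G_Y,G_Z],$$ the sums running over unordered decompositions into two nonempty disjoint subsets of $\{1,\dots,n\}$, respectively of $X$, where $[f,g]=-(f\bullet g+g\bullet f)$ and $(f\bullet g)(a,b,c)=f(g(a,b),c)-f(a,g(b,c))$. The Maurer–Cartan equation is $\sum_{n\ge1}\frac1{n!}\langle\widetilde\varphi,\dots,\widetilde\varphi\rangle_n=0$. **Theorem 9.2.** 1. For every $w\in S_3$ and $\widetilde\varphi\in\operatorname{Hom}(\Bbbk S,A)_\prec$ the sum in the Maurer–Cartan equation is finite at $w$. The coefficients of its left-hand side at $\widetilde\varphi=\sum x_ib_i$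 with respect to the basis $\mathrm{Irr}_S$ of $A$ are the values at $x$ of the polynomials in $\Bbbk[X_1,\dots,X_N]$ obtained by evaluating the brackets on the $b_i$ (in each of these polynomials only finitely many brackets contribute). An element of $\operatorname{Hom}(\Bbbk S,A)_\prec$ lies in $V_\prec$ if and only if it satisfies the Maurer–Cartan equation, i.e. $V_\prec\subset\mathbb A^N$ is the zero set of these polynomials. More generally, for every commutative $\Bbbk$-algebra $B$, a point $x\in B^N$ is a zero of these polynomials if and only if the reduction system of $\varphi+\sum x_ib_i$ over $B$ is reduction unique. Thus the polynomials define $V_\prec$ as an affine scheme with $B$-points $V_\prec(B)$. 2. The sets $G(\psi,\psi')$ contain the identities and are closed under composition and inverses, so they form a groupoid $G\rightrightarrows\mathrm{MC}$, which via $\widetilde\varphi\mapsto\varphi+\widetilde\varphi$ restricts to a groupoid $G_\prec\rightrightarrows V_\prec$. For $\widetilde\varphi,\widetilde\varphi'\in V_\prec$ the following are equivalent: $R_{\varphi+\widetilde\varphi}$ and $R_{\varphi+\widetilde\varphi'}$ are equivalent; $\widetilde\varphi$ and $\widetilde\varphi'$ lie in the same orbit of $G_\prec$; there is a $\Bbbk$-algebra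 isomorphism $A_{\varphi+\widetilde\varphi}\simeq A_{\varphi+\widetilde\varphi'}$ that maps $e_i$ to $e_i$ for all $i\in Q_0$. 3. Let $\widetilde\varphi\in V_\prec$. The Zariski tangent space $\mathrm T_{\widetilde\varphi}V_\prec$ of the scheme in 1, as a subspace of $\operatorname{Hom}(\Bbbk S,A)_\prec$, equals $\{v \mid \widetilde\varphi+\epsilon v\in V_\prec(\Bbbk[\epsilon]/(\epsilon^2))\}$ and is the space of $2$-cocycles in $\operatorname{Hom}(\Bbbk S,A_{\varphi+\widetilde\varphi})_\prec$, i.e. of those elements of $\operatorname{Hom}(\Bbbk S,\Bbbk\,\mathrm{Irr}_S)$ with values in paths $\prec s$ that are $2$-cocycles of the cochain complex $\operatorname{Hom}(\Bbbk S_\bullet,A_{\varphi+\widetilde\varphi})$ of the resolution given by $R_{\varphi+\widetilde\varphi}$. For such $v$ the Hochschild cochain $G^2(v)$ of $A_{\varphi+\widetilde\varphi}$ is a $2$-cocycle, and $v\mapsto[G^2(v)]$ is a linear map, the Kodaira–Spencer map $\mathrm{KS}\colon\mathrm T_{\widetilde\varphi}V_\prec\to\mathrm{HH}^2(A_{\varphi+\widetilde\varphi},A_{\varphi+\widetilde\varphi})$.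 4. Let $\widetilde\varphi\in V_\prec$. The Zariski tangent space at $\widetilde\varphi$ to the orbit of $G_\prec\rightrightarrows V_\prec$, i.e. the set of $v\in\operatorname{Hom}(\Bbbk S,A)_\prec$ such that $\widetilde\varphi+\epsilon v\in V_\prec(\Bbbk[\epsilon]/(\epsilon^2))$ lies in the orbit of $\widetilde\varphi$ under the groupoid $G_\prec$ over $\Bbbk[\epsilon]/(\epsilon^2)$, is the space of $2$-coboundaries in $\operatorname{Hom}(\Bbbk S,A_{\varphi+\widetilde\varphi})_\prec$, i.e. of those of its elements that are images of elements of $\operatorname{Hom}(\Bbbk Q_1,A_{\varphi+\widetilde\varphi})$ under the differential of $\operatorname{Hom}(\Bbbk S_\bullet,A_{\varphi+\widetilde\varphi})$. -/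

import Mathlib

universe u v w

namespace ReductionSystem

noncomputable section

open scoped Classical TensorProduct

/-! ### Paths of a quiver and the path algebra -/

/-- A path of arbitrary source and target in the quiver `V`. -/
structure QPath (V : Type v) [Quiver.{w} V] where
  src : V
  tgt : V
  path : Quiver.Path src tgt

namespace QPath

variable {V : Type v} [Quiver.{w} V]

/-- The path `e_i` of length zero at the vertex `i`. -/
def idPath (i : V) : QPath V := ⟨i, i, Quiver.Path.nil⟩

/-- An arrow, viewed as a path of length one. -/
def arrow {a b : V} (x : a ⟶ b) : QPath V := ⟨a, b, x.toPath⟩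

/-- The length of a path. -/
def length (p : QPath V) : ℕ := p.path.length

/-- The concatenation `p q` (first `p`, then `q`). -/
def comp (p q : QPath V) (h : p.tgt = q.src) : QPath V :=
  ⟨p.src, q.tgt, p.path.comp (q.path.cast h.symm rfl)⟩

/-- The paths `p` and `q` are parallel. -/
def Parallel (p q : QPath V) : Prop := p.src = q.src ∧ p.tgt = q.tgt

/-- `p = q r` as a concatenation of paths. -/
def Factors (q r p : QPath V) : Prop := ∃ h : q.tgt = r.src, q.comp r h = p

/-- `p = q x r` as a concatenation of paths. -/
def Factors3 (q x r p : QPath V) : Prop := ∃ y, Factors q x y ∧ Factors y r p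

/-- `x` is a subpath of `p`. -/
def IsSubpath (x p : QPath V) : Prop := ∃ q r, Factors3 q x r p

theorem comp_assoc (p q r : QPath V) (h : p.tgt = q.src) (h' : q.tgt = r.src) :
    (p.comp q h).comp r h' = p.comp (q.comp r h') h := by
  obtain ⟨a, b, p⟩ := p
  obtain ⟨c, d, q⟩ := q
  obtain ⟨e, f, r⟩ := r
  dsimp only at h h'
  subst h
  subst h'
  simp [comp, Quiver.Path.comp_assoc]

theorem idPath_comp (p : QPath V) (i : V) (h : i = p.src) : (idPath i).comp p h = p := by
  obtain ⟨a, b, p⟩ := p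
  dsimp only at h
  subst h
  simp [comp, idPath]

theorem comp_idPath (p : QPath V) (i : V) (h : p.tgt = i) : p.comp (idPath i) h = p := by
  subst h
  obtain ⟨a, b, p⟩ := p
  simp [comp, idPath]

end QPath

/-- The path algebra `kQ`: finitely supported functions on the set of paths. -/
def PathAlgebra (k : Type u) [CommRing k] (V : Type v) [Quiver.{w} V] : Type max u v w :=
  QPath V →₀ k

namespace PathAlgebra

variable (k : Type u) [CommRing k] {V : Type v} [Quiver.{w} V]

instance : AddCommGroup (PathAlgebra k V) := inferInstanceAs (AddCommGroup (QPath V →₀ k))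

instance : Module k (PathAlgebra k V) := inferInstanceAs (Module k (QPath V →₀ k))

/-- A path as an element of the path algebra. -/
def of (p : QPath V) : PathAlgebra k V := Finsupp.single p 1

variable {k}

/-- The coefficient of the path `p` in an element of the path algebra. -/
def coeff (p : QPath V) : PathAlgebra k V →ₗ[k] k := Finsupp.lapply p

/-- The set of paths that occur in an element of the path algebra. -/
def support (x : PathAlgebra k V) : Set (QPath V) := {p | coeff p x ≠ 0}

/-- The linear map on the path algebra with given values on paths. -/
def lin {M : Type*} [AddCommGroup M] [Module k M] (f : QPath V → M) : PathAlgebra k V →ₗ[k] M :=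
  Finsupp.linearCombination k f

@[simp] theorem lin_of {M : Type*} [AddCommGroup M] [Module k M] (f : QPath V → M) (p : QPath V) :
    lin f (of k p) = f p :=
  (Finsupp.linearCombination_single k 1 p).trans (one_smul k (f p))

theorem lin_ext {M : Type*} [AddCommGroup M] [Module k M] {f g : PathAlgebra k V →ₗ[k] M}
    (h : ∀ p, f (of k p) = g (of k p)) : f = g :=
  Finsupp.lhom_ext' fun p => LinearMap.ext_ring (h p)

/-- The product of two paths: their concatenation, or `0` if they cannot be concatenated. -/
def pathMul (p q : QPath V) : PathAlgebra k V :=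
  if h : p.tgt = q.src then of k (p.comp q h) else 0

/-- The multiplication of the path algebra as a bilinear map. -/
def mulMap : PathAlgebra k V →ₗ[k] PathAlgebra k V →ₗ[k] PathAlgebra k V :=
  lin fun p => lin fun q => pathMul p q

instance : Mul (PathAlgebra k V) := ⟨fun x y => mulMap x y⟩

theorem mul_def (x y : PathAlgebra k V) : x * y = mulMap x y := rfl

theorem of_mul_of (p q : QPath V) : of k p * of k q = pathMul p q := by
  simp [mul_def, mulMap]

theorem induct {P : PathAlgebra k V → Prop} (x : PathAlgebra k V) (h0 : P 0)
    (ha : ∀ x y, P x → P y → P (x + y)) (hs : ∀ (c : k) p, P (c • of k p)) : P x := by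
  refine Finsupp.induction_linear (motive := P) x h0 (fun f g hf hg => ha f g hf hg) fun p c => ?_
  have : (Finsupp.single p c : QPath V →₀ k) = c • Finsupp.single p 1 := by simp
  rw [this]
  exact hs c p

theorem mul_pathMul (p q r : QPath V) :
    mulMap (of k p) (pathMul (k := k) q r) = mulMap (pathMul (k := k) p q) (of k r) := by
  simp only [pathMul]
  split_ifs with h h' h'
  · have e : (p.comp q h').tgt = r.src := h
    have e' : p.tgt = (q.comp r h).src := h'
    simp only [mulMap, lin_of, pathMul, dif_pos e, dif_pos e']
    rw [QPath.comp_assoc p q r h' h]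
  · have e' : ¬ p.tgt = (q.comp r h).src := h'
    simp [mulMap, pathMul, dif_neg e']
  · have e : ¬ (p.comp q h').tgt = r.src := h
    simp [mulMap, pathMul, dif_neg e]
  · simp

theorem mulMap_assoc (x y z : PathAlgebra k V) :
    mulMap (mulMap x y) z = mulMap x (mulMap y z) := by
  induction x using induct with
  | h0 => simp
  | ha x x' h h' => simp [h, h']
  | hs c p =>
    induction y using induct with
    | h0 => simp
    | ha x x' h h' => simp only [map_add, LinearMap.add_apply, h, h']
    | hs d q =>
      induction z using induct with
      | h0 => simp
      | ha x x' h h' => simp only [map_add, h, h']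
      | hs e r =>
        have h1 : mulMap (of k p) (of k q) = pathMul (k := k) p q := of_mul_of p q
        have h2 : mulMap (of k q) (of k r) = pathMul (k := k) q r := of_mul_of q r
        simp only [map_smul, LinearMap.smul_apply, h1, h2, mul_pathMul]

variable [Fintype V]

instance : One (PathAlgebra k V) := ⟨∑ i : V, of k (QPath.idPath i)⟩

theorem one_def : (1 : PathAlgebra k V) = ∑ i : V, of k (QPath.idPath i) := rfl

theorem mulMap_one_left (x : PathAlgebra k V) : mulMap 1 x = x := by
  induction x using induct with
  | h0 => simp
  | ha x x' h h' => simp [h, h']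
  | hs c p =>
    have h1 : ∀ i, mulMap (of k (QPath.idPath i)) (of k p) =
        if i = p.src then of k p else 0 := fun i => by
      have : mulMap (of k (QPath.idPath i)) (of k p) = pathMul (k := k) (QPath.idPath i) p :=
        of_mul_of _ p
      rw [this, pathMul]
      by_cases h : i = p.src
      · have h' : (QPath.idPath i).tgt = p.src := h
        rw [dif_pos h', if_pos h, QPath.idPath_comp p i h]
      · have h' : ¬ (QPath.idPath i).tgt = p.src := h
        rw [dif_neg h', if_neg h]
    simp [one_def, h1]

theorem mulMap_one_right (x : PathAlgebra k V) : mulMap x 1 = x := by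
  induction x using induct with
  | h0 => simp
  | ha x x' h h' => simp [h, h']
  | hs c p =>
    have h1 : ∀ i, mulMap (of k p) (of k (QPath.idPath i)) =
        if p.tgt = i then of k p else 0 := fun i => by
      have : mulMap (of k p) (of k (QPath.idPath i)) = pathMul (k := k) p (QPath.idPath i) :=
        of_mul_of p _
      rw [this, pathMul]
      by_cases h : p.tgt = i
      · have h' : p.tgt = (QPath.idPath i).src := h
        rw [dif_pos h', if_pos h, QPath.comp_idPath p i h]
      · have h' : ¬ p.tgt = (QPath.idPath i).src := h
        rw [dif_neg h', if_neg h]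
    simp [one_def, h1]

instance : Ring (PathAlgebra k V) :=
  { (inferInstance : AddCommGroup (PathAlgebra k V)) with
    mul := fun x y => mulMap x y
    one := 1
    left_distrib := fun x y z => by simp [mul_def]
    right_distrib := fun x y z => by simp [mul_def]
    zero_mul := fun x => by simp [mul_def]
    mul_zero := fun x => by simp [mul_def]
    mul_assoc := mulMap_assoc
    one_mul := mulMap_one_left
    mul_one := mulMap_one_right }

instance : Algebra k (PathAlgebra k V) :=
  Algebra.ofModule (fun c x y => by simp [mul_def]) (fun c x y => by simp [mul_def])

end PathAlgebra

/-! ### Reduction systems -/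

section Reductions

variable {V : Type v} [Quiver.{w} V]

open PathAlgebra

/-- `S` is a set of paths of length at least two, none of which is a subpath of another one. -/
structure IsReductionSet (S : Set (QPath V)) : Prop where
  two_le_length : ∀ s ∈ S, 2 ≤ s.length
  antichain : ∀ s ∈ S, ∀ t ∈ S, s.IsSubpath t → s = t

/-- The irreducible paths: those without a subpath in `S`. -/
def Irr (S : Set (QPath V)) : Set (QPath V) := {p | ∀ s ∈ S, ¬ s.IsSubpath p}

variable (k : Type u) [CommRing k]

/-- The span `k Irr_S` of the irreducible paths. -/
def irrMod (S : Set (QPath V)) : Submodule k (PathAlgebra k V) where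
  carrier := {x | ∀ p, coeff p x ≠ 0 → p ∈ Irr S}
  zero_mem' p h := by simp at h
  add_mem' {x y} hx hy p h := by
    by_contra hp
    have h1 : coeff p x = 0 := not_not.mp fun h' => hp (hx p h')
    have h2 : coeff p y = 0 := not_not.mp fun h' => hp (hy p h')
    simp [h1, h2] at h
  smul_mem' c x hx p h := by
    by_contra hp
    have h1 : coeff p x = 0 := not_not.mp fun h' => hp (hx p h')
    simp [h1] at h

/-- Functions on a set `W` of paths with values in the path algebra, such that all paths `p`
that occur in the value at `x` satisfy the condition `C p x`. -/
def cochOf (W : Set (QPath V)) (C : QPath V → QPath V → Prop) :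
    Submodule k (W → PathAlgebra k V) where
  carrier := {f | ∀ x p, coeff p (f x) ≠ 0 → C p x}
  zero_mem' x p h := by simp at h
  add_mem' {f g} hf hg x p h := by
    by_contra hp
    have h1 : coeff p (f x) = 0 := not_not.mp fun h' => hp (hf x p h')
    have h2 : coeff p (g x) = 0 := not_not.mp fun h' => hp (hg x p h')
    simp [h1, h2] at h
  smul_mem' c f hf x p h := by
    by_contra hp
    have h1 : coeff p (f x) = 0 := not_not.mp fun h' => hp (hf x p h')
    simp [h1] at h

/-- `Hom(kW, k Irr_S)`, the homomorphisms of `kQ_0`-bimodules: the value at `x` is a linear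
combination of irreducible paths that are parallel to `x`. If the irreducible paths form a basis
of an algebra `A = kQ/I`, this is the space of cochains `Hom(kW, A)`. -/
def coch (S W : Set (QPath V)) : Submodule k (W → PathAlgebra k V) :=
  cochOf k W fun p x => p ∈ Irr S ∧ p.Parallel x

/-- The subspace `Hom(kS, A)_≺` of those `f` in `Hom(kS, k Irr_S)` for which `f s` is a
linear combination of paths that are smaller than `s`. -/
def cochPrec (S : Set (QPath V)) (prec : QPath V → QPath V → Prop) :
    Submodule k (S → PathAlgebra k V) :=
  cochOf k S fun p x => (p ∈ Irr S ∧ p.Parallel x) ∧ prec p x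

variable {k} {S : Set (QPath V)} (φ : S → PathAlgebra k V)

/-- The basic reduction that replaces the path `q s r` by `q φ_s r` and fixes all other paths. -/
def basicReduction (q : QPath V) (s : S) (r : QPath V) : PathAlgebra k V →ₗ[k] PathAlgebra k V :=
  lin fun p => if QPath.Factors3 q s r p then of k q * φ s * of k r else of k p

/-- The reductions: nonempty compositions of basic reductions at nonzero paths `q s r`. -/
inductive IsReduction : (PathAlgebra k V →ₗ[k] PathAlgebra k V) → Prop
  | basic (q : QPath V) (s : S) (r p : QPath V) (h : QPath.Factors3 q s r p) :
      IsReduction (basicReduction φ q s r)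
  | comp (f g : PathAlgebra k V →ₗ[k] PathAlgebra k V) :
      IsReduction f → IsReduction g → IsReduction (f ∘ₗ g)

/-- Apply the first `n` maps of a sequence, one after the other. -/
def applySeq (f : ℕ → PathAlgebra k V →ₗ[k] PathAlgebra k V) (x : PathAlgebra k V) :
    ℕ → PathAlgebra k V
  | 0 => x
  | n + 1 => f n (applySeq f x n)

/-- The path `p` is reduction finite: every infinite sequence of reductions becomes stationary. -/
def ReductionFinite (p : QPath V) : Prop :=
  ∀ f : ℕ → PathAlgebra k V →ₗ[k] PathAlgebra k V, (∀ i, IsReduction φ (f i)) →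
    ∃ n₀, ∀ n ≥ n₀, applySeq f (of k p) n = applySeq f (of k p) n₀

/-- The path `p` is reduction unique: it is reduction finite, and any two irreducible elements
that are obtained from it by reductions coincide. -/
def ReductionUnique (p : QPath V) : Prop :=
  ReductionFinite φ p ∧ ∀ f g, IsReduction φ f → IsReduction φ g →
    f (of k p) ∈ irrMod k S → g (of k p) ∈ irrMod k S → f (of k p) = g (of k p)

/-- The reduction system `R_φ` is reduction unique. -/
def SystemUnique : Prop := ∀ p, ReductionUnique φ p

/-- `q x r = p` is the decomposition with the right-most subpath `x` of `p` that lies in `W`. -/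
def IsRightmost (W : Set (QPath V)) (p : QPath V) (t : QPath V × W × QPath V) : Prop :=
  QPath.Factors3 t.1 t.2.1 t.2.2 p ∧
    ∀ t' : QPath V × W × QPath V, QPath.Factors3 t'.1 t'.2.1 t'.2.2 p →
      t'.1.length ≤ t.1.length

/-- `q x r = p` is the decomposition with the left-most subpath `x` of `p` that lies in `W`. -/
def IsLeftmost (W : Set (QPath V)) (p : QPath V) (t : QPath V × W × QPath V) : Prop :=
  QPath.Factors3 t.1 t.2.1 t.2.2 p ∧
    ∀ t' : QPath V × W × QPath V, QPath.Factors3 t'.1 t'.2.1 t'.2.2 p →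
      t.1.length ≤ t'.1.length

/-- The right-most reduction `red_φ`. -/
def red : PathAlgebra k V →ₗ[k] PathAlgebra k V :=
  lin fun p =>
    if h : ∃ t : QPath V × S × QPath V, IsRightmost S p t then
      of k h.choose.1 * φ h.choose.2.1 * of k h.choose.2.2
    else of k p

/-- The map `red_φ^(∞)`: iterate the right-most reduction until the result is irreducible
(the value is `0` if this never happens). -/
def redInf (x : PathAlgebra k V) : PathAlgebra k V :=
  if h : ∃ n, (red φ)^[n] x ∈ irrMod k S then (red φ)^[Nat.find h] x else 0

/-! ### Equivalence of reduction systems -/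

/-- A linear automorphism `T` of `k Irr_S`, as a function on the path algebra (with value `0`
outside of `k Irr_S`). -/
def ofIrr (T : irrMod k S ≃ₗ[k] irrMod k S) (x : PathAlgebra k V) : PathAlgebra k V :=
  if h : x ∈ irrMod k S then (T ⟨x, h⟩ : PathAlgebra k V) else 0

/-- The product `T(p_1) ⋯ T(p_m)` in `kQ`, for a path `p = p_1 ⋯ p_m` with arrows `p_i`. -/
def prodArrows (T : irrMod k S ≃ₗ[k] irrMod k S) {a : V} :
    {b : V} → Quiver.Path a b → PathAlgebra k V
  | _, .nil => of k (QPath.idPath a)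
  | _, .cons p x => prodArrows T p * ofIrr T (of k (QPath.arrow x))

/-- `T` belongs to `G(φ, φ')`: it is an automorphism of the `kQ_0`-bimodule `k Irr_S` that fixes
the paths of length zero and satisfies
`T (red_φ'^(∞) (p)) = red_φ^(∞) (T(p_1) ⋯ T(p_m))` for all paths `p = p_1 ⋯ p_m`. -/
structure IsEquivalence (φ φ' : S → PathAlgebra k V) (T : irrMod k S ≃ₗ[k] irrMod k S) :
    Prop where
  parallel : ∀ p ∈ Irr S, ∀ q, coeff q (ofIrr T (of k p)) ≠ 0 → q.Parallel p
  map_idPath : ∀ i : V, ofIrr T (of k (QPath.idPath i)) = of k (QPath.idPath i)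
  map_red : ∀ p : QPath V, ofIrr T (redInf φ' (of k p)) = redInf φ (prodArrows T p.path)

/-- The reduction systems given by `φ` and `φ'` are equivalent. -/
def Equivalent (φ φ' : S → PathAlgebra k V) : Prop := ∃ T, IsEquivalence φ φ' T

/-! ### The algebra of a reduction system -/

variable [Fintype V]

/-- The two-sided ideal generated by the elements `s - φ_s`. -/
def relIdeal : TwoSidedIdeal (PathAlgebra k V) :=
  TwoSidedIdeal.span (Set.range fun s : S => of k (s : QPath V) - φ s)

/-- The algebra `A_φ = kQ / ⟨s - φ_s⟩`. -/
def QuotAlg : Type max u v w := (relIdeal φ).ringCon.Quotient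

instance : Ring (QuotAlg φ) := inferInstanceAs (Ring (relIdeal φ).ringCon.Quotient)

instance : Algebra k (QuotAlg φ) := inferInstanceAs (Algebra k (relIdeal φ).ringCon.Quotient)

/-- The projection `kQ → A_φ`. -/
def proj : PathAlgebra k V →ₐ[k] QuotAlg φ := (relIdeal φ).ringCon.mkₐ k

/-- The projection restricted to the span of the irreducible paths. -/
def projIrr : irrMod k S →ₗ[k] QuotAlg φ := (proj φ).toLinearMap ∘ₗ (irrMod k S).subtype

/-- The inverse `σ : A_φ → k Irr_S ⊆ kQ` of the restricted projection, which is bijective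
if the reduction system is reduction unique (and `0` if it is not bijective). -/
def irrSection : QuotAlg φ →ₗ[k] PathAlgebra k V :=
  if h : Function.Bijective (projIrr φ) then
    (irrMod k S).subtype ∘ₗ (LinearEquiv.ofBijective (projIrr φ) h).symm.toLinearMap
  else 0

/-- The reduction system `R_φ` satisfies the diamond condition for the ideal `I`. -/
def Diamond (I : TwoSidedIdeal (PathAlgebra k V)) : Prop := I = relIdeal φ ∧ SystemUnique φ

end Reductions

/-! ### Admissible orders and noncommutative Gröbner bases -/

section Orders

open PathAlgebra

variable {V : Type v} [Quiver.{w} V]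

/-- Admissible orders on the set of paths. -/
structure IsAdmissible (prec : QPath V → QPath V → Prop) : Prop where
  irrefl : ∀ p, ¬ prec p p
  trans : ∀ p q r, prec p q → prec q r → prec p r
  total : ∀ p q, prec p q ∨ p = q ∨ prec q p
  exists_min : ∀ X : Set (QPath V), X.Nonempty → ∃ p ∈ X, ∀ q ∈ X, ¬ prec q p
  mul_right : ∀ p q r pr qr, QPath.Factors p r pr → QPath.Factors q r qr → prec p q → prec pr qr
  mul_left : ∀ p q r rp rq, QPath.Factors r p rp → QPath.Factors r q rq → prec p q → prec rp rq
  subpath : ∀ p q, q.IsSubpath p → q = p ∨ prec q p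

variable {k : Type u} [CommRing k] (prec : QPath V → QPath V → Prop)

/-- `p` is the largest path that occurs in `x`. -/
def IsTip (x : PathAlgebra k V) (p : QPath V) : Prop :=
  coeff p x ≠ 0 ∧ ∀ q, coeff q x ≠ 0 → q ≠ p → prec q p

/-- The ideal generated by the tips of the nonzero elements of `X`. -/
def tipIdeal [Fintype V] (X : Set (PathAlgebra k V)) : TwoSidedIdeal (PathAlgebra k V) :=
  TwoSidedIdeal.span {y | ∃ x ∈ X, ∃ p, IsTip prec x p ∧ y = of k p}

/-- `G` is a (reduced) noncommutative Gröbner basis of the ideal `I`. -/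
structure IsGroebnerBasis [Fintype V] (I : TwoSidedIdeal (PathAlgebra k V))
    (G : Set (PathAlgebra k V)) : Prop where
  mem : ∀ x ∈ G, x ∈ I
  uniform : ∀ x ∈ G, ∀ p q, coeff p x ≠ 0 → coeff q x ≠ 0 → p.Parallel q
  tip : tipIdeal prec {x | x ∈ I} = tipIdeal prec G
  monic : ∀ x ∈ G, ∃ p, IsTip prec x p ∧ coeff p x = 1
  not_subpath : ∀ x ∈ G, ∀ y ∈ G, x ≠ y → ∀ p q, IsTip prec x p → IsTip prec y q →
    ¬ p.IsSubpath q

end Orders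

/-! ### Higher ambiguities -/

section Ambiguities

variable {V : Type v} [Quiver.{w} V] (S : Set (QPath V))

/-- The path `p` is an `n`-ambiguity: `p = u_0 u_1 ⋯ u_{n+1}` with an arrow `u_0` and irreducible
paths `u_1, …, u_{n+1}`, such that `u_i u_{i+1}` is reducible and `u_i d` is irreducible for each
proper left subpath `d` of `u_{i+1}`. Here `z i` is the path `u_0 ⋯ u_i`. -/
def IsAmbiguity (n : ℕ) (p : QPath V) : Prop :=
  ∃ u z : ℕ → QPath V, (u 0).length = 1 ∧ (∀ i ≤ n, u (i + 1) ∈ Irr S) ∧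
    z 0 = u 0 ∧ (∀ i ≤ n, QPath.Factors (z i) (u (i + 1)) (z (i + 1))) ∧ z (n + 1) = p ∧
    ∀ i ≤ n, (∀ x, QPath.Factors (u i) (u (i + 1)) x → x ∉ Irr S) ∧
      ∀ d r x, QPath.Factors d r (u (i + 1)) → d ≠ u (i + 1) → QPath.Factors (u i) d x → x ∈ Irr S

/-- The sets `S_0` (vertices), `S_1` (arrows), `S_2 = S` and `S_{n+2}` (`n`-ambiguities). -/
def amb : ℕ → Set (QPath V)
  | 0 => Set.range QPath.idPath
  | 1 => {p | p.length = 1}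
  | 2 => S
  | n + 3 => {p | IsAmbiguity S (n + 1) p}

end Ambiguities

/-! ### Bimodules and cochains over an algebra -/

section Bimodules

variable {k : Type u} [CommRing k] {A : Type*} [Ring A] [Algebra k A]

set_option maxSynthPendingDepth 6

/-- The `A`-bimodule action `y ↦ a y b` on a direct sum of copies of `A ⊗_k A`. -/
def biact {W : Type*} (a b : A) : (W →₀ A ⊗[k] A) →ₗ[k] (W →₀ A ⊗[k] A) :=
  Finsupp.mapRange.linearMap
    (TensorProduct.map (LinearMap.mulLeft k a) (LinearMap.mulRight k b))

theorem biact_add_left {W : Type*} (a a' b : A) :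
    biact (k := k) (W := W) (a + a') b = biact a b + biact a' b := by
  refine Finsupp.lhom_ext' fun x => TensorProduct.ext' fun y z => ?_
  simp [biact, add_mul, TensorProduct.add_tmul]

theorem biact_add_right {W : Type*} (a b b' : A) :
    biact (k := k) (W := W) a (b + b') = biact a b + biact a b' := by
  refine Finsupp.lhom_ext' fun x => TensorProduct.ext' fun y z => ?_
  simp [biact, mul_add, TensorProduct.tmul_add]

theorem biact_smul_left {W : Type*} (c : k) (a b : A) :
    biact (k := k) (W := W) (c • a) b = c • biact a b := by
  refine Finsupp.lhom_ext' fun x => TensorProduct.ext' fun y z => ?_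
  simp [biact, TensorProduct.smul_tmul']

theorem biact_smul_right {W : Type*} (c : k) (a b : A) :
    biact (k := k) (W := W) a (c • b) = c • biact a b := by
  refine Finsupp.lhom_ext' fun x => TensorProduct.ext' fun y z => ?_
  simp [biact]

/-- The bimodule map `a ⊗ x ⊗ b ↦ a c(x) b`. -/
def bimodExt {W W' : Type*} (c : W → (W' →₀ A ⊗[k] A)) :
    (W →₀ A ⊗[k] A) →ₗ[k] (W' →₀ A ⊗[k] A) :=
  Finsupp.lsum k fun x => TensorProduct.lift (LinearMap.mk₂ k (fun a b => biact a b (c x))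
    (fun a a' b => by simp [biact_add_left]) (fun r a b => by simp [biact_smul_left])
    (fun a b b' => by simp [biact_add_right]) (fun r a b => by simp [biact_smul_right]))

/-- The map of left modules `a ⊗ x ⊗ b ↦ a c(x, b)`. -/
def leftExt {W W' : Type*} (c : W → A →ₗ[k] (W' →₀ A ⊗[k] A)) :
    (W →₀ A ⊗[k] A) →ₗ[k] (W' →₀ A ⊗[k] A) :=
  Finsupp.lsum k fun x => TensorProduct.lift (LinearMap.mk₂ k (fun a b => biact a 1 (c x b))
    (fun a a' b => by simp [biact_add_left]) (fun r a b => by simp [biact_smul_left])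
    (fun a b b' => by simp) (fun r a b => by simp))

/-- The map `y ⊗ b ↦ f(y) b`. -/
def rightExt {M W : Type*} [AddCommGroup M] [Module k M] (f : M →ₗ[k] (W →₀ A ⊗[k] A)) :
    M ⊗[k] A →ₗ[k] (W →₀ A ⊗[k] A) :=
  TensorProduct.lift (LinearMap.mk₂ k (fun y b => biact 1 b (f y))
    (fun a a' b => by simp) (fun r a b => by simp)
    (fun a b b' => by simp [biact_add_right]) (fun r a b => by simp [biact_smul_right]))

/-- The map `a ⊗ x ⊗ b ↦ a f(x) b` to `A` that belongs to a function `f` on `W`. -/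
def evalCochain {W : Type*} (f : W → A) : (W →₀ A ⊗[k] A) →ₗ[k] A :=
  Finsupp.lsum k fun x => LinearMap.mul' k A ∘ₗ LinearMap.rTensor A (LinearMap.mulRight k (f x))

/-- The sum `∑ N^i` for a locally nilpotent map `N` (and `0` if `N` is not locally nilpotent). -/
def geomSum {M : Type*} [AddCommGroup M] [Module k M] (N : M →ₗ[k] M) : M →ₗ[k] M :=
  if h : ∀ x, ∃ n, (N ^ n) x = 0 then
    have hfin : ∀ x, (Function.support fun i => (N ^ i) x).Finite := fun x => by
      obtain ⟨n, hn⟩ := h x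
      refine (Set.finite_lt_nat n).subset fun i hi => ?_
      by_contra hi'
      have h2 : n ≤ i := not_lt.mp hi'
      apply hi
      have h3 : N ^ i = N ^ (i - n) * N ^ n := by rw [← pow_add, Nat.sub_add_cancel h2]
      simp [h3, hn]
    { toFun := fun x => ∑ᶠ i, (N ^ i) x
      map_add' := fun x y => by
        simp only [map_add]
        exact finsum_add_distrib (hfin x) (hfin y)
      map_smul' := fun c x => by
        simp only [map_smul, RingHom.id_apply]
        exact (smul_finsum' c (hfin x)).symm }
  else 0

/-- The terms `A ⊗_k A^{⊗ n} ⊗_k A` of the bar resolution for `n ≤ 3`. -/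
abbrev Bar0 (k A : Type*) [CommRing k] [Ring A] [Algebra k A] := A ⊗[k] A

/-- See `Bar0`. -/
abbrev Bar1 (k A : Type*) [CommRing k] [Ring A] [Algebra k A] := Bar0 k A ⊗[k] A

/-- See `Bar0`. -/
abbrev Bar2 (k A : Type*) [CommRing k] [Ring A] [Algebra k A] := Bar1 k A ⊗[k] A

/-- See `Bar0`. -/
abbrev Bar3 (k A : Type*) [CommRing k] [Ring A] [Algebra k A] := Bar2 k A ⊗[k] A

variable (k A)

/-- The map `y ↦ y ⊗ 1`. -/
def appendOne (M : Type*) [AddCommGroup M] [Module k M] : M →ₗ[k] M ⊗[k] A :=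
  (TensorProduct.mk k M A).flip 1

/-- The map `y ⊗ a ⊗ b ↦ y ⊗ a b`. -/
def mulLast (M : Type*) [AddCommGroup M] [Module k M] : (M ⊗[k] A) ⊗[k] A →ₗ[k] M ⊗[k] A :=
  LinearMap.lTensor M (LinearMap.mul' k A) ∘ₗ (TensorProduct.assoc k M A A).toLinearMap

/-- The bar differential `a ⊗ b ⊗ c ↦ a b ⊗ c - a ⊗ b c`. -/
def barD1 : Bar1 k A →ₗ[k] Bar0 k A := LinearMap.rTensor A (LinearMap.mul' k A) - mulLast k A A

/-- The bar differential `a ⊗ b ⊗ c ⊗ d ↦ a b ⊗ c ⊗ d - a ⊗ b c ⊗ d + a ⊗ b ⊗ c d`. -/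
def barD2 : Bar2 k A →ₗ[k] Bar1 k A := LinearMap.rTensor A (barD1 k A) + mulLast k A (A ⊗[k] A)

/-- Bilinear maps `A × A → A`, the Hochschild 2-cochains. -/
abbrev C2 := A →ₗ[k] A →ₗ[k] A

/-- Trilinear maps `A × A × A → A`, the Hochschild 3-cochains. -/
abbrev C3 := A →ₗ[k] A →ₗ[k] A →ₗ[k] A

variable {k A}

/-- The trilinear map `f(g(a, b), c)`. -/
def compLeft (f g : C2 k A) : C3 k A := g.compr₂ f

/-- The trilinear map `f(a, g(b, c))`. -/
def compRight (f g : C2 k A) : C3 k A where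
  toFun a := g.compr₂ (f a)
  map_add' a b := by ext; simp
  map_smul' c a := by ext; simp

/-- The Gerstenhaber circle product `f(g(a, b), c) - f(a, g(b, c))`. -/
def circ (f g : C2 k A) : C3 k A := compLeft f g - compRight f g

/-- The symmetric bracket on 2-cochains, placed in degree zero of the shifted complex: it is the
Gerstenhaber bracket `f ∘ g + g ∘ f` up to the sign of the shift. -/
def gerst (f g : C2 k A) : C3 k A := -(circ f g + circ g f)

variable (k A)

/-- The Hochschild differential `f ↦ a f(b) - f(a b) + f(a) b` on 1-cochains. -/
def hochD1 : (A →ₗ[k] A) →ₗ[k] C2 k A where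
  toFun f := (LinearMap.mul k A).compl₂ f - (LinearMap.mul k A).compr₂ f + LinearMap.mul k A ∘ₗ f
  map_add' f g := by ext a b; simp [mul_add]; abel
  map_smul' c f := by ext; simp [smul_sub]

/-- The Hochschild differential
`f ↦ a f(b, c) - f(a b, c) + f(a, b c) - f(a, b) c` on 2-cochains. -/
def hochD2 : C2 k A →ₗ[k] C3 k A where
  toFun f := compRight (LinearMap.mul k A) f - compLeft f (LinearMap.mul k A)
    + compRight f (LinearMap.mul k A) - compLeft (LinearMap.mul k A) f
  map_add' f g := by ext; simp [compLeft, compRight, mul_add]; abel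
  map_smul' c f := by ext; simp [compLeft, compRight, smul_sub]

/-- The Hochschild 2-cocycles. -/
def hochCocycles : Submodule k (C2 k A) := LinearMap.ker (hochD2 k A)

/-- The Hochschild 2-coboundaries, as a subspace of the 2-cocycles. -/
def hochCoboundaries : Submodule k (hochCocycles k A) :=
  (LinearMap.range (hochD1 k A)).comap (hochCocycles k A).subtype

instance : AddCommGroup (hochCocycles k A) := Submodule.addCommGroup _

/-- The second Hochschild cohomology `HH²(A, A)`: 2-cocycles modulo 2-coboundaries. -/
def HH2 := hochCocycles k A ⧸ hochCoboundaries k A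

instance : AddCommGroup (HH2 k A) := inferInstanceAs (AddCommGroup (_ ⧸ hochCoboundaries k A))

instance : Module k (HH2 k A) := inferInstanceAs (Module k (_ ⧸ hochCoboundaries k A))

variable {k A}

/-- The class in `HH²(A, A)` of a Hochschild 2-cocycle. -/
def hochClass (f : C2 k A) (h : f ∈ hochCocycles k A) : HH2 k A :=
  (hochCoboundaries k A).mkQ ⟨f, h⟩

/-- The quadrilinear map `(a, b, c, d) ↦ a g(b, c, d)`. -/
def mulC3 (g : C3 k A) : A →ₗ[k] A →ₗ[k] A →ₗ[k] A →ₗ[k] A :=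
  LinearMap.mk₂ k (fun a b => (g b).compr₂ (LinearMap.mulLeft k a))
    (fun a a' b => by ext; simp [add_mul]) (fun r a b => by ext; simp)
    (fun a b b' => by ext; simp [mul_add]) (fun r a b => by ext; simp)

/-- The bimodule map `a ⊗ b ⊗ c ⊗ d ⊗ e ↦ a g(b, c, d) e` that belongs to a 3-cochain `g`. -/
def evalBar3 (g : C3 k A) : Bar3 k A →ₗ[k] A :=
  LinearMap.mul' k A ∘ₗ LinearMap.rTensor A
    (TensorProduct.lift (TensorProduct.lift (TensorProduct.lift (mulC3 g))))

end Bimodules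

/-! ### The bimodule resolution of a reduction system -/

section Resolution

open PathAlgebra

variable {k : Type u} [CommRing k] {V : Type v} [Quiver.{w} V] [Fintype V]
  {S : Set (QPath V)} (φ : S → PathAlgebra k V)

set_option maxSynthPendingDepth 6

/-- The bimodules `P_n`. The `n`-th term `A ⊗ kS_n ⊗ A` (tensor products over `kQ_0`) of the
resolution is the direct summand `⨁_x A e_i ⊗_k e_j A`, where `x` runs through the paths in `S_n`
and `i`, `j` are the source and target of `x`; the element `a ⊗ x ⊗ b` of it is represented by
`single x (a e_i ⊗ e_j b)`. All maps below respect these summands. -/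
abbrev Res (n : ℕ) := amb S n →₀ QuotAlg φ ⊗[k] QuotAlg φ

/-- The element `q ⊗ x ⊗ r` for paths `q`, `r` and `x ∈ S_n`. -/
def resOf {n : ℕ} (t : QPath V × amb S n × QPath V) : Res φ n :=
  Finsupp.single t.2.1 (proj φ (of k t.1) ⊗ₜ proj φ (of k t.2.2))

/-- The generator `1 ⊗ x ⊗ 1` for `x ∈ S_n`. -/
def gen {n : ℕ} (x : amb S n) : Res φ n :=
  resOf φ (QPath.idPath (x : QPath V).src, x, QPath.idPath (x : QPath V).tgt)

/-- `split_n` : the sum of `q ⊗ x ⊗ r` over all decompositions `p = q x r` with `x ∈ S_n`. -/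
def split (n : ℕ) (p : QPath V) : Res φ n :=
  ∑ᶠ t ∈ {t : QPath V × amb S n × QPath V | QPath.Factors3 t.1 t.2.1 t.2.2 p}, resOf φ t

/-- The right-most part of `split_n`. -/
def splitR (n : ℕ) (p : QPath V) : Res φ n :=
  ∑ᶠ t ∈ {t : QPath V × amb S n × QPath V | IsRightmost (amb S n) p t}, resOf φ t

/-- The left-most part of `split_n`. -/
def splitL (n : ℕ) (p : QPath V) : Res φ n :=
  ∑ᶠ t ∈ {t : QPath V × amb S n × QPath V | IsLeftmost (amb S n) p t}, resOf φ t

/-- The bimodule map `δ_{n+1} : P_{n+1} → P_n`. For an arrow `x`, the value of `δ_1` on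
`1 ⊗ x ⊗ 1` is `x ⊗ 1 - 1 ⊗ x`. -/
def del (n : ℕ) : Res φ (n + 1) →ₗ[k] Res φ n :=
  bimodExt fun x => if Odd (n + 1) then splitR φ n x - splitL φ n x else split φ n x

/-- The map of left modules `γ_n : P_n → P_{n+1}` with
`γ_n (1 ⊗ x ⊗ u) = (-1)^(n+1) split_{n+1} (x u)` for irreducible paths `u`. -/
def gam (n : ℕ) : Res φ n →ₗ[k] Res φ (n + 1) :=
  leftExt fun x => (-1 : k) ^ (n + 1) •
    (lin (split φ (n + 1)) ∘ₗ LinearMap.mulLeft k (of k (x : QPath V)) ∘ₗ irrSection φ)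

/-- The differential `∂_{n+1} : P_{n+1} → P_n` and the homotopy `ρ_n : P_n → P_{n+1}`, defined by
`∂_1 = δ_1`, `∂_{n+2} (1 ⊗ x ⊗ 1) = (id - ρ_n ∂_{n+1}) δ_{n+2} (1 ⊗ x ⊗ 1)` and
`ρ_n = ∑_{i ≥ 0} γ_n (δ_{n+1} γ_n - ∂_{n+1} γ_n)^i`. -/
def resolution : (n : ℕ) → (Res φ (n + 1) →ₗ[k] Res φ n) × (Res φ n →ₗ[k] Res φ (n + 1))
  | 0 => (del φ 0, gam φ 0)
  | n + 1 =>
    let d : Res φ (n + 2) →ₗ[k] Res φ (n + 1) := bimodExt fun x =>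
      del φ (n + 1) (gen φ x)
        - (resolution n).2 ((resolution n).1 (del φ (n + 1) (gen φ x)))
    (d, gam φ (n + 1) ∘ₗ geomSum (del φ (n + 1) ∘ₗ gam φ (n + 1) - d ∘ₗ gam φ (n + 1)))

/-- The differential `∂_{n+1} : P_{n+1} → P_n`. -/
def diff (n : ℕ) : Res φ (n + 1) →ₗ[k] Res φ n := (resolution φ n).1

/-- The homotopy `ρ_n : P_n → P_{n+1}`. -/
def rho (n : ℕ) : Res φ n →ₗ[k] Res φ (n + 1) := (resolution φ n).2

/-! ### The homotopy retract onto the bar resolution, in low degrees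

The bar resolution is the normalized one relative to `kQ_0`. It is a quotient of the standard bar
resolution `A ⊗_k A^{⊗ n} ⊗_k A`. The maps below are lifts of the maps `F_n`, `G_n`, `h_n` to the
standard bar resolution. They are only applied to cochains that factor through the quotient. -/

/-- The map `F_{n+1}`, given `F_n`:
`F_{n+1} (a ⊗ x ⊗ b) = (-1)^(n+1) F_n ∂_{n+1} (a ⊗ x ⊗ 1) ⊗ b`. -/
def nextF {n : ℕ} {M : Type*} [AddCommGroup M] [Module k M] (F : Res φ n →ₗ[k] M) :
    Res φ (n + 1) →ₗ[k] M ⊗[k] QuotAlg φ :=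
  Finsupp.lsum k fun x => LinearMap.rTensor (QuotAlg φ) ((-1 : k) ^ (n + 1) •
    (F ∘ₗ diff φ n ∘ₗ Finsupp.lsingle x ∘ₗ appendOne k (QuotAlg φ) (QuotAlg φ)))

/-- The map `F_0 : P_0 → A ⊗ A`. -/
def mapF0 : Res φ 0 →ₗ[k] Bar0 k (QuotAlg φ) :=
  Finsupp.lsum k fun x => TensorProduct.map (LinearMap.mulRight k (proj φ (of k (x : QPath V))))
    (LinearMap.mulLeft k (proj φ (of k (x : QPath V))))

/-- The map `F_1 : P_1 → Bar_1`. -/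
def mapF1 : Res φ 1 →ₗ[k] Bar1 k (QuotAlg φ) := nextF φ (mapF0 φ)

/-- The map `F_2 : P_2 → Bar_2`. -/
def mapF2 : Res φ 2 →ₗ[k] Bar2 k (QuotAlg φ) := nextF φ (mapF1 φ)

/-- The map `F_3 : P_3 → Bar_3`. -/
def mapF3 : Res φ 3 →ₗ[k] Bar3 k (QuotAlg φ) := nextF φ (mapF2 φ)

/-- The map `G_0 : A ⊗ A → P_0`, `a ⊗ b ↦ ∑ a e_i ⊗ e_i ⊗ e_i b`. -/
def mapG0 : Bar0 k (QuotAlg φ) →ₗ[k] Res φ 0 :=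
  ∑ i : V, Finsupp.lsingle (⟨QPath.idPath i, i, rfl⟩ : amb S 0) ∘ₗ
    TensorProduct.map (LinearMap.mulRight k (proj φ (of k (QPath.idPath i))))
      (LinearMap.mulLeft k (proj φ (of k (QPath.idPath i))))

/-- The map `G_1 : Bar_1 → P_1`, `G_1 (y ⊗ b) = (ρ_0 G_0 d_1 (y ⊗ 1)) b`. -/
def mapG1 : Bar1 k (QuotAlg φ) →ₗ[k] Res φ 1 :=
  rightExt (rho φ 0 ∘ₗ mapG0 φ ∘ₗ barD1 k (QuotAlg φ) ∘ₗ appendOne k (QuotAlg φ) _)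

/-- The map `G_2 : Bar_2 → P_2`, `G_2 (y ⊗ b) = (ρ_1 G_1 d_2 (y ⊗ 1)) b`. -/
def mapG2 : Bar2 k (QuotAlg φ) →ₗ[k] Res φ 2 :=
  rightExt (rho φ 1 ∘ₗ mapG1 φ ∘ₗ barD2 k (QuotAlg φ) ∘ₗ appendOne k (QuotAlg φ) _)

/-- The map `h_1 : Bar_1 → Bar_2`, `h_1 (y ⊗ b) = F_1 G_1 (y ⊗ 1) ⊗ b`. -/
def homotopy1 : Bar1 k (QuotAlg φ) →ₗ[k] Bar2 k (QuotAlg φ) :=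
  LinearMap.rTensor (QuotAlg φ) (mapF1 φ ∘ₗ mapG1 φ ∘ₗ appendOne k (QuotAlg φ) _)

/-- The map `h_2 : Bar_2 → Bar_3`, `h_2 (y ⊗ b) = (h_1 (y) - F_2 G_2 (y ⊗ 1)) ⊗ b`. -/
def homotopy2 : Bar2 k (QuotAlg φ) →ₗ[k] Bar3 k (QuotAlg φ) :=
  LinearMap.rTensor (QuotAlg φ)
    (homotopy1 φ - mapF2 φ ∘ₗ mapG2 φ ∘ₗ appendOne k (QuotAlg φ) _)

/-- The map `a ⊗ b ↦ 1 ⊗ a ⊗ b ⊗ 1`. -/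
def insert2 : QuotAlg φ ⊗[k] QuotAlg φ →ₗ[k] Bar2 k (QuotAlg φ) :=
  appendOne k (QuotAlg φ) _ ∘ₗ
    LinearMap.rTensor (QuotAlg φ) (TensorProduct.mk k (QuotAlg φ) (QuotAlg φ) 1)

/-- The map `G^2` from the cochains `Hom(kS, A)` to the Hochschild 2-cochains, dual to `G_2`. -/
def dualG2 (f : S → QuotAlg φ) : C2 k (QuotAlg φ) :=
  TensorProduct.curry (evalCochain (W := amb S 2) f ∘ₗ mapG2 φ ∘ₗ insert2 φ)

/-- The map `h^2` from the Hochschild 3-cochains to the Hochschild 2-cochains, dual to `h_2`. -/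
def dualH2 (g : C3 k (QuotAlg φ)) : C2 k (QuotAlg φ) :=
  TensorProduct.curry (evalBar3 g ∘ₗ homotopy2 φ ∘ₗ insert2 φ)

/-- The map `F^3` from the Hochschild 3-cochains to the cochains `Hom(kS_3, A)`, dual to `F_3`. -/
def dualF3 (g : C3 k (QuotAlg φ)) (x : amb S 3) : QuotAlg φ :=
  evalBar3 g (mapF3 φ (gen φ x))

/-! ### The L-infinity[1] algebra of a reduction system

Only the brackets of elements of degree zero, i.e. of cochains in `Hom(kS, A)`, are needed.
They are obtained by homotopy transfer from the Hochschild complex along `F`, `G`, `h`. -/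

/-- The subsets `Y ≠ X` of `X` that contain the smallest element of `X`: they represent the
unordered decompositions of `X` into two nonempty disjoint subsets `Y`, `X \ Y`. -/
def halves {n : ℕ} (X : Finset (Fin n)) : Finset (Finset (Fin n)) :=
  X.powerset.filter fun Y => Y ≠ X ∧ ∃ i ∈ Y, ∀ j ∈ X, i ≤ j

/-- Auxiliary recursion for `transferG`; the first argument bounds the cardinality of `X`. -/
def transferGAux {n : ℕ} (f : Fin n → S → QuotAlg φ) : ℕ → Finset (Fin n) → C2 k (QuotAlg φ)
  | 0, _ => 0
  | m + 1, X =>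
    if X.card = 1 then ∑ i ∈ X, dualG2 φ (f i)
    else ∑ Y ∈ halves X, dualH2 φ (gerst (transferGAux f m Y) (transferGAux f m (X \ Y)))

/-- The components of the transferred L-infinity morphism to the Hochschild complex:
the component on one element is `G^2`, and the component on the elements `f i`, `i ∈ X`, is
the sum of `h^2 [G_Y, G_{X \ Y}]` over the decompositions of `X`. -/
def transferG {n : ℕ} (f : Fin n → S → QuotAlg φ) (X : Finset (Fin n)) : C2 k (QuotAlg φ) :=
  transferGAux φ f X.card X

/-- The value at `x ∈ S_3` of the `n`-ary bracket `⟨f_1, …, f_n⟩` of `n` cochains in `Hom(kS, A)`.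
The unary bracket is the differential `f ↦ f ∂_3`, and for `n ≥ 2` the bracket is the sum of
`F^3 [G_Y, G_Z]` over the decompositions `{1, …, n} = Y ∪ Z`. -/
def bracket (n : ℕ) (f : Fin n → S → QuotAlg φ) (x : amb S 3) : QuotAlg φ :=
  if n = 1 then ∑ i, evalCochain (W := amb S 2) (f i) (diff φ 2 (gen φ x))
  else ∑ Y ∈ halves Finset.univ, dualF3 φ (gerst (transferG φ f Y) (transferG φ f Yᶜ)) x

end Resolution

/-! ### The Maurer-Cartan equation -/

section MaurerCartan

open PathAlgebra

variable {k : Type u} [Field k] {V : Type v} [Quiver.{w} V] [Fintype V]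
  {S : Set (QPath V)} (φ : S → PathAlgebra k V)

/-- The cochain in `Hom(kS, A)` that corresponds to an element of `Hom(kS, k Irr_S)`. -/
def toQuot (f : S → PathAlgebra k V) (s : S) : QuotAlg φ := proj φ (f s)

/-- The term `1/n! ⟨f, …, f⟩_n` of the Maurer-Cartan equation, at `x ∈ S_3`. -/
def mcTerm (f : S → PathAlgebra k V) (x : amb S 3) (n : ℕ) : QuotAlg φ :=
  (n.factorial : k)⁻¹ • bracket φ n (fun _ => toQuot φ f) x

/-- The element `f` satisfies the Maurer-Cartan equation `∑_{n ≥ 1} 1/n! ⟨f, …, f⟩_n = 0`,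
where the sum is finite at each `x ∈ S_3`. -/
def MaurerCartan (f : S → PathAlgebra k V) : Prop :=
  ∀ x, (Function.support fun n => mcTerm φ f x (n + 1)).Finite ∧
    ∑ᶠ n, mcTerm φ f x (n + 1) = 0

variable {N : ℕ} (b : Fin N → S → PathAlgebra k V)

/-- The homogeneous part of degree `n` of the polynomial `mcPoly`. -/
def mcPolyDeg (x : amb S 3) (p : QPath V) (n : ℕ) : MvPolynomial (Fin N) k :=
  ∑ i : Fin n → Fin N,
    MvPolynomial.C ((n.factorial : k)⁻¹ *
      coeff p (irrSection φ (bracket φ n (fun j => toQuot φ (b (i j))) x))) *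
    ∏ j, MvPolynomial.X (i j)

/-- The coefficient of the irreducible path `p` in the value at `x ∈ S_3` of the left-hand side
of the Maurer-Cartan equation for the generic element `X_1 b_1 + ⋯ + X_N b_N`, as a polynomial
in the coordinates `X_1, …, X_N`. -/
def mcPoly (x : amb S 3) (p : QPath V) : MvPolynomial (Fin N) k :=
  ∑ᶠ n, mcPolyDeg φ b x p (n + 1)

/-- The ideal generated by the Maurer-Cartan polynomials. -/
def mcIdeal : Ideal (MvPolynomial (Fin N) k) :=
  Ideal.span {f | ∃ x p, f = mcPoly φ b x p}

/-- The Zariski tangent space at the point `a` of the subscheme of affine space that is defined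
by the ideal `J`: the vectors that are annihilated by the differentials of all `f ∈ J`. -/
def zariskiTangent (J : Ideal (MvPolynomial (Fin N) k)) (a : Fin N → k) :
    Submodule k (Fin N → k) :=
  ⨅ f ∈ J, LinearMap.ker
    (∑ i, MvPolynomial.eval a (MvPolynomial.pderiv i f) • LinearMap.proj (R := k) (φ := fun _ => k) i)

/-- The variety `V_≺` of reduction systems: the elements `f` of `Hom(kS, A)_≺` for which the
reduction system of `φ + f` is reduction unique. -/
def redVariety (prec : QPath V → QPath V → Prop) : Set (S → PathAlgebra k V) :=
  {f | f ∈ cochPrec k S prec ∧ SystemUnique (φ + f)}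

/-- The orbit of `f` under the groupoid of reduction systems, restricted to `V_≺`. -/
def orbit (prec : QPath V → QPath V → Prop) (f : S → PathAlgebra k V) :
    Set (S → PathAlgebra k V) :=
  {f' | f' ∈ redVariety φ prec ∧ ∃ T, IsEquivalence (φ + f) (φ + f') T}

/-- The elements `f` of `Hom(kS, k Irr_S)` for which the reduction system of `f` is reduction
unique: the objects of the groupoid of reduction systems. -/
def uniqueSystems (k : Type u) [CommRing k] (S : Set (QPath V)) : Set (S → PathAlgebra k V) :=
  {f | f ∈ coch k S S ∧ SystemUnique f}

/-- Extension of scalars from `k` to a commutative `k`-algebra `B`. -/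
def baseChange (B : Type u) [CommRing B] [Algebra k B] :
    PathAlgebra k V → PathAlgebra B V :=
  Finsupp.mapRange (algebraMap k B) (map_zero _)

/-- The function `φ + x_1 b_1 + ⋯ + x_N b_N` over the `k`-algebra `B`. -/
def pointOver (B : Type u) [CommRing B] [Algebra k B] (x : Fin N → B) (s : S) :
    PathAlgebra B V :=
  baseChange B (φ s) + ∑ i, x i • baseChange B (b i s)

/-- The function `φ + ε v` over the dual numbers `k[ε]`. -/
def dualPoint (v : S → PathAlgebra k V) (s : S) : PathAlgebra (DualNumber k) V :=
  baseChange (DualNumber k) (φ s) + (DualNumber.eps : DualNumber k) •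
    baseChange (DualNumber k) (v s)

/-- `v` is a 2-cocycle of the complex `Hom(kS_•, A)` of the reduction system `R_φ`. -/
def IsCocycle (v : S → PathAlgebra k V) : Prop :=
  ∀ x : amb S 3, evalCochain (W := amb S 2) (toQuot φ v) (diff φ 2 (gen φ x)) = 0

/-- `v` is a 2-coboundary of the complex `Hom(kS_•, A)` of the reduction system `R_φ`: it
is the image of an element of `Hom(kQ_1, A)`. -/
def IsCoboundary (v : S → PathAlgebra k V) : Prop :=
  ∃ ψ ∈ coch k S (amb S 1), ∀ s : S,
    toQuot φ v s = evalCochain (fun x : amb S 1 => proj φ (ψ x)) (diff φ 1 (gen φ (n := 2) s))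

/-- The Zariski tangent space at the point `f` of the subscheme of the affine space `Hom(kS, A)_≺`
that is cut out by the Maurer-Cartan equation, in the coordinates given by a basis `c`. -/
def tangentSpace {prec : QPath V → QPath V → Prop} (c : Module.Basis (Fin N) k (cochPrec k S prec))
    (f : cochPrec k S prec) : Submodule k (cochPrec k S prec) :=
  (zariskiTangent (mcIdeal φ fun i => (c i).1) (c.equivFun f)).comap c.equivFun.toLinearMap

/-- The tangent space at `f` to the orbit of `f` under the groupoid: the vectors `v`
in `Hom(kS, A)_≺` such that `f + ε v` is a point over the dual numbers `k[ε]` of the variety `V_≺`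
and lies in the orbit of `f` under the groupoid of reduction systems over `k[ε]`. -/
def orbitTangent (prec : QPath V → QPath V → Prop) (f : S → PathAlgebra k V) :
    Set (cochPrec k S prec) :=
  {v | SystemUnique (dualPoint (φ + f) v.1) ∧
    Equivalent (fun s => baseChange (DualNumber k) ((φ + f) s)) (dualPoint (φ + f) v.1)}

end MaurerCartan

end

end ReductionSystem

open ReductionSystem

/-! Fix an overlap `w = s r`, where `s = x s'` with an arrow `x` and `s' r` is minimally reducible;
the overlaps are exactly the elements of `S_3` (`IsReductionSet.mem_amb_three`). For a system `ψ`
with `ψ_s` below `s`, right-most reduction terminates, and the diamond lemma says that `ψ` is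
reduction unique exactly when the `obstruction`, the difference of the normal forms of `w` and of
`ψ_s r`, vanishes at every overlap (`systemUnique_iff_obstruction`). The heart of the proof is
therefore `mcTerm_eq`: the term of degree `n` of the Maurer-Cartan equation at `w` is the
coefficient of `t^n` in the obstruction of `φ + t f` over `k[t]`.

To see this, put `β_1 = G^2(f)` and `β_n = h^2(γ_n)` for `n ≥ 2`, with `γ_n = -∑ β_i ∘ β_j` over `i
+ j = n`. Counting decompositions of a finite set shows that the `n`-ary bracket on equal arguments
is `n!` times `F^3(γ_n)` (`bracket_const`), which cancels the factor `1/n!`. The product `a ⋆ b = a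
b + ∑ β_n(a, b) t^n` turns out to be the normal form, with respect to `φ + t f`, of the product of
the normal forms of `a` and `b` (`starSeries_eq`). Both sides obey the same recursion along the
order: they agree with concatenation when the result is irreducible, they replace `s r` by `(φ_s + t
f_s) r`, and an initial arrow may be split off. On the side of the resolution this recursion comes
from the homotopy `ρ_1`, a geometric series that carries out one reduction after the other
(`crossing_arrow_of_head`). Uniqueness of `φ + t f` is not needed, because right-most reduction is
compatible with left multiplication for every terminating system (`redInf_mul_redInf`). Evaluating
at `w` gives the coefficients of `x ⋆ (s' ⋆ r) - (φ_s + t f_s) ⋆ r` (`evalCochain_overlapDiff`),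
which is the obstruction.

Normal forms commute with extension of scalars. Hence the generic point over `k[X_1, …, X_N]`
governs all `B`-points at once: the coefficients of its obstruction are the Maurer-Cartan
polynomials (`mcPoly_eq`), without constant term because `φ` is reduction unique. Over the dual
numbers only the linear term survives, so tangent vectors are cocycles. For a cocycle `v` the normal
form product over `k[ε]` is associative, and its `ε`-part is `G^2(v)`; this makes `G^2(v)` a
Hochschild cocycle.

For the groupoid, the irreducible paths of a reduction unique system form a basis of its algebra,
and an element of `G(ψ, ψ')` is an algebra isomorphism written in these bases. A general element of
`MC` is not bounded by the order; termination of right-most reduction is then extracted from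
reduction finiteness (`wellFounded_redStep`). Over `k[ε]`, an equivalence `T` induces an algebra
automorphism of the undeformed algebra modulo `ε`, and its `ε`-part, corrected by the inverse of
that automorphism, is a derivation `δ` of the path algebra with `δ(s - φ_s) = v_s`. Conversely such
a `δ` exponentiates to `x ↦ x + ε δ(x)`. Existence of `δ` is the coboundary condition, since `∂_2`
sends `s` to the universal derivation of `s - φ_s` (`diff_one_tens`). -/

namespace ReductionSystem

noncomputable section

open scoped Classical TensorProduct

open PathAlgebra

/-! ### Paths as lists of arrows -/

namespace QPath

variable {V : Type v} [Quiver.{w} V]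

/-- The list of arrows of a path between fixed vertices. -/
def arrowList {a : V} : {b : V} → Quiver.Path a b → List (Σ a b : V, a ⟶ b)
  | _, .nil => []
  | _, .cons p x => arrowList p ++ [⟨_, _, x⟩]

/-- The list of arrows of a path. -/
def arrows (p : QPath V) : List (Σ a b : V, a ⟶ b) := arrowList p.path

theorem arrowList_comp {a b c : V} (p : Quiver.Path a b) (q : Quiver.Path b c) :
    arrowList (p.comp q) = arrowList p ++ arrowList q := by
  induction q with
  | nil => simp [arrowList]
  | cons q x ih => simp [arrowList, ih]

theorem arrows_comp (p q : QPath V) (h : p.tgt = q.src) :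
    (p.comp q h).arrows = p.arrows ++ q.arrows := by
  obtain ⟨a, b, p⟩ := p
  obtain ⟨c, d, q⟩ := q
  dsimp only at h
  subst h
  simp [comp, arrows, arrowList_comp]

theorem length_arrows (p : QPath V) : p.arrows.length = p.length := by
  obtain ⟨a, b, p⟩ := p
  simp only [arrows, length]
  induction p with
  | nil => rfl
  | cons p x ih => simp [arrowList, ih]

@[simp] theorem arrows_idPath (i : V) : (idPath i).arrows = [] := rfl

@[simp] theorem arrows_arrow {a b : V} (x : a ⟶ b) : (arrow x).arrows = [⟨a, b, x⟩] := rfl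

/-- The source is part of the data because a path of length zero has an empty list of arrows, which
forgets the vertex. -/
theorem ext_src {p q : QPath V} (h : p.src = q.src) (h' : p.arrows = q.arrows) : p = q := by
  obtain ⟨a, b, p⟩ := p
  obtain ⟨c, d, q⟩ := q
  dsimp only at h
  subst h
  simp only [arrows] at h'
  induction p generalizing d with
  | nil =>
    cases q with
    | nil => rfl
    | cons q y => simp [arrowList] at h'
  | cons p x ih =>
    cases q with
    | nil => simp [arrowList] at h'
    | cons q y =>
      simp only [arrowList] at h'
      obtain ⟨h1, h2⟩ := List.append_inj' h' rfl
      simp only [List.cons.injEq, and_true] at h2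
      have := ih _ q h1
      cases this
      cases h2
      rfl

theorem src_of_arrows {p : QPath V} {x l} (h : p.arrows = x :: l) : p.src = x.1 := by
  obtain ⟨a, b, p⟩ := p
  simp only [arrows] at h ⊢
  induction p generalizing l with
  | nil => simp [arrowList] at h
  | cons p y ih =>
    simp only [arrowList] at h
    cases hp : arrowList p with
    | nil =>
      rw [hp] at h
      cases p with
      | nil => simp at h; rw [← h.1]
      | cons p z => simp [arrowList] at hp
    | cons z l' =>
      rw [hp] at h
      simp at h
      exact ih (l := l') (by rw [hp, h.1])

theorem ext_arrows {p q : QPath V} (h' : p.arrows = q.arrows) (h : p.arrows ≠ []) : p = q := by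
  refine ext_src ?_ h'
  cases hp : p.arrows with
  | nil => exact absurd hp h
  | cons x l => rw [src_of_arrows hp, src_of_arrows (h'.symm.trans hp)]

theorem eq_idPath_of_arrows {p : QPath V} (h : p.arrows = []) : p = idPath p.src :=
  ext_src rfl (by simp [h])

theorem exists_split (p : QPath V) (l₁ l₂) (h : p.arrows = l₁ ++ l₂) :
    ∃ q r, Factors q r p ∧ q.arrows = l₁ ∧ r.arrows = l₂ := by
  obtain ⟨a, b, p⟩ := p
  simp only [arrows] at h
  induction p generalizing l₂ with
  | nil =>
    simp [arrowList] at h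
    exact ⟨idPath a, idPath a, ⟨rfl, idPath_comp (idPath a) _ rfl⟩, by simp [h.1], by simp [h.2]⟩
  | @cons b c p x ih =>
    simp only [arrowList] at h
    rcases List.eq_nil_or_concat l₂ with rfl | ⟨l₃, y, rfl⟩
    · refine ⟨⟨a, c, p.cons x⟩, idPath c, ⟨rfl, comp_idPath _ _ rfl⟩, ?_, rfl⟩
      simpa [arrows, arrowList] using h
    · simp only [List.concat_eq_append, ← List.append_assoc] at h
      obtain ⟨h1, h2⟩ := List.append_inj' h rfl
      obtain ⟨q, r, ⟨e, hqr⟩, hq, hr⟩ := ih _ h1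
      have e2 : r.tgt = (arrow x).src := congrArg QPath.tgt hqr
      have e3 : (q.comp r e).tgt = (arrow x).src := e2
      refine ⟨q, r.comp (arrow x) e2, ⟨e, ?_⟩, hq, ?_⟩
      · rw [← comp_assoc q r (arrow x) e e2]
        apply ext_src
        · exact (show (q.comp r e).src = a from congrArg QPath.src hqr)
        · refine (arrows_comp _ _ e3).trans ?_
          rw [hqr]
          rfl
      · rw [arrows_comp, hr, arrows_arrow, h2, List.concat_eq_append]

theorem factors_iff {q r p : QPath V} :
    Factors q r p ↔ q.tgt = r.src ∧ p.src = q.src ∧ p.arrows = q.arrows ++ r.arrows := by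
  constructor
  · rintro ⟨h, rfl⟩
    exact ⟨h, rfl, arrows_comp _ _ _⟩
  · rintro ⟨h, h1, h2⟩
    exact ⟨h, ext_src h1.symm (by rw [arrows_comp, h2])⟩

theorem Factors.tgt {q r p : QPath V} (h : Factors q r p) : p.tgt = r.tgt := by
  obtain ⟨h, rfl⟩ := h; rfl

theorem Factors.src {q r p : QPath V} (h : Factors q r p) : p.src = q.src := by
  obtain ⟨h, rfl⟩ := h; rfl

theorem Factors.mid {q r p : QPath V} (h : Factors q r p) : q.tgt = r.src := h.1

theorem Factors.arrows {q r p : QPath V} (h : Factors q r p) : p.arrows = q.arrows ++ r.arrows :=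
  (factors_iff.mp h).2.2

theorem Factors.length {q r p : QPath V} (h : Factors q r p) : p.length = q.length + r.length := by
  rw [← length_arrows, h.arrows, List.length_append, length_arrows, length_arrows]

theorem factors_comp (q r : QPath V) (h : q.tgt = r.src) : Factors q r (q.comp r h) := ⟨h, rfl⟩

theorem Factors.assoc {q x r y p : QPath V} (h : Factors q x y) (h' : Factors y r p) :
    ∃ z, Factors x r z ∧ Factors q z p := by
  obtain ⟨e, rfl⟩ := h
  obtain ⟨e', rfl⟩ := h'
  exact ⟨x.comp r e', ⟨e', rfl⟩, ⟨e, (comp_assoc q x r e e').symm⟩⟩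

theorem Factors.assoc' {q x r z p : QPath V} (h : Factors x r z) (h' : Factors q z p) :
    ∃ y, Factors q x y ∧ Factors y r p := by
  obtain ⟨e, rfl⟩ := h
  obtain ⟨e', rfl⟩ := h'
  exact ⟨q.comp x e', ⟨e', rfl⟩, ⟨e, comp_assoc q x r e' e⟩⟩

theorem factors3_iff {q x r p : QPath V} :
    Factors3 q x r p ↔ q.tgt = x.src ∧ x.tgt = r.src ∧ p.src = q.src ∧
      p.arrows = q.arrows ++ x.arrows ++ r.arrows := by
  constructor
  · rintro ⟨y, h, h'⟩
    exact ⟨h.mid, h.tgt.symm.trans h'.mid, h'.src.trans h.src, by rw [h'.arrows, h.arrows]⟩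
  · rintro ⟨h1, h2, h3, h4⟩
    refine ⟨q.comp x h1, ⟨h1, rfl⟩, factors_iff.mpr ⟨h2, h3, ?_⟩⟩
    rw [h4, arrows_comp]

theorem exists_split3 (p x : QPath V) (l₁ l₂) (hx : x.arrows ≠ [])
    (h : p.arrows = l₁ ++ x.arrows ++ l₂) :
    ∃ q r, Factors3 q x r p ∧ q.arrows = l₁ ∧ r.arrows = l₂ := by
  obtain ⟨y, r, hyr, hy, hr⟩ := exists_split p _ _ h
  obtain ⟨q, x', hqx, hq, hx'⟩ := exists_split y _ _ hy
  obtain rfl : x' = x := ext_arrows hx' (by rwa [hx'])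
  exact ⟨q, r, ⟨y, hqx, hyr⟩, hq, hr⟩

theorem isSubpath_iff {x p : QPath V} (hx : x.arrows ≠ []) :
    x.IsSubpath p ↔ x.arrows <:+: p.arrows := by
  constructor
  · rintro ⟨q, r, h⟩
    exact ⟨q.arrows, r.arrows, (factors3_iff.mp h).2.2.2.symm⟩
  · rintro ⟨l₁, l₂, h⟩
    obtain ⟨q, r, h, -⟩ := exists_split3 p x l₁ l₂ hx h.symm
    exact ⟨q, r, h⟩

theorem Factors3.unique {q x r q' x' r' p : QPath V} (h : Factors3 q x r p)
    (h' : Factors3 q' x' r' p) (hq : q.length = q'.length) (hx : x.length = x'.length) :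
    q = q' ∧ x = x' ∧ r = r' := by
  rw [factors3_iff] at h h'
  have e := h.2.2.2.symm.trans h'.2.2.2
  rw [List.append_assoc, List.append_assoc] at e
  obtain ⟨e1, e2⟩ := List.append_inj e (by simpa [length_arrows] using hq)
  obtain ⟨e3, e4⟩ := List.append_inj e2 (by simpa [length_arrows] using hx)
  have hq' : q = q' := ext_src (h.2.2.1.symm.trans h'.2.2.1) e1
  subst hq'
  have hx' : x = x' := ext_src (h.1.symm.trans h'.1) e3
  subst hx'
  exact ⟨rfl, rfl, ext_src (h.2.1.symm.trans h'.2.1) e4⟩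

theorem Factors3.left {q x r p : QPath V} (h : Factors3 q x r p) :
    ∃ z, Factors x r z ∧ Factors q z p := by
  obtain ⟨y, h1, h2⟩ := h
  exact h1.assoc h2

theorem Factors3.of_left {q x r z p : QPath V} (h : Factors x r z) (h' : Factors q z p) :
    Factors3 q x r p := h.assoc' h'

theorem Factors.unique {q r q' r' p : QPath V} (h : Factors q r p) (h' : Factors q' r' p)
    (hq : q.length = q'.length) : q = q' ∧ r = r' := by
  rw [factors_iff] at h h'
  have e := h.2.2.symm.trans h'.2.2
  obtain ⟨e1, e2⟩ := List.append_inj e (by simpa [length_arrows] using hq)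
  have hq' : q = q' := ext_src (h.2.1.symm.trans h'.2.1) e1
  subst hq'
  exact ⟨rfl, ext_src (h.1.symm.trans h'.1) e2⟩

theorem Factors.eq_left {q r p : QPath V} (h : Factors q r p) (hr : r.length = 0) : q = p := by
  have e := h.arrows
  have hr' : r.arrows = [] := List.length_eq_zero_iff.mp (by rw [length_arrows]; exact hr)
  rw [hr', List.append_nil] at e
  exact ext_src h.src.symm e.symm

theorem Factors.eq_right {q r p : QPath V} (h : Factors q r p) (hq : q.length = 0) : r = p := by
  have e := h.arrows
  have hq' : q.arrows = [] := List.length_eq_zero_iff.mp (by rw [length_arrows]; exact hq)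
  rw [hq', List.nil_append] at e
  refine ext_src ?_ e.symm
  rw [h.src, ← h.mid]
  exact congrArg QPath.tgt (eq_idPath_of_arrows hq')

theorem factors_idPath_left (p : QPath V) : Factors (idPath p.src) p p :=
  ⟨rfl, idPath_comp _ _ rfl⟩

theorem factors_idPath_right (p : QPath V) : Factors p (idPath p.tgt) p :=
  ⟨rfl, comp_idPath _ _ rfl⟩

/-- A path of positive length begins with an arrow. -/
theorem exists_head (p : QPath V) (h : p.arrows ≠ []) :
    ∃ x q, x.length = 1 ∧ Factors x q p := by
  cases hp : p.arrows with
  | nil => exact absurd hp h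
  | cons y l =>
    obtain ⟨x, q, h1, h2, -⟩ := exists_split p [y] l hp
    exact ⟨x, q, by rw [← length_arrows, h2]; rfl, h1⟩

/-- Induction on the first arrow of a path. -/
theorem head_induction {P : QPath V → Prop} (p : QPath V) (h0 : ∀ i, P (idPath i))
    (hs : ∀ x q p, x.length = 1 → Factors x q p → P q → P p) : P p := by
  induction hn : p.arrows.length generalizing p with
  | zero =>
    rw [eq_idPath_of_arrows (List.length_eq_zero_iff.mp hn)]
    exact h0 _
  | succ n ih =>
    obtain ⟨x, q, hx, hq⟩ := exists_head p (by rintro h; simp [h] at hn)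
    refine hs x q p hx hq (ih q ?_)
    have := hq.length
    rw [length_arrows] at hn ⊢
    omega

theorem eq_of_factors {q r p p' : QPath V} (h : Factors q r p) (h' : Factors q r p') : p = p' := by
  obtain ⟨_, rfl⟩ := h
  obtain ⟨_, rfl⟩ := h'
  rfl

theorem eq_of_factors3 {q x r p p' : QPath V} (h : Factors3 q x r p) (h' : Factors3 q x r p') :
    p = p' := by
  obtain ⟨y, h1, h2⟩ := h
  obtain ⟨y', h1', h2'⟩ := h'
  obtain rfl := eq_of_factors h1 h1'
  exact eq_of_factors h2 h2'

theorem Parallel.refl (p : QPath V) : p.Parallel p := ⟨rfl, rfl⟩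

theorem Parallel.symm {p q : QPath V} (h : p.Parallel q) : q.Parallel p := ⟨h.1.symm, h.2.symm⟩

theorem Parallel.trans {p q r : QPath V} (h : p.Parallel q) (h' : q.Parallel r) : p.Parallel r :=
  ⟨h.1.trans h'.1, h.2.trans h'.2⟩

theorem IsSubpath.of_factors_left {x q r p : QPath V} (h : x.IsSubpath q) (h' : Factors q r p) :
    x.IsSubpath p := by
  obtain ⟨a, b, y, h1, h2⟩ := h
  obtain ⟨z, h3, h4⟩ := h2.assoc h'
  exact ⟨a, z, y, h1, h4⟩

theorem IsSubpath.of_factors_right {x q r p : QPath V} (h : x.IsSubpath r) (h' : Factors q r p) :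
    x.IsSubpath p := by
  obtain ⟨a, b, h1⟩ := h
  obtain ⟨z, h2, h3⟩ := h1.left
  obtain ⟨y, h4, h5⟩ := h3.assoc' h'
  exact ⟨y, b, Factors3.of_left h2 h5⟩

theorem isSubpath_left {q r p : QPath V} (h : Factors q r p) : q.IsSubpath p :=
  ⟨idPath q.src, r, q, factors_idPath_left q, h⟩

theorem isSubpath_right {q r p : QPath V} (h : Factors q r p) : r.IsSubpath p :=
  ⟨q, idPath r.tgt, p, h, by rw [← h.tgt]; exact factors_idPath_right p⟩

end QPath

/-! ### Irreducible paths and occurrences of elements of `S` -/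

variable {V : Type v} [Quiver.{w} V] {S : Set (QPath V)}

theorem IsReductionSet.arrows_ne_nil (hS : IsReductionSet S) {s : QPath V} (hs : s ∈ S) :
    s.arrows ≠ [] := by
  intro h
  have := hS.two_le_length s hs
  rw [← QPath.length_arrows, h] at this
  simp at this

theorem Irr.left {q r p : QPath V} (hp : p ∈ Irr S) (h : QPath.Factors q r p) : q ∈ Irr S :=
  fun s hs h' => hp s hs (h'.of_factors_left h)

theorem Irr.right {q r p : QPath V} (hp : p ∈ Irr S) (h : QPath.Factors q r p) : r ∈ Irr S :=
  fun s hs h' => hp s hs (h'.of_factors_right h)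

theorem IsReductionSet.irr_of_length_le_one (hS : IsReductionSet S) {p : QPath V}
    (hp : p.length ≤ 1) : p ∈ Irr S := by
  intro s hs h
  have h1 := (QPath.isSubpath_iff (hS.arrows_ne_nil hs)).mp h
  have h2 := h1.length_le
  have h3 := hS.two_le_length s hs
  rw [QPath.length_arrows, QPath.length_arrows] at h2
  omega

theorem not_irr_of_mem {s : QPath V} (hs : s ∈ S) : s ∉ Irr S := fun h =>
  h s hs (QPath.isSubpath_left (QPath.factors_idPath_right s))

theorem exists_factors3_of_not_irr {p : QPath V} (hp : p ∉ Irr S) :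
    ∃ q, ∃ s : S, ∃ r, QPath.Factors3 q s r p := by
  simp only [Irr, Set.mem_ofPred_eq, not_forall, not_not] at hp
  obtain ⟨s, hs, q, r, h⟩ := hp
  exact ⟨q, ⟨s, hs⟩, r, h⟩

theorem not_irr_of_factors3 {p q r : QPath V} {s : S} (h : QPath.Factors3 q s r p) :
    p ∉ Irr S := fun hp => hp s s.2 ⟨q, r, h⟩

/-- Two elements of `S` at the same position of a path coincide. -/
theorem IsReductionSet.unique_of_length (hS : IsReductionSet S) {q r q' r' p : QPath V}
    {s s' : S} (h : QPath.Factors3 q s r p) (h' : QPath.Factors3 q' s' r' p)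
    (hq : q.length = q'.length) : q = q' ∧ s = s' ∧ r = r' := by
  have key : (s : QPath V).length = (s' : QPath V).length := by
    have h1 := QPath.factors3_iff.mp h
    have h2 := QPath.factors3_iff.mp h'
    have e := h1.2.2.2.symm.trans h2.2.2.2
    rw [List.append_assoc, List.append_assoc] at e
    obtain ⟨-, e2⟩ := List.append_inj e (by simpa [QPath.length_arrows] using hq)
    -- Two initial segments of one list are comparable, so one element of `S` is a subpath of the
    -- other and the antichain condition makes them equal.
    rcases List.append_eq_append_iff.mp e2 with ⟨l, hl, -⟩ | ⟨l, hl, -⟩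
    · rw [hS.antichain s s.2 s' s'.2 ((QPath.isSubpath_iff (hS.arrows_ne_nil s.2)).mpr
        ⟨[], l, by simp [hl]⟩)]
    · rw [hS.antichain s' s'.2 s s.2 ((QPath.isSubpath_iff (hS.arrows_ne_nil s'.2)).mpr
        ⟨[], l, by simp [hl]⟩)]
  obtain ⟨h1, h2, h3⟩ := h.unique h' hq key
  exact ⟨h1, Subtype.ext h2, h3⟩

theorem exists_isRightmost {p : QPath V} (hp : p ∉ Irr S) :
    ∃ t : QPath V × S × QPath V, IsRightmost S p t := by
  obtain ⟨q, s, r, h⟩ := exists_factors3_of_not_irr hp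
  let X : Set ℕ := {n | ∃ t : QPath V × S × QPath V, QPath.Factors3 t.1 t.2.1 t.2.2 p ∧
    t.1.length = n}
  have hX : X.Nonempty := ⟨_, (q, s, r), h, rfl⟩
  have hb : BddAbove X := ⟨p.length, by
    rintro n ⟨t, ht, rfl⟩
    have := congrArg List.length (QPath.factors3_iff.mp ht).2.2.2
    simp only [List.length_append, QPath.length_arrows] at this
    omega⟩
  obtain ⟨t, ht, hn⟩ := Nat.sSup_mem hX hb
  exact ⟨t, ht, fun t' ht' => hn ▸ le_csSup hb ⟨t', ht', rfl⟩⟩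

theorem IsReductionSet.isRightmost_unique (hS : IsReductionSet S) {p : QPath V}
    {t t' : QPath V × S × QPath V} (h : IsRightmost S p t) (h' : IsRightmost S p t') : t = t' := by
  obtain ⟨h1, h2, h3⟩ := hS.unique_of_length h.1 h'.1 (le_antisymm (h'.2 _ h.1) (h.2 _ h'.1))
  exact Prod.ext h1 (Prod.ext h2 h3)

/-- The right-most decomposition of a right factor is the right-most decomposition. -/
theorem IsReductionSet.isRightmost_of_right (hS : IsReductionSet S) {a p ap q q' r : QPath V} {s : S}
    (h : IsRightmost S p (q, s, r)) (hap : QPath.Factors a p ap) (hq : QPath.Factors a q q') :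
    IsRightmost S ap (q', s, r) := by
  obtain ⟨h1, h2⟩ := h
  obtain ⟨z, hz, hz'⟩ := QPath.Factors3.left h1
  obtain ⟨y, hy, hy'⟩ := hz'.assoc' hap
  obtain rfl := QPath.eq_of_factors hq hy
  refine ⟨QPath.Factors3.of_left hz hy', ?_⟩
  rintro ⟨q₁, s₁, r₁⟩ h3
  dsimp only at h3 ⊢
  by_contra hlt
  rw [not_le] at hlt
  have h4 := QPath.factors3_iff.mp h3
  -- An occurrence further to the right than `q'`, which begins with `a`, starts behind `a`. It is
  -- thus an occurrence in `p`, against the choice of `q`.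
  have hal : a.length ≤ q₁.length := by have := hq.length; omega
  have e := hap.arrows.symm.trans h4.2.2.2
  rw [List.append_assoc] at e
  rcases List.append_eq_append_iff.mp e with ⟨l, hl1, hl2⟩ | ⟨l, hl1, hl2⟩
  · obtain ⟨q₂, r₂, h5, hq2, hr2⟩ := QPath.exists_split3 p s₁ l r₁.arrows
      (hS.arrows_ne_nil s₁.2) (by rw [hl2, List.append_assoc])
    have h6 := h2 (q₂, s₁, r₂) h5
    have e1 := congrArg List.length hl1
    have e2 := congrArg List.length hq2
    have e3 := hq.length
    simp only [List.length_append, QPath.length_arrows] at e1 e2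
    dsimp only at h6
    omega
  · have e1 := congrArg List.length hl1
    simp only [List.length_append, QPath.length_arrows] at e1
    have hl : l = [] := List.length_eq_zero_iff.mp (by omega)
    subst hl
    obtain ⟨q₂, r₂, h5, hq2, hr2⟩ := QPath.exists_split3 p s₁ [] r₁.arrows
      (hS.arrows_ne_nil s₁.2) (by simpa using hl2.symm)
    have h6 := h2 (q₂, s₁, r₂) h5
    have e3 := hq.length
    simp at e1
    omega

/-- If `s = x s'` with an arrow `x` and `s' r` is irreducible, then `s` is the only
element of `S` that is a subpath of `s r`. -/
theorem IsReductionSet.factors3_unique (hS : IsReductionSet S) {x v p r : QPath V} {s : S}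
    (hx : x.length = 1) (hv : v ∈ Irr S) (hp : QPath.Factors x v p)
    (hs : QPath.Factors s r p) {q₁ r₁ : QPath V} {s₁ : S} (h : QPath.Factors3 q₁ s₁ r₁ p) :
    q₁ = QPath.idPath p.src ∧ s₁ = s ∧ r₁ = r := by
  have h0 : QPath.Factors3 (QPath.idPath p.src) s r p :=
    ⟨s, by rw [hs.src]; exact QPath.factors_idPath_left _, hs⟩
  -- An occurrence at a positive position lies behind the arrow `x`, inside the irreducible path
  -- `v`.
  have hq : q₁.length = 0 := by
    by_contra hne
    have h1 := QPath.factors3_iff.mp h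
    have e := hp.arrows.symm.trans h1.2.2.2
    obtain ⟨q', hq'⟩ : ∃ l, q₁.arrows = x.arrows ++ l := by
      rw [List.append_assoc] at e
      rcases List.append_eq_append_iff.mp e with ⟨l, hl, -⟩ | ⟨l, hl, -⟩
      · exact ⟨l, hl⟩
      · have := congrArg List.length hl
        simp only [List.length_append, QPath.length_arrows] at this
        have hl : l = [] := List.length_eq_zero_iff.mp (by omega)
        subst hl
        exact ⟨[], by simp [hl]⟩
    rw [hq'] at e
    simp only [List.append_assoc, List.append_cancel_left_eq] at e
    exact hv s₁ s₁.2 ((QPath.isSubpath_iff (hS.arrows_ne_nil s₁.2)).mpr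
      ⟨q', r₁.arrows, by rw [e]; simp⟩)
  exact hS.unique_of_length h h0 (by rw [hq]; rfl)

/-- If `p = x v` with an arrow `x` and `v` irreducible, then `p` is irreducible or begins
with an element of `S`. -/
theorem IsReductionSet.irr_or_factors (hS : IsReductionSet S) {x v p : QPath V}
    (hx : x.length = 1) (hv : v ∈ Irr S) (hp : QPath.Factors x v p) :
    p ∈ Irr S ∨ ∃ s : S, ∃ r, QPath.Factors s r p := by
  by_cases h : p ∈ Irr S
  · exact Or.inl h
  · right
    obtain ⟨q, s, r, h1⟩ := exists_factors3_of_not_irr h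
    refine ⟨s, r, ?_⟩
    have h2 := QPath.factors3_iff.mp h1
    cases hq : q.arrows with
    | nil =>
      obtain ⟨y, h3, h4⟩ := h1
      have : y = s := QPath.ext_arrows (by rw [h3.arrows, hq]; rfl)
        (by rw [h3.arrows, hq]; exact hS.arrows_ne_nil s.2)
      rwa [this] at h4
    | cons y l =>
      exfalso
      have e := hp.arrows.symm.trans h2.2.2.2
      have hx' : x.arrows.length = 1 := by rw [QPath.length_arrows, hx]
      obtain ⟨z, hz⟩ := List.length_eq_one_iff.mp hx'
      rw [hz, hq] at e
      simp only [List.cons_append, List.nil_append, List.cons.injEq] at e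
      exact hv s s.2 ((QPath.isSubpath_iff (hS.arrows_ne_nil s.2)).mpr ⟨l, r.arrows, e.2.symm⟩)

theorem IsReductionSet.isRightmost_head (hS : IsReductionSet S) {x v p r : QPath V} {s : S}
    (hx : x.length = 1) (hv : v ∈ Irr S) (hp : QPath.Factors x v p)
    (hs : QPath.Factors s r p) : IsRightmost S p (QPath.idPath p.src, s, r) :=
  ⟨⟨s, by rw [hs.src]; exact QPath.factors_idPath_left _, hs⟩, fun t' ht' => by
    obtain ⟨q', s', r'⟩ := t'
    rw [(hS.factors3_unique hx hv hp hs ht').1]⟩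

/-! ### Spans of sets of paths in the path algebra -/

section Algebra

variable {k : Type u} [CommRing k] {V : Type v} [Quiver.{w} V]

namespace PathAlgebra

theorem coeff_of (p q : QPath V) : coeff p (of k q) = if q = p then 1 else 0 :=
  Finsupp.single_apply

theorem ext_coeff {x y : PathAlgebra k V} (h : ∀ p, coeff p x = coeff p y) : x = y :=
  Finsupp.ext h

/-- The span of a set of paths. -/
def spanOn (k : Type u) [CommRing k] (X : Set (QPath V)) : Submodule k (PathAlgebra k V) where
  carrier := {x | ∀ p, coeff p x ≠ 0 → p ∈ X}
  zero_mem' p h := by simp at h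
  add_mem' {x y} hx hy p h := by
    by_contra hp
    have h1 : coeff p x = 0 := not_not.mp fun h' => hp (hx p h')
    have h2 : coeff p y = 0 := not_not.mp fun h' => hp (hy p h')
    simp [h1, h2] at h
  smul_mem' c x hx p h := by
    by_contra hp
    have h1 : coeff p x = 0 := not_not.mp fun h' => hp (hx p h')
    simp [h1] at h

theorem eq_sum (x : PathAlgebra k V) :
    ∃ F : Finset (QPath V), (∀ p ∈ F, coeff p x ≠ 0) ∧ x = ∑ p ∈ F, coeff p x • of k p := by
  refine ⟨Finsupp.support x, fun p hp => Finsupp.mem_support_iff.mp hp, ?_⟩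
  refine (Finsupp.sum_single x).symm.trans ?_
  refine Finset.sum_congr rfl fun p _ => ?_
  exact (Finsupp.smul_single_one p _).symm

theorem of_mem_spanOn {X : Set (QPath V)} {p : QPath V} (hp : p ∈ X) : of k p ∈ spanOn k X := by
  intro q hq
  rw [coeff_of] at hq
  split_ifs at hq with h
  · exact h ▸ hp
  · simp at hq

theorem spanOn_mono {X Y : Set (QPath V)} (h : X ⊆ Y) : spanOn k X ≤ spanOn k Y :=
  fun _ hx p hp => h (hx p hp)

theorem spanOn_le {X : Set (QPath V)} {N : Submodule k (PathAlgebra k V)}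
    (h : ∀ p ∈ X, of k p ∈ N) : spanOn k X ≤ N := by
  intro x hx
  obtain ⟨F, hF, e⟩ := eq_sum x
  rw [e]
  exact Submodule.sum_mem _ fun p hp => N.smul_mem _ (h p (hx p (hF p hp)))

theorem map_mem_of_spanOn {M : Type*} [AddCommGroup M] [Module k M] {X : Set (QPath V)}
    {x : PathAlgebra k V} (hx : x ∈ spanOn k X) (f : PathAlgebra k V →ₗ[k] M) (N : Submodule k M)
    (h : ∀ p ∈ X, f (of k p) ∈ N) : f x ∈ N :=
  (spanOn_le (N := N.comap f) h : _ ≤ _) hx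

theorem eq_of_spanOn {M : Type*} [AddCommGroup M] [Module k M] {X : Set (QPath V)}
    {x : PathAlgebra k V} (hx : x ∈ spanOn k X) (f g : PathAlgebra k V →ₗ[k] M)
    (h : ∀ p ∈ X, f (of k p) = g (of k p)) : f x = g x :=
  (spanOn_le (N := LinearMap.eqLocus f g) h : _ ≤ _) hx

theorem mem_spanOn_univ (x : PathAlgebra k V) : x ∈ spanOn k (Set.univ : Set (QPath V)) :=
  fun _ _ => trivial

theorem of_mul_factors {q r p : QPath V} (h : QPath.Factors q r p) : of k q * of k r = of k p := by
  obtain ⟨e, rfl⟩ := h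
  rw [of_mul_of, pathMul, dif_pos e]

theorem of_mul_eq_zero {q r : QPath V} (h : q.tgt ≠ r.src) : of k q * of k r = 0 := by
  rw [of_mul_of, pathMul, dif_neg h]

theorem mul_mem_spanOn {X Y Z : Set (QPath V)} {x y : PathAlgebra k V} (hx : x ∈ spanOn k X)
    (hy : y ∈ spanOn k Y) (h : ∀ p ∈ X, ∀ q ∈ Y, ∀ r, QPath.Factors p q r → r ∈ Z) :
    x * y ∈ spanOn k Z := by
  have h1 : ∀ p ∈ X, of k p * y ∈ spanOn k Z := fun p hp =>
    map_mem_of_spanOn hy (mulMap (of k p)) _ fun q hq => by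
      change of k p * of k q ∈ _
      by_cases e : p.tgt = q.src
      · rw [of_mul_factors (QPath.factors_comp p q e)]
        exact of_mem_spanOn (h p hp q hq _ (QPath.factors_comp p q e))
      · rw [of_mul_eq_zero e]
        exact zero_mem _
  exact map_mem_of_spanOn hx (mulMap.flip y) _ h1

end PathAlgebra

end Algebra

section Rings

variable {k : Type u} [CommRing k] {V : Type v} [Quiver.{w} V]

namespace PathAlgebra

theorem of_mul_factors3 {q x r p : QPath V} (h : QPath.Factors3 q x r p) :
    of k q * of k x * of k r = of k p := by
  obtain ⟨y, h1, h2⟩ := h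
  rw [of_mul_factors h1, of_mul_factors h2]

theorem idPath_mul (p : QPath V) : of k (QPath.idPath p.src) * of k p = of k p :=
  of_mul_factors (QPath.factors_idPath_left p)

theorem mul_idPath (p : QPath V) : of k p * of k (QPath.idPath p.tgt) = of k p :=
  of_mul_factors (QPath.factors_idPath_right p)

theorem idPath_mul_of_mem {i : V} {x : PathAlgebra k V} {X : Set (QPath V)}
    [Fintype V] (hx : x ∈ spanOn k X) (h : ∀ p ∈ X, p.src = i) :
    of k (QPath.idPath i) * x = x :=
  eq_of_spanOn hx (LinearMap.mulLeft k (of k (QPath.idPath i))) LinearMap.id fun p hp => by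
    rw [← h p hp]
    exact idPath_mul p

theorem mul_idPath_of_mem {i : V} {x : PathAlgebra k V} {X : Set (QPath V)}
    [Fintype V] (hx : x ∈ spanOn k X) (h : ∀ p ∈ X, p.tgt = i) :
    x * of k (QPath.idPath i) = x :=
  eq_of_spanOn hx (LinearMap.mulRight k (of k (QPath.idPath i))) LinearMap.id fun p hp => by
    rw [← h p hp]
    exact mul_idPath p

end PathAlgebra

end Rings

/-! ### Right-most reduction and normal forms -/

section Red

variable {k : Type u} [CommRing k] {V : Type v} [Quiver.{w} V] {S : Set (QPath V)}

theorem IsReductionSet.red_of_irr (ψ : S → PathAlgebra k V) {p : QPath V} (hp : p ∈ Irr S) :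
    red ψ (of k p) = of k p := by
  rw [red, lin_of, dif_neg]
  rintro ⟨t, ht⟩
  exact not_irr_of_factors3 ht.1 hp

theorem IsReductionSet.red_of_rightmost (hS : IsReductionSet S) (ψ : S → PathAlgebra k V)
    {p : QPath V} {q r : QPath V} {s : S} (h : IsRightmost S p (q, s, r)) :
    red ψ (of k p) = of k q * ψ s * of k r := by
  have hex : ∃ t : QPath V × S × QPath V, IsRightmost S p t := ⟨_, h⟩
  rw [red, lin_of, dif_pos hex, hS.isRightmost_unique hex.choose_spec h]

theorem IsReductionSet.red_irrMod (ψ : S → PathAlgebra k V) {x : PathAlgebra k V}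
    (hx : x ∈ irrMod k S) : red ψ x = x :=
  eq_of_spanOn (X := Irr S) hx (red ψ) LinearMap.id fun _ hp => IsReductionSet.red_of_irr ψ hp

/-- The right-most reduction terminates. -/
def RedTerminates (ψ : S → PathAlgebra k V) : Prop :=
  ∀ x, ∃ n, (red ψ)^[n] x ∈ irrMod k S

theorem iterate_red_irrMod (ψ : S → PathAlgebra k V) {x : PathAlgebra k V}
    (hx : x ∈ irrMod k S) (n : ℕ) : (red ψ)^[n] x = x := by
  induction n with
  | zero => rfl
  | succ n ih => rw [Function.iterate_succ_apply, IsReductionSet.red_irrMod ψ hx, ih]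

theorem iterate_red_mem (ψ : S → PathAlgebra k V) {x : PathAlgebra k V} {n m : ℕ}
    (hx : (red ψ)^[n] x ∈ irrMod k S) (h : n ≤ m) : (red ψ)^[m] x = (red ψ)^[n] x := by
  obtain ⟨d, rfl⟩ := Nat.exists_eq_add_of_le' h
  rw [Function.iterate_add_apply, iterate_red_irrMod ψ hx]

theorem redInf_eq (ψ : S → PathAlgebra k V) {x : PathAlgebra k V} {n : ℕ}
    (hx : (red ψ)^[n] x ∈ irrMod k S) : redInf ψ x = (red ψ)^[n] x := by
  have h : ∃ n, (red ψ)^[n] x ∈ irrMod k S := ⟨n, hx⟩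
  rw [redInf, dif_pos h]
  exact (iterate_red_mem ψ (Nat.find_spec h) (Nat.find_min' h hx)).symm

theorem redInf_of_irr (ψ : S → PathAlgebra k V) {x : PathAlgebra k V}
    (hx : x ∈ irrMod k S) : redInf ψ x = x := redInf_eq (n := 0) ψ hx

theorem redInf_red (ψ : S → PathAlgebra k V) (hT : RedTerminates ψ) (x : PathAlgebra k V) :
    redInf ψ (red ψ x) = redInf ψ x := by
  obtain ⟨n, hn⟩ := hT (red ψ x)
  rw [redInf_eq ψ hn, redInf_eq (n := n + 1) ψ (by rwa [Function.iterate_succ_apply]),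
    Function.iterate_succ_apply]

theorem redInf_mem (ψ : S → PathAlgebra k V) (x : PathAlgebra k V) :
    redInf ψ x ∈ irrMod k S := by
  by_cases h : ∃ n, (red ψ)^[n] x ∈ irrMod k S
  · rw [redInf_eq ψ h.choose_spec]
    exact h.choose_spec
  · rw [redInf, dif_neg h]
    exact zero_mem _

/-- The elements whose iterated reductions become irreducible form a submodule: for a sum, the
larger of the two exponents serves. Well-founded induction places every path in it. -/
theorem redTerminates_of_wf (ψ : S → PathAlgebra k V)
    (h : WellFounded fun p' p : QPath V => p ∉ Irr S ∧ coeff p' (red ψ (of k p)) ≠ 0) :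
    RedTerminates ψ := by
  have hlin : ∀ (f : PathAlgebra k V →ₗ[k] PathAlgebra k V) n, ⇑(f ^ n) = f^[n] := fun f n =>
    Module.End.coe_pow f n
  have hadd : ∀ x y : PathAlgebra k V, (∃ n, (red ψ)^[n] x ∈ irrMod k S) →
      (∃ n, (red ψ)^[n] y ∈ irrMod k S) → ∃ n, (red ψ)^[n] (x + y) ∈ irrMod k S := by
    rintro x y ⟨n, hn⟩ ⟨m, hm⟩
    refine ⟨max n m, ?_⟩
    rw [← hlin, map_add, hlin, iterate_red_mem ψ hn (le_max_left _ _),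
      iterate_red_mem ψ hm (le_max_right _ _)]
    exact add_mem hn hm
  have hsmul : ∀ (c : k) (x : PathAlgebra k V), (∃ n, (red ψ)^[n] x ∈ irrMod k S) →
      ∃ n, (red ψ)^[n] (c • x) ∈ irrMod k S := by
    rintro c x ⟨n, hn⟩
    refine ⟨n, ?_⟩
    rw [← hlin, map_smul, hlin]
    exact Submodule.smul_mem _ _ hn
  let N : Submodule k (PathAlgebra k V) :=
    { carrier := {x | ∃ n, (red ψ)^[n] x ∈ irrMod k S}
      zero_mem' := ⟨0, zero_mem _⟩
      add_mem' := fun {x y} => hadd x y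
      smul_mem' := hsmul }
  have key : ∀ p, of k p ∈ N := by
    intro p
    induction p using h.induction with
    | _ p ih =>
      by_cases hp : p ∈ Irr S
      · exact ⟨0, of_mem_spanOn (X := Irr S) hp⟩
      · have h1 : red ψ (of k p) ∈ N := by
          obtain ⟨F, hF, e⟩ := eq_sum (red ψ (of k p))
          rw [e]
          exact Submodule.sum_mem _ fun q hq => N.smul_mem _ (ih q ⟨hp, hF q hq⟩)
        obtain ⟨n, hn⟩ := h1
        exact ⟨n + 1, hn⟩
  exact fun x => (spanOn_le (X := Set.univ) (N := N) fun p _ => key p) (mem_spanOn_univ x)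

/-- The map `red^(∞)` as a linear map, for terminating right-most reductions. -/
def redLin (ψ : S → PathAlgebra k V) (hT : RedTerminates ψ) :
    PathAlgebra k V →ₗ[k] PathAlgebra k V where
  toFun := redInf ψ
  map_add' x y := by
    obtain ⟨n, hn⟩ := hT x
    obtain ⟨m, hm⟩ := hT y
    have h1 := iterate_red_mem ψ hn (le_max_left n m)
    have h2 := iterate_red_mem ψ hm (le_max_right n m)
    have h3 : (red ψ)^[max n m] (x + y) = (red ψ)^[n] x + (red ψ)^[m] y := by
      rw [← h1, ← h2]
      simp only [← Module.End.coe_pow, map_add]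
    rw [redInf_eq ψ hn, redInf_eq ψ hm, redInf_eq (n := max n m) ψ, h3]
    rw [h3]
    exact add_mem hn hm
  map_smul' c x := by
    obtain ⟨n, hn⟩ := hT x
    have h3 : (red ψ)^[n] (c • x) = c • (red ψ)^[n] x := by
      simp only [← Module.End.coe_pow, map_smul]
    rw [redInf_eq ψ hn, redInf_eq (n := n) ψ, h3]
    · rfl
    · rw [h3]
      exact Submodule.smul_mem _ _ hn

@[simp] theorem redLin_apply (ψ : S → PathAlgebra k V) (hT : RedTerminates ψ)
    (x : PathAlgebra k V) : redLin ψ hT x = redInf ψ x := rfl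

/-- The value of `red^(∞)` on `s r = x v` with an arrow `x` and `v` irreducible. -/
theorem redInf_head (hS : IsReductionSet S) (ψ : S → PathAlgebra k V)
    (hT : RedTerminates ψ) {x v p r : QPath V} {s : S}
    (hx : x.length = 1) (hv : v ∈ Irr S) (hp : QPath.Factors x v p) (hs : QPath.Factors s r p)
    (hsrc : of k (QPath.idPath (s : QPath V).src) * ψ s = ψ s) :
    redInf ψ (of k p) = redInf ψ (ψ s * of k r) := by
  rw [← redInf_red ψ hT, hS.red_of_rightmost ψ (hS.isRightmost_head hx hv hp hs), hs.src, hsrc]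

variable [Fintype V]

/-- Left multiplication does not change which occurrence is the right-most one. Reducibility of `p`
matters: if `p` is irreducible, `q p` may still be reducible. -/
theorem red_mul_of_not_irr (hS : IsReductionSet S) (ψ : S → PathAlgebra k V) (q : QPath V)
    {p : QPath V} (hp : p ∉ Irr S) : red ψ (of k q * of k p) = of k q * red ψ (of k p) := by
  obtain ⟨⟨a, s, b⟩, ht⟩ := exists_isRightmost hp
  rw [hS.red_of_rightmost ψ ht]
  by_cases e : q.tgt = p.src
  · have hqp := QPath.factors_comp q p e
    obtain ⟨z, hz, hz'⟩ := ht.1.left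
    obtain ⟨y, hy, -⟩ := hz'.assoc' hqp
    rw [of_mul_factors hqp, hS.red_of_rightmost ψ (hS.isRightmost_of_right ht hqp hy),
      ← of_mul_factors hy]
    simp only [mul_assoc]
  · have e' : q.tgt ≠ a.src := by
      rw [← (QPath.factors3_iff.mp ht.1).2.2.1]
      exact e
    rw [of_mul_eq_zero e, map_zero, mul_assoc, ← mul_assoc, of_mul_eq_zero e', zero_mul]

/-- Valid for every terminating system, since right-most reductions of the right factor stay
right-most in the product. Reducing the left factor first is legitimate only when reductions
resolve; this asymmetry shapes all later inductions, which split off the first arrow of a path. -/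
theorem redInf_mul_redInf (hS : IsReductionSet S) (ψ : S → PathAlgebra k V)
    (hT : RedTerminates ψ) (x y : PathAlgebra k V) :
    redInf ψ (x * redInf ψ y) = redInf ψ (x * y) := by
  have h1 : ∀ (q : QPath V) (y : PathAlgebra k V),
      redInf ψ (of k q * red ψ y) = redInf ψ (of k q * y) := by
    intro q y
    refine LinearMap.congr_fun (f := redLin ψ hT ∘ₗ LinearMap.mulLeft k (of k q) ∘ₗ red ψ)
      (g := redLin ψ hT ∘ₗ LinearMap.mulLeft k (of k q)) (lin_ext fun p => ?_) y
    simp only [LinearMap.comp_apply, LinearMap.mulLeft_apply, redLin_apply]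
    by_cases hp : p ∈ Irr S
    · rw [IsReductionSet.red_of_irr ψ hp]
    · rw [← red_mul_of_not_irr hS ψ q hp, redInf_red ψ hT]
  have h2 : ∀ (x y : PathAlgebra k V), redInf ψ (x * red ψ y) = redInf ψ (x * y) := by
    intro x y
    exact LinearMap.congr_fun (f := redLin ψ hT ∘ₗ LinearMap.mulRight k (red ψ y))
      (g := redLin ψ hT ∘ₗ LinearMap.mulRight k y) (lin_ext fun p => h1 p y) x
  obtain ⟨n, hn⟩ := hT y
  rw [redInf_eq ψ hn]
  clear hn
  induction n generalizing y with
  | zero => rfl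
  | succ n ih => rw [Function.iterate_succ_apply, ih, h2]

end Red

/-! ### Consequences of an admissible order -/

section Order

variable {V : Type v} [Quiver.{w} V] {prec : QPath V → QPath V → Prop}

theorem IsAdmissible.wf (h : IsAdmissible prec) : WellFounded prec :=
  WellFounded.wellFounded_iff_has_min.mpr fun X hX => h.exists_min X hX

theorem IsAdmissible.of_factors_right (h : IsAdmissible prec) {q r p : QPath V}
    (hp : QPath.Factors q r p) (hq : 0 < q.length) : prec r p := by
  rcases h.subpath p r (QPath.isSubpath_right hp) with e | e
  · have := hp.length
    rw [e] at this
    omega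
  · exact e

end Order

/-! ### Systems bounded by the order are terminating and reduction finite -/

section Coch

variable {k : Type u} [CommRing k] {V : Type v} [Quiver.{w} V] {S : Set (QPath V)}
  {prec : QPath V → QPath V → Prop} {ψ : S → PathAlgebra k V}

theorem mem_coch_of_cochPrec (h : ψ ∈ cochPrec k S prec) : ψ ∈ coch k S S :=
  fun x p hp => (h x p hp).1

theorem coch_mem_parallel {W : Set (QPath V)} {f : W → PathAlgebra k V} (h : f ∈ coch k S W) (s : W) :
    f s ∈ spanOn k {p | p.Parallel s} := fun p hp => (h s p hp).2

theorem coch_mem_irr {W : Set (QPath V)} {f : W → PathAlgebra k V} (h : f ∈ coch k S W) (s : W) :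
    f s ∈ irrMod k S := fun p hp => (h s p hp).1

theorem cochPrec_mem (h : ψ ∈ cochPrec k S prec) (s : S) :
    ψ s ∈ spanOn k {p | prec p s ∧ p.Parallel s} := fun p hp => ⟨(h s p hp).2, (h s p hp).1.2⟩

theorem mul_mem_parallel {q r p x : QPath V} (h : QPath.Factors3 q x r p) {y : PathAlgebra k V}
    (hy : y ∈ spanOn k {p | p.Parallel x}) :
    of k q * y * of k r ∈ spanOn k {p' | p'.Parallel p} := by
  refine mul_mem_spanOn (Y := {r}) (mul_mem_spanOn (X := {q}) (Z := {z | ∃ t, t.Parallel x ∧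
    QPath.Factors q t z}) (of_mem_spanOn rfl) hy ?_) (of_mem_spanOn rfl) ?_
  · rintro _ rfl t ht z hz
    exact ⟨t, ht, hz⟩
  · rintro y ⟨t, ht, hz⟩ _ rfl z hz'
    obtain ⟨y', h1, h2⟩ := h
    exact ⟨by rw [hz'.src, h2.src, hz.src, h1.src], by rw [hz'.tgt, h2.tgt]⟩

theorem mul_mem_prec (hprec : IsAdmissible prec) {q r p x : QPath V}
    (h : QPath.Factors3 q x r p) {y : PathAlgebra k V}
    (hy : y ∈ spanOn k {p | prec p x ∧ p.Parallel x}) :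
    of k q * y * of k r ∈ spanOn k {p' | prec p' p ∧ p'.Parallel p} := by
  intro z hz
  refine ⟨?_, mul_mem_parallel h (spanOn_mono (fun _ h => h.2) hy) z hz⟩
  revert z
  refine mul_mem_spanOn (Z := {z | prec z p}) (Y := {r}) (mul_mem_spanOn (X := {q}) (Z := {z | ∃ t, prec t x ∧
    QPath.Factors q t z}) (of_mem_spanOn rfl) hy ?_) (of_mem_spanOn rfl) ?_
  · rintro _ rfl t ht z hz
    exact ⟨t, ht.1, hz⟩
  · rintro y ⟨t, ht, hz⟩ _ rfl z hz'
    obtain ⟨y', h1, h2⟩ := h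
    exact hprec.mul_right _ _ _ _ _ hz' h2 (hprec.mul_left _ _ _ _ _ hz h1 ht)

theorem red_mem_parallel (hS : IsReductionSet S) (hψ : ψ ∈ coch k S S) (p : QPath V) :
    red ψ (of k p) ∈ spanOn k {p' | p'.Parallel p} := by
  by_cases hp : p ∈ Irr S
  · rw [IsReductionSet.red_of_irr ψ hp]
    exact of_mem_spanOn (QPath.Parallel.refl p)
  · obtain ⟨⟨q, s, r⟩, h⟩ := exists_isRightmost hp
    rw [hS.red_of_rightmost ψ h]
    exact mul_mem_parallel h.1 (coch_mem_parallel hψ s)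

theorem red_mem_prec (hS : IsReductionSet S) (hprec : IsAdmissible prec)
    (hψ : ψ ∈ cochPrec k S prec) {p : QPath V} (hp : p ∉ Irr S) :
    red ψ (of k p) ∈ spanOn k {p' | prec p' p ∧ p'.Parallel p} := by
  obtain ⟨⟨q, s, r⟩, h⟩ := exists_isRightmost hp
  rw [hS.red_of_rightmost ψ h]
  exact mul_mem_prec hprec h.1 (cochPrec_mem hψ s)

theorem redTerminates_of_prec (hS : IsReductionSet S) (hprec : IsAdmissible prec)
    (hψ : ψ ∈ cochPrec k S prec) : RedTerminates ψ := by
  refine redTerminates_of_wf ψ (Subrelation.wf ?_ hprec.wf)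
  intro p' p h
  exact (red_mem_prec hS hprec hψ h.1 p' h.2).1

theorem iterate_red_mem_spanOn {X : Set (QPath V)} (h : ∀ p ∈ X, red ψ (of k p) ∈ spanOn k X)
    {x : PathAlgebra k V} (hx : x ∈ spanOn k X) (n : ℕ) : (red ψ)^[n] x ∈ spanOn k X := by
  induction n with
  | zero => exact hx
  | succ n ih =>
    rw [Function.iterate_succ_apply']
    exact map_mem_of_spanOn ih (red ψ) _ h

theorem redInf_mem_spanOn {X : Set (QPath V)} (h : ∀ p ∈ X, red ψ (of k p) ∈ spanOn k X)
    {x : PathAlgebra k V} (hx : x ∈ spanOn k X) : redInf ψ x ∈ spanOn k X := by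
  by_cases hn : ∃ n, (red ψ)^[n] x ∈ irrMod k S
  · rw [redInf_eq ψ hn.choose_spec]
    exact iterate_red_mem_spanOn h hx _
  · rw [redInf, dif_neg hn]
    exact zero_mem _

theorem redInf_mem_parallel (hS : IsReductionSet S) (hψ : ψ ∈ coch k S S) (p : QPath V) :
    redInf ψ (of k p) ∈ spanOn k {p' | p'.Parallel p} :=
  redInf_mem_spanOn (fun q hq => spanOn_mono (fun _ h => h.trans hq) (red_mem_parallel hS hψ q))
    (of_mem_spanOn (QPath.Parallel.refl p))

theorem redInf_mem_le (hS : IsReductionSet S) (hprec : IsAdmissible prec)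
    (hψ : ψ ∈ cochPrec k S prec) (p : QPath V) :
    redInf ψ (of k p) ∈ spanOn k {p' | (p' = p ∨ prec p' p) ∧ p'.Parallel p ∧ p' ∈ Irr S} := by
  intro p' hp'
  refine ⟨?_, redInf_mem_parallel hS (mem_coch_of_cochPrec hψ) p p' hp',
    redInf_mem ψ (of k p) p' hp'⟩
  revert p'
  refine redInf_mem_spanOn (X := {p' | p' = p ∨ prec p' p}) (fun q hq => ?_)
    (of_mem_spanOn (Or.inl rfl))
  by_cases h : q ∈ Irr S
  · rw [IsReductionSet.red_of_irr ψ h]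
    exact of_mem_spanOn hq
  · refine spanOn_mono (fun z hz => Or.inr ?_) (red_mem_prec hS hprec hψ h)
    rcases hq with rfl | hq
    · exact hz.1
    · exact hprec.trans _ _ _ hz.1 hq

/-- The `n`-fold applications are linear maps, and the elements on which they become stationary form
a submodule. So finiteness passes from paths to linear combinations. -/
theorem applySeq_of_mem {X : Set (QPath V)}
    (hX : ∀ p ∈ X, ReductionFinite ψ p) {x : PathAlgebra k V} (hx : x ∈ spanOn k X)
    (f : ℕ → PathAlgebra k V →ₗ[k] PathAlgebra k V) (hf : ∀ i, IsReduction ψ (f i)) :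
    ∃ n₀, ∀ n ≥ n₀, applySeq f x n = applySeq f x n₀ := by
  have hlin : ∃ g : ℕ → PathAlgebra k V →ₗ[k] PathAlgebra k V, ∀ n x, applySeq f x n = g n x := by
    refine ⟨fun n => Nat.rec LinearMap.id (fun n g => f n ∘ₗ g) n, fun n x => ?_⟩
    induction n with
    | zero => rfl
    | succ n ih => simp only [applySeq, ih]; rfl
  obtain ⟨g, hg⟩ := hlin
  simp only [hg]
  let N : Submodule k (PathAlgebra k V) :=
    { carrier := {x | ∃ n₀, ∀ n ≥ n₀, g n x = g n₀ x}
      zero_mem' := ⟨0, fun n _ => by simp⟩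
      add_mem' := by
        rintro x y ⟨n, hn⟩ ⟨m, hm⟩
        refine ⟨max n m, fun d hd => ?_⟩
        rw [map_add, map_add, hn d (le_trans (le_max_left _ _) hd),
          hm d (le_trans (le_max_right _ _) hd), ← hn _ (le_max_left n m), ← hm _ (le_max_right n m)]
      smul_mem' := by
        rintro c x ⟨n, hn⟩
        exact ⟨n, fun d hd => by rw [map_smul, map_smul, hn d hd]⟩ }
  refine spanOn_le (N := N) (fun p hp => ?_) hx
  obtain ⟨n, hn⟩ := hX p hp f hf
  exact ⟨n, fun d hd => by rw [← hg, ← hg]; exact hn d hd⟩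

theorem isReduction_mem_prec (hprec : IsAdmissible prec) (hψ : ψ ∈ cochPrec k S prec)
    {f : PathAlgebra k V →ₗ[k] PathAlgebra k V} (hf : IsReduction ψ f) (p : QPath V) :
    f (of k p) = of k p ∨ f (of k p) ∈ spanOn k {p' | prec p' p} := by
  induction hf generalizing p with
  | basic q s r p₀ h =>
    rw [basicReduction, lin_of]
    split_ifs with h'
    · exact Or.inr (spanOn_mono (fun _ h => h.1) (mul_mem_prec hprec h' (cochPrec_mem hψ s)))
    · exact Or.inl rfl
  | comp f g _ _ hf hg =>
    rw [LinearMap.comp_apply]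
    rcases hg p with h | h
    · rw [h]
      exact hf p
    · right
      refine map_mem_of_spanOn h f _ fun q hq => ?_
      rcases hf q with h' | h'
      · rw [h']
        exact of_mem_spanOn hq
      · exact spanOn_mono (fun z hz => hprec.trans _ _ _ hz hq) h'

/-- Noetherian induction on `p`: a sequence of reductions either never moves `p`, or its first map
that does replaces `p` by smaller paths, on which the remaining sequence becomes stationary. -/
theorem reductionFinite_of_prec (hprec : IsAdmissible prec) (hψ : ψ ∈ cochPrec k S prec)
    (p : QPath V) : ReductionFinite ψ p := by
  induction p using hprec.wf.induction with
  | _ p ih =>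
    intro f hf
    by_cases h : ∀ i, f i (of k p) = of k p
    · refine ⟨0, fun n _ => ?_⟩
      induction n with
      | zero => rfl
      | succ n ihn => exact (congrArg (f n) (ihn (Nat.zero_le _))).trans (h n)
    · push Not at h
      let m := Nat.find h
      have hm : f m (of k p) ≠ of k p := Nat.find_spec h
      have hlt : ∀ n ≤ m, applySeq f (of k p) n = of k p := by
        intro n
        induction n with
        | zero => intro _; rfl
        | succ n ihn =>
          intro hn
          rw [applySeq, ihn (by omega)]
          exact not_not.mp (Nat.find_min h (m := n) hn)
      have hmem := (isReduction_mem_prec hprec hψ (hf m) p).resolve_left hm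
      obtain ⟨n₀, h0⟩ := applySeq_of_mem (X := {p' | prec p' p}) (fun q hq => ih q hq) hmem
        (fun i => f (m + 1 + i)) fun i => hf _
      -- After the first `m + 1` maps the sequence starts afresh at an element supported on smaller
      -- paths.
      have hshift : ∀ n, applySeq f (of k p) (m + 1 + n) =
          applySeq (fun i => f (m + 1 + i)) (f m (of k p)) n := by
        intro n
        induction n with
        | zero => simp only [applySeq, hlt m le_rfl]
        | succ n ihn => rw [← Nat.add_assoc, applySeq, applySeq, ihn]
      refine ⟨m + 1 + n₀, fun n hn => ?_⟩
      obtain ⟨d, rfl⟩ := Nat.exists_eq_add_of_le (show m + 1 ≤ n by omega)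
      rw [hshift, hshift]
      exact h0 d (by omega)

end Coch

/-! ### Overlaps and 1-ambiguities -/

section Overlaps

variable {V : Type v} [Quiver.{w} V] {S : Set (QPath V)}

/-- The path `w = x s' r` is an overlap: `x` is an arrow, `x s' = s` is an element of `S`, the
paths `s'` and `r` are irreducible, and `s' r` is minimally reducible. -/
structure Overlap (x s' : QPath V) (s : S) (r w : QPath V) : Prop where
  length_eq : x.length = 1
  factors_left : QPath.Factors x s' s
  factors : QPath.Factors s r w
  irr_left : s' ∈ Irr S
  irr_right : r ∈ Irr S
  not_irr : ∀ y, QPath.Factors s' r y → y ∉ Irr S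
  irr_of_ne : ∀ d e y, QPath.Factors d e r → d ≠ r → QPath.Factors s' d y → y ∈ Irr S

theorem IsReductionSet.irr_of_proper (hS : IsReductionSet S) {s p : QPath V} (hs : s ∈ S)
    (hp : p.IsSubpath s) (hne : p.length < s.length) : p ∈ Irr S := by
  rintro t ht ⟨a, b, h⟩
  obtain ⟨c, d, h'⟩ := hp
  have h1 : t.IsSubpath s := by
    obtain ⟨y, h1, h2⟩ := h'
    exact IsSubpath.trans_aux ⟨a, b, h⟩ h1 h2
  obtain rfl := hS.antichain t ht s hs h1
  have := congrArg List.length (QPath.factors3_iff.mp h).2.2.2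
  simp only [List.length_append, QPath.length_arrows] at this
  omega
where
  IsSubpath.trans_aux {t p c y d s : QPath V} (h : t.IsSubpath p) (h1 : QPath.Factors c p y)
      (h2 : QPath.Factors y d s) : t.IsSubpath s :=
    (h.of_factors_right h1).of_factors_left h2

theorem IsReductionSet.irr_tail (hS : IsReductionSet S) {x s' s : QPath V} (hs : s ∈ S)
    (hx : x.length = 1) (h : QPath.Factors x s' s) : s' ∈ Irr S :=
  hS.irr_of_proper hs (QPath.isSubpath_right h) (by have := h.length; omega)

/-- In a 1-ambiguity `u_0 u_1 u_2` the initial part `u_0 u_1` is reducible, and minimality of `u_1`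
forces it to be an element of `S`. The remaining conditions are those of an overlap with `x = u_0`,
`s' = u_1`, `r = u_2`. -/
theorem IsReductionSet.mem_amb_three (hS : IsReductionSet S) (w : QPath V) :
    w ∈ amb S 3 ↔ ∃ x s' s r, Overlap (S := S) x s' s r w := by
  constructor
  · rintro ⟨u, z, h0, hirr, hz0, hz, rfl, hmin⟩
    have f0 : QPath.Factors (u 0) (u 1) (z 1) := hz0 ▸ hz 0 (by omega)
    have f1 : QPath.Factors (z 1) (u 2) (z 2) := hz 1 (by omega)
    have hz1 : z 1 ∉ Irr S := (hmin 0 (by omega)).1 _ f0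
    obtain ⟨s, r, hsr⟩ := (hS.irr_or_factors h0 (hirr 0 (by omega)) f0).resolve_left hz1
    -- Otherwise `s = u_0 d` with a proper left subpath `d` of `u_1`, and such a path is irreducible
    -- by minimality.
    have hs : z 1 = s := by
      by_contra hne
      have hlen : 0 < r.length := by
        by_contra h
        exact hne (hsr.eq_left (by omega)).symm
      have e1 := f0.arrows.symm.trans hsr.arrows
      have h2 := hS.two_le_length s s.2
      obtain ⟨l, hl⟩ : ∃ l, (s : QPath V).arrows = (u 0).arrows ++ l ∧ (u 1).arrows = l ++ r.arrows := by
        rcases List.append_eq_append_iff.mp e1 with ⟨l, h1, h3⟩ | ⟨l, h1, h3⟩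
        · exact ⟨l, h1, h3⟩
        · have := congrArg List.length h1
          simp only [List.length_append, QPath.length_arrows] at this
          omega
      obtain ⟨d, e, hde, hd, he⟩ := QPath.exists_split _ _ _ hl.2
      have hud : QPath.Factors (u 0) d s := by
        refine QPath.factors_iff.mpr ⟨f0.mid.trans hde.src, ?_, by rw [hl.1, hd]⟩
        rw [← hsr.src, f0.src]
      refine not_irr_of_mem s.2 ((hmin 0 (by omega)).2 d e s hde ?_ hud)
      intro hdu
      have h3 := hde.length
      rw [← QPath.length_arrows e, he, QPath.length_arrows, hdu] at h3
      have h4 : (u 1).length = (u (0 + 1)).length := rfl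
      omega
    rw [hs] at f0 f1
    exact ⟨u 0, u 1, s, u 2, h0, f0, f1, hirr 0 (by omega), hirr 1 (by omega),
      (hmin 1 (by omega)).1, (hmin 1 (by omega)).2⟩
  · rintro ⟨x, s', s, r, h⟩
    refine ⟨fun i => match i with | 0 => x | 1 => s' | _ => r,
      fun i => match i with | 0 => x | 1 => s | _ => w, h.length_eq, ?_, rfl, ?_, rfl, ?_⟩
    · intro i hi
      interval_cases i
      · exact h.irr_left
      · exact h.irr_right
    · intro i hi
      interval_cases i
      · exact h.factors_left
      · exact h.factors
    · intro i hi
      interval_cases i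
      · refine ⟨?_, ?_⟩
        · intro y hy
          rw [QPath.eq_of_factors hy h.factors_left]
          exact not_irr_of_mem s.2
        · intro d e y hde hne hy
          obtain ⟨z, h1, h2⟩ := hde.assoc' h.factors_left
          obtain rfl := QPath.eq_of_factors hy h1
          refine hS.irr_of_proper s.2 (QPath.isSubpath_left h2) ?_
          have e1 := h2.length
          have e2 : e.length ≠ 0 := fun h0 => hne (hde.eq_left h0)
          omega
      · exact ⟨h.not_irr, h.irr_of_ne⟩

/-- If `s = x s'`, the path `r` is irreducible and `s' r` is reducible, then a left subpath of
`s r` is an overlap. -/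
theorem IsReductionSet.exists_overlap (hS : IsReductionSet S) {x s' r p' : QPath V} {s : S}
    (hx : x.length = 1) (hs : QPath.Factors x s' s) (hr : r ∈ Irr S)
    (hp' : QPath.Factors s' r p') (hirr : p' ∉ Irr S) :
    ∃ r₁ r₂ w, QPath.Factors r₁ r₂ r ∧ Overlap x s' s r₁ w := by
  -- The shortest left subpath `d` of `r` for which `s' d` is reducible gives the overlap; `r`
  -- itself shows that one exists.
  have hex : ∃ n, ∃ d e y, QPath.Factors d e r ∧ d.length = n ∧ QPath.Factors s' d y ∧
      y ∉ Irr S :=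
    ⟨_, r, _, p', QPath.factors_idPath_right r, rfl, hp', hirr⟩
  obtain ⟨d, e, y, hde, hn, hy, hyirr⟩ := Nat.find_spec hex
  have hsd : (s : QPath V).tgt = d.src := by rw [hs.tgt, hy.mid]
  refine ⟨d, e, _, hde, hx, hs, QPath.factors_comp s d hsd, hS.irr_tail s.2 hx hs, Irr.left hr hde, ?_, ?_⟩
  · intro y' hy'
    rwa [QPath.eq_of_factors hy' hy]
  · intro d' e' y' hd' hne hy'
    by_contra hcon
    obtain ⟨z, h1, h2⟩ := hd'.assoc hde
    have hlt : d'.length < d.length := by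
      have e1 := hd'.length
      have e2 : e'.length ≠ 0 := fun h0 => hne (hd'.eq_left h0)
      omega
    exact Nat.find_min hex (hn ▸ hlt) ⟨d', z, y', h2, rfl, hy', hcon⟩

end Overlaps

/-! ### The diamond lemma -/

section Diamond

variable {k : Type u} [CommRing k] {V : Type v} [Quiver.{w} V] [Fintype V] {S : Set (QPath V)}
  {prec : QPath V → QPath V → Prop} {ψ : S → PathAlgebra k V}

theorem idPath_mul_coch {W : Set (QPath V)} {f : W → PathAlgebra k V} (h : f ∈ coch k S W) (s : W) :
    of k (QPath.idPath (s : QPath V).src) * f s = f s :=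
  idPath_mul_of_mem (coch_mem_parallel h s) fun _ hp => hp.1

theorem coch_mul_idPath {W : Set (QPath V)} {f : W → PathAlgebra k V} (h : f ∈ coch k S W) (s : W) :
    f s * of k (QPath.idPath (s : QPath V).tgt) = f s :=
  mul_idPath_of_mem (coch_mem_parallel h s) fun _ hp => hp.2

/-- All basic reductions of `p` are compatible with `red^(∞)`. -/
def Resolves (ψ : S → PathAlgebra k V) (p : QPath V) : Prop :=
  ∀ q (s : S) r, QPath.Factors3 q s r p → redInf ψ (of k p) = redInf ψ (of k q * ψ s * of k r)

/-- A right-most reduction of `y` need not be right-most in `y r`. It is still a basic reduction of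
paths below `p`, and those resolve by the induction hypothesis `ih`. -/
theorem redInf_redInf_mul (hS : IsReductionSet S) (hprec : IsAdmissible prec)
    (hψ : ψ ∈ cochPrec k S prec) {p : QPath V}
    (ih : ∀ p', prec p' p → Resolves ψ p') {p₀ r : QPath V} (hp : QPath.Factors p₀ r p)
    {y : PathAlgebra k V} (hy : y ∈ spanOn k {p' | prec p' p₀}) :
    redInf ψ (redInf ψ y * of k r) = redInf ψ (y * of k r) := by
  have hT := redTerminates_of_prec hS hprec hψ
  have hred : ∀ q, prec q p₀ → red ψ (of k q) ∈ spanOn k {p' | prec p' p₀} := by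
    intro q hq
    by_cases h : q ∈ Irr S
    · rw [IsReductionSet.red_of_irr ψ h]
      exact of_mem_spanOn hq
    · exact spanOn_mono (fun z hz => hprec.trans _ _ _ hz.1 hq) (red_mem_prec hS hprec hψ h)
  have h1 : ∀ y ∈ spanOn k {p' | prec p' p₀},
      redInf ψ (red ψ y * of k r) = redInf ψ (y * of k r) := by
    intro y hy
    refine eq_of_spanOn hy (redLin ψ hT ∘ₗ LinearMap.mulRight k (of k r) ∘ₗ red ψ)
      (redLin ψ hT ∘ₗ LinearMap.mulRight k (of k r)) fun q hq => ?_
    simp only [LinearMap.comp_apply, LinearMap.mulRight_apply, redLin_apply]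
    by_cases h : q ∈ Irr S
    · rw [IsReductionSet.red_of_irr ψ h]
    · obtain ⟨⟨a, t, b⟩, ht⟩ := exists_isRightmost h
      rw [hS.red_of_rightmost ψ ht]
      obtain ⟨c, hc, hc'⟩ := ht.1
      by_cases e : q.tgt = r.src
      · have hqr := QPath.factors_comp q r e
        obtain ⟨z, hz, hz'⟩ := hc'.assoc hqr
        rw [of_mul_factors hqr, ih _ (hprec.mul_right _ _ _ _ _ hqr hp hq) a t z ⟨c, hc, hz'⟩,
          ← of_mul_factors hz]
        simp only [mul_assoc]
      · have e' : b.tgt ≠ r.src := by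
          rw [← hc'.tgt]
          exact e
        rw [of_mul_eq_zero e, mul_assoc, of_mul_eq_zero e', mul_zero]
  obtain ⟨n, hn⟩ := hT y
  rw [redInf_eq ψ hn]
  clear hn
  induction n generalizing y with
  | zero => rfl
  | succ n ihn =>
    rw [Function.iterate_succ_apply, ihn (map_mem_of_spanOn hy (red ψ) _ hred), h1 y hy]

/-- Noetherian induction on `p`. The reduction at `s` is compared with the reductions of the path
behind the first arrow, which resolve already; only when `s` overlaps another element of `S` is the
hypothesis `hov` needed. -/
theorem resolves_of_overlaps (hS : IsReductionSet S) (hprec : IsAdmissible prec)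
    (hψ : ψ ∈ cochPrec k S prec)
    (hov : ∀ x s' s r w, Overlap x s' s r w → redInf ψ (of k w) = redInf ψ (ψ s * of k r))
    (p : QPath V) : Resolves ψ p := by
  have hT := redTerminates_of_prec hS hprec hψ
  have hψ' := mem_coch_of_cochPrec hψ
  have hR := redInf_mul_redInf hS ψ hT
  induction p using hprec.wf.induction with
  | _ p ih =>
    intro q s r hp
    obtain ⟨z, hz, hz'⟩ := hp.left
    by_cases hq : q.arrows = []
    · obtain rfl : p = z := (hz'.eq_right (by rw [← QPath.length_arrows, hq]; rfl)).symm
      have hsrc : q = QPath.idPath (s : QPath V).src := by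
        rw [QPath.eq_idPath_of_arrows hq, ← hz.src, hz'.src]
      rw [hsrc, idPath_mul_coch hψ' s]
      obtain ⟨x, s', hx, hs⟩ := QPath.exists_head s (hS.arrows_ne_nil s.2)
      obtain ⟨p', hp1, hp2⟩ := hs.assoc hz
      have hlt : prec p' p := hprec.of_factors_right hp2 (by omega)
      have hxp : ∀ y, redInf ψ (of k p') = redInf ψ y → redInf ψ (of k p) = redInf ψ (of k x * y) := by
        intro y hy
        rw [← of_mul_factors hp2, ← hR, hy, hR]
      by_cases hirr : p' ∈ Irr S
      -- Nothing is reducible behind the first arrow, so this occurrence of `s` is the right-most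
      -- one.
      · exact redInf_head hS ψ hT hx hirr hp2 hz (idPath_mul_coch hψ' s)
      · by_cases hr : r ∈ Irr S
        -- An overlap `w = s r₁` is an initial subpath of `p = w r₂`. The hypothesis compares the
        -- two reductions of `w`, and multiplication by `r₂` on the right is allowed because all
        -- terms are smaller than `w`.
        · obtain ⟨r₁, r₂, w, hr12, how⟩ := hS.exists_overlap hx hs hr hp1 hirr
          obtain ⟨v, hv1, hv2⟩ := how.factors_left.assoc how.factors
          obtain ⟨a, t, b, habt⟩ := exists_factors3_of_not_irr (how.not_irr _ hv1)
          have hw : QPath.Factors w r₂ p := by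
            obtain ⟨w', h1, h2⟩ := hr12.assoc' hz
            rwa [QPath.eq_of_factors how.factors h1]
          have hv3 : QPath.Factors v r₂ p' := by
            obtain ⟨v', h1, h2⟩ := hr12.assoc' hp1
            rwa [QPath.eq_of_factors hv1 h1]
          have hvp : prec v p := by
            rcases hprec.subpath p' v (QPath.isSubpath_left hv3) with e | e
            · rwa [e]
            · exact hprec.trans _ _ _ e hlt
          obtain ⟨c, hc1, hc2⟩ := habt
          obtain ⟨e, he1, he2⟩ := hc2.assoc hv3
          have E1 := hxp _ (ih p' hlt a t e ⟨c, hc1, he2⟩)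
          have E2 : redInf ψ (of k w) = redInf ψ (of k x * (of k a * ψ t * of k b)) := by
            rw [← of_mul_factors hv2, ← hR, ih v hvp a t b ⟨c, hc1, hc2⟩, hR]
          have hxa : ∃ z, QPath.Factors x a z ∧ QPath.Factors3 z t b w := by
            obtain ⟨z, h1, h2⟩ := hc2.assoc' hv2
            obtain ⟨z', h3, h4⟩ := hc1.assoc' h1
            exact ⟨z', h3, z, h4, h2⟩
          obtain ⟨xa, hxa1, hxa2⟩ := hxa
          have m1 : of k x * (of k a * ψ t * of k b) ∈ spanOn k {p' | prec p' w} := by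
            have := mul_mem_prec hprec hxa2 (cochPrec_mem hψ t)
            rw [← of_mul_factors hxa1] at this
            simp only [mul_assoc] at this ⊢
            exact spanOn_mono (fun _ h => h.1) this
          have m2 : ψ s * of k r₁ ∈ spanOn k {p' | prec p' w} := by
            have := mul_mem_prec hprec (q := QPath.idPath (s : QPath V).src)
              ⟨s, QPath.factors_idPath_left (s : QPath V), how.factors⟩ (cochPrec_mem hψ s)
            rw [idPath_mul_coch hψ' s] at this
            exact spanOn_mono (fun _ h => h.1) this
          calc redInf ψ (of k p) = redInf ψ (of k x * (of k a * ψ t * of k b) * of k r₂) := by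
                rw [E1, ← of_mul_factors he1]
                simp only [mul_assoc]
            _ = redInf ψ (ψ s * of k r₁ * of k r₂) := by
                rw [← redInf_redInf_mul hS hprec hψ ih hw m1, ← E2, hov _ _ _ _ _ how,
                  redInf_redInf_mul hS hprec hψ ih hw m2]
            _ = redInf ψ (ψ s * of k r) := by
                rw [mul_assoc, of_mul_factors hr12]
        -- An element `t` of `S` inside `r` is disjoint from `s`. The two replacements commute and
        -- both lead to `ψ_s a ψ_t b`.
        · obtain ⟨a, t, b, habt⟩ := exists_factors3_of_not_irr hr
          have m := mul_mem_prec hprec habt (cochPrec_mem hψ t)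
          obtain ⟨c, hc1, hc2⟩ := habt
          obtain ⟨y, hy1, hy2⟩ := hc2.assoc' hp1
          obtain ⟨y', hy3, hy4⟩ := hc1.assoc' hy1
          have E1 := hxp _ (ih p' hlt y' t b ⟨y, hy4, hy2⟩)
          have E2 : redInf ψ (of k s * (of k a * ψ t * of k b)) =
              redInf ψ (ψ s * (of k a * ψ t * of k b)) := by
            refine eq_of_spanOn m (redLin ψ hT ∘ₗ LinearMap.mulLeft k (of k s))
              (redLin ψ hT ∘ₗ LinearMap.mulLeft k (ψ s)) fun d hd => ?_
            simp only [LinearMap.comp_apply, LinearMap.mulLeft_apply, redLin_apply]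
            have hsd : (s : QPath V).tgt = d.src := by rw [hd.2.1]; exact hz.mid
            have hsd' := QPath.factors_comp _ _ hsd
            have := ih _ (hprec.mul_left _ _ _ _ _ hsd' hz hd.1) (QPath.idPath (s : QPath V).src)
              s d ⟨s, QPath.factors_idPath_left (s : QPath V), hsd'⟩
            rwa [idPath_mul_coch hψ' s, ← of_mul_factors hsd'] at this
          have E3 : redInf ψ (ψ s * of k r) = redInf ψ (ψ s * (of k a * ψ t * of k b)) := by
            refine eq_of_spanOn (cochPrec_mem hψ s) (redLin ψ hT ∘ₗ LinearMap.mulRight k (of k r))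
              (redLin ψ hT ∘ₗ LinearMap.mulRight k (of k a * ψ t * of k b)) fun d hd => ?_
            simp only [LinearMap.comp_apply, LinearMap.mulRight_apply, redLin_apply]
            have hdr : d.tgt = r.src := by rw [hd.2.2]; exact hz.mid
            have hdr' := QPath.factors_comp _ _ hdr
            obtain ⟨y, h1, h2⟩ := hc2.assoc' hdr'
            obtain ⟨y', h3, h4⟩ := hc1.assoc' h1
            have := ih _ (hprec.mul_right _ _ _ _ _ hdr' hz hd.1) y' t b ⟨y, h4, h2⟩
            rw [of_mul_factors hdr', this, ← of_mul_factors h3]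
            simp only [mul_assoc]
          rw [E1, E3, ← E2, ← of_mul_factors hy3, ← of_mul_factors hs]
          simp only [mul_assoc]
    -- A nontrivial left factor `q` is handled by compatibility of `redInf` with left
    -- multiplication.
    · have hlt : prec z p := hprec.of_factors_right hz' (by
        rw [← QPath.length_arrows]
        exact List.length_pos_iff.mpr hq)
      have := ih z hlt (QPath.idPath (s : QPath V).src) s r ⟨s, QPath.factors_idPath_left (s : QPath V), hz⟩
      rw [idPath_mul_coch hψ' s] at this
      rw [← of_mul_factors hz', ← hR, this, hR, mul_assoc]

theorem redInf_isReduction {ψ : S → PathAlgebra k V} (hT : RedTerminates ψ)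
    (h : ∀ p, Resolves ψ p) {f : PathAlgebra k V →ₗ[k] PathAlgebra k V} (hf : IsReduction ψ f)
    (x : PathAlgebra k V) : redInf ψ (f x) = redInf ψ x := by
  induction hf generalizing x with
  | basic q s r p₀ h0 =>
    refine LinearMap.congr_fun (f := redLin ψ hT ∘ₗ basicReduction ψ q s r) (g := redLin ψ hT)
      (lin_ext fun p => ?_) x
    simp only [LinearMap.comp_apply, redLin_apply, basicReduction, lin_of]
    split_ifs with h'
    · exact (h p q s r h').symm
    · rfl
  | comp f g _ _ hf hg => rw [LinearMap.comp_apply, hf, hg]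

/-- Once all basic reductions resolve, `redInf` is invariant under every reduction, so each
irreducible result equals the normal form. -/
theorem systemUnique_of_overlaps (hS : IsReductionSet S) (hprec : IsAdmissible prec)
    (hψ : ψ ∈ cochPrec k S prec)
    (hov : ∀ x s' s r w, Overlap x s' s r w → redInf ψ (of k w) = redInf ψ (ψ s * of k r)) :
    SystemUnique ψ := by
  have hT := redTerminates_of_prec hS hprec hψ
  have h := resolves_of_overlaps hS hprec hψ hov
  refine fun p => ⟨reductionFinite_of_prec hprec hψ p, fun f g hf hg hf' hg' => ?_⟩
  rw [← redInf_of_irr ψ hf', ← redInf_of_irr ψ hg', redInf_isReduction hT h hf,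
    redInf_isReduction hT h hg]

end Diamond

/-! ### Reduction uniqueness and the basis of irreducible paths -/

section NormalForms

variable {k : Type u} [CommRing k] {V : Type v} [Quiver.{w} V] {S : Set (QPath V)}
  {ψ : S → PathAlgebra k V}

/-- If `q s r` occurred in `q ψ_s r`, it would be `q t r` with `t` irreducible; lengths give `t =
s`, which is reducible. Hence a basic reduction really removes the path it acts on. -/
theorem coeff_mul_eq_zero (hψ : ψ ∈ coch k S S) {p q r : QPath V} {s : S}
    (h : QPath.Factors3 q s r p) : coeff p (of k q * ψ s * of k r) = 0 := by
  by_contra hne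
  have hmem : of k q * ψ s * of k r ∈ spanOn k {z | ∃ t ∈ Irr S, QPath.Factors3 q t r z} := by
    refine mul_mem_spanOn (X := {z | ∃ t ∈ Irr S, QPath.Factors q t z}) (Y := {r})
      (mul_mem_spanOn (X := {q}) (of_mem_spanOn rfl) (coch_mem_irr hψ s) ?_) (of_mem_spanOn rfl) ?_
    · rintro _ rfl t ht z hz
      exact ⟨t, ht, hz⟩
    · rintro y ⟨t, ht, hz⟩ _ rfl z hz'
      exact ⟨t, ht, y, hz, hz'⟩
  obtain ⟨t, ht, h'⟩ := hmem p hne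
  have e : t.length = (s : QPath V).length := by
    have h1 := congrArg List.length (QPath.factors3_iff.mp h).2.2.2
    have h2 := congrArg List.length (QPath.factors3_iff.mp h').2.2.2
    simp only [List.length_append, QPath.length_arrows] at h1 h2
    omega
  obtain ⟨-, rfl, -⟩ := h'.unique h rfl e
  exact not_irr_of_mem s.2 ht

theorem basicReduction_apply {p q r : QPath V} {s : S}
    (h : QPath.Factors3 q s r p) (x : PathAlgebra k V) :
    basicReduction ψ q s r x = x + coeff p x • (of k q * ψ s * of k r - of k p) := by
  refine LinearMap.congr_fun (g := LinearMap.id + (coeff p).smulRight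
    (of k q * ψ s * of k r - of k p)) (lin_ext fun z => ?_) x
  simp only [basicReduction, lin_of, LinearMap.add_apply, LinearMap.id_apply,
    LinearMap.smulRight_apply, coeff_of]
  by_cases hz : z = p
  · subst hz
    simp [h]
  · rw [if_neg fun h' => hz (QPath.eq_of_factors3 h' h), if_neg hz]
    simp

theorem isReduction_irrMod {f : PathAlgebra k V →ₗ[k] PathAlgebra k V} (hf : IsReduction ψ f)
    {x : PathAlgebra k V} (hx : x ∈ irrMod k S) : f x = x := by
  induction hf generalizing x with
  | basic q s r p h =>
    have h0 : coeff p x = 0 := by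
      by_contra h0
      exact not_irr_of_factors3 h (hx p h0)
    rw [basicReduction_apply h, h0, zero_smul, add_zero]
  | comp f g _ _ hf hg => rw [LinearMap.comp_apply, hg hx, hf hx]

/-- A composition of basic reductions that may be empty. -/
def IsWeakReduction (ψ : S → PathAlgebra k V) (f : PathAlgebra k V →ₗ[k] PathAlgebra k V) : Prop :=
  f = LinearMap.id ∨ IsReduction ψ f

theorem IsWeakReduction.comp {f g : PathAlgebra k V →ₗ[k] PathAlgebra k V}
    (hf : IsWeakReduction ψ f) (hg : IsWeakReduction ψ g) : IsWeakReduction ψ (f ∘ₗ g) := by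
  rcases hf with rfl | hf
  · exact hg
  · rcases hg with rfl | hg
    · exact Or.inr hf
    · exact Or.inr (.comp _ _ hf hg)

theorem IsWeakReduction.irrMod {f : PathAlgebra k V →ₗ[k] PathAlgebra k V}
    (hf : IsWeakReduction ψ f) {x : PathAlgebra k V} (hx : x ∈ irrMod k S) : f x = x := by
  rcases hf with rfl | hf
  · rfl
  · exact isReduction_irrMod hf hx

/-- If no reduction makes `x` irreducible, every reduct of `x` has the same defect and is moved by
some further reduction. Iterating gives a sequence that never becomes stationary. -/
theorem exists_weakReduction (hψ : ψ ∈ coch k S S) (hu : ∀ p, ReductionFinite ψ p)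
    (x : PathAlgebra k V) : ∃ f, IsWeakReduction ψ f ∧ f x ∈ irrMod k S := by
  by_contra hcon
  have step : ∀ y : {y : PathAlgebra k V // ¬ ∃ f, IsWeakReduction ψ f ∧ f y ∈ irrMod k S},
      ∃ g, IsReduction ψ g ∧ g y.1 ≠ y.1 := by
    rintro ⟨y, hy⟩
    have h1 : y ∉ irrMod k S := fun h => hy ⟨LinearMap.id, Or.inl rfl, h⟩
    have h2 : ∃ p, coeff p y ≠ 0 ∧ p ∉ Irr S := by
      by_contra h2
      push Not at h2
      exact h1 h2
    obtain ⟨p, hp, hirr⟩ := h2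
    obtain ⟨q, s, r, h⟩ := exists_factors3_of_not_irr hirr
    refine ⟨_, .basic q s r p h, fun e => hp ?_⟩
    rw [basicReduction_apply h] at e
    have := congrArg (coeff p) e
    rw [map_add, map_smul, map_sub, coeff_mul_eq_zero hψ h, coeff_of, if_pos rfl] at this
    simpa using this.symm
  choose g hg hne using step
  let next : {y : PathAlgebra k V // ¬ ∃ f, IsWeakReduction ψ f ∧ f y ∈ irrMod k S} →
      {y : PathAlgebra k V // ¬ ∃ f, IsWeakReduction ψ f ∧ f y ∈ irrMod k S} := fun y =>
    ⟨g y y.1, fun ⟨f, hf, hf'⟩ => y.2 ⟨f ∘ₗ g y, hf.comp (Or.inr (hg y)), hf'⟩⟩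
  let Y : ℕ → {y : PathAlgebra k V // ¬ ∃ f, IsWeakReduction ψ f ∧ f y ∈ irrMod k S} :=
    fun n => next^[n] ⟨x, hcon⟩
  have hY : ∀ n, applySeq (fun i => g (Y i)) x n = (Y n).1 := by
    intro n
    induction n with
    | zero => rfl
    | succ n ih =>
      rw [applySeq, ih]
      simp only [Y, Function.iterate_succ_apply']
      rfl
  obtain ⟨n, hn⟩ := applySeq_of_mem (X := Set.univ) (fun p _ => hu p) (mem_spanOn_univ x)
    (fun i => g (Y i)) fun i => hg _
  have := hn (n + 1) (by omega)
  rw [applySeq, hY n] at this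
  exact hne _ this

/-- Later reductions fix what is already irreducible, so finitely many elements can be treated one
after another by a single composite. -/
theorem exists_weakReduction_finset (hψ : ψ ∈ coch k S S) (hu : ∀ p, ReductionFinite ψ p)
    (F : Finset (PathAlgebra k V)) : ∃ f, IsWeakReduction ψ f ∧ ∀ x ∈ F, f x ∈ irrMod k S := by
  induction F using Finset.induction_on with
  | empty => exact ⟨LinearMap.id, Or.inl rfl, fun x hx => by simp at hx⟩
  | insert a F _ ih =>
    obtain ⟨f, hf, hF⟩ := ih
    obtain ⟨g, hg, ha⟩ := exists_weakReduction hψ hu (f a)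
    refine ⟨g ∘ₗ f, hg.comp hf, fun x hx => ?_⟩
    rcases Finset.mem_insert.mp hx with rfl | hx
    · exact ha
    · rw [LinearMap.comp_apply, hg.irrMod (hF x hx)]
      exact hF x hx

theorem weakReduction_unique (hu : SystemUnique ψ) {f g : PathAlgebra k V →ₗ[k] PathAlgebra k V}
    (hf : IsWeakReduction ψ f) (hg : IsWeakReduction ψ g) {p : QPath V}
    (hf' : f (of k p) ∈ irrMod k S) (hg' : g (of k p) ∈ irrMod k S) : f (of k p) = g (of k p) := by
  rcases hf with rfl | hf
  · exact (hg.irrMod hf').symm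
  · rcases hg with rfl | hg
    · exact isReduction_irrMod hf hg'
    · exact (hu p).2 f g hf hg hf' hg'

variable [Fintype V]

/-- Let `N` send each path to an irreducible reduct and extend linearly. Every weak reduction with
irreducible outcome agrees with `N`, so `N` is invariant under basic reductions and coincides with
`redInf`. -/
theorem resolves_of_systemUnique (hS : IsReductionSet S) (hψ : ψ ∈ coch k S S) (hu : SystemUnique ψ)
    (hT : RedTerminates ψ) (p : QPath V) : Resolves ψ p := by
  have hfin := fun p => (hu p).1
  choose h hw hirr using fun p : QPath V => exists_weakReduction hψ hfin (of k p)
  let N : PathAlgebra k V →ₗ[k] PathAlgebra k V := lin fun p => h p (of k p)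
  have key : ∀ (f : PathAlgebra k V →ₗ[k] PathAlgebra k V) x, IsWeakReduction ψ f →
      f x ∈ irrMod k S → f x = N x := by
    intro f x hf hx
    obtain ⟨F, -, e⟩ := eq_sum x
    -- Uniqueness is known for single paths only, and the images of the paths in `x` need not be
    -- irreducible although their combination is. One more reduction `g` makes them all irreducible
    -- and fixes `f x`.
    obtain ⟨g, hg, hgF⟩ := exists_weakReduction_finset hψ hfin (F.image fun p => f (of k p))
    rw [← hg.irrMod hx, e]
    simp only [map_sum, map_smul]
    refine Finset.sum_congr rfl fun p hp => ?_
    congr 1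
    simp only [N, lin_of]
    exact weakReduction_unique hu (hg.comp hf) (hw p)
      (hgF _ (Finset.mem_image_of_mem _ hp)) (hirr p)
  have hstep : ∀ q (s : S) r p, QPath.Factors3 q s r p → N (of k p) = N (of k q * ψ s * of k r) := by
    intro q s r p hp
    obtain ⟨f, hf, hf'⟩ := exists_weakReduction hψ hfin (of k q * ψ s * of k r)
    have e : basicReduction ψ q s r (of k p) = of k q * ψ s * of k r := by
      rw [basicReduction, lin_of, if_pos hp]
    rw [← key f _ hf hf', ← e]
    rw [← e] at hf'
    exact (key (f ∘ₗ basicReduction ψ q s r) _ (hf.comp (Or.inr (.basic q s r p hp))) hf').symm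
  have hNred : ∀ x, N (red ψ x) = N x := by
    intro x
    refine LinearMap.congr_fun (f := N ∘ₗ red ψ) (lin_ext fun p => ?_) x
    rw [LinearMap.comp_apply]
    by_cases hp : p ∈ Irr S
    · rw [IsReductionSet.red_of_irr ψ hp]
    · obtain ⟨⟨q, s, r⟩, ht⟩ := exists_isRightmost hp
      rw [hS.red_of_rightmost ψ ht]
      exact (hstep q s r p ht.1).symm
  have hN : ∀ x, redInf ψ x = N x := by
    intro x
    obtain ⟨n, hn⟩ := hT x
    have h1 : ∀ n, N ((red ψ)^[n] x) = N x := by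
      intro n
      induction n with
      | zero => rfl
      | succ n ih => rw [Function.iterate_succ_apply', hNred, ih]
    rw [redInf_eq ψ hn, ← h1 n]
    exact key LinearMap.id _ (Or.inl rfl) hn
  intro q s r hp
  rw [hN, hN]
  exact hstep q s r p hp

/-- The system `ψ` has values in `k Irr_S`, its right-most reduction terminates, and all
basic reductions are compatible with `red^(∞)`. -/
structure Convergent (ψ : S → PathAlgebra k V) : Prop where
  isReductionSet : IsReductionSet S
  mem_coch : ψ ∈ coch k S S
  terminates : RedTerminates ψ
  resolves : ∀ p, Resolves ψ p

namespace Convergent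

theorem proj_basic (ψ : S → PathAlgebra k V) {p q r : QPath V} {s : S}
    (h : QPath.Factors3 q s r p) : proj ψ (of k q * ψ s * of k r) = proj ψ (of k p) := by
  have h1 : proj ψ (ψ s) = proj ψ (of k s) := by
    refine (Quotient.sound ?_ : _)
    change (relIdeal ψ).ringCon _ _
    rw [TwoSidedIdeal.rel_iff, ← neg_sub]
    exact (relIdeal ψ).neg_mem (TwoSidedIdeal.subset_span ⟨s, rfl⟩)
  rw [← of_mul_factors3 h]
  simp only [map_mul, h1]

theorem proj_eq_iff_sub_mem (ψ : S → PathAlgebra k V) (x y : PathAlgebra k V) :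
    proj ψ x = proj ψ y ↔ x - y ∈ relIdeal ψ := by
  rw [← TwoSidedIdeal.rel_iff]
  exact (relIdeal ψ).ringCon.eq

theorem proj_surjective (ψ : S → PathAlgebra k V) : Function.Surjective (proj ψ) :=
  Quotient.mk_surjective

theorem proj_rel (ψ : S → PathAlgebra k V) (s : S) : proj ψ (of k s) = proj ψ (ψ s) :=
  (proj_eq_iff_sub_mem ψ _ _).mpr (TwoSidedIdeal.subset_span ⟨s, rfl⟩)

variable (h : Convergent ψ)
include h

theorem proj_redInf (x : PathAlgebra k V) : proj ψ (redInf ψ x) = proj ψ x := by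
  have h1 : ∀ x, proj ψ (red ψ x) = proj ψ x := by
    intro x
    refine LinearMap.congr_fun (f := (proj ψ).toLinearMap ∘ₗ red ψ) (g := (proj ψ).toLinearMap)
      (lin_ext fun p => ?_) x
    rw [LinearMap.comp_apply]
    by_cases hp : p ∈ Irr S
    · rw [IsReductionSet.red_of_irr ψ hp]
    · obtain ⟨⟨q, s, r⟩, ht⟩ := exists_isRightmost hp
      rw [h.isReductionSet.red_of_rightmost ψ ht]
      exact proj_basic ψ ht.1
  obtain ⟨n, hn⟩ := h.terminates x
  rw [redInf_eq ψ hn]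
  clear hn
  induction n with
  | zero => rfl
  | succ n ih => rw [Function.iterate_succ_apply', h1, ih]

theorem redInf_mul_sub_mul (x y : PathAlgebra k V) (s : S) :
    redInf ψ (x * (of k s - ψ s) * y) = 0 := by
  have e : ∀ p r : QPath V, redInf ψ (of k p * (of k s - ψ s) * of k r) = 0 := by
    intro p r
    by_cases h1 : p.tgt = (s : QPath V).src
    · by_cases h2 : (s : QPath V).tgt = r.src
      · have h3 : QPath.Factors3 p s r ((p.comp s h1).comp r h2) := ⟨_, ⟨h1, rfl⟩, ⟨h2, rfl⟩⟩
        have := h.resolves _ _ _ _ h3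
        rw [← of_mul_factors3 h3] at this
        rw [mul_sub, sub_mul]
        exact (map_sub (redLin ψ h.terminates) _ _).trans (sub_eq_zero.mpr this)
      · have h3 : ψ s * of k r = 0 := by
          rw [← coch_mul_idPath h.mem_coch s, mul_assoc,
            of_mul_eq_zero (q := QPath.idPath (s : QPath V).tgt) h2, mul_zero]
        rw [mul_assoc, sub_mul, h3, of_mul_eq_zero h2, sub_zero, mul_zero]
        exact map_zero (redLin ψ h.terminates)
    · have h3 : of k p * ψ s = 0 := by
        rw [← idPath_mul_coch h.mem_coch s, ← mul_assoc,
          of_mul_eq_zero (r := QPath.idPath (s : QPath V).src) h1, zero_mul]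
      rw [mul_sub, h3, of_mul_eq_zero h1, sub_zero, zero_mul]
      exact map_zero (redLin ψ h.terminates)
  have e2 : ∀ (p : QPath V) y, redInf ψ (of k p * (of k s - ψ s) * y) = 0 := by
    intro p y
    have := eq_of_spanOn (mem_spanOn_univ y) (redLin ψ h.terminates ∘ₗ
      LinearMap.mulLeft k (of k p * (of k s - ψ s))) (0 : PathAlgebra k V →ₗ[k] PathAlgebra k V)
      fun r _ => by
        simp only [LinearMap.comp_apply, LinearMap.mulLeft_apply, redLin_apply,
          LinearMap.zero_apply, e p r]
    simpa only [LinearMap.comp_apply, LinearMap.mulLeft_apply, redLin_apply,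
          LinearMap.zero_apply] using this
  have := eq_of_spanOn (mem_spanOn_univ x) (redLin ψ h.terminates ∘ₗ
      LinearMap.mulRight k y ∘ₗ LinearMap.mulRight k (of k s - ψ s))
      (0 : PathAlgebra k V →ₗ[k] PathAlgebra k V) fun p _ => by
        simp only [LinearMap.comp_apply, LinearMap.mulRight_apply, redLin_apply,
          LinearMap.zero_apply, e2 p y]
  simpa only [LinearMap.comp_apply, LinearMap.mulRight_apply, redLin_apply,
          LinearMap.zero_apply] using this

/-- The elements `z` with `redInf ψ (a z b) = 0` for all `a`, `b` form a two-sided ideal, and it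
contains the generators `s - ψ_s`. -/
theorem redInf_of_mem {x : PathAlgebra k V} (hx : x ∈ relIdeal ψ) : redInf ψ x = 0 := by
  let J : TwoSidedIdeal (PathAlgebra k V) :=
    TwoSidedIdeal.mk' {z | ∀ a b, redLin ψ h.terminates (a * z * b) = 0}
      (fun a b => by simp only [mul_zero, zero_mul, map_zero])
      (fun {x y} hx hy a b => by rw [mul_add, add_mul, map_add, hx, hy, add_zero])
      (fun {x} hx a b => by rw [mul_neg, neg_mul, map_neg, hx, neg_zero])
      (fun {x y} hy a b => by rw [← mul_assoc, hy])
      (fun {x y} hx a b => by rw [← mul_assoc, mul_assoc _ y b, hx])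
  have hJ : relIdeal ψ ≤ J := by
    refine TwoSidedIdeal.span_le.mpr ?_
    rintro _ ⟨s, rfl⟩
    simp only [SetLike.mem_coe, J, TwoSidedIdeal.mem_mk']
    exact fun a b => h.redInf_mul_sub_mul a b s
  have := hJ hx
  simp only [J, TwoSidedIdeal.mem_mk'] at this
  simpa using this 1 1

/-- This makes the irreducible paths a basis of the quotient algebra: `redInf` is constant on
classes and picks the irreducible representative. -/
theorem proj_eq_iff (x y : PathAlgebra k V) : proj ψ x = proj ψ y ↔ redInf ψ x = redInf ψ y := by
  constructor
  · intro e
    have := h.redInf_of_mem ((proj_eq_iff_sub_mem ψ x y).mp e)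
    exact sub_eq_zero.mp ((map_sub (redLin ψ h.terminates) x y).symm.trans this)
  · intro e
    rw [← h.proj_redInf x, e, h.proj_redInf]

theorem redInf_redInf_mul_redInf (x y : PathAlgebra k V) :
    redInf ψ (redInf ψ x * redInf ψ y) = redInf ψ (x * y) := by
  rw [← h.proj_eq_iff, map_mul, h.proj_redInf, h.proj_redInf, map_mul]

theorem redInf_redInf_mul (x y : PathAlgebra k V) :
    redInf ψ (redInf ψ x * y) = redInf ψ (x * y) := by
  rw [← h.proj_eq_iff, map_mul, h.proj_redInf, map_mul]

theorem bijective_projIrr : Function.Bijective (projIrr ψ) := by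
  constructor
  · rintro ⟨x, hx⟩ ⟨y, hy⟩ e
    have e' : proj ψ x = proj ψ y := e
    rw [h.proj_eq_iff, redInf_of_irr ψ hx, redInf_of_irr ψ hy] at e'
    exact Subtype.ext e'
  · intro a
    obtain ⟨x, rfl⟩ := proj_surjective ψ a
    exact ⟨⟨redInf ψ x, redInf_mem ψ x⟩, h.proj_redInf x⟩

theorem irrSection_proj (x : PathAlgebra k V) : irrSection ψ (proj ψ x) = redInf ψ x := by
  rw [irrSection, dif_pos h.bijective_projIrr]
  have : (LinearEquiv.ofBijective (projIrr ψ) h.bijective_projIrr).symm (proj ψ x) =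
      ⟨redInf ψ x, redInf_mem ψ x⟩ := by
    rw [LinearEquiv.symm_apply_eq]
    exact (h.proj_redInf x).symm
  simp only [LinearMap.comp_apply, LinearEquiv.coe_coe, this]
  rfl

theorem proj_irrSection (a : QuotAlg ψ) : proj ψ (irrSection ψ a) = a := by
  obtain ⟨x, rfl⟩ := proj_surjective ψ a
  rw [h.irrSection_proj, h.proj_redInf]

theorem irrSection_mem (a : QuotAlg ψ) : irrSection ψ a ∈ irrMod k S := by
  obtain ⟨x, rfl⟩ := proj_surjective ψ a
  rw [h.irrSection_proj]
  exact redInf_mem ψ x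

theorem irrSection_proj_of_mem {x : PathAlgebra k V} (hx : x ∈ irrMod k S) :
    irrSection ψ (proj ψ x) = x := by rw [h.irrSection_proj, redInf_of_irr ψ hx]

theorem redInf_rel (s : S) : redInf ψ (of k s) = ψ s := by
  rw [(h.proj_eq_iff _ _).mp (proj_rel ψ s), redInf_of_irr ψ (coch_mem_irr h.mem_coch s)]

end Convergent

theorem convergent_of_systemUnique {prec : QPath V → QPath V → Prop} (hS : IsReductionSet S)
    (hprec : IsAdmissible prec) (hψ : ψ ∈ cochPrec k S prec) (hu : SystemUnique ψ) :
    Convergent ψ :=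
  have hT := redTerminates_of_prec hS hprec hψ
  ⟨hS, mem_coch_of_cochPrec hψ, hT,
    resolves_of_systemUnique hS (mem_coch_of_cochPrec hψ) hu hT⟩

theorem systemUnique_iff_overlaps {prec : QPath V → QPath V → Prop} (hS : IsReductionSet S)
    (hprec : IsAdmissible prec) (hψ : ψ ∈ cochPrec k S prec) :
    SystemUnique ψ ↔ ∀ x s' s r w, Overlap x s' s r w →
      redInf ψ (of k w) = redInf ψ (ψ s * of k r) := by
  refine ⟨fun hu x s' s r w h => ?_, systemUnique_of_overlaps hS hprec hψ⟩
  have hc := convergent_of_systemUnique hS hprec hψ hu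
  have := hc.resolves w (QPath.idPath (s : QPath V).src) s r
    ⟨s, QPath.factors_idPath_left (s : QPath V), h.factors⟩
  rwa [idPath_mul_coch hc.mem_coch s] at this

end NormalForms

/-! ### Termination of right-most reduction without an order -/

section Chains

variable {k : Type u} [Field k] {V : Type v} [Quiver.{w} V] {S : Set (QPath V)}
  {ψ : S → PathAlgebra k V}

/-- The path `p'` occurs in the right-most reduction of the reducible path `p`. -/
def RedStep (ψ : S → PathAlgebra k V) (p' p : QPath V) : Prop :=
  p ∉ Irr S ∧ coeff p' (red ψ (of k p)) ≠ 0

/-- Reducing at `d 0`, then `d 1`, and so on gives a sequence that moves the element at every stage.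
The hypothesis `hstar` excludes shortcuts to later members of the chain, which could otherwise
cancel the coefficient to be reduced next. -/
theorem not_reductionFinite_of_chain (hS : IsReductionSet S) (hψ : ψ ∈ coch k S S)
    (d : ℕ → QPath V) (hd : ∀ i, RedStep ψ (d (i + 1)) (d i))
    (hstar : ∀ i m, i + 1 < m → RedStep ψ (d m) (d i) → d m = d (i + 1)) :
    ¬ ReductionFinite ψ (d 0) := by
  intro hfin
  choose t ht using fun i => exists_isRightmost (hd i).1
  let f : ℕ → PathAlgebra k V →ₗ[k] PathAlgebra k V := fun i =>
    basicReduction ψ (t i).1 (t i).2.1 (t i).2.2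
  have hred : ∀ i, red ψ (of k (d i)) = of k (t i).1 * ψ (t i).2.1 * of k (t i).2.2 := fun i =>
    hS.red_of_rightmost ψ (ht i)
  have hfapp : ∀ i x, f i x = x + coeff (d i) x • (red ψ (of k (d i)) - of k (d i)) := fun i x => by
    rw [hred]
    exact basicReduction_apply (ht i).1 x
  have hself : ∀ i, coeff (d i) (red ψ (of k (d i))) = 0 := fun i => by
    rw [hred]
    exact coeff_mul_eq_zero hψ (ht i).1
  let y := applySeq f (of k (d 0))
  -- At stage `n` the path `d n` is present, and any later member that is present coincides with it.
  -- Hence the coefficient of `d (n + 1)` at the next stage is a product of two nonzero scalars.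
  have inv : ∀ n, coeff (d n) (y n) ≠ 0 ∧ ∀ m, n < m → coeff (d m) (y n) ≠ 0 → d m = d n := by
    intro n
    induction n with
    | zero =>
      refine ⟨by simp [y, applySeq, coeff_of], fun m _ hm => ?_⟩
      simp only [y, applySeq, coeff_of] at hm
      by_contra hne
      exact hm (if_neg fun e => hne e.symm)
    | succ n ih =>
      have hy : y (n + 1) = f n (y n) := rfl
      have hne : ∀ m, d m ≠ d n → coeff (d m) (y (n + 1)) =
          coeff (d m) (y n) + coeff (d n) (y n) * coeff (d m) (red ψ (of k (d n))) := by
        intro m hm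
        rw [hy, hfapp, map_add, map_smul, map_sub, coeff_of, if_neg fun e => hm e.symm, sub_zero,
          smul_eq_mul]
      have hne1 : d (n + 1) ≠ d n := fun e => (hd n).2 (by rw [e, hself])
      refine ⟨?_, fun m hm hc => ?_⟩
      · have h0 : coeff (d (n + 1)) (y n) = 0 := by
          by_contra h0
          exact hne1 (ih.2 _ (by omega) h0)
        rw [hne _ hne1, h0, zero_add]
        exact mul_ne_zero ih.1 (hd n).2
      · by_cases e : d m = d n
        · exfalso
          apply hc
          rw [e, hy, hfapp, map_add, map_smul, map_sub, hself, coeff_of, if_pos rfl]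
          simp
        · have h0 : coeff (d m) (y n) = 0 := by
            by_contra h0
            exact e (ih.2 _ (by omega) h0)
          rw [hne _ e, h0, zero_add] at hc
          exact hstar n m hm ⟨(hd n).1, right_ne_zero_of_mul hc⟩
  obtain ⟨n, hn⟩ := hfin f fun i => .basic _ _ _ _ (ht i).1
  have h1 : y (n + 1) = y n := hn (n + 1) (by omega)
  have h2 : y (n + 1) = f n (y n) := rfl
  rw [h2, hfapp] at h1
  have h3 := congrArg (coeff (d n)) h1
  rw [map_add, map_smul, map_sub, hself, coeff_of, if_pos rfl] at h3
  exact (inv n).1 (by simpa using h3.symm)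

/-- From an infinite chain of reduction steps one without shortcuts is built, contradicting
reduction finiteness: a cycle of minimal length if cycles exist, and otherwise a chain that always
jumps as far as possible. -/
theorem wellFounded_redStep (hS : IsReductionSet S) (hψ : ψ ∈ coch k S S)
    (hfin : ∀ p, ReductionFinite ψ p) : WellFounded (RedStep ψ) := by
  by_cases hper : ∃ n, 0 < n ∧ ∃ f : ℕ → QPath V, (∀ i, f (i + n) = f i) ∧
      ∀ i, RedStep ψ (f (i + 1)) (f i)
  · exfalso
    obtain ⟨hn, f, hf, hchain⟩ := Nat.find_spec hper
    have hmin := fun m h => Nat.find_min hper (m := m) h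
    generalize Nat.find hper = n at hn hf hmin
    have hmul : ∀ i t, f (i + n * t) = f i := by
      intro i t
      induction t with
      | zero => simp
      | succ t ih => rw [Nat.mul_succ, ← Nat.add_assoc, hf, ih]
    refine not_reductionFinite_of_chain hS hψ f hchain (fun i m him hstep => ?_) (hfin _)
    -- A step from `f i` to `f m`, followed by the chain up to the next index congruent to `i`
    -- modulo `n`, is a cycle of length `n - ρ`. If `ρ = 0`, then `f m = f (i + 1)` by periodicity;
    -- otherwise the minimal period is contradicted.
    let q := (m - i - 1) / n
    let ρ := (m - i - 1) % n
    have h1 : n * q + ρ = m - i - 1 := Nat.div_add_mod _ _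
    have h2 : ρ < n := Nat.mod_lt _ hn
    have h3 : i + n * (q + 1) = m + (n - 1 - ρ) := by
      rw [Nat.mul_succ]
      omega
    have h4 : f (m + (n - 1 - ρ)) = f i := by rw [← h3, hmul]
    by_cases hρ : ρ = 0
    · have h5 : f (i + 1) = f (m + n) := by
        rw [← hmul (i + 1) (q + 1)]
        congr 1
        omega
      rw [h5, hf]
    · exfalso
      have hL : n - ρ < n := by omega
      refine hmin (n - ρ) hL ⟨by omega, fun j => f (m + j % (n - ρ)), fun j => by simp, fun j => ?_⟩
      have hj := Nat.mod_lt j (show 0 < n - ρ by omega)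
      by_cases hlast : j % (n - ρ) = n - 1 - ρ
      · have e : (j + 1) % (n - ρ) = 0 := by
          rw [← Nat.mod_add_mod, hlast, show n - 1 - ρ + 1 = n - ρ by omega, Nat.mod_self]
        simp only [hlast, e, h4]
        exact hstep
      · have e : (j + 1) % (n - ρ) = j % (n - ρ) + 1 := by
          rw [← Nat.mod_add_mod, Nat.mod_eq_of_lt (by omega)]
        simp only [e, ← Nat.add_assoc]
        exact hchain _
  · rw [wellFounded_iff_isEmpty_descending_chain]
    refine ⟨fun ⟨c, hc⟩ => ?_⟩
    -- A repetition in the chain would close up to a cycle.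
    have hinj : Function.Injective c := by
      have key : ∀ i j, i < j → c i ≠ c j := by
        intro i j hij e
        refine hper ⟨j - i, by omega, fun l => c (i + l % (j - i)), fun l => by simp, fun l => ?_⟩
        have hl := Nat.mod_lt l (show 0 < j - i by omega)
        by_cases hlast : l % (j - i) = j - i - 1
        · have e' : (l + 1) % (j - i) = 0 := by
            rw [← Nat.mod_add_mod, hlast, show j - i - 1 + 1 = j - i by omega, Nat.mod_self]
          simp only [e', Nat.add_zero, e, hlast]
          have := hc (i + (j - i - 1))
          rwa [show i + (j - i - 1) + 1 = j by omega] at this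
        · have e' : (l + 1) % (j - i) = l % (j - i) + 1 := by
            rw [← Nat.mod_add_mod, Nat.mod_eq_of_lt (by omega)]
          simp only [e', ← Nat.add_assoc]
          exact hc _
      intro i j e
      rcases lt_trichotomy i j with h | h | h
      · exact absurd e (key i j h)
      · exact h
      · exact absurd e.symm (key j i h)
    have hfinite : ∀ i, {j | RedStep ψ (c j) (c i)}.Finite := by
      intro i
      have h1 : {p | coeff p (red ψ (of k (c i))) ≠ 0}.Finite :=
        Finsupp.hasFiniteSupport (red ψ (of k (c i)))
      exact Set.Finite.preimage (hinj.injOn) (h1.subset fun p hp => hp) |>.subset fun j hj => hj.2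
    -- A path has finitely many successors and the chain is injective, so there is a last index that
    -- can be reached in one step. Jumping there leaves no shortcut.
    let next : ℕ → ℕ := fun i => sSup {j | RedStep ψ (c j) (c i)}
    have hnext : ∀ i, RedStep ψ (c (next i)) (c i) := fun i =>
      Nat.sSup_mem ⟨i + 1, hc i⟩ (hfinite i).bddAbove
    have hle : ∀ i j, RedStep ψ (c j) (c i) → j ≤ next i := fun i j h =>
      le_csSup (hfinite i).bddAbove h
    have hlt : ∀ i, i < next i := fun i => hle i (i + 1) (hc i)
    have hmono : StrictMono fun n => next^[n] 0 := strictMono_nat_of_lt_succ fun n => by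
      rw [Function.iterate_succ_apply']
      exact hlt _
    refine not_reductionFinite_of_chain hS hψ (fun n => c (next^[n] 0)) (fun n => ?_)
      (fun i m him hstep => ?_) (hfin _)
    · simp only [Function.iterate_succ_apply']
      exact hnext _
    · exfalso
      have h1 := hle _ _ hstep
      have h2 := hmono him
      simp only [Function.iterate_succ_apply'] at h2
      omega

/-- Elements of `MC` need not have values below `s`, so termination comes from `wellFounded_redStep`
instead of the order. -/
theorem convergent_of_mem_uniqueSystems [Fintype V] (hS : IsReductionSet S)
    (h : ψ ∈ uniqueSystems k S) : Convergent ψ :=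
  have hT := redTerminates_of_wf ψ (wellFounded_redStep hS h.1 fun p => (h.2 p).1)
  ⟨hS, h.1, hT, resolves_of_systemUnique hS h.1 h.2 hT⟩

end Chains

/-! ### The multiplicative extension of an automorphism of the irreducible span -/

section TensorHom

variable {k : Type u} [CommRing k] {V : Type v} [Quiver.{w} V] {S : Set (QPath V)}

theorem ofIrr_of_mem (T : irrMod k S ≃ₗ[k] irrMod k S) {x : PathAlgebra k V} (h : x ∈ irrMod k S) :
    ofIrr T x = T ⟨x, h⟩ := dif_pos h

theorem ofIrr_mem (T : irrMod k S ≃ₗ[k] irrMod k S) (x : PathAlgebra k V) :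
    ofIrr T x ∈ irrMod k S := by
  rw [ofIrr]
  split_ifs
  · exact Subtype.property _
  · exact zero_mem _

theorem ofIrr_trans (T T' : irrMod k S ≃ₗ[k] irrMod k S) {x : PathAlgebra k V}
    (h : x ∈ irrMod k S) : ofIrr (T'.trans T) x = ofIrr T (ofIrr T' x) := by
  rw [ofIrr_of_mem _ h, ofIrr_of_mem T' h, ofIrr_of_mem T (Subtype.property _)]
  rfl

theorem ofIrr_refl {x : PathAlgebra k V} (h : x ∈ irrMod k S) :
    ofIrr (LinearEquiv.refl k (irrMod k S)) x = x := by
  rw [ofIrr_of_mem _ h]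
  rfl

theorem ofIrr_symm_ofIrr (T : irrMod k S ≃ₗ[k] irrMod k S) {x : PathAlgebra k V}
    (h : x ∈ irrMod k S) : ofIrr T.symm (ofIrr T x) = x := by
  rw [← ofIrr_trans _ _ h, LinearEquiv.self_trans_symm, ofIrr_refl h]

theorem ofIrr_ofIrr_symm (T : irrMod k S ≃ₗ[k] irrMod k S) {x : PathAlgebra k V}
    (h : x ∈ irrMod k S) : ofIrr T (ofIrr T.symm x) = x := by
  rw [← ofIrr_trans _ _ h, LinearEquiv.symm_trans_self, ofIrr_refl h]

theorem ofIrr_add (T : irrMod k S ≃ₗ[k] irrMod k S) {x y : PathAlgebra k V}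
    (hx : x ∈ irrMod k S) (hy : y ∈ irrMod k S) : ofIrr T (x + y) = ofIrr T x + ofIrr T y := by
  rw [ofIrr_of_mem T hx, ofIrr_of_mem T hy, ofIrr_of_mem T (add_mem hx hy), ← Submodule.coe_add,
    ← map_add]
  rfl

theorem ofIrr_smul (T : irrMod k S ≃ₗ[k] irrMod k S) (c : k) {x : PathAlgebra k V}
    (hx : x ∈ irrMod k S) : ofIrr T (c • x) = c • ofIrr T x := by
  rw [ofIrr_of_mem T hx, ofIrr_of_mem T (Submodule.smul_mem _ c hx), ← Submodule.coe_smul,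
    ← map_smul]
  rfl

/-- The map `T red^(∞)`, as a linear map. -/
def ofIrrRed (T : irrMod k S ≃ₗ[k] irrMod k S) {φ : S → PathAlgebra k V} (hT : RedTerminates φ) :
    PathAlgebra k V →ₗ[k] PathAlgebra k V where
  toFun x := ofIrr T (redInf φ x)
  map_add' x y := by
    rw [← ofIrr_add T (redInf_mem φ x) (redInf_mem φ y)]
    exact congrArg _ (map_add (redLin φ hT) x y)
  map_smul' c x := by
    rw [RingHom.id_apply, ← ofIrr_smul T c (redInf_mem φ x)]
    exact congrArg _ (map_smul (redLin φ hT) c x)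

/-- The linear map `T` preserves the source and the target of paths. -/
def PreservesParallel (T : irrMod k S ≃ₗ[k] irrMod k S) : Prop :=
  ∀ p ∈ Irr S, ∀ q, coeff q (ofIrr T (of k p)) ≠ 0 → q.Parallel p

theorem of_mem_irrMod {p : QPath V} (hp : p ∈ Irr S) : of k p ∈ irrMod k S :=
  of_mem_spanOn (X := Irr S) hp

theorem IsReductionSet.arrow_mem (hS : IsReductionSet S) {a b : V} (x : a ⟶ b) :
    QPath.arrow x ∈ Irr S := hS.irr_of_length_le_one le_rfl

theorem IsReductionSet.idPath_mem (hS : IsReductionSet S) (i : V) :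
    QPath.idPath i ∈ Irr S := hS.irr_of_length_le_one (Nat.zero_le _)

theorem mul_mem_parallel_comp {a b c : V} {p : Quiver.Path a b} {q : Quiver.Path b c}
    {x y : PathAlgebra k V} (hx : x ∈ spanOn k {z | z.Parallel ⟨a, b, p⟩})
    (hy : y ∈ spanOn k {z | z.Parallel ⟨b, c, q⟩}) :
    x * y ∈ spanOn k {z | z.Parallel ⟨a, c, p.comp q⟩} :=
  mul_mem_spanOn hx hy fun _ hz _ hz' _ hr => ⟨hr.src.trans hz.1, hr.tgt.trans hz'.2⟩

theorem prodArrows_mem (hS : IsReductionSet S) {T : irrMod k S ≃ₗ[k] irrMod k S}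
    (hT : PreservesParallel T) {a b : V} (p : Quiver.Path a b) :
    prodArrows T p ∈ spanOn k {q | q.Parallel ⟨a, b, p⟩} := by
  induction p with
  | nil => exact of_mem_spanOn ⟨rfl, rfl⟩
  | cons p x ih => exact mul_mem_parallel_comp (q := x.toPath) ih (hT _ (hS.arrow_mem x))

theorem prodArrows_refl (hS : IsReductionSet S) {a b : V} (p : Quiver.Path a b) :
    prodArrows (LinearEquiv.refl k (irrMod k S)) p = of k ⟨a, b, p⟩ := by
  induction p with
  | nil => rfl
  | cons p x ih =>
    rw [prodArrows, ih, ofIrr_refl (of_mem_irrMod (hS.arrow_mem x))]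
    exact of_mul_factors ⟨rfl, rfl⟩

variable [Fintype V]

theorem prodArrows_comp (hS : IsReductionSet S) {T : irrMod k S ≃ₗ[k] irrMod k S}
    (hT : PreservesParallel T) {a b c : V} (p : Quiver.Path a b) (q : Quiver.Path b c) :
    prodArrows T (p.comp q) = prodArrows T p * prodArrows T q := by
  induction q with
  | nil => exact (mul_idPath_of_mem (prodArrows_mem hS hT p) fun _ h => h.2).symm
  | cons q x ih => rw [Quiver.Path.comp_cons, prodArrows, prodArrows, ih, mul_assoc]

theorem mul_eq_zero_of_parallel {p q : QPath V} {x y : PathAlgebra k V}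
    (hx : x ∈ spanOn k {z | z.Parallel p}) (hy : y ∈ spanOn k {z | z.Parallel q})
    (h : p.tgt ≠ q.src) : x * y = 0 := by
  rw [← mul_idPath_of_mem hx fun _ h => h.2, ← idPath_mul_of_mem hy fun _ h => h.1, mul_assoc,
    ← mul_assoc _ _ y, of_mul_eq_zero (q := QPath.idPath p.tgt) (r := QPath.idPath q.src) h,
    zero_mul, mul_zero]

/-- The endomorphism of the path algebra with `p_1 ⋯ p_m ↦ T(p_1) ⋯ T(p_m)`. -/
def tensorHom (hS : IsReductionSet S) {T : irrMod k S ≃ₗ[k] irrMod k S}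
    (hT : PreservesParallel T) : PathAlgebra k V →ₐ[k] PathAlgebra k V :=
  AlgHom.ofLinearMap (lin fun p => prodArrows T p.path)
    (by
      rw [one_def, map_sum]
      exact Finset.sum_congr rfl fun i _ => lin_of _ _)
    (fun x y => by
      have h1 : ∀ p q : QPath V, lin (fun p => prodArrows T p.path) (of k p * of k q) =
          prodArrows T p.path * prodArrows T q.path := by
        rintro ⟨a, b, p⟩ ⟨c, d, q⟩
        by_cases h : b = c
        · subst h
          rw [of_mul_factors (p := ⟨a, d, p.comp q⟩) ⟨rfl, rfl⟩, lin_of]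
          exact prodArrows_comp hS hT p q
        · rw [of_mul_eq_zero h, map_zero,
            mul_eq_zero_of_parallel (prodArrows_mem hS hT p) (prodArrows_mem hS hT q) h]
      have h2 : ∀ (p : QPath V) y, lin (fun p => prodArrows T p.path) (of k p * y) =
          prodArrows T p.path * lin (fun p => prodArrows T p.path) y := fun p y =>
        eq_of_spanOn (mem_spanOn_univ y) (lin (fun p => prodArrows T p.path) ∘ₗ
          LinearMap.mulLeft k (of k p)) (LinearMap.mulLeft k (prodArrows T p.path) ∘ₗ
          lin (fun p => prodArrows T p.path)) fun q _ => by simpa using h1 p q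
      exact eq_of_spanOn (mem_spanOn_univ x) (lin (fun p => prodArrows T p.path) ∘ₗ
          LinearMap.mulRight k y) (LinearMap.mulRight k (lin (fun p => prodArrows T p.path) y) ∘ₗ
          lin (fun p => prodArrows T p.path)) fun q _ => by simpa using h2 q y)

theorem tensorHom_of (hS : IsReductionSet S) {T : irrMod k S ≃ₗ[k] irrMod k S}
    (hT : PreservesParallel T) (p : QPath V) : tensorHom hS hT (of k p) = prodArrows T p.path :=
  lin_of _ _

theorem tensorHom_idPath (hS : IsReductionSet S) {T : irrMod k S ≃ₗ[k] irrMod k S}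
    (hT : PreservesParallel T) (i : V) :
    tensorHom hS hT (of k (QPath.idPath i)) = of k (QPath.idPath i) := tensorHom_of hS hT _

theorem tensorHom_arrow (hS : IsReductionSet S) {T : irrMod k S ≃ₗ[k] irrMod k S}
    (hT : PreservesParallel T) {x : QPath V} (hx : x.length = 1) :
    tensorHom hS hT (of k x) = ofIrr T (of k x) := by
  obtain ⟨a, b, p⟩ := x
  rw [tensorHom_of]
  cases p with
  | nil => simp [QPath.length] at hx
  | cons p x =>
    cases p with
    | cons p y => simp [QPath.length] at hx
    | nil =>
      exact idPath_mul_of_mem (X := {q | q.Parallel (QPath.arrow x)}) (hT _ (hS.arrow_mem x))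
        fun _ h => h.1

omit [Fintype V] in
theorem IsEquivalence.preservesParallel {φ φ' : S → PathAlgebra k V}
    {T : irrMod k S ≃ₗ[k] irrMod k S} (h : IsEquivalence φ φ' T) : PreservesParallel T := h.parallel

/-- The defining condition on paths says that `T` intertwines the normal form maps along the algebra
endomorphism `tensorHom`; linearity extends it to all elements. -/
theorem IsEquivalence.map_redInf {φ φ' : S → PathAlgebra k V} {T : irrMod k S ≃ₗ[k] irrMod k S}
    (h : IsEquivalence φ φ' T) (hS : IsReductionSet S) (hφ : RedTerminates φ)
    (hφ' : RedTerminates φ') (x : PathAlgebra k V) :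
    ofIrr T (redInf φ' x) = redInf φ (tensorHom hS h.preservesParallel x) :=
  eq_of_spanOn (mem_spanOn_univ x) (ofIrrRed T hφ')
    (redLin φ hφ ∘ₗ (tensorHom hS h.preservesParallel).toLinearMap) fun p _ => by
      rw [LinearMap.comp_apply, AlgHom.toLinearMap_apply, tensorHom_of]
      exact h.map_red p

end TensorHom

/-! ### The groupoid of reduction systems and algebra isomorphisms -/

section Groupoid

variable {k : Type u} [CommRing k] {V : Type v} [Quiver.{w} V] [Fintype V] {S : Set (QPath V)}
  {φ φ' φ'' : S → PathAlgebra k V} {T T' : irrMod k S ≃ₗ[k] irrMod k S}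

/-- The two products differ in `kQ`, but each factor `T(T'(x))` is the normal form of `tensorHom` at
`T'(x)`, and for a convergent system normal forms may be taken factor by factor. -/
theorem IsEquivalence.redInf_prodArrows (h : IsEquivalence φ φ' T) (hφ : Convergent φ)
    (hφ' : Convergent φ') {a b : V} (p : Quiver.Path a b) :
    redInf φ (prodArrows (T'.trans T) p) =
      redInf φ (tensorHom hφ.isReductionSet h.preservesParallel (prodArrows T' p)) := by
  induction p with
  | nil => rw [prodArrows, prodArrows, tensorHom_idPath]
  | cons p x ih =>
    have hx := of_mem_irrMod (k := k) (hφ.isReductionSet.arrow_mem x)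
    have e := h.map_redInf hφ.isReductionSet hφ.terminates hφ'.terminates (ofIrr T' (of k (QPath.arrow x)))
    rw [redInf_of_irr φ' (ofIrr_mem T' _)] at e
    rw [prodArrows, prodArrows, map_mul, ← hφ.redInf_redInf_mul_redInf, ih,
      ← hφ.redInf_redInf_mul_redInf (tensorHom _ _ _), ← e, ofIrr_trans T T' hx,
      redInf_of_irr φ (ofIrr_mem T _)]

omit [Fintype V] in
theorem IsEquivalence.refl (hS : IsReductionSet S) (φ : S → PathAlgebra k V) :
    IsEquivalence φ φ (LinearEquiv.refl k (irrMod k S)) where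
  parallel p hp q hq := by
    rw [ofIrr_refl (of_mem_irrMod hp), coeff_of] at hq
    split_ifs at hq with h
    · exact h ▸ QPath.Parallel.refl _
    · simp at hq
  map_idPath i := ofIrr_refl (of_mem_irrMod (hS.idPath_mem i))
  map_red p := by rw [ofIrr_refl (redInf_mem φ _), prodArrows_refl hS]

theorem IsEquivalence.trans (h : IsEquivalence φ φ' T) (h' : IsEquivalence φ' φ'' T')
    (hφ : Convergent φ) (hφ' : Convergent φ') : IsEquivalence φ φ'' (T'.trans T) where
  parallel p hp q hq := by
    rw [ofIrr_trans T T' (of_mem_irrMod hp)] at hq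
    have h1 : ofIrr T' (of k p) ∈ spanOn k {q | q ∈ Irr S ∧ q.Parallel p} := fun q hq =>
      ⟨ofIrr_mem T' _ q hq, h'.parallel p hp q hq⟩
    have h2 := map_mem_of_spanOn h1 (ofIrrRed T hφ'.terminates) (spanOn k {q | q.Parallel p})
      fun z hz => by
        change ofIrr T (redInf φ' (of k z)) ∈ _
        rw [redInf_of_irr φ' (of_mem_irrMod hz.1)]
        exact fun w hw => (h.parallel z hz.1 w hw).trans hz.2
    change ofIrr T (redInf φ' _) ∈ _ at h2
    rw [redInf_of_irr φ' (ofIrr_mem T' _)] at h2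
    exact h2 q hq
  map_idPath i := by
    rw [ofIrr_trans T T' (of_mem_irrMod (hφ.isReductionSet.idPath_mem i)), h'.map_idPath,
      h.map_idPath]
  map_red p := by
    rw [ofIrr_trans T T' (redInf_mem φ'' _), h'.map_red,
      h.map_redInf hφ.isReductionSet hφ.terminates hφ'.terminates,
      h.redInf_prodArrows hφ hφ']

/-- Split the preimage of `p` into a part `x` parallel to `p` and a rest `y`. The image of `y`
avoids paths parallel to `p`, yet it equals `p - T(x)`, which has only such paths. So it is zero,
and so is `y`. -/
theorem PreservesParallel.symm (hT : PreservesParallel T) : PreservesParallel T.symm := by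
  intro p hp
  have hp' := of_mem_irrMod (k := k) hp
  let z := ofIrr T.symm (of k p)
  have hz : z ∈ irrMod k S := ofIrr_mem _ _
  obtain ⟨F, hF, e⟩ := eq_sum z
  have hpart : ∀ (P : QPath V → Prop), (∑ q ∈ F with P q, coeff q z • of k q) ∈ irrMod k S := by
    intro P
    refine Submodule.sum_mem _ fun q hq => Submodule.smul_mem _ _ (of_mem_irrMod ?_)
    exact hz q (hF q (Finset.mem_filter.mp hq).1)
  have himg : ∀ (P : QPath V → Prop), ofIrr T (∑ q ∈ F with P q, coeff q z • of k q) ∈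
      spanOn k {q | ∃ q', P q' ∧ q.Parallel q'} := by
    intro P
    have h1 : ∀ x ∈ irrMod k S, ofIrr T x ∈ irrMod k S := fun x _ => ofIrr_mem T x
    have h2 := fun G : Finset (QPath V) => show (∀ q ∈ G, q ∈ Irr S ∧ P q) →
        (∑ q ∈ G, coeff q z • of k q) ∈ irrMod k S ∧ ofIrr T (∑ q ∈ G, coeff q z • of k q) ∈
      spanOn k {q | ∃ q', P q' ∧ q.Parallel q'} from by
      induction G using Finset.induction_on with
      | empty =>
        intro _
        refine ⟨by simp, ?_⟩
        rw [Finset.sum_empty, ofIrr_of_mem T (zero_mem _)]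
        have : (⟨0, zero_mem _⟩ : irrMod k S) = 0 := rfl
        rw [this, map_zero]
        exact zero_mem _
      | insert a G ha ih =>
        intro hG
        obtain ⟨i1, i2⟩ := ih fun q hq => hG q (Finset.mem_insert_of_mem hq)
        have ha' := hG a (Finset.mem_insert_self a G)
        have hm := of_mem_irrMod (k := k) ha'.1
        rw [Finset.sum_insert ha]
        refine ⟨add_mem (Submodule.smul_mem _ _ hm) i1, ?_⟩
        rw [ofIrr_add T (Submodule.smul_mem _ _ hm) i1, ofIrr_smul T _ hm]
        refine add_mem (Submodule.smul_mem _ _ fun q hq => ?_) i2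
        exact ⟨a, ha'.2, hT a ha'.1 q hq⟩
    refine (h2 _ fun q hq => ?_).2
    obtain ⟨h3, h4⟩ := Finset.mem_filter.mp hq
    exact ⟨hz q (hF q h3), h4⟩
  obtain ⟨x, y, hx, hy, h1, h2, hxP, hxy⟩ : ∃ x y, x ∈ irrMod k S ∧ y ∈ irrMod k S ∧
      ofIrr T x ∈ spanOn k {q | ∃ q' : QPath V, q'.Parallel p ∧ q.Parallel q'} ∧
      ofIrr T y ∈ spanOn k {q | ∃ q' : QPath V, ¬ q'.Parallel p ∧ q.Parallel q'} ∧
      x ∈ spanOn k {q | q.Parallel p} ∧ x + y = z := by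
    refine ⟨_, _, hpart fun q => q.Parallel p, hpart fun q => ¬ q.Parallel p,
      himg fun q => q.Parallel p, himg fun q => ¬ q.Parallel p, ?_, ?_⟩
    · exact Submodule.sum_mem _ fun q hq => Submodule.smul_mem _ _
        (of_mem_spanOn (Finset.mem_filter.mp hq).2)
    · rw [Finset.sum_filter, Finset.sum_filter, ← Finset.sum_add_distrib]
      refine Eq.trans (Finset.sum_congr rfl fun q _ => ?_) e.symm
      by_cases hq : q.Parallel p <;> simp [hq]
  have h3 : ofIrr T z = of k p := ofIrr_ofIrr_symm T hp'
  rw [← hxy, ofIrr_add T hx hy] at h3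
  have h4 : ofIrr T y = 0 := by
    refine ext_coeff fun q => ?_
    rw [map_zero]
    by_contra hne
    obtain ⟨q', hq', hqq'⟩ := h2 q hne
    have h5 : ofIrr T y ∈ spanOn k {q | q.Parallel p} := by
      rw [← eq_sub_iff_add_eq'] at h3
      rw [h3]
      refine sub_mem (of_mem_spanOn (QPath.Parallel.refl p)) ?_
      refine spanOn_mono ?_ h1
      rintro q ⟨q', h, h'⟩
      exact h'.trans h
    exact hq' (hqq'.symm.trans (h5 q hne))
  have h5 : y = 0 := by
    rw [← ofIrr_symm_ofIrr T hy, h4, ofIrr_of_mem _ (zero_mem _)]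
    have : (⟨0, zero_mem _⟩ : irrMod k S) = 0 := rfl
    rw [this, map_zero]
    rfl
  have h6 : z ∈ spanOn k {q | q.Parallel p} := by rwa [← hxy, h5, add_zero]
  exact h6

/-- The condition on paths follows by applying `redInf_prodArrows` to the composite of `T` with its
inverse, whose product of arrows is the path itself. -/
theorem IsEquivalence.symm (h : IsEquivalence φ φ' T) (hφ : Convergent φ) (hφ' : Convergent φ') :
    IsEquivalence φ' φ T.symm where
  parallel := PreservesParallel.symm h.parallel
  map_idPath i := by
    have h1 := ofIrr_symm_ofIrr T (of_mem_irrMod (k := k) (hφ.isReductionSet.idPath_mem i))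
    rwa [h.map_idPath] at h1
  map_red p := by
    have h1 := h.redInf_prodArrows (T' := T.symm) hφ hφ' p.path
    rw [LinearEquiv.symm_trans_self, prodArrows_refl hφ.isReductionSet,
      ← h.map_redInf hφ.isReductionSet hφ.terminates hφ'.terminates] at h1
    exact (congrArg (ofIrr T.symm) h1).trans (ofIrr_symm_ofIrr T (redInf_mem φ' _))

/-- Transported to the quotients, `T` goes from the algebra of `φ'` to that of `φ` and is induced by
`tensorHom`, hence multiplicative. The isomorphism asked for is its inverse. -/
theorem IsEquivalence.exists_algEquiv (h : IsEquivalence φ φ' T) (hφ : Convergent φ)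
    (hφ' : Convergent φ') : ∃ e : QuotAlg φ ≃ₐ[k] QuotAlg φ', ∀ i : V,
      e (proj φ (of k (QPath.idPath i))) = proj φ' (of k (QPath.idPath i)) := by
  let g : QuotAlg φ' ≃ₗ[k] QuotAlg φ :=
    (LinearEquiv.ofBijective (projIrr φ') hφ'.bijective_projIrr).symm ≪≫ₗ T ≪≫ₗ
      LinearEquiv.ofBijective (projIrr φ) hφ.bijective_projIrr
  have hg : ∀ x, g (proj φ' x) = proj φ (tensorHom hφ.isReductionSet h.preservesParallel x) := by
    intro x
    have h1 : (LinearEquiv.ofBijective (projIrr φ') hφ'.bijective_projIrr).symm (proj φ' x) =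
        ⟨redInf φ' x, redInf_mem φ' x⟩ := by
      rw [LinearEquiv.symm_apply_eq]
      exact (hφ'.proj_redInf x).symm
    simp only [g, LinearEquiv.trans_apply, h1]
    rw [← hφ.proj_redInf (tensorHom _ _ _), ← h.map_redInf hφ.isReductionSet hφ.terminates
      hφ'.terminates, ofIrr_of_mem T (redInf_mem φ' x)]
    rfl
  have hmul : ∀ a b, g (a * b) = g a * g b := by
    intro a b
    obtain ⟨x, rfl⟩ := Convergent.proj_surjective φ' a
    obtain ⟨y, rfl⟩ := Convergent.proj_surjective φ' b
    rw [← map_mul, hg, hg, hg, map_mul, map_mul]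
  have hone : g 1 = 1 := by rw [← map_one (proj φ'), hg, map_one, map_one]
  refine ⟨(AlgEquiv.ofLinearEquiv g hone hmul).symm, fun i => ?_⟩
  rw [AlgEquiv.symm_apply_eq]
  refine Eq.symm ((hg _).trans ?_)
  rw [tensorHom_idPath]

theorem Convergent.eq_of_proj_eq (hφ : Convergent φ) {x y : PathAlgebra k V}
    (hx : x ∈ irrMod k S) (hy : y ∈ irrMod k S) (h : proj φ x = proj φ y) : x = y := by
  rwa [hφ.proj_eq_iff, redInf_of_irr φ hx, redInf_of_irr φ hy] at h

/-- `T` is the inverse of `e` in the bases of irreducible paths. Since `e` fixes the idempotents,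
`T(p)` is unchanged by multiplication with those at the ends of `p`, so its terms are parallel to
`p`. -/
theorem equivalent_of_algEquiv (hφ : Convergent φ) (hφ' : Convergent φ')
    (e : QuotAlg φ ≃ₐ[k] QuotAlg φ') (he : ∀ i : V,
      e (proj φ (of k (QPath.idPath i))) = proj φ' (of k (QPath.idPath i))) :
    Equivalent φ φ' := by
  have hS := hφ.isReductionSet
  let T : irrMod k S ≃ₗ[k] irrMod k S :=
    LinearEquiv.ofBijective (projIrr φ') hφ'.bijective_projIrr ≪≫ₗ e.symm.toLinearEquiv ≪≫ₗ
      (LinearEquiv.ofBijective (projIrr φ) hφ.bijective_projIrr).symm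
  have hT : ∀ x, x ∈ irrMod k S → proj φ (ofIrr T x) = e.symm (proj φ' x) := by
    intro x hx
    rw [ofIrr_of_mem T hx]
    exact (LinearEquiv.ofBijective (projIrr φ) hφ.bijective_projIrr).apply_symm_apply
      (e.symm (proj φ' x))
  have he' : ∀ i, e.symm (proj φ' (of k (QPath.idPath i))) = proj φ (of k (QPath.idPath i)) := by
    intro i
    rw [← he, e.symm_apply_apply]
  have hpar : PreservesParallel T := by
    intro p hp
    have h1 : of k (QPath.idPath p.src) * ofIrr T (of k p) * of k (QPath.idPath p.tgt) ∈
        spanOn k {q | q.Parallel p ∧ q ∈ Irr S} := by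
      refine mul_mem_spanOn (Z := {q | q.Parallel p ∧ q ∈ Irr S}) (X := {q | q.src = p.src ∧ q ∈ Irr S})
        (Y := {QPath.idPath p.tgt}) (mul_mem_spanOn (X := {QPath.idPath p.src}) (of_mem_spanOn rfl)
        (ofIrr_mem T (of k p)) ?_) (of_mem_spanOn rfl) ?_
      · rintro _ rfl q hq r hr
        obtain rfl := hr.eq_right rfl
        exact ⟨hr.src, hq⟩
      · rintro q hq _ rfl r hr
        obtain rfl := hr.eq_left rfl
        exact ⟨⟨hq.1, hr.tgt⟩, hq.2⟩
    have h2 : of k (QPath.idPath p.src) * ofIrr T (of k p) * of k (QPath.idPath p.tgt) =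
        ofIrr T (of k p) := by
      refine hφ.eq_of_proj_eq (fun q hq => (h1 q hq).2) (ofIrr_mem T _) ?_
      rw [map_mul, map_mul, hT _ (of_mem_irrMod hp), ← he', ← he', ← map_mul, ← map_mul, ← map_mul,
        ← map_mul, idPath_mul, mul_idPath]
    rw [h2] at h1
    exact fun q hq => (h1 q hq).1
  have hprod : ∀ p, proj φ (tensorHom hS hpar (of k p)) = e.symm (proj φ' (of k p)) := by
    intro p
    induction p using QPath.head_induction with
    | h0 i => rw [tensorHom_idPath, he']
    | hs x q p hx hp ih =>
      rw [← of_mul_factors hp, map_mul, map_mul, ih, tensorHom_arrow hS hpar hx,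
        hT _ (of_mem_irrMod (hS.irr_of_length_le_one hx.le)), map_mul, map_mul]
  refine ⟨T, hpar, fun i => ?_, fun p => ?_⟩
  · refine hφ.eq_of_proj_eq (ofIrr_mem T _) (of_mem_irrMod (hS.idPath_mem i)) ?_
    rw [hT _ (of_mem_irrMod (hS.idPath_mem i)), he']
  · refine hφ.eq_of_proj_eq (ofIrr_mem T _) (redInf_mem φ _) ?_
    rw [hT _ (redInf_mem φ' _), hφ'.proj_redInf, hφ.proj_redInf, ← hprod, tensorHom_of]

end Groupoid

/-! ### Geometric series of locally nilpotent maps -/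

section GeomSum

variable {k : Type u} [CommRing k] {M : Type*} [AddCommGroup M] [Module k M]

theorem geomSum_apply {N : M →ₗ[k] M} (h : ∀ x, ∃ n, (N ^ n) x = 0) {x : M} {n : ℕ}
    (hn : (N ^ n) x = 0) : geomSum N x = ∑ i ∈ Finset.range n, (N ^ i) x := by
  rw [geomSum, dif_pos h]
  refine finsum_eq_sum_of_support_subset _ fun i hi => ?_
  rw [Finset.coe_range, Set.mem_Iio]
  by_contra hlt
  apply hi
  obtain ⟨d, rfl⟩ := Nat.exists_eq_add_of_le' (not_lt.mp hlt)
  change (N ^ (d + n)) x = 0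
  rw [pow_add, Module.End.mul_apply, hn, map_zero]

theorem geomSum_eq {N : M →ₗ[k] M} (h : ∀ x, ∃ n, (N ^ n) x = 0) (x : M) :
    geomSum N x = x + geomSum N (N x) := by
  obtain ⟨n, hn⟩ := h x
  have h1 : (N ^ n) (N x) = 0 := by
    rw [← Module.End.mul_apply, ← pow_succ, pow_succ', Module.End.mul_apply, hn, map_zero]
  have h2 : (N ^ (n + 1)) x = 0 := by rw [pow_succ, Module.End.mul_apply, h1]
  rw [geomSum_apply h h1, geomSum_apply h h2, Finset.sum_range_succ', add_comm]
  rfl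

theorem geomSum_comm {N : M →ₗ[k] M} (h : ∀ x, ∃ n, (N ^ n) x = 0) (f : M →ₗ[k] M)
    (hf : ∀ x, N (f x) = f (N x)) (x : M) : geomSum N (f x) = f (geomSum N x) := by
  have h1 : ∀ i x, (N ^ i) (f x) = f ((N ^ i) x) := by
    intro i
    induction i with
    | zero => intro x; rfl
    | succ i ih => intro x; rw [pow_succ, Module.End.mul_apply, hf, ih, Module.End.mul_apply]
  obtain ⟨n, hn⟩ := h x
  rw [geomSum_apply h hn, geomSum_apply (n := n) h (by rw [h1, hn, map_zero]), map_sum]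
  simp only [h1]

end GeomSum

set_option maxSynthPendingDepth 6

/-! ### The bimodule action on free bimodules -/

section Biact

variable {k : Type u} [CommRing k] {A : Type*} [Ring A] [Algebra k A] {W W' : Type*}

theorem biact_single (a b c d : A) (x : W) :
    biact (k := k) a b (Finsupp.single x (c ⊗ₜ[k] d)) = Finsupp.single x ((a * c) ⊗ₜ (d * b)) := by
  simp [biact]

theorem res_induction {P : (W →₀ A ⊗[k] A) → Prop} (z : W →₀ A ⊗[k] A) (h0 : P 0)
    (ha : ∀ y z, P y → P z → P (y + z)) (hs : ∀ x a b, P (Finsupp.single x (a ⊗ₜ b))) : P z := by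
  induction z using Finsupp.induction_linear with
  | zero => exact h0
  | add f g hf hg => exact ha f g hf hg
  | single x y =>
    induction y using TensorProduct.induction_on with
    | zero => rwa [Finsupp.single_zero]
    | tmul a b => exact hs x a b
    | add y z hy hz => rw [Finsupp.single_add]; exact ha _ _ hy hz

theorem res_ext {M : Type*} [AddCommGroup M] [Module k M] {f g : (W →₀ A ⊗[k] A) →ₗ[k] M}
    (h : ∀ x a b, f (Finsupp.single x (a ⊗ₜ b)) = g (Finsupp.single x (a ⊗ₜ b))) : f = g :=
  Finsupp.lhom_ext' fun x => TensorProduct.ext' fun a b => h x a b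

theorem biact_biact (a b c d : A) (z : W →₀ A ⊗[k] A) :
    biact (k := k) a b (biact c d z) = biact (a * c) (d * b) z := by
  refine LinearMap.congr_fun (f := biact a b ∘ₗ biact c d) (res_ext fun x e f => ?_) z
  simp only [LinearMap.comp_apply, biact_single, mul_assoc]

theorem biact_one_one (z : W →₀ A ⊗[k] A) : biact (k := k) 1 1 z = z := by
  refine LinearMap.congr_fun (g := LinearMap.id) (res_ext fun x e f => ?_) z
  simp only [LinearMap.id_apply, biact_single, mul_one, one_mul]

theorem bimodExt_single (c : W → (W' →₀ A ⊗[k] A)) (x : W) (a b : A) :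
    bimodExt (k := k) c (Finsupp.single x (a ⊗ₜ b)) = biact a b (c x) := by
  simp [bimodExt]

theorem leftExt_single (c : W → A →ₗ[k] (W' →₀ A ⊗[k] A)) (x : W) (a b : A) :
    leftExt (k := k) c (Finsupp.single x (a ⊗ₜ b)) = biact a 1 (c x b) := by
  simp [leftExt]

theorem rightExt_tmul {M : Type*} [AddCommGroup M] [Module k M] (f : M →ₗ[k] (W →₀ A ⊗[k] A))
    (y : M) (b : A) : rightExt f (y ⊗ₜ b) = biact 1 b (f y) := rfl

theorem bimodExt_biact (c : W → (W' →₀ A ⊗[k] A)) (a b : A) (z : W →₀ A ⊗[k] A) :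
    bimodExt (k := k) c (biact a b z) = biact a b (bimodExt c z) := by
  refine LinearMap.congr_fun (f := bimodExt c ∘ₗ biact a b) (g := biact a b ∘ₗ bimodExt c)
    (res_ext fun x e f => ?_) z
  simp only [LinearMap.comp_apply, biact_single, bimodExt_single, biact_biact]

theorem leftExt_biact (c : W → A →ₗ[k] (W' →₀ A ⊗[k] A)) (a : A) (z : W →₀ A ⊗[k] A) :
    leftExt (k := k) c (biact a 1 z) = biact a 1 (leftExt c z) := by
  refine LinearMap.congr_fun (f := leftExt c ∘ₗ biact a 1) (g := biact a 1 ∘ₗ leftExt c)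
    (res_ext fun x e f => ?_) z
  simp only [LinearMap.comp_apply, biact_single, leftExt_single, biact_biact, mul_one]

theorem evalCochain_single (f : W → A) (x : W) (a b : A) :
    evalCochain (k := k) f (Finsupp.single x (a ⊗ₜ b)) = a * f x * b := by
  simp [evalCochain]

theorem evalCochain_biact (f : W → A) (a b : A) (z : W →₀ A ⊗[k] A) :
    evalCochain (k := k) f (biact a b z) = a * evalCochain f z * b := by
  refine LinearMap.congr_fun (f := evalCochain f ∘ₗ biact a b)
    (g := LinearMap.mulRight k b ∘ₗ LinearMap.mulLeft k a ∘ₗ evalCochain f)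
    (res_ext fun x e f => ?_) z
  simp only [LinearMap.comp_apply, biact_single, evalCochain_single, LinearMap.mulLeft_apply,
    LinearMap.mulRight_apply, mul_assoc]

end Biact

/-! ### The universal derivation and the differential in degree one -/

section Split

variable {k : Type u} [CommRing k] {V : Type v} [Quiver.{w} V] [Fintype V]
  {S : Set (QPath V)} (φ : S → PathAlgebra k V)

/-- An element of `S`, viewed as an element of `S_2`. -/
def ambTwo (s : S) : amb S 2 := s

/-- An arrow, viewed as an element of `S_1`. -/
def ambOne (S : Set (QPath V)) {x : QPath V} (hx : x.length = 1) : amb S 1 := ⟨x, hx⟩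

/-- A vertex, viewed as an element of `S_0`. -/
def ambZero (S : Set (QPath V)) (i : V) : amb S 0 := ⟨QPath.idPath i, i, rfl⟩

/-- The element `a ⊗ x ⊗ b`. -/
def tens {n : ℕ} (x : amb S n) (a b : QuotAlg φ) : Res φ n := Finsupp.single x (a ⊗ₜ b)

variable {φ}

theorem tens_add_right {n : ℕ} (x : amb S n) (a b c : QuotAlg φ) :
    tens φ x a (b + c) = tens φ x a b + tens φ x a c := by
  rw [tens, TensorProduct.tmul_add, Finsupp.single_add]; rfl

theorem tens_smul_right {n : ℕ} (x : amb S n) (a b : QuotAlg φ) (c : k) :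
    tens φ x a (c • b) = c • tens φ x a b := by
  rw [tens, TensorProduct.tmul_smul, ← Finsupp.smul_single]; rfl

variable (φ) in
/-- The linear map `b ↦ a ⊗ x ⊗ b`. -/
def tensRight {n : ℕ} (x : amb S n) (a : QuotAlg φ) : QuotAlg φ →ₗ[k] Res φ n where
  toFun b := tens φ x a b
  map_add' := tens_add_right x a
  map_smul' c b := tens_smul_right x a b c

theorem biact_tens {n : ℕ} (x : amb S n) (a b c d : QuotAlg φ) :
    biact (k := k) a b (tens φ x c d) = tens φ x (a * c) (d * b) := biact_single a b c d x

theorem tens_induction {n : ℕ} {P : Res φ n → Prop} (z : Res φ n) (h0 : P 0)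
    (ha : ∀ y z, P y → P z → P (y + z)) (hs : ∀ x a b, P (tens φ x a b)) : P z :=
  res_induction z h0 ha hs

/-- The universal derivation `p ↦ ∑ q ⊗ x ⊗ r` on the path algebra. -/
def fox (φ : S → PathAlgebra k V) : PathAlgebra k V →ₗ[k] Res φ 1 := lin (split φ 1)

theorem split_eq_zero {n : ℕ} {p : QPath V}
    (h : ∀ q (x : amb S n) r, ¬ QPath.Factors3 q x r p) : split φ n p = 0 := by
  rw [split]
  have : {t : QPath V × amb S n × QPath V | QPath.Factors3 t.1 t.2.1 t.2.2 p} = ∅ :=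
    Set.eq_empty_of_forall_notMem fun t ht => h _ _ _ ht
  rw [this, finsum_mem_empty]

theorem fox_idPath (i : V) : fox φ (of k (QPath.idPath i)) = 0 := by
  rw [fox, lin_of]
  refine split_eq_zero fun q x r h => ?_
  have h1 : (x : QPath V).length = 1 := x.2
  have h2 := congrArg List.length (QPath.factors3_iff.mp h).2.2.2
  simp only [List.length_append, QPath.length_arrows, QPath.arrows_idPath, List.length_nil] at h2
  omega

-- The marked arrow in a decomposition of `p = x q` is either `x` or an arrow of `q`. The
-- alternative in the conditional is a default value that is never reached on decompositions of `q`.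
omit [Fintype V] in
theorem factors3_set_head {x q p : QPath V} (hx : x.length = 1) (h : QPath.Factors x q p) :
    {t : QPath V × amb S 1 × QPath V | QPath.Factors3 t.1 t.2.1 t.2.2 p} =
      {(QPath.idPath x.src, ambOne S hx, q)} ∪
      (fun t : QPath V × amb S 1 × QPath V =>
        (if e : x.tgt = t.1.src then x.comp t.1 e else t.1, t.2)) ''
        {t : QPath V × amb S 1 × QPath V | QPath.Factors3 t.1 t.2.1 t.2.2 q} := by
  have hbase : QPath.Factors3 (QPath.idPath x.src) x q p :=
    ⟨x, QPath.factors_idPath_left x, h⟩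
  ext ⟨a, y, b⟩
  simp only [Set.mem_ofPred_eq, Set.mem_union, Set.mem_singleton_iff, Set.mem_image, Prod.mk.injEq]
  constructor
  · intro hf
    by_cases ha : a.length = 0
    · left
      obtain ⟨h1, h2, h3⟩ := QPath.Factors3.unique hf hbase ha (y.2.trans hx.symm)
      exact ⟨h1, Subtype.ext h2, h3⟩
    · right
      have h1 := QPath.factors3_iff.mp hf
      obtain ⟨z, a', hz, haz⟩ := QPath.exists_head a (by
        intro h0
        rw [← QPath.length_arrows, h0] at ha
        exact ha rfl)
      obtain ⟨c, hc1, hc2⟩ := hf.left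
      obtain ⟨d, hd1, hd2⟩ := haz.assoc hc2
      obtain ⟨rfl, rfl⟩ := hd2.unique h (hz.trans hx.symm)
      refine ⟨(a', y, b), QPath.Factors3.of_left hc1 hd1, ?_, rfl⟩
      rw [dif_pos haz.mid]
      exact QPath.eq_of_factors (QPath.factors_comp _ _ _) haz
  · rintro (⟨rfl, rfl, rfl⟩ | ⟨⟨a', y', b'⟩, hf, rfl, rfl, rfl⟩)
    · exact hbase
    · obtain ⟨c, hc1, hc2⟩ := QPath.Factors3.left hf
      obtain ⟨d, hd1, hd2⟩ := hc2.assoc' h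
      dsimp only
      rw [dif_pos hd1.mid]
      obtain ⟨e, rfl⟩ := hd1
      exact QPath.Factors3.of_left hc1 hd2

omit [Fintype V] in
theorem factors3_set_finite (p : QPath V) :
    {t : QPath V × amb S 1 × QPath V | QPath.Factors3 t.1 t.2.1 t.2.2 p}.Finite := by
  induction p using QPath.head_induction with
  | h0 i =>
    refine Set.finite_empty.subset fun t h => ?_
    have h1 : (t.2.1 : QPath V).length = 1 := t.2.1.2
    have h2 := congrArg List.length (QPath.factors3_iff.mp h).2.2.2
    simp only [List.length_append, QPath.length_arrows, QPath.arrows_idPath, List.length_nil] at h2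
    omega
  | hs x q p hx h ih =>
    rw [factors3_set_head hx h]
    exact (Set.finite_singleton _).union (ih.image _)

/-- The Leibniz rule for splitting off the first arrow, from which all values of the derivation are
computed. -/
theorem fox_head {x q p : QPath V} (hx : x.length = 1) (h : QPath.Factors x q p) :
    fox φ (of k p) = tens φ (ambOne S hx) (proj φ (of k (QPath.idPath x.src))) (proj φ (of k q)) +
      biact (proj φ (of k x)) 1 (fox φ (of k q)) := by
  rw [fox, lin_of, lin_of, split, factors3_set_head hx h, finsum_mem_union]
  · rw [finsum_mem_singleton]
    congr 1
    have hsrc : ∀ t ∈ {t : QPath V × amb S 1 × QPath V | QPath.Factors3 t.1 t.2.1 t.2.2 q},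
        x.tgt = t.1.src := fun t ht => h.mid.trans (QPath.factors3_iff.mp ht).2.2.1
    rw [finsum_mem_image]
    · rw [split]
      refine Eq.trans ?_ (AddMonoidHom.map_finsum_mem (resOf φ) (biact (proj φ (of k x)) 1).toAddMonoidHom (factors3_set_finite q)).symm
      refine finsum_mem_congr rfl fun t ht => ?_
      rw [dif_pos (hsrc t ht)]
      refine (?_ : _ = biact _ _ (tens φ _ _ _))
      rw [biact_tens, mul_one, ← map_mul, of_mul_factors (QPath.factors_comp x t.1 (hsrc t ht))]
      rfl
    · rintro ⟨a, y, b⟩ ht ⟨a', y', b'⟩ ht' e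
      simp only [Prod.mk.injEq] at e
      obtain ⟨e1, rfl, rfl⟩ := e
      have h1 := hsrc _ ht
      have h2 := hsrc _ ht'
      dsimp only at h1 h2
      rw [dif_pos h1, dif_pos h2] at e1
      have := (QPath.Factors.unique (QPath.factors_comp x a h1)
        (e1 ▸ QPath.factors_comp x a' h2) rfl).2
      rw [this]
  · rw [Set.disjoint_left]
    rintro _ rfl ⟨⟨a, y, b⟩, ht, e⟩
    have h1 : x.tgt = a.src := h.mid.trans (QPath.factors3_iff.mp ht).2.2.1
    simp only [Prod.mk.injEq] at e
    rw [dif_pos h1] at e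
    have h2 := (QPath.factors_comp x a h1).length
    rw [e.1] at h2
    have h3 : (QPath.idPath x.src).length = 0 := rfl
    omega
  · exact Set.finite_singleton _
  · exact (factors3_set_finite q).image _

omit [Fintype V] in
theorem idPath_mul_idPath (i : V) :
    of k (QPath.idPath i) * of k (QPath.idPath i) = of k (QPath.idPath i) :=
  idPath_mul (QPath.idPath i)

theorem biact_left_fox (p : QPath V) :
    biact (proj φ (of k (QPath.idPath p.src))) 1 (fox φ (of k p)) = fox φ (of k p) := by
  by_cases hp : p.arrows = []
  · rw [QPath.eq_idPath_of_arrows hp, fox_idPath, map_zero]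
  · obtain ⟨x, q, hx, h⟩ := QPath.exists_head p hp
    rw [fox_head hx h, map_add, biact_tens, biact_biact, mul_one, mul_one, ← map_mul, ← map_mul, h.src,
      idPath_mul, idPath_mul_idPath]

theorem biact_right_fox (p : QPath V) :
    biact 1 (proj φ (of k (QPath.idPath p.tgt))) (fox φ (of k p)) = fox φ (of k p) := by
  induction p using QPath.head_induction with
  | h0 i => rw [fox_idPath, map_zero]
  | hs x q p hx h ih =>
    rw [fox_head hx h, map_add, biact_tens, biact_biact, one_mul, h.tgt, ← map_mul, mul_idPath]
    have := congrArg (biact (proj φ (of k x)) 1) ih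
    rw [biact_biact] at this
    simpa using this

theorem biact_fox_of_mem {i : V} {y : PathAlgebra k V} {X : Set (QPath V)} (hy : y ∈ spanOn k X)
    (hX : ∀ p ∈ X, p.src = i) : biact (proj φ (of k (QPath.idPath i))) 1 (fox φ y) = fox φ y :=
  eq_of_spanOn hy (biact (proj φ (of k (QPath.idPath i))) 1 ∘ₗ fox φ) (fox φ) fun p hp => by
    rw [LinearMap.comp_apply, ← hX p hp, biact_left_fox]

theorem split_two_of_irr {p : QPath V} (hp : p ∈ Irr S) : split φ 2 p = 0 :=
  split_eq_zero fun _ x _ h => not_irr_of_factors3 (s := (x : S)) h hp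

/-- Behind the first arrow everything is irreducible, so the sum over occurrences of elements of `S`
has a single term. -/
theorem split_two_head (hS : IsReductionSet S) {x v p r : QPath V} {s : S}
    (hx : x.length = 1) (hv : v ∈ Irr S) (hp : QPath.Factors x v p) (hs : QPath.Factors s r p) :
    split φ 2 p = tens φ (ambTwo s) (proj φ (of k (QPath.idPath (s : QPath V).src)))
      (proj φ (of k r)) := by
  have : {t : QPath V × amb S 2 × QPath V | QPath.Factors3 t.1 t.2.1 t.2.2 p} =
      {(QPath.idPath (s : QPath V).src, ambTwo s, r)} := by
    ext ⟨a, y, b⟩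
    simp only [Set.mem_ofPred_eq, Set.mem_singleton_iff, Prod.mk.injEq]
    constructor
    · intro h
      rw [← hs.src]
      exact hS.factors3_unique (s₁ := (y : S)) hx hv hp hs h
    · rintro ⟨h1, h2, h3⟩
      rw [h1, h2, h3]
      exact ⟨s, QPath.factors_idPath_left (s : QPath V), hs⟩
  rw [split, this, finsum_mem_singleton]
  rfl

/-- A vertex occurs at every position of a path; the right-most occurrence is the target.
Correspondingly the left-most one is the source. -/
theorem splitR_zero {x : QPath V} : splitR φ 0 x =
    tens φ (ambZero S x.tgt) (proj φ (of k x)) (proj φ (of k (QPath.idPath x.tgt))) := by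
  have hbase : QPath.Factors3 x (QPath.idPath x.tgt) (QPath.idPath x.tgt) x :=
    ⟨x, QPath.factors_idPath_right x, QPath.factors_idPath_right x⟩
  have : {t : QPath V × amb S 0 × QPath V | IsRightmost (amb S 0) x t} =
      {(x, ambZero S x.tgt, QPath.idPath x.tgt)} := by
    ext ⟨a, ⟨y, i, rfl⟩, b⟩
    simp only [Set.mem_ofPred_eq, Set.mem_singleton_iff, Prod.mk.injEq]
    constructor
    · rintro ⟨h1, h2⟩
      have h3 : x.length ≤ a.length := h2 (x, ambZero S x.tgt, QPath.idPath x.tgt) hbase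
      have h4 := congrArg List.length (QPath.factors3_iff.mp h1).2.2.2
      simp only [List.length_append, QPath.length_arrows] at h4
      obtain ⟨h5, h6, h7⟩ := QPath.Factors3.unique h1 hbase (show a.length = x.length by omega) rfl
      exact ⟨h5, Subtype.ext h6, h7⟩
    · rintro ⟨rfl, h, rfl⟩
      rw [h]
      refine ⟨hbase, fun t' ht' => ?_⟩
      have h4 := congrArg List.length (QPath.factors3_iff.mp ht').2.2.2
      simp only [List.length_append, QPath.length_arrows] at h4
      exact (by omega : t'.1.length ≤ a.length)
  rw [splitR, this, finsum_mem_singleton]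
  rfl

theorem splitL_zero {x : QPath V} : splitL φ 0 x =
    tens φ (ambZero S x.src) (proj φ (of k (QPath.idPath x.src))) (proj φ (of k x)) := by
  have hbase : QPath.Factors3 (QPath.idPath x.src) (QPath.idPath x.src) x x :=
    ⟨QPath.idPath x.src, QPath.factors_idPath_left (QPath.idPath x.src), QPath.factors_idPath_left x⟩
  have : {t : QPath V × amb S 0 × QPath V | IsLeftmost (amb S 0) x t} =
      {(QPath.idPath x.src, ambZero S x.src, x)} := by
    ext ⟨a, ⟨y, i, rfl⟩, b⟩
    simp only [Set.mem_ofPred_eq, Set.mem_singleton_iff, Prod.mk.injEq]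
    constructor
    · rintro ⟨h1, h2⟩
      have h3 : a.length ≤ 0 := h2 (QPath.idPath x.src, ambZero S x.src, x) hbase
      obtain ⟨h5, h6, h7⟩ := QPath.Factors3.unique h1 hbase (show a.length = 0 by omega) rfl
      exact ⟨h5, Subtype.ext h6, h7⟩
    · rintro ⟨rfl, h, rfl⟩
      rw [h]
      exact ⟨hbase, fun t' ht' => Nat.zero_le _⟩
  rw [splitL, this, finsum_mem_singleton]
  rfl

theorem diff_zero_tens {x : QPath V} (hx : x.length = 1) (a b : QuotAlg φ) :
    diff φ 0 (tens φ (ambOne S hx) a b) =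
      tens φ (ambZero S x.tgt) (a * proj φ (of k x)) (proj φ (of k (QPath.idPath x.tgt)) * b) -
      tens φ (ambZero S x.src) (a * proj φ (of k (QPath.idPath x.src))) (proj φ (of k x) * b) := by
  change del φ 0 _ = _
  rw [del, tens, bimodExt_single, if_pos (by decide)]
  refine (map_sub _ _ _).trans ?_
  change biact a b (splitR φ 0 x) - biact a b (splitL φ 0 x) = _
  rw [splitR_zero, splitL_zero, biact_tens, biact_tens]

theorem diff_zero_biact (a b : QuotAlg φ) (z : Res φ 1) :
    diff φ 0 (biact a b z) = biact a b (diff φ 0 z) := bimodExt_biact _ a b z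

/-- The contributions of the inner vertices of the path telescope. -/
theorem diff_zero_fox (p : QPath V) : diff φ 0 (fox φ (of k p)) =
    tens φ (ambZero S p.tgt) (proj φ (of k p)) (proj φ (of k (QPath.idPath p.tgt))) -
      tens φ (ambZero S p.src) (proj φ (of k (QPath.idPath p.src))) (proj φ (of k p)) := by
  induction p using QPath.head_induction with
  | h0 i => rw [fox_idPath, map_zero]; exact (sub_self _).symm
  | hs x q p hx h ih =>
    have e1 : proj φ (of k x) * proj φ (of k q) = proj φ (of k p) := by
      rw [← map_mul, of_mul_factors h]
    have e2 : proj φ (of k x) * proj φ (of k (QPath.idPath x.tgt)) = proj φ (of k x) := by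
      rw [← map_mul, mul_idPath]
    have e3 : proj φ (of k (QPath.idPath x.tgt)) * proj φ (of k q) = proj φ (of k q) := by
      rw [← map_mul, h.mid, idPath_mul]
    have e4 : proj φ (of k (QPath.idPath x.src)) * proj φ (of k x) = proj φ (of k x) := by
      rw [← map_mul, idPath_mul]
    have e5 : proj φ (of k (QPath.idPath x.src)) * proj φ (of k (QPath.idPath x.src)) =
        proj φ (of k (QPath.idPath x.src)) := by rw [← map_mul, idPath_mul_idPath]
    rw [fox_head hx h, map_add, diff_zero_tens, diff_zero_biact, ih, map_sub, biact_tens, biact_tens,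
      h.tgt, h.src, ← h.mid, mul_one, mul_one, e1, e2, e3, e4, e5]
    abel

end Split

/-! ### The right-most relation in an overlap -/

section Overlaps

variable {V : Type v} [Quiver.{w} V] {S : Set (QPath V)}

theorem QPath.Factors.compare {z b p r y : QPath V} (h : QPath.Factors z b y)
    (h' : QPath.Factors p r y) :
    (∃ c, QPath.Factors z c p) ∨ ∃ d, QPath.Factors p d z ∧ QPath.Factors d b r := by
  have e := h.arrows.symm.trans h'.arrows
  rcases List.append_eq_append_iff.mp e with ⟨l, hl, -⟩ | ⟨l, hl, -⟩
  · left
    obtain ⟨q, c, h1, h2, h3⟩ := QPath.exists_split p _ _ hl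
    have : q = z := QPath.ext_src (by rw [← h1.src, ← h'.src, h.src]) h2
    exact ⟨c, this ▸ h1⟩
  · right
    obtain ⟨q, d, h1, h2, h3⟩ := QPath.exists_split z _ _ hl
    have : q = p := QPath.ext_src (by rw [← h1.src, ← h.src, h'.src]) h2
    subst this
    obtain ⟨x, hx1, hx2⟩ := h1.assoc h
    obtain ⟨-, rfl⟩ := hx2.unique h' rfl
    exact ⟨d, h1, hx1⟩

theorem Overlap.exists_isRightmost (hS : IsReductionSet S) {x s' r w : QPath V} {s : S}
    (h : Overlap x s' s r w) :
    ∃ (q : QPath V) (t : S), IsRightmost S w (q, t, QPath.idPath w.tgt) ∧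
      QPath.Factors q t w := by
  obtain ⟨y, hy, hxy⟩ := h.factors_left.assoc h.factors
  have hw : QPath.Factors3 (QPath.idPath (s : QPath V).src) s r w :=
    ⟨s, QPath.factors_idPath_left (s : QPath V), h.factors⟩
  obtain ⟨⟨q, t, b⟩, h1, h2⟩ := ReductionSystem.exists_isRightmost (not_irr_of_factors3 hw)
  obtain ⟨q₀, t₀, b₀, h3⟩ := exists_factors3_of_not_irr (h.not_irr y hy)
  obtain ⟨c₀, hc1, hc2⟩ := QPath.Factors3.left h3
  obtain ⟨d₀, hd1, hd2⟩ := hc2.assoc' hxy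
  have h4 := h2 (d₀, t₀, b₀) (QPath.Factors3.of_left hc1 hd2)
  have h5 := hd1.length
  have hx := h.length_eq
  dsimp only at h1 h4
  obtain ⟨z, hz1, hz2⟩ := h1
  -- The occurrence starts behind `x`, because `s' r` is reducible. If it ended before `w` does, it
  -- would be a proper subpath of `s` or lie in `s' d` for a proper left subpath `d` of `r`; both
  -- are irreducible.
  have hb : b.length = 0 := by
    by_contra hb
    rcases hz2.compare h.factors with ⟨c, hc⟩ | ⟨d, hd, hdb⟩
    · have e1 := hc.length
      have e2 := hz1.length
      exact not_irr_of_mem t.2 (hS.irr_of_proper s.2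
        ((QPath.isSubpath_right hz1).of_factors_left hc) (by omega))
    · obtain ⟨y', hy1, hy2⟩ := h.factors_left.assoc hd
      have hirr := h.irr_of_ne d b y' hdb (fun e => hb (by
        have := hdb.length
        rw [e] at this
        omega)) hy1
      rcases hz1.compare hy2 with ⟨c, hc⟩ | ⟨c, hc1, hc2⟩
      · have e1 := hc.length
        obtain ⟨-, e2⟩ := hz1.unique hy2 (by omega)
        exact not_irr_of_mem t.2 (e2 ▸ hirr)
      · exact not_irr_of_mem t.2 (Irr.right hirr hc2)
  have hz : z = w := hz2.eq_left hb
  subst hz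
  have hb' : b = QPath.idPath z.tgt := by
    rw [QPath.eq_idPath_of_arrows (List.length_eq_zero_iff.mp ((QPath.length_arrows b).trans hb)),
      hz2.mid]
  subst hb'
  exact ⟨q, t, ⟨⟨z, hz1, hz2⟩, h2⟩, hz1⟩

end Overlaps

/-! ### The homotopies `ρ_0`, `ρ_1` and the differential `∂_2` -/

section LowDegrees

variable {k : Type u} [CommRing k] {V : Type v} [Quiver.{w} V] [Fintype V]
  {S : Set (QPath V)} {φ : S → PathAlgebra k V}

theorem Convergent.quot_ext (hc : Convergent φ) {M : Type*} [AddCommGroup M] [Module k M]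
    {f g : QuotAlg φ →ₗ[k] M} (h : ∀ v ∈ Irr S, f (proj φ (of k v)) = g (proj φ (of k v))) :
    f = g := by
  ext a
  rw [← hc.proj_irrSection a]
  exact eq_of_spanOn (hc.irrSection_mem a) (f ∘ₗ (proj φ).toLinearMap) (g ∘ₗ (proj φ).toLinearMap) h

theorem Convergent.irrSection_of (hc : Convergent φ) {v : QPath V} (hv : v ∈ Irr S) :
    irrSection φ (proj φ (of k v)) = of k v :=
  hc.irrSection_proj_of_mem (of_mem_spanOn (X := Irr S) hv)

theorem Convergent.irrSection_idPath (hc : Convergent φ) (i : V) :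
    irrSection φ (proj φ (of k (QPath.idPath i))) = of k (QPath.idPath i) :=
  hc.irrSection_of (hc.isReductionSet.irr_of_length_le_one (by exact Nat.zero_le 1))

theorem Convergent.irrSection_rel (hc : Convergent φ) (s : S) :
    irrSection φ (proj φ (of k s)) = φ s := by rw [hc.irrSection_proj, hc.redInf_rel]

theorem proj_idPath_mul (p : QPath V) :
    proj φ (of k (QPath.idPath p.src)) * proj φ (of k p) = proj φ (of k p) := by
  rw [← map_mul, idPath_mul]

theorem proj_mul_idPath (p : QPath V) :
    proj φ (of k p) * proj φ (of k (QPath.idPath p.tgt)) = proj φ (of k p) := by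
  rw [← map_mul, mul_idPath]

theorem proj_mul_factors {q r p : QPath V} (h : QPath.Factors q r p) :
    proj φ (of k q) * proj φ (of k r) = proj φ (of k p) := by
  rw [← map_mul, of_mul_factors h]

theorem proj_mul_eq_zero {q r : QPath V} (h : q.tgt ≠ r.src) :
    proj φ (of k q) * proj φ (of k r) = 0 := by
  rw [← map_mul, of_mul_eq_zero h, map_zero]

theorem proj_idPath_mul_idPath (i : V) :
    proj φ (of k (QPath.idPath i)) * proj φ (of k (QPath.idPath i)) =
      proj φ (of k (QPath.idPath i)) := proj_idPath_mul (QPath.idPath i)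

theorem biact_left_fox_coch (hφ : φ ∈ coch k S S) (s : S) :
    biact (proj φ (of k (QPath.idPath (s : QPath V).src))) 1 (fox φ (φ s)) = fox φ (φ s) :=
  biact_fox_of_mem (coch_mem_parallel hφ s) fun _ hp => hp.1

theorem gam_zero_tens (i : V) (a b : QuotAlg φ) : gam φ 0 (tens φ (ambZero S i) a b) =
    -biact a 1 (fox φ (of k (QPath.idPath i) * irrSection φ b)) := by
  rw [gam, tens, leftExt_single]
  rw [show (-1 : k) ^ (0 + 1) = -1 by norm_num, LinearMap.smul_apply, neg_smul, one_smul, map_neg]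
  rfl

theorem del_one_tens (s : S) (a b : QuotAlg φ) :
    del φ 1 (tens φ (ambTwo s) a b) = biact a b (fox φ (of k s)) := by
  rw [del, tens, bimodExt_single, if_neg (by decide), fox, lin_of]
  rfl

/-- By telescoping, `∂_1` of the derivation of `s` depends only on the class of `s` in the quotient,
and `ρ_0` rebuilds it from the normal form `φ_s`. -/
theorem rho_zero_diff_zero_fox (hc : Convergent φ) (s : S) :
    rho φ 0 (diff φ 0 (fox φ (of k s))) = fox φ (φ s) := by
  change gam φ 0 _ = _
  rw [diff_zero_fox, map_sub, gam_zero_tens, gam_zero_tens, hc.irrSection_idPath,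
    idPath_mul_idPath, fox_idPath, map_zero, neg_zero, zero_sub, neg_neg, hc.irrSection_rel,
    idPath_mul_coch hc.mem_coch, biact_left_fox_coch hc.mem_coch]

/-- The correction `ρ_0 ∂_1` in the recursive definition contributes the derivation of `φ_s`. So
`∂_2` is the universal derivation of the relation `s - φ_s`. -/
theorem diff_one_tens (hc : Convergent φ) (s : S) (a b : QuotAlg φ) :
    diff φ 1 (tens φ (ambTwo s) a b) = biact a b (fox φ (of k s) - fox φ (φ s)) := by
  have h1 : del φ 1 (gen φ (n := 2) s) = fox φ (of k s) := by
    refine (del_one_tens s (proj φ (of k (QPath.idPath (s : QPath V).src)))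
      (proj φ (of k (QPath.idPath (s : QPath V).tgt)))).trans ?_
    have := congrArg (biact (proj φ (of k (QPath.idPath (s : QPath V).src))) 1)
      (biact_right_fox (φ := φ) (s : QPath V))
    rw [biact_biact, mul_one, mul_one, biact_left_fox] at this
    exact this
  refine (bimodExt_single _ _ _ _).trans ?_
  congr 1
  refine (congrArg₂ (· - ·) h1 ?_)
  exact (congrArg (fun z => rho φ 0 (diff φ 0 z)) h1).trans (rho_zero_diff_zero_fox hc s)

theorem diff_one_biact (a b : QuotAlg φ) (z : Res φ 2) :
    diff φ 1 (biact a b z) = biact a b (diff φ 1 z) := bimodExt_biact _ a b z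

theorem gam_one_biact (a : QuotAlg φ) (z : Res φ 1) :
    gam φ 1 (biact a 1 z) = biact a 1 (gam φ 1 z) := leftExt_biact _ a z

theorem gam_one_tens {x : QPath V} (hx : x.length = 1) (a b : QuotAlg φ) :
    gam φ 1 (tens φ (ambOne S hx) a b) =
      biact a 1 (lin (split φ 2) (of k x * irrSection φ b)) := by
  rw [gam, tens, leftExt_single]
  rw [show (-1 : k) ^ (1 + 1) = 1 by norm_num, one_smul]
  rfl

theorem gam_one_of_irr (hc : Convergent φ) {x v p : QPath V} (hx : x.length = 1) (hv : v ∈ Irr S)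
    (h : QPath.Factors x v p) (hp : p ∈ Irr S) (a : QuotAlg φ) :
    gam φ 1 (tens φ (ambOne S hx) a (proj φ (of k v))) = 0 := by
  rw [gam_one_tens, hc.irrSection_of hv, of_mul_factors h, lin_of, split_two_of_irr hp, map_zero]

theorem gam_one_of_ne (hc : Convergent φ) {x v : QPath V} (hx : x.length = 1) (hv : v ∈ Irr S)
    (h : x.tgt ≠ v.src) (a : QuotAlg φ) :
    gam φ 1 (tens φ (ambOne S hx) a (proj φ (of k v))) = 0 := by
  rw [gam_one_tens, hc.irrSection_of hv, of_mul_eq_zero h, map_zero, map_zero]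

theorem gam_one_of_head (hc : Convergent φ) {x v p r : QPath V} {s : S} (hx : x.length = 1)
    (hv : v ∈ Irr S) (h : QPath.Factors x v p) (hs : QPath.Factors s r p) (a : QuotAlg φ) :
    gam φ 1 (tens φ (ambOne S hx) a (proj φ (of k v))) =
      tens φ (ambTwo s) (a * proj φ (of k (QPath.idPath (s : QPath V).src))) (proj φ (of k r)) := by
  rw [gam_one_tens, hc.irrSection_of hv, of_mul_factors h, lin_of,
    split_two_head hc.isReductionSet hx hv h hs, biact_tens, mul_one]

/-- The map `δ_2 γ_1 - ∂_2 γ_1`. -/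
def defect (φ : S → PathAlgebra k V) : Res φ 1 →ₗ[k] Res φ 1 :=
  del φ 1 ∘ₗ gam φ 1 - diff φ 1 ∘ₗ gam φ 1

theorem defect_apply (z : Res φ 1) : defect φ z = del φ 1 (gam φ 1 z) - diff φ 1 (gam φ 1 z) := rfl

theorem rho_one (φ : S → PathAlgebra k V) : rho φ 1 = gam φ 1 ∘ₗ geomSum (defect φ) := rfl

theorem defect_biact (a : QuotAlg φ) (z : Res φ 1) :
    defect φ (biact a 1 z) = biact a 1 (defect φ z) := by
  rw [defect_apply, defect_apply, gam_one_biact, diff_one_biact, map_sub, del, bimodExt_biact]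

theorem defect_of_gam_eq_zero {z : Res φ 1} (h : gam φ 1 z = 0) : defect φ z = 0 := by
  rw [defect_apply, h, map_zero, map_zero, sub_zero]

/-- `γ_1` finds `s` at the start of `x v = s r`, and `δ_2 - ∂_2` leaves the derivation of `φ_s`.
Thus `defect` performs one reduction step and moves down in the order. -/
theorem defect_of_head (hc : Convergent φ) {x v p r : QPath V} {s : S} (hx : x.length = 1)
    (hv : v ∈ Irr S) (h : QPath.Factors x v p) (hs : QPath.Factors s r p) (a : QuotAlg φ) :
    defect φ (tens φ (ambOne S hx) a (proj φ (of k v))) =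
      biact a 1 (biact 1 (proj φ (of k r)) (fox φ (φ s))) := by
  rw [defect_apply, gam_one_of_head hc hx hv h hs, del_one_tens, diff_one_tens hc, map_sub,
    sub_sub_cancel, biact_biact, mul_one, mul_one]
  have := congrArg (biact a (proj φ (of k r))) (biact_left_fox_coch hc.mem_coch s)
  rw [biact_biact, one_mul] at this
  exact this

/-- The elements that are annihilated by a power of the map `δ_2 γ_1 - ∂_2 γ_1`. -/
def defectNil (φ : S → PathAlgebra k V) : Submodule k (Res φ 1) where
  carrier := {z | ∃ n, (defect φ ^ n) z = 0}
  zero_mem' := ⟨0, map_zero _⟩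
  add_mem' := by
    rintro y z ⟨n, hn⟩ ⟨m, hm⟩
    refine ⟨n + m, ?_⟩
    rw [map_add]
    nth_rewrite 1 [add_comm n m]
    rw [pow_add, pow_add, Module.End.mul_apply, Module.End.mul_apply, hn, hm, map_zero, map_zero,
      add_zero]
  smul_mem' := by
    rintro c z ⟨n, hn⟩
    exact ⟨n, by rw [map_smul, hn, smul_zero]⟩

theorem mem_defectNil {z : Res φ 1} (h : defect φ z ∈ defectNil φ) : z ∈ defectNil φ := by
  obtain ⟨n, hn⟩ := h
  exact ⟨n + 1, by rw [pow_succ, Module.End.mul_apply, hn]⟩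

theorem biact_mem_defectNil {z : Res φ 1} (h : z ∈ defectNil φ) (a : QuotAlg φ) :
    biact a 1 z ∈ defectNil φ := by
  obtain ⟨n, hn⟩ := h
  refine ⟨n, ?_⟩
  have : ∀ z, (defect φ ^ n) (biact a 1 z) = biact a 1 ((defect φ ^ n) z) := by
    clear hn
    induction n with
    | zero => intro z; rfl
    | succ n ih =>
      intro z
      rw [pow_succ, Module.End.mul_apply, defect_biact, ih, Module.End.mul_apply]
  rw [this, hn, map_zero]

variable {prec : QPath V → QPath V → Prop}

/-- Each term of the derivation of `u`, multiplied by `r`, consists of an arrow `y` of `u` and a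
path behind it in `u r`. After normalising that path, `y v` is still at most a right subpath of `u
r`, hence below `p`, and the hypothesis `ih` applies. -/
theorem biact_fox_mem (hprec : IsAdmissible prec) (hφ : φ ∈ cochPrec k S prec) (hc : Convergent φ)
    {p : QPath V} {N : Submodule k (Res φ 1)}
    (hN : ∀ z ∈ N, ∀ a, biact a 1 z ∈ N)
    (ih : ∀ p', prec p' p → ∀ y v (hy : y.length = 1), v ∈ Irr S → QPath.Factors y v p' →
      ∀ a, tens φ (ambOne S hy) a (proj φ (of k v)) ∈ N) (u r p' : QPath V)
    (hp' : prec p' p) (h : QPath.Factors u r p') :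
    biact 1 (proj φ (of k r)) (fox φ (of k u)) ∈ N := by
  induction u using QPath.head_induction generalizing p' with
  | h0 i => rw [fox_idPath, map_zero]; exact N.zero_mem
  | hs y q u hy hu ihu =>
    obtain ⟨z, hz1, hz2⟩ := hu.assoc h
    rw [fox_head hy hu, map_add, biact_tens, biact_biact, one_mul, one_mul, one_mul,
      proj_mul_factors hz1]
    refine N.add_mem ?_ ?_
    · rw [← hc.proj_redInf (of k z)]
      refine map_mem_of_spanOn (redInf_mem_le hc.isReductionSet hprec hφ z)
        (tensRight φ (ambOne S hy) (proj φ (of k (QPath.idPath y.src))) ∘ₗ (proj φ).toLinearMap)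
        N fun v hv => ?_
      obtain ⟨hle, hpar, hirr⟩ := hv
      have hyv := QPath.factors_comp y v (hz2.mid.trans hpar.1.symm)
      refine ih _ ?_ y v hy hirr hyv _
      rcases hle with rfl | hlt
      · rwa [QPath.eq_of_factors hyv hz2]
      · exact hprec.trans _ _ _ (hprec.mul_left _ _ _ _ _ hyv hz2 hlt) hp'
    · have h3 : prec z p := by
        exact hprec.trans _ _ _ (hprec.of_factors_right hz2 (by omega)) hp'
      have := hN _ (ihu z h3 hz1) (proj φ (of k y))
      rwa [biact_biact, mul_one, mul_one] at this

theorem tens_mem_defectNil (hprec : IsAdmissible prec) (hφ : φ ∈ cochPrec k S prec)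
    (hc : Convergent φ) (p : QPath V) : ∀ x v (hx : x.length = 1), v ∈ Irr S →
      QPath.Factors x v p → ∀ a, tens φ (ambOne S hx) a (proj φ (of k v)) ∈ defectNil φ := by
  induction p using hprec.wf.induction with
  | h p ih =>
    intro x v hx hv h a
    apply mem_defectNil
    rcases hc.isReductionSet.irr_or_factors hx hv h with hp | ⟨s, r, hs⟩
    · rw [defect_of_gam_eq_zero (gam_one_of_irr hc hx hv h hp a)]
      exact Submodule.zero_mem _
    · rw [defect_of_head hc hx hv h hs]
      refine biact_mem_defectNil ?_ a
      refine map_mem_of_spanOn (cochPrec_mem hφ s)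
        (biact 1 (proj φ (of k r)) ∘ₗ fox φ) _ fun u hu => ?_
      have hur := QPath.factors_comp u r (hu.2.2.trans hs.mid)
      exact biact_fox_mem hprec hφ hc (fun z hz b => biact_mem_defectNil hz b) ih u r _
        (hprec.mul_right _ _ _ _ _ hur hs hu.1) hur

/-- Local nilpotency ensures that `geomSum` in the definition of `ρ_1` is the genuine series and not
its default value `0`. -/
theorem mem_defectNil_of_prec (hprec : IsAdmissible prec) (hφ : φ ∈ cochPrec k S prec)
    (hc : Convergent φ) (z : Res φ 1) : ∃ n, (defect φ ^ n) z = 0 := by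
  change z ∈ defectNil φ
  induction z using tens_induction with
  | h0 => exact Submodule.zero_mem _
  | ha y z hy hz => exact Submodule.add_mem _ hy hz
  | hs x a b =>
    obtain ⟨x, hx⟩ := x
    rw [← hc.proj_irrSection b]
    refine map_mem_of_spanOn (hc.irrSection_mem b)
      (tensRight φ (ambOne S hx) a ∘ₗ (proj φ).toLinearMap) _ fun v hv => ?_
    change tens φ (ambOne S hx) a (proj φ (of k v)) ∈ _
    by_cases h : x.tgt = v.src
    · exact tens_mem_defectNil hprec hφ hc _ x v hx hv (QPath.factors_comp x v h) a
    · apply mem_defectNil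
      rw [defect_of_gam_eq_zero (gam_one_of_ne hc hx hv h a)]
      exact Submodule.zero_mem _

theorem rho_one_eq (hprec : IsAdmissible prec) (hφ : φ ∈ cochPrec k S prec) (hc : Convergent φ)
    (z : Res φ 1) : rho φ 1 z = gam φ 1 z + rho φ 1 (defect φ z) := by
  rw [rho_one, LinearMap.comp_apply, geomSum_eq (mem_defectNil_of_prec hprec hφ hc), map_add]
  rfl

theorem rho_one_of_gam_eq_zero (hprec : IsAdmissible prec) (hφ : φ ∈ cochPrec k S prec)
    (hc : Convergent φ) {z : Res φ 1} (h : gam φ 1 z = 0) : rho φ 1 z = 0 := by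
  rw [rho_one_eq hprec hφ hc, h, defect_of_gam_eq_zero h, map_zero, add_zero]

theorem rho_one_biact (hprec : IsAdmissible prec) (hφ : φ ∈ cochPrec k S prec) (hc : Convergent φ)
    (a : QuotAlg φ) (z : Res φ 1) : rho φ 1 (biact a 1 z) = biact a 1 (rho φ 1 z) := by
  rw [rho_one, LinearMap.comp_apply, LinearMap.comp_apply,
    geomSum_comm (mem_defectNil_of_prec hprec hφ hc) (biact a 1) (defect_biact a), gam_one_biact]

end LowDegrees

/-! ### The differential `∂_3` and the comparison map `G_2` -/

section Crossing

variable {k : Type u} [CommRing k] {V : Type v} [Quiver.{w} V] [Fintype V]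
  {S : Set (QPath V)} {φ : S → PathAlgebra k V} {prec : QPath V → QPath V → Prop}

/-- The bilinear map `(y, b) ↦ ρ_1(D(y) b)`, where `D` is the universal derivation. -/
def crossing (φ : S → PathAlgebra k V) : PathAlgebra k V →ₗ[k] QuotAlg φ →ₗ[k] Res φ 2 :=
  LinearMap.mk₂ k (fun y b => rho φ 1 (biact 1 b (fox φ y)))
    (fun y z b => by simp only [map_add]) (fun c y b => by simp only [map_smul])
    (fun y b c => by rw [biact_add_right, LinearMap.add_apply, map_add])
    (fun c y b => by rw [biact_smul_right, LinearMap.smul_apply, map_smul])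

theorem crossing_apply (y : PathAlgebra k V) (b : QuotAlg φ) :
    crossing φ y b = rho φ 1 (biact 1 b (fox φ y)) := rfl

theorem crossing_idPath (i : V) (b : QuotAlg φ) : crossing φ (of k (QPath.idPath i)) b = 0 := by
  rw [crossing_apply, fox_idPath, map_zero, map_zero]

theorem crossing_of_ne {u v : QPath V} (h : u.tgt ≠ v.src) :
    crossing φ (of k u) (proj φ (of k v)) = 0 := by
  have := congrArg (biact 1 (proj φ (of k v))) (biact_right_fox (φ := φ) u)
  rw [biact_biact, one_mul, proj_mul_eq_zero (q := QPath.idPath u.tgt) h] at this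
  rw [crossing_apply, ← this]
  have : biact (k := k) (W := amb S 1) (1 : QuotAlg φ) 0 = 0 := by
    rw [← zero_smul k (0 : QuotAlg φ), biact_smul_right, zero_smul]
  rw [this, LinearMap.zero_apply, map_zero]

theorem fox_arrow {x : QPath V} (hx : x.length = 1) : fox φ (of k x) =
    tens φ (ambOne S hx) (proj φ (of k (QPath.idPath x.src)))
      (proj φ (of k (QPath.idPath x.tgt))) := by
  rw [fox_head hx (QPath.factors_idPath_right x), fox_idPath, map_zero, add_zero]

theorem biact_fox_arrow {x v p : QPath V} (hx : x.length = 1) (h : QPath.Factors x v p) :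
    biact 1 (proj φ (of k v)) (fox φ (of k x)) =
    tens φ (ambOne S hx) (proj φ (of k (QPath.idPath x.src))) (proj φ (of k v)) := by
  rw [fox_arrow hx, biact_tens, one_mul, h.mid, proj_idPath_mul]

theorem crossing_idPath_mul (hprec : IsAdmissible prec) (hφ : φ ∈ cochPrec k S prec)
    (hc : Convergent φ) (i : V) (y : PathAlgebra k V) (b : QuotAlg φ) :
    crossing φ (of k (QPath.idPath i) * y) b =
      biact (proj φ (of k (QPath.idPath i))) 1 (crossing φ y b) := by
  refine eq_of_spanOn (mem_spanOn_univ y) ((crossing φ).flip b ∘ₗ LinearMap.mulLeft k _)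
    (biact (proj φ (of k (QPath.idPath i))) 1 ∘ₗ (crossing φ).flip b) fun p _ => ?_
  simp only [LinearMap.comp_apply, LinearMap.flip_apply, LinearMap.mulLeft_apply]
  rw [crossing_apply, crossing_apply, ← rho_one_biact hprec hφ hc, biact_biact, mul_one, mul_one]
  by_cases h : i = p.src
  · rw [h, idPath_mul]
    have := congrArg (biact 1 b) (biact_left_fox (φ := φ) p)
    rw [biact_biact, one_mul, one_mul] at this
    rw [this]
  · have h' : (QPath.idPath i).tgt ≠ p.src := h
    have := congrArg (biact (proj φ (of k (QPath.idPath i))) b) (biact_left_fox (φ := φ) p)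
    rw [biact_biact, proj_mul_eq_zero (r := QPath.idPath p.src) h', one_mul] at this
    rw [← this, of_mul_eq_zero h', map_zero, map_zero, map_zero]
    have : biact (k := k) (W := amb S 1) (0 : QuotAlg φ) b = 0 := by
      rw [← zero_smul k (0 : QuotAlg φ), biact_smul_left, zero_smul]
    rw [this, LinearMap.zero_apply, map_zero]

theorem crossing_arrow_of_irr (hprec : IsAdmissible prec) (hφ : φ ∈ cochPrec k S prec)
    (hc : Convergent φ) {x v p : QPath V} (hx : x.length = 1) (hv : v ∈ Irr S)
    (h : QPath.Factors x v p) (hp : p ∈ Irr S) :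
    crossing φ (of k x) (proj φ (of k v)) = 0 := by
  rw [crossing_apply, biact_fox_arrow hx h]
  exact rho_one_of_gam_eq_zero hprec hφ hc (gam_one_of_irr hc hx hv h hp _)

/-- The recursion behind the whole comparison: `ρ_1` records the relation `s` that is used and
continues with `φ_s r`, just as right-most reduction does. -/
theorem crossing_arrow_of_head (hprec : IsAdmissible prec) (hφ : φ ∈ cochPrec k S prec)
    (hc : Convergent φ) {x v p r : QPath V} {s : S} (hx : x.length = 1) (hv : v ∈ Irr S)
    (h : QPath.Factors x v p) (hs : QPath.Factors s r p) :
    crossing φ (of k x) (proj φ (of k v)) =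
      tens φ (ambTwo s) (proj φ (of k (QPath.idPath (s : QPath V).src))) (proj φ (of k r)) +
      crossing φ (φ s) (proj φ (of k r)) := by
  have hsrc : x.src = (s : QPath V).src := h.src.symm.trans hs.src
  rw [crossing_apply, biact_fox_arrow hx h, rho_one_eq hprec hφ hc, gam_one_of_head hc hx hv h hs,
    defect_of_head hc hx hv h hs, hsrc, proj_idPath_mul_idPath, biact_biact, mul_one, mul_one]
  have := congrArg (biact 1 (proj φ (of k r))) (biact_left_fox_coch hc.mem_coch s)
  rw [biact_biact, one_mul, one_mul] at this
  rw [this, crossing_apply]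

theorem crossing_head (hprec : IsAdmissible prec) (hφ : φ ∈ cochPrec k S prec)
    (hc : Convergent φ) {x q p : QPath V} (hx : x.length = 1) (h : QPath.Factors x q p)
    (b : QuotAlg φ) : crossing φ (of k p) b = crossing φ (of k x) (proj φ (of k q) * b) +
      biact (proj φ (of k x)) 1 (crossing φ (of k q) b) := by
  rw [crossing_apply, fox_head hx h, map_add, map_add, crossing_apply, crossing_apply,
    ← rho_one_biact hprec hφ hc, biact_biact, biact_biact, fox_arrow hx, biact_tens, biact_tens,
    ← mul_assoc, h.mid, proj_idPath_mul]
  simp only [one_mul, mul_one]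

/-- `crossing` collects the relations applied when `u` and `v` are multiplied. No relation is used
when the concatenation is irreducible. -/
theorem crossing_of_irr (hprec : IsAdmissible prec) (hφ : φ ∈ cochPrec k S prec)
    (hc : Convergent φ) {u v p : QPath V} (hp : p ∈ Irr S) (h : QPath.Factors u v p) :
    crossing φ (of k u) (proj φ (of k v)) = 0 := by
  induction u using QPath.head_induction generalizing p with
  | h0 i => rw [crossing_idPath]
  | hs x q u hx hu ih =>
    obtain ⟨z, hz1, hz2⟩ := hu.assoc h
    have hz := Irr.right hp hz2
    rw [crossing_head hprec hφ hc hx hu, proj_mul_factors hz1,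
      crossing_arrow_of_irr hprec hφ hc hx hz hz2 hp, ih hz hz1, map_zero, add_zero]

theorem crossing_right_idPath (hprec : IsAdmissible prec) (hφ : φ ∈ cochPrec k S prec)
    (hc : Convergent φ) {y : PathAlgebra k V} (hy : y ∈ irrMod k S) (i : V) :
    crossing φ y (proj φ (of k (QPath.idPath i))) = 0 := by
  refine eq_of_spanOn hy ((crossing φ).flip (proj φ (of k (QPath.idPath i)))) 0 fun u hu => ?_
  rw [LinearMap.flip_apply, LinearMap.zero_apply]
  by_cases h : u.tgt = i
  · subst h
    exact crossing_of_irr hprec hφ hc hu (QPath.factors_idPath_right u)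
  · exact crossing_of_ne h

theorem crossing_right_one (hprec : IsAdmissible prec) (hφ : φ ∈ cochPrec k S prec)
    (hc : Convergent φ) {y : PathAlgebra k V} (hy : y ∈ irrMod k S) : crossing φ y 1 = 0 := by
  rw [← map_one (proj φ), one_def, map_sum, map_sum]
  exact Finset.sum_eq_zero fun i _ => crossing_right_idPath hprec hφ hc hy i

theorem splitR_sub_splitL {x s' r w : QPath V} {s : S} (hS : IsReductionSet S)
    (h : Overlap x s' s r w) : ∃ (q : QPath V) (t : S), QPath.Factors q t w ∧
      splitR φ 2 w - splitL φ 2 w =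
        tens φ (ambTwo t) (proj φ (of k q)) (proj φ (of k (QPath.idPath w.tgt))) -
        tens φ (ambTwo s) (proj φ (of k (QPath.idPath (s : QPath V).src))) (proj φ (of k r)) := by
  obtain ⟨q, t, ht, hqt⟩ := h.exists_isRightmost hS
  refine ⟨q, t, hqt, ?_⟩
  have h1 : {t : QPath V × amb S 2 × QPath V | IsRightmost (amb S 2) w t} =
      {(q, ambTwo t, QPath.idPath w.tgt)} := by
    ext t'
    exact ⟨fun h' => hS.isRightmost_unique h' ht, fun h' => by rw [h']; exact ht⟩
  have hs : QPath.Factors3 (QPath.idPath (s : QPath V).src) s r w :=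
    ⟨s, QPath.factors_idPath_left (s : QPath V), h.factors⟩
  have h2 : {t : QPath V × amb S 2 × QPath V | IsLeftmost (amb S 2) w t} =
      {(QPath.idPath (s : QPath V).src, ambTwo s, r)} := by
    ext ⟨q', s'', r'⟩
    constructor
    · rintro ⟨h3, h4⟩
      have h5 := h4 (QPath.idPath (s : QPath V).src, s, r) hs
      obtain ⟨e1, e2, e3⟩ := hS.unique_of_length (s := s'') h3 hs (Nat.le_antisymm h5 (Nat.zero_le _))
      exact Prod.ext e1 (Prod.ext e2 e3)
    · intro h'
      rw [h']
      exact ⟨hs, fun _ _ => Nat.zero_le _⟩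
  rw [splitR, splitL, h1, h2, finsum_mem_singleton, finsum_mem_singleton]
  rfl

/-- The value of `∂_3` on the overlap `w = s r`, where `s = x s'`. -/
def overlapDiff (φ : S → PathAlgebra k V) (x s' : QPath V) (s : S) (r : QPath V) : Res φ 2 :=
  crossing φ (of k x) (proj φ (of k s') * proj φ (of k r)) +
    biact (proj φ (of k x)) 1 (crossing φ (of k s') (proj φ (of k r))) -
    crossing φ (φ s) (proj φ (of k r)) -
    tens φ (ambTwo s) (proj φ (of k (QPath.idPath (s : QPath V).src))) (proj φ (of k r))

theorem crossing_rel_idPath (hprec : IsAdmissible prec) (hφ : φ ∈ cochPrec k S prec)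
    (hc : Convergent φ) (s : S) :
    crossing φ (of k s) (proj φ (of k (QPath.idPath (s : QPath V).tgt))) =
      tens φ (ambTwo s) (proj φ (of k (QPath.idPath (s : QPath V).src)))
        (proj φ (of k (QPath.idPath (s : QPath V).tgt))) := by
  obtain ⟨x, s', hx, h⟩ := QPath.exists_head (s : QPath V) (hc.isReductionSet.arrows_ne_nil s.2)
  have hs' := hc.isReductionSet.irr_tail s.2 hx h
  rw [crossing_head hprec hφ hc hx h, h.tgt, proj_mul_idPath,
    crossing_right_idPath hprec hφ hc (of_mem_spanOn (X := Irr S) hs'), map_zero, add_zero,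
    crossing_arrow_of_head hprec hφ hc hx hs' h (QPath.factors_idPath_right (s : QPath V)),
    crossing_right_idPath hprec hφ hc (coch_mem_irr hc.mem_coch s), add_zero, h.tgt]

theorem crossing_rel (hprec : IsAdmissible prec) (hφ : φ ∈ cochPrec k S prec)
    (hc : Convergent φ) (s : S) (a b : QuotAlg φ) :
    rho φ 1 (biact a b (fox φ (of k s) - fox φ (φ s))) =
      biact a 1 (crossing φ (of k s) b - crossing φ (φ s) b) := by
  rw [crossing_apply, crossing_apply, map_sub (biact a b), map_sub (rho φ 1), map_sub (biact a 1),
    ← rho_one_biact hprec hφ hc, ← rho_one_biact hprec hφ hc, biact_biact, biact_biact, mul_one,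
    mul_one]

/-- `δ_3(w)` has the right-most term `q ⊗ t` and the left-most term `s ⊗ r`. Since `ρ_1 ∂_2`
reproduces `q ⊗ t`, the right-most term cancels, and the value depends only on `s` and `r`: it is
`crossing` at `s - φ_s` and `r`, minus `s ⊗ r`, with the first arrow of `s` split off. -/
theorem diff_two_tens (hprec : IsAdmissible prec) (hφ : φ ∈ cochPrec k S prec)
    (hc : Convergent φ) {x s' r : QPath V} {s : S} (w : amb S 3)
    (h : Overlap x s' s r w) (a b : QuotAlg φ) :
    diff φ 2 (tens φ w a b) = biact a b (overlapDiff φ x s' s r) := by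
  obtain ⟨q, t, hqt, e⟩ := splitR_sub_splitL (φ := φ) hc.isReductionSet h
  have h1 : del φ 2 (gen φ w) =
      tens φ (ambTwo t) (proj φ (of k q)) (proj φ (of k (QPath.idPath (w : QPath V).tgt))) -
        tens φ (ambTwo s) (proj φ (of k (QPath.idPath (s : QPath V).src))) (proj φ (of k r)) := by
    refine (bimodExt_single _ _ _ _).trans ?_
    rw [if_pos (by decide)]
    refine (congrArg _ e).trans ?_
    rw [map_sub, biact_tens, biact_tens, hqt.src, proj_idPath_mul, ← hqt.src, h.factors.src,
      proj_idPath_mul_idPath, proj_idPath_mul_idPath, h.factors.tgt, proj_mul_idPath]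
  have h2 : diff φ 1 (del φ 2 (gen φ w)) = _ := congrArg (diff φ 1) h1
  rw [map_sub, diff_one_tens hc, diff_one_tens hc] at h2
  have h3 : rho φ 1 (diff φ 1 (del φ 2 (gen φ w))) = _ := congrArg (rho φ 1) h2
  rw [map_sub, crossing_rel hprec hφ hc, crossing_rel hprec hφ hc, hqt.tgt,
    crossing_rel_idPath hprec hφ hc, crossing_right_idPath hprec hφ hc
      (coch_mem_irr hc.mem_coch t), sub_zero, biact_tens, mul_one, ← hqt.mid, proj_mul_idPath,
    map_sub, ← crossing_idPath_mul hprec hφ hc, ← crossing_idPath_mul hprec hφ hc, idPath_mul,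
    idPath_mul_coch hc.mem_coch, crossing_head hprec hφ hc h.length_eq h.factors_left] at h3
  rw [hqt.tgt] at h1
  refine (bimodExt_single _ _ _ _).trans (congrArg _ ?_)
  refine (congrArg₂ (· - ·) h1 h3).trans ?_
  dsimp only
  rw [overlapDiff]
  abel

theorem mapF0_tens (i : V) (a b : QuotAlg φ) : mapF0 φ (tens φ (ambZero S i) a b) =
    (a * proj φ (of k (QPath.idPath i))) ⊗ₜ (proj φ (of k (QPath.idPath i)) * b) := by
  simp [mapF0, tens]
  rfl

theorem mapG0_tmul (a : QuotAlg φ) (v : QPath V) : mapG0 φ (a ⊗ₜ proj φ (of k v)) =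
    tens φ (ambZero S v.src) (a * proj φ (of k (QPath.idPath v.src))) (proj φ (of k v)) := by
  rw [mapG0, LinearMap.sum_apply, Finset.sum_eq_single v.src]
  · simp only [LinearMap.comp_apply, TensorProduct.map_tmul, LinearMap.mulRight_apply,
      LinearMap.mulLeft_apply, proj_idPath_mul]
    rfl
  · intro i _ hi
    simp only [LinearMap.comp_apply, TensorProduct.map_tmul, LinearMap.mulRight_apply,
      LinearMap.mulLeft_apply, proj_mul_eq_zero (q := QPath.idPath i) (r := v) hi,
      TensorProduct.tmul_zero, map_zero]
  · intro h
    exact absurd (Finset.mem_univ _) h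

theorem rho_zero_mapG0 (hc : Convergent φ) (a b : QuotAlg φ) :
    rho φ 0 (mapG0 φ (a ⊗ₜ b)) = -biact a 1 (fox φ (irrSection φ b)) := by
  refine LinearMap.congr_fun (hc.quot_ext (f := rho φ 0 ∘ₗ mapG0 φ ∘ₗ TensorProduct.mk k _ _ a)
    (g := -(biact a 1 ∘ₗ fox φ ∘ₗ irrSection φ)) fun v hv => ?_) b
  simp only [LinearMap.comp_apply, TensorProduct.mk_apply, LinearMap.neg_apply]
  rw [mapG0_tmul]
  refine (gam_zero_tens _ _ _).trans ?_
  have := congrArg (biact a 1) (biact_left_fox (φ := φ) v)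
  rw [biact_biact, mul_one] at this
  rw [hc.irrSection_of hv, idPath_mul, this]

theorem Convergent.irrSection_one (hc : Convergent φ) : irrSection φ 1 = 1 := by
  rw [← map_one (proj φ), one_def, map_sum, map_sum]
  exact Finset.sum_congr rfl fun i _ => hc.irrSection_idPath i

theorem fox_one : fox φ 1 = 0 := by
  rw [one_def, map_sum]
  exact Finset.sum_eq_zero fun i _ => fox_idPath i

theorem mapG1_tmul (hc : Convergent φ) (a b c : QuotAlg φ) :
    mapG1 φ ((a ⊗ₜ b) ⊗ₜ c) = biact a c (fox φ (irrSection φ b)) := by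
  rw [mapG1, rightExt_tmul]
  have : barD1 k (QuotAlg φ) (appendOne k (QuotAlg φ) _ (a ⊗ₜ b)) = (a * b) ⊗ₜ 1 - a ⊗ₜ b := by
    simp [barD1, appendOne, mulLast]
  simp only [LinearMap.comp_apply]
  rw [this, map_sub, map_sub, rho_zero_mapG0 hc, rho_zero_mapG0 hc, hc.irrSection_one, fox_one,
    map_zero, neg_zero, zero_sub, neg_neg, biact_biact, one_mul, one_mul]

/-- Two of the three terms of the bar differential yield derivations of irreducible elements with
right factor `1`, where `ρ_1` vanishes. -/
theorem mapG2_insert (hprec : IsAdmissible prec) (hφ : φ ∈ cochPrec k S prec)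
    (hc : Convergent φ) (a b : QuotAlg φ) :
    mapG2 φ (((1 ⊗ₜ a) ⊗ₜ b) ⊗ₜ 1) = crossing φ (irrSection φ a) b := by
  rw [mapG2, rightExt_tmul]
  have : barD2 k (QuotAlg φ) (appendOne k (QuotAlg φ) _ ((1 ⊗ₜ a) ⊗ₜ b)) =
      (a ⊗ₜ b) ⊗ₜ 1 - (1 ⊗ₜ (a * b)) ⊗ₜ 1 + (1 ⊗ₜ a) ⊗ₜ b := by
    simp [barD2, barD1, appendOne, mulLast]
  simp only [LinearMap.comp_apply]
  have h1 : ∀ c d, rho φ 1 (biact c 1 (fox φ (irrSection φ d))) = 0 := fun c d => by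
    rw [rho_one_biact hprec hφ hc, ← biact_one_one (fox φ (irrSection φ d)), ← crossing_apply,
      crossing_right_one hprec hφ hc (hc.irrSection_mem d), map_zero]
  rw [this, map_add, map_sub, map_add, map_sub, mapG1_tmul hc, mapG1_tmul hc, mapG1_tmul hc,
    h1, h1, sub_zero, zero_add, biact_one_one, crossing_apply]

theorem dualG2_apply (hprec : IsAdmissible prec) (hφ : φ ∈ cochPrec k S prec)
    (hc : Convergent φ) (f : S → QuotAlg φ) (a b : QuotAlg φ) :
    dualG2 φ f a b = evalCochain (W := amb S 2) f (crossing φ (irrSection φ a) b) := by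
  rw [← mapG2_insert hprec hφ hc]
  rfl

end Crossing

/-! ### Evaluation of 3-cochains on the bar resolution -/

section EvalBar

variable {k : Type u} [CommRing k] {A : Type*} [Ring A] [Algebra k A]

theorem evalBar3_tmul (g : C3 k A) (a b c d e : A) :
    evalBar3 g ((((a ⊗ₜ[k] b) ⊗ₜ[k] c) ⊗ₜ[k] d) ⊗ₜ[k] e) = a * g b c d * e := rfl

theorem evalBar3_tmul_right (g : C3 k A) (y : Bar2 k A) (e : A) :
    evalBar3 g (y ⊗ₜ e) = evalBar3 g (y ⊗ₜ 1) * e := by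
  simp [evalBar3]

theorem evalBar3_add (g h : C3 k A) : evalBar3 (g + h) = evalBar3 g + evalBar3 h := by
  ext a b c d e
  simp [evalBar3, mulC3, mul_add, add_mul]

theorem evalBar3_smul (r : k) (g : C3 k A) : evalBar3 (r • g) = r • evalBar3 g := by
  ext a b c d e
  simp [evalBar3, mulC3]

end EvalBar

/-! ### The transferred cochains and their normalisation -/

section Transfer

variable {k : Type u} [CommRing k] {V : Type v} [Quiver.{w} V] [Fintype V]
  {S : Set (QPath V)} {φ : S → PathAlgebra k V} {prec : QPath V → QPath V → Prop}

/-- A 2-cochain that is normalized relative to `kQ_0` in both arguments and left linear. -/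
structure Normalized₂ (g : C2 k (QuotAlg φ)) : Prop where
  left : ∀ i b, g (proj φ (of k (QPath.idPath i))) b = 0
  right : ∀ a i, g a (proj φ (of k (QPath.idPath i))) = 0
  mul : ∀ i a b, g (proj φ (of k (QPath.idPath i)) * a) b = proj φ (of k (QPath.idPath i)) * g a b

/-- A 3-cochain that is normalized relative to `kQ_0` in all arguments and left linear. -/
structure Normalized₃ (g : C3 k (QuotAlg φ)) : Prop where
  left : ∀ i b c, g (proj φ (of k (QPath.idPath i))) b c = 0
  mid : ∀ a i c, g a (proj φ (of k (QPath.idPath i))) c = 0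
  right : ∀ a b i, g a b (proj φ (of k (QPath.idPath i))) = 0
  mul : ∀ i a b c, g (proj φ (of k (QPath.idPath i)) * a) b c =
    proj φ (of k (QPath.idPath i)) * g a b c

theorem Normalized₂.zero : Normalized₂ (0 : C2 k (QuotAlg φ)) :=
  ⟨fun _ _ => rfl, fun _ _ => rfl, fun _ _ _ => (mul_zero _).symm⟩

theorem Normalized₂.add {g h : C2 k (QuotAlg φ)} (hg : Normalized₂ g) (hh : Normalized₂ h) :
    Normalized₂ (g + h) :=
  ⟨fun i b => by simp only [LinearMap.add_apply, hg.left, hh.left, add_zero],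
    fun i b => by simp only [LinearMap.add_apply, hg.right, hh.right, add_zero],
    fun i a b => by simp only [LinearMap.add_apply, hg.mul, hh.mul, mul_add]⟩

theorem circ_apply {A : Type*} [Ring A] [Algebra k A] (f g : C2 k A) (a b c : A) :
    circ f g a b c = f (g a b) c - f a (g b c) := rfl

theorem Normalized₃.neg_sum_circ {ι : Type*} (I : Finset ι) {g h : ι → C2 k (QuotAlg φ)}
    (hg : ∀ i ∈ I, Normalized₂ (g i)) (hh : ∀ i ∈ I, Normalized₂ (h i)) :
    Normalized₃ (-∑ i ∈ I, circ (g i) (h i)) := by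
  constructor
  · intro i b c
    simp only [LinearMap.neg_apply, LinearMap.sum_apply, circ_apply]
    rw [Finset.sum_eq_zero, neg_zero]
    intro j hj
    rw [(hh j hj).left, (hg j hj).left, map_zero, LinearMap.zero_apply, sub_zero]
  · intro a i c
    simp only [LinearMap.neg_apply, LinearMap.sum_apply, circ_apply]
    rw [Finset.sum_eq_zero, neg_zero]
    intro j hj
    rw [(hh j hj).left, (hh j hj).right, map_zero, map_zero, LinearMap.zero_apply, sub_zero]
  · intro a b i
    simp only [LinearMap.neg_apply, LinearMap.sum_apply, circ_apply]
    rw [Finset.sum_eq_zero, neg_zero]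
    intro j hj
    rw [(hh j hj).right, (hg j hj).right, map_zero, sub_zero]
  · intro i a b c
    simp only [LinearMap.neg_apply, LinearMap.sum_apply, circ_apply]
    rw [mul_neg, Finset.mul_sum]
    congr 1
    refine Finset.sum_congr rfl fun j hj => ?_
    rw [(hh j hj).mul, (hg j hj).mul, (hg j hj).mul, mul_sub]

theorem nextF_tens {n : ℕ} {M : Type*} [AddCommGroup M] [Module k M] (F : Res φ n →ₗ[k] M)
    (x : amb S (n + 1)) (a b : QuotAlg φ) : nextF φ F (tens φ x a b) =
      ((-1 : k) ^ (n + 1) • F (diff φ n (tens φ x a 1))) ⊗ₜ b := by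
  rw [nextF, tens, Finsupp.lsum_single, LinearMap.rTensor_tmul]
  rfl

theorem mapF1_tens {x : QPath V} (hx : x.length = 1) (a b : QuotAlg φ) :
    mapF1 φ (tens φ (ambOne S hx) a b) =
      ((a * proj φ (of k (QPath.idPath x.src))) ⊗ₜ proj φ (of k x)) ⊗ₜ b -
      ((a * proj φ (of k x)) ⊗ₜ proj φ (of k (QPath.idPath x.tgt))) ⊗ₜ b := by
  have h : mapF1 φ (tens φ (ambOne S hx) a b) =
      ((-1 : k) ^ (0 + 1) • mapF0 φ (diff φ 0 (tens φ (ambOne S hx) a 1))) ⊗ₜ b :=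
    nextF_tens _ _ a b
  rw [h, diff_zero_tens, map_sub, mapF0_tens, mapF0_tens, ← TensorProduct.sub_tmul]
  congr 1
  rw [show (-1 : k) ^ (0 + 1) = -1 by norm_num, neg_smul, one_smul, neg_sub, mul_one, mul_one,
    mul_assoc a (proj φ (of k x)), proj_mul_idPath, mul_assoc a, proj_idPath_mul_idPath,
    proj_idPath_mul, proj_idPath_mul_idPath]

/-- The map `(z, c) ↦ g(F_1(z) ⊗ c ⊗ 1)`. -/
def evalF1 (g : C3 k (QuotAlg φ)) : Res φ 1 →ₗ[k] QuotAlg φ →ₗ[k] QuotAlg φ :=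
  LinearMap.mk₂ k (fun z c => evalBar3 g ((mapF1 φ z ⊗ₜ c) ⊗ₜ 1))
    (fun y z c => by rw [map_add, TensorProduct.add_tmul, TensorProduct.add_tmul, map_add])
    (fun r z c => by
      rw [map_smul, ← TensorProduct.smul_tmul', ← TensorProduct.smul_tmul', map_smul])
    (fun z c d => by rw [TensorProduct.tmul_add, TensorProduct.add_tmul, map_add])
    (fun r z c => by rw [TensorProduct.tmul_smul, ← TensorProduct.smul_tmul', map_smul])

/-- The map `z ↦ g(F_2(z) ⊗ 1)`. -/
def evalF2 (g : C3 k (QuotAlg φ)) : Res φ 2 →ₗ[k] QuotAlg φ :=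
  evalBar3 g ∘ₗ appendOne k (QuotAlg φ) _ ∘ₗ mapF2 φ

theorem evalF1_tens {g : C3 k (QuotAlg φ)} (hg : Normalized₃ g) {x : QPath V} (hx : x.length = 1)
    (a b c : QuotAlg φ) :
    evalF1 g (tens φ (ambOne S hx) a b) c = a * g (proj φ (of k x)) b c := by
  change evalBar3 g ((mapF1 φ _ ⊗ₜ c) ⊗ₜ 1) = _
  rw [mapF1_tens, TensorProduct.sub_tmul, TensorProduct.sub_tmul, map_sub, evalBar3_tmul,
    evalBar3_tmul, hg.left, mul_zero, zero_mul, sub_zero, mul_one, mul_assoc, ← hg.mul,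
    proj_idPath_mul]

theorem evalF1_biact {g : C3 k (QuotAlg φ)} (hg : Normalized₃ g) (a c : QuotAlg φ) (z : Res φ 1) :
    evalF1 g (biact a 1 z) c = a * evalF1 g z c := by
  induction z using tens_induction with
  | h0 => simp
  | ha y z hy hz => simp only [map_add, LinearMap.add_apply, hy, hz, mul_add]
  | hs x d b =>
    obtain ⟨x, hx⟩ := x
    have hx' : x.length = 1 := hx
    have h := biact_tens (φ := φ) (ambOne S hx') a 1 d b
    change evalF1 g (biact a 1 (tens φ (ambOne S hx') d b)) c =
      a * evalF1 g (tens φ (ambOne S hx') d b) c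
    rw [h, evalF1_tens hg, evalF1_tens hg, mul_one, mul_assoc]

/-- `F_2` is obtained from `F_1` by applying `∂_2`, so the derivation of `s - φ_s` appears.
Normalisation of `g` lets the left factor be pulled out. -/
theorem evalF2_tens (hc : Convergent φ) {g : C3 k (QuotAlg φ)} (hg : Normalized₃ g) (s : S)
    (a b : QuotAlg φ) : evalF2 g (tens φ (ambTwo s) a b) =
      a * evalF1 g (fox φ (of k s) - fox φ (φ s)) b := by
  have h : mapF2 φ (tens φ (ambTwo s) a b) =
      ((-1 : k) ^ (1 + 1) • mapF1 φ (diff φ 1 (tens φ (ambTwo s) a 1))) ⊗ₜ b :=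
    nextF_tens _ _ a b
  rw [diff_one_tens hc, show (-1 : k) ^ (1 + 1) = 1 by norm_num, one_smul] at h
  rw [← evalF1_biact hg]
  change evalBar3 g (mapF2 φ _ ⊗ₜ 1) = _
  rw [h]
  rfl

theorem evalF2_biact (hc : Convergent φ) {g : C3 k (QuotAlg φ)} (hg : Normalized₃ g)
    (a : QuotAlg φ) (z : Res φ 2) : evalF2 g (biact a 1 z) = a * evalF2 g z := by
  induction z using tens_induction with
  | h0 => simp
  | ha y z hy hz => simp only [map_add, hy, hz, mul_add]
  | hs s d b =>
    obtain ⟨s, hs⟩ := s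
    have hs' : s ∈ S := hs
    have h := biact_tens (φ := φ) (ambTwo ⟨s, hs'⟩) a 1 d b
    change evalF2 g (biact a 1 (tens φ (ambTwo ⟨s, hs'⟩) d b)) =
      a * evalF2 g (tens φ (ambTwo ⟨s, hs'⟩) d b)
    rw [h, evalF2_tens hc hg, evalF2_tens hc hg, mul_one, mul_assoc]

/-- The extension of the cochain `h^2(g)` to the path algebra in the first argument. -/
def dualH2Ext (g : C3 k (QuotAlg φ)) : PathAlgebra k V →ₗ[k] QuotAlg φ →ₗ[k] QuotAlg φ :=
  evalF1 g ∘ₗ fox φ - (crossing φ).compr₂ (evalF2 g)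

theorem dualH2Ext_apply (g : C3 k (QuotAlg φ)) (y : PathAlgebra k V) (b : QuotAlg φ) :
    dualH2Ext g y b = evalF1 g (fox φ y) b - evalF2 g (crossing φ y b) := rfl

/-- The two summands are the two terms of `h_2`: the one through `F_1 G_1` and the one through `F_2
G_2`. The right-hand side makes sense for reducible elements in the first argument, which the
recursions below need. -/
theorem dualH2_apply (hprec : IsAdmissible prec) (hφ : φ ∈ cochPrec k S prec)
    (hc : Convergent φ) (g : C3 k (QuotAlg φ)) (a b : QuotAlg φ) :
    dualH2 φ g a b = dualH2Ext g (irrSection φ a) b := by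
  have h1 : homotopy2 φ (((1 ⊗ₜ a) ⊗ₜ b) ⊗ₜ 1) =
      ((mapF1 φ (mapG1 φ ((1 ⊗ₜ a) ⊗ₜ 1))) ⊗ₜ b - mapF2 φ (mapG2 φ (((1 ⊗ₜ a) ⊗ₜ b) ⊗ₜ 1))) ⊗ₜ 1 :=
    rfl
  rw [mapG2_insert hprec hφ hc, mapG1_tmul hc, biact_one_one] at h1
  rw [dualH2Ext_apply]
  change evalBar3 g (homotopy2 φ (((1 ⊗ₜ a) ⊗ₜ b) ⊗ₜ 1)) = _
  rw [h1, TensorProduct.sub_tmul, map_sub]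
  rfl

/-- The sign is the factor `(-1)^3` in the definition of `F_3`. The two idempotents are those of the
generator of `w`. -/
theorem dualF3_apply (hprec : IsAdmissible prec) (hφ : φ ∈ cochPrec k S prec)
    (hc : Convergent φ) {g : C3 k (QuotAlg φ)} (hg : Normalized₃ g) {x s' r : QPath V} {s : S}
    (w : amb S 3) (h : Overlap x s' s r w) :
    dualF3 φ g w = -(proj φ (of k (QPath.idPath (w : QPath V).src)) *
      evalF2 g (overlapDiff φ x s' s r) * proj φ (of k (QPath.idPath (w : QPath V).tgt))) := by
  have h1 : ∀ a b, mapF3 φ (tens φ w a b) =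
      ((-1 : k) ^ (2 + 1) • mapF2 φ (diff φ 2 (tens φ w a 1))) ⊗ₜ b :=
    nextF_tens _ w
  refine (congrArg (evalBar3 g) (h1 _ _)).trans ?_
  rw [evalBar3_tmul_right, diff_two_tens hprec hφ hc w h, show (-1 : k) ^ (2 + 1) = -1 by norm_num,
    ← TensorProduct.smul_tmul', map_smul, neg_smul, one_smul, ← evalF2_biact hc hg, neg_mul]
  rfl

theorem evalF1_fox_arrow {g : C3 k (QuotAlg φ)} (hg : Normalized₃ g) {x : QPath V}
    (hx : x.length = 1) (c : QuotAlg φ) : evalF1 g (fox φ (of k x)) c = 0 := by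
  rw [fox_arrow hx, evalF1_tens hg, hg.mid, mul_zero]

theorem evalF1_fox_head {g : C3 k (QuotAlg φ)} (hg : Normalized₃ g) {x q p : QPath V}
    (hx : x.length = 1) (h : QPath.Factors x q p) (c : QuotAlg φ) :
    evalF1 g (fox φ (of k p)) c = g (proj φ (of k x)) (proj φ (of k q)) c +
      proj φ (of k x) * evalF1 g (fox φ (of k q)) c := by
  rw [fox_head hx h, map_add, LinearMap.add_apply, evalF1_tens hg, evalF1_biact hg, ← hg.mul,
    proj_idPath_mul]

theorem evalF1_fox_right {g : C3 k (QuotAlg φ)} (hg : Normalized₃ g) (y : PathAlgebra k V) (i : V) :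
    evalF1 g (fox φ y) (proj φ (of k (QPath.idPath i))) = 0 := by
  refine LinearMap.congr_fun (f := (evalF1 g).flip (proj φ (of k (QPath.idPath i)))) (g := 0)
    (res_ext fun x a b => ?_) (fox φ y)
  obtain ⟨x, hx⟩ := x
  refine (evalF1_tens hg hx a b _).trans ?_
  rw [hg.right, mul_zero]
  rfl

theorem dualH2Ext_arrow_of_irr (hprec : IsAdmissible prec) (hφ : φ ∈ cochPrec k S prec)
    (hc : Convergent φ) {g : C3 k (QuotAlg φ)} (hg : Normalized₃ g) {x v p : QPath V}
    (hx : x.length = 1) (hv : v ∈ Irr S) (h : QPath.Factors x v p) (hp : p ∈ Irr S) :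
    dualH2Ext g (of k x) (proj φ (of k v)) = 0 := by
  rw [dualH2Ext_apply, evalF1_fox_arrow hg hx, crossing_arrow_of_irr hprec hφ hc hx hv h hp,
    map_zero, sub_zero]

/-- The recursion of `crossing_arrow_of_head` carried through `h^2`. The term with the derivation of
`s` is what later brings in the value of the cochain on the relation. -/
theorem dualH2Ext_arrow_of_head (hprec : IsAdmissible prec) (hφ : φ ∈ cochPrec k S prec)
    (hc : Convergent φ) {g : C3 k (QuotAlg φ)} (hg : Normalized₃ g) {x v p r : QPath V} {s : S}
    (hx : x.length = 1) (hv : v ∈ Irr S) (h : QPath.Factors x v p) (hs : QPath.Factors s r p) :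
    dualH2Ext g (of k x) (proj φ (of k v)) =
      dualH2Ext g (φ s) (proj φ (of k r)) - evalF1 g (fox φ (of k s)) (proj φ (of k r)) := by
  rw [dualH2Ext_apply, evalF1_fox_arrow hg hx, crossing_arrow_of_head hprec hφ hc hx hv h hs,
    map_add, evalF2_tens hc hg, ← evalF1_biact hg,
    map_sub (biact (k := k) (W := amb S 1) (proj φ (of k (QPath.idPath (s : QPath V).src))) 1),
    biact_left_fox, biact_left_fox_coch hc.mem_coch, dualH2Ext_apply, map_sub, LinearMap.sub_apply]
  abel

/-- The Leibniz rule holds up to the value of `g` itself. This is how a prescribed associator is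
produced by applying `h^2`. -/
theorem dualH2Ext_head (hprec : IsAdmissible prec) (hφ : φ ∈ cochPrec k S prec)
    (hc : Convergent φ) {g : C3 k (QuotAlg φ)} (hg : Normalized₃ g) {x q p : QPath V}
    (hx : x.length = 1) (h : QPath.Factors x q p) (b : QuotAlg φ) :
    dualH2Ext g (of k p) b = g (proj φ (of k x)) (proj φ (of k q)) b +
      dualH2Ext g (of k x) (proj φ (of k q) * b) + proj φ (of k x) * dualH2Ext g (of k q) b := by
  rw [dualH2Ext_apply, dualH2Ext_apply, dualH2Ext_apply, evalF1_fox_head hg hx h,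
    crossing_head hprec hφ hc hx h, map_add, evalF2_biact hc hg, evalF1_fox_arrow hg hx]
  rw [mul_sub]
  abel

theorem dualH2Ext_idPath (g : C3 k (QuotAlg φ)) (i : V) (b : QuotAlg φ) :
    dualH2Ext g (of k (QPath.idPath i)) b = 0 := by
  rw [dualH2Ext_apply, fox_idPath, crossing_idPath, map_zero, map_zero, LinearMap.zero_apply,
    sub_zero]

theorem fox_idPath_mul (i : V) (y : PathAlgebra k V) :
    fox φ (of k (QPath.idPath i) * y) = biact (proj φ (of k (QPath.idPath i))) 1 (fox φ y) := by
  refine eq_of_spanOn (mem_spanOn_univ y) (fox φ ∘ₗ LinearMap.mulLeft k (of k (QPath.idPath i)))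
    (biact (proj φ (of k (QPath.idPath i))) 1 ∘ₗ fox φ) fun p _ => ?_
  simp only [LinearMap.comp_apply, LinearMap.mulLeft_apply]
  by_cases h : i = p.src
  · rw [h, idPath_mul, biact_left_fox]
  · have h' : (QPath.idPath i).tgt ≠ p.src := h
    have := congrArg (biact (proj φ (of k (QPath.idPath i))) 1) (biact_left_fox (φ := φ) p)
    rw [biact_biact, proj_mul_eq_zero (r := QPath.idPath p.src) h', one_mul] at this
    rw [← this, of_mul_eq_zero h', map_zero]
    have : biact (k := k) (W := amb S 1) (0 : QuotAlg φ) 1 = 0 := by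
      rw [← zero_smul k (0 : QuotAlg φ), biact_smul_left, zero_smul]
    rw [this, LinearMap.zero_apply]

theorem Convergent.irrSection_idPath_mul (hc : Convergent φ) (i : V) (a : QuotAlg φ) :
    irrSection φ (proj φ (of k (QPath.idPath i)) * a) =
      of k (QPath.idPath i) * irrSection φ a := by
  refine LinearMap.congr_fun (hc.quot_ext (f := irrSection φ ∘ₗ LinearMap.mulLeft k _)
    (g := LinearMap.mulLeft k (of k (QPath.idPath i)) ∘ₗ irrSection φ) fun v hv => ?_) a
  simp only [LinearMap.comp_apply, LinearMap.mulLeft_apply, hc.irrSection_of hv]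
  by_cases h : i = v.src
  · rw [h, idPath_mul, proj_idPath_mul, hc.irrSection_of hv]
  · have h' : (QPath.idPath i).tgt ≠ v.src := h
    rw [of_mul_eq_zero h', proj_mul_eq_zero h', map_zero]

theorem Normalized₂.dualH2 (hprec : IsAdmissible prec) (hφ : φ ∈ cochPrec k S prec)
    (hc : Convergent φ) {g : C3 k (QuotAlg φ)} (hg : Normalized₃ g) :
    Normalized₂ (dualH2 φ g) := by
  constructor
  · intro i b
    rw [dualH2_apply hprec hφ hc, hc.irrSection_idPath, dualH2Ext_idPath]
  · intro a i
    rw [dualH2_apply hprec hφ hc, dualH2Ext_apply, evalF1_fox_right hg,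
      crossing_right_idPath hprec hφ hc (hc.irrSection_mem a), map_zero, sub_zero]
  · intro i a b
    rw [dualH2_apply hprec hφ hc, dualH2_apply hprec hφ hc, dualH2Ext_apply, dualH2Ext_apply,
      hc.irrSection_idPath_mul, fox_idPath_mul, crossing_idPath_mul hprec hφ hc,
      evalF1_biact hg, evalF2_biact hc hg, mul_sub]

theorem Normalized₂.dualG2 (hprec : IsAdmissible prec) (hφ : φ ∈ cochPrec k S prec)
    (hc : Convergent φ) (f : S → QuotAlg φ) : Normalized₂ (dualG2 φ f) := by
  constructor
  · intro i b
    rw [dualG2_apply hprec hφ hc, hc.irrSection_idPath, crossing_idPath, map_zero]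
  · intro a i
    rw [dualG2_apply hprec hφ hc, crossing_right_idPath hprec hφ hc (hc.irrSection_mem a), map_zero]
  · intro i a b
    rw [dualG2_apply hprec hφ hc, dualG2_apply hprec hφ hc, hc.irrSection_idPath_mul,
      crossing_idPath_mul hprec hφ hc]
    exact (evalCochain_biact (W := amb S 2) f _ _ _).trans (mul_one _)

/-- The series of 2-cochains given by `β_1 = G^2(f)` and `β_n = -∑_{i+j=n} h^2(β_i ∘ β_j)`. -/
def transferSeries (φ : S → PathAlgebra k V) (f : S → QuotAlg φ) (n : ℕ) : C2 k (QuotAlg φ) :=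
  (if n = 1 then dualG2 φ f else 0) + dualH2 φ (-∑ i : Fin (n - 1),
    circ (transferSeries φ f (i + 1)) (transferSeries φ f (n - 1 - i)))
termination_by n
decreasing_by all_goals omega

/-- The 3-cochains `γ_n = -∑_{i+j=n} β_i ∘ β_j`. -/
def transferDefect (φ : S → PathAlgebra k V) (f : S → QuotAlg φ) (n : ℕ) : C3 k (QuotAlg φ) :=
  -∑ i : Fin (n - 1), circ (transferSeries φ f (i + 1)) (transferSeries φ f (n - 1 - i))

theorem transferSeries_eq (f : S → QuotAlg φ) (n : ℕ) : transferSeries φ f n =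
    (if n = 1 then dualG2 φ f else 0) + dualH2 φ (transferDefect φ f n) := by
  rw [transferSeries, transferDefect]

theorem Normalized₂.transferSeries (hprec : IsAdmissible prec) (hφ : φ ∈ cochPrec k S prec)
    (hc : Convergent φ) (f : S → QuotAlg φ) (n : ℕ) : Normalized₂ (transferSeries φ f n) := by
  induction n using Nat.strong_induction_on with
  | _ n ih =>
    rw [transferSeries_eq]
    refine Normalized₂.add ?_ (Normalized₂.dualH2 hprec hφ hc
      (Normalized₃.neg_sum_circ _ (fun i _ => ih _ (by omega)) fun i _ => ih _ (by omega)))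
    split_ifs
    · exact Normalized₂.dualG2 hprec hφ hc f
    · exact Normalized₂.zero

theorem Normalized₃.transferDefect (hprec : IsAdmissible prec) (hφ : φ ∈ cochPrec k S prec)
    (hc : Convergent φ) (f : S → QuotAlg φ) (n : ℕ) : Normalized₃ (transferDefect φ f n) :=
  Normalized₃.neg_sum_circ _ (fun _ _ => Normalized₂.transferSeries hprec hφ hc f _)
    fun _ _ => Normalized₂.transferSeries hprec hφ hc f _

theorem dualH2_zero : dualH2 φ (0 : C3 k (QuotAlg φ)) = 0 := by
  have : evalBar3 (0 : C3 k (QuotAlg φ)) = 0 := by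
    rw [← zero_smul k (0 : C3 k (QuotAlg φ)), evalBar3_smul, zero_smul]
  ext a b
  change evalBar3 0 (homotopy2 φ (insert2 φ (a ⊗ₜ b))) = 0
  rw [this, LinearMap.zero_apply]

theorem transferSeries_zero (f : S → QuotAlg φ) : transferSeries φ f 0 = 0 := by
  have : transferDefect φ f 0 = 0 := neg_eq_zero.mpr (Finset.sum_empty)
  rw [transferSeries_eq, this, dualH2_zero, if_neg (by decide), add_zero]

/-- Since `β_0 = 0`, the pairs containing a zero contribute nothing and may be added to the sum over
positive pairs. -/
theorem transferDefect_eq (f : S → QuotAlg φ) (n : ℕ) : transferDefect φ f n =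
    -∑ ij ∈ Finset.HasAntidiagonal.antidiagonal n, circ (transferSeries φ f ij.1) (transferSeries φ f ij.2) := by
  have h0 : ∀ g : C2 k (QuotAlg φ), circ 0 g = 0 ∧ circ g 0 = 0 := fun g => by
    constructor <;> ext a b c <;> simp [circ_apply]
  rw [transferDefect]
  congr 1
  rw [Finset.Nat.sum_antidiagonal_eq_sum_range_succ_mk]
  rcases n with _ | n
  · simp [transferSeries_zero, h0]
  · rw [Finset.sum_range_succ, Finset.sum_range_succ']
    simp only [Nat.sub_self, transferSeries_zero, h0, add_zero, Nat.add_sub_cancel]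
    rw [Finset.sum_range]
    refine Finset.sum_congr rfl fun i _ => ?_
    congr 2
    omega

end Transfer

/-! ### Boundary terms of sums over antidiagonals -/

section Antidiagonal

variable {M : Type*} [AddCommMonoid M]

theorem sum_antidiagonal_left (n : ℕ) (g : ℕ → M) :
    ∑ ij ∈ Finset.HasAntidiagonal.antidiagonal n, (if ij.1 = 0 then g ij.2 else 0) = g n := by
  rw [Finset.sum_eq_single (0, n)]
  · rw [if_pos rfl]
  · rintro ⟨i, j⟩ hij hne
    rw [Finset.HasAntidiagonal.mem_antidiagonal] at hij
    exact if_neg fun h => hne (Prod.ext h (by dsimp only at hij h ⊢; omega))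
  · intro h
    exact absurd (Finset.HasAntidiagonal.mem_antidiagonal.mpr (zero_add n)) h

theorem sum_antidiagonal_right (n : ℕ) (g : ℕ → M) :
    ∑ ij ∈ Finset.HasAntidiagonal.antidiagonal n, (if ij.2 = 0 then g ij.1 else 0) = g n := by
  rw [Finset.sum_eq_single (n, 0)]
  · rw [if_pos rfl]
  · rintro ⟨i, j⟩ hij hne
    rw [Finset.HasAntidiagonal.mem_antidiagonal] at hij
    exact if_neg fun h => hne (Prod.ext (by dsimp only at hij h ⊢; omega) h)
  · intro h
    exact absurd (Finset.HasAntidiagonal.mem_antidiagonal.mpr (add_zero n)) h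

end Antidiagonal

/-! ### The recursion for the deformed product -/

section StarSeries

variable {k : Type u} [CommRing k] {V : Type v} [Quiver.{w} V] [Fintype V]
  {S : Set (QPath V)} {φ : S → PathAlgebra k V} {prec : QPath V → QPath V → Prop}

/-- The extension of `transferSeries` to the path algebra in the first argument. -/
def transferExt (φ : S → PathAlgebra k V) (f : S → QuotAlg φ) (n : ℕ) :
    PathAlgebra k V →ₗ[k] QuotAlg φ →ₗ[k] QuotAlg φ :=
  (if n = 1 then (crossing φ).compr₂ (evalCochain (W := amb S 2) f) else 0) +
    dualH2Ext (transferDefect φ f n)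

theorem transferExt_apply (f : S → QuotAlg φ) (n : ℕ) (y : PathAlgebra k V) (b : QuotAlg φ) :
    transferExt φ f n y b =
      (if n = 1 then evalCochain (W := amb S 2) f (crossing φ y b) else 0) +
      dualH2Ext (transferDefect φ f n) y b := by
  rw [transferExt]
  split_ifs <;> rfl

theorem transferSeries_apply (hprec : IsAdmissible prec) (hφ : φ ∈ cochPrec k S prec)
    (hc : Convergent φ) (f : S → QuotAlg φ) (n : ℕ) (a b : QuotAlg φ) :
    transferSeries φ f n a b = transferExt φ f n (irrSection φ a) b := by
  rw [transferSeries_eq, transferExt_apply, LinearMap.add_apply, LinearMap.add_apply,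
    dualH2_apply hprec hφ hc]
  congr 1
  split_ifs
  · exact dualG2_apply hprec hφ hc f a b
  · rfl

theorem transferSeries_proj (hprec : IsAdmissible prec) (hφ : φ ∈ cochPrec k S prec)
    (hc : Convergent φ) (f : S → QuotAlg φ) (n : ℕ) {y : PathAlgebra k V} (hy : y ∈ irrMod k S)
    (b : QuotAlg φ) : transferSeries φ f n (proj φ y) b = transferExt φ f n y b := by
  rw [transferSeries_apply hprec hφ hc, hc.irrSection_proj_of_mem hy]

theorem transferExt_arrow_of_irr (hprec : IsAdmissible prec) (hφ : φ ∈ cochPrec k S prec)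
    (hc : Convergent φ) (f : S → QuotAlg φ) (n : ℕ) {x v p : QPath V} (hx : x.length = 1)
    (hv : v ∈ Irr S) (h : QPath.Factors x v p) (hp : p ∈ Irr S) :
    transferExt φ f n (of k x) (proj φ (of k v)) = 0 := by
  rw [transferExt_apply, crossing_arrow_of_irr hprec hφ hc hx hv h hp, map_zero, ite_self,
    dualH2Ext_arrow_of_irr hprec hφ hc (Normalized₃.transferDefect hprec hφ hc f n) hx hv h hp,
    add_zero]

theorem transferExt_arrow_of_head (hprec : IsAdmissible prec) (hφ : φ ∈ cochPrec k S prec)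
    (hc : Convergent φ) {f : S → QuotAlg φ}
    (hf : ∀ s : S, proj φ (of k (QPath.idPath (s : QPath V).src)) * f s = f s) (n : ℕ)
    {x v p r : QPath V} {s : S} (hx : x.length = 1) (hv : v ∈ Irr S) (h : QPath.Factors x v p)
    (hs : QPath.Factors s r p) :
    transferExt φ f n (of k x) (proj φ (of k v)) =
      (if n = 1 then f s * proj φ (of k r) else 0) +
      transferExt φ f n (φ s) (proj φ (of k r)) -
      evalF1 (transferDefect φ f n) (fox φ (of k s)) (proj φ (of k r)) := by
  have e : evalCochain (k := k) (W := amb S 2) f (tens φ (ambTwo s)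
      (proj φ (of k (QPath.idPath (s : QPath V).src))) (proj φ (of k r))) =
      f s * proj φ (of k r) := (evalCochain_single _ _ _ _).trans (congrArg (· * _) (hf s))
  rw [transferExt_apply, crossing_arrow_of_head hprec hφ hc hx hv h hs, map_add, e,
    dualH2Ext_arrow_of_head hprec hφ hc (Normalized₃.transferDefect hprec hφ hc f n) hx hv h hs,
    transferExt_apply]
  split_ifs <;> abel

theorem transferExt_head (hprec : IsAdmissible prec) (hφ : φ ∈ cochPrec k S prec)
    (hc : Convergent φ) (f : S → QuotAlg φ) (n : ℕ) {x q p : QPath V} (hx : x.length = 1)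
    (h : QPath.Factors x q p) (b : QuotAlg φ) :
    transferExt φ f n (of k p) b =
      transferDefect φ f n (proj φ (of k x)) (proj φ (of k q)) b +
      transferExt φ f n (of k x) (proj φ (of k q) * b) +
      proj φ (of k x) * transferExt φ f n (of k q) b := by
  have e : evalCochain (k := k) (W := amb S 2) f (crossing φ (of k p) b) =
      evalCochain (W := amb S 2) f (crossing φ (of k x) (proj φ (of k q) * b)) +
      proj φ (of k x) * evalCochain (W := amb S 2) f (crossing φ (of k q) b) := by
    rw [crossing_head hprec hφ hc hx h, map_add]
    congr 1
    exact (evalCochain_biact (W := amb S 2) f _ _ _).trans (mul_one _)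
  rw [transferExt_apply, e,
    dualH2Ext_head hprec hφ hc (Normalized₃.transferDefect hprec hφ hc f n) hx h,
    transferExt_apply, transferExt_apply, mul_add]
  split_ifs
  · abel
  · rw [mul_zero]
    abel

theorem transferDefect_apply (f : S → QuotAlg φ) (n : ℕ) (a b c : QuotAlg φ) :
    transferDefect φ f n a b c = ∑ ij ∈ Finset.HasAntidiagonal.antidiagonal n,
      (transferSeries φ f ij.1 a (transferSeries φ f ij.2 b c) -
        transferSeries φ f ij.1 (transferSeries φ f ij.2 a b) c) := by
  rw [transferDefect_eq]
  simp only [LinearMap.neg_apply, LinearMap.sum_apply, circ_apply]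
  rw [← Finset.sum_neg_distrib]
  exact Finset.sum_congr rfl fun ij _ => neg_sub _ _

variable (hprec : IsAdmissible prec) (hφ : φ ∈ cochPrec k S prec) (hc : Convergent φ)
  (f : S → QuotAlg φ)

include hprec hφ hc

/-- Concatenation with irreducible result is not deformed. By induction on `u`, the Leibniz rule
leaves only values of the same kind, and so does the expansion of `γ_n` into compositions of the
`β_i`. -/
theorem transferSeries_of_irr (n : ℕ) {u v p : QPath V} (hp : p ∈ Irr S)
    (h : QPath.Factors u v p) : transferSeries φ f n (proj φ (of k u)) (proj φ (of k v)) = 0 := by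
  induction u using QPath.head_induction generalizing p n with
  | h0 i => exact (Normalized₂.transferSeries hprec hφ hc f n).left i _
  | hs x q u hx hu ih =>
    obtain ⟨z, hz1, hz2⟩ := hu.assoc h
    have hz := Irr.right hp hz2
    have hui := Irr.left hp h
    rw [transferSeries_proj hprec hφ hc f n (of_mem_spanOn (X := Irr S) hui),
      transferExt_head hprec hφ hc f n hx hu, proj_mul_factors hz1,
      transferExt_arrow_of_irr hprec hφ hc f n hx hz hz2 hp,
      ← transferSeries_proj hprec hφ hc f n (of_mem_spanOn (X := Irr S) (Irr.right hui hu)),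
      ih n hz hz1, mul_zero, add_zero, add_zero, transferDefect_apply]
    refine Finset.sum_eq_zero fun ij _ => ?_
    rw [ih _ hz hz1, map_zero, transferSeries_proj hprec hφ hc f _
      (of_mem_spanOn (X := Irr S) (Irr.left hui hu)),
      transferExt_arrow_of_irr hprec hφ hc f _ hx (Irr.right hui hu) hu hui, map_zero,
      LinearMap.zero_apply, sub_zero]

theorem evalF1_fox_of_irr (n : ℕ) {u v p : QPath V} (hp : p ∈ Irr S) (h : QPath.Factors u v p) :
    evalF1 (transferDefect φ f n) (fox φ (of k u)) (proj φ (of k v)) = 0 := by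
  induction u using QPath.head_induction generalizing p with
  | h0 i => rw [fox_idPath, map_zero, LinearMap.zero_apply]
  | hs x q u hx hu ih =>
    obtain ⟨z, hz1, hz2⟩ := hu.assoc h
    rw [evalF1_fox_head (Normalized₃.transferDefect hprec hφ hc f n) hx hu,
      ih (Irr.right hp hz2) hz1, mul_zero, add_zero, transferDefect_apply]
    refine Finset.sum_eq_zero fun ij _ => ?_
    rw [transferSeries_of_irr hprec hφ hc f _ (Irr.right hp hz2) hz1, map_zero,
      transferSeries_of_irr hprec hφ hc f _ (Irr.left hp h) hu, map_zero, LinearMap.zero_apply,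
      sub_zero]

variable {f} (hf : ∀ s : S, proj φ (of k (QPath.idPath (s : QPath V).src)) * f s = f s)
  (hf' : ∀ s : S, f s * proj φ (of k (QPath.idPath (s : QPath V).tgt)) = f s)

include hf hf'

/-- Together with the undeformed product this says `x ⋆ q = φ_s + t f_s`: the star product satisfies
the deformed relation. -/
theorem transferSeries_rel (n : ℕ) {x q : QPath V} {s : S} (hx : x.length = 1)
    (h : QPath.Factors x q s) : transferSeries φ f n (proj φ (of k x)) (proj φ (of k q)) =
      if n = 1 then f s else 0 := by
  have hq := hc.isReductionSet.irr_tail s.2 hx h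
  have hxi : x ∈ Irr S := hc.isReductionSet.irr_of_length_le_one hx.le
  rw [transferSeries_proj hprec hφ hc f n (of_mem_spanOn (X := Irr S) hxi),
    transferExt_arrow_of_head hprec hφ hc hf n hx hq h (QPath.factors_idPath_right (s : QPath V)),
    hf', evalF1_fox_right (Normalized₃.transferDefect hprec hφ hc f n),
    ← transferSeries_proj hprec hφ hc f n (coch_mem_irr hc.mem_coch s),
    (Normalized₂.transferSeries hprec hφ hc f n).right, add_zero, sub_zero]

theorem transferDefect_rel (n : ℕ) {x q : QPath V} {s : S} (hx : x.length = 1)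
    (h : QPath.Factors x q s) (b : QuotAlg φ) :
    transferDefect φ f (n + 1) (proj φ (of k x)) (proj φ (of k q)) b =
      ∑ ij ∈ Finset.HasAntidiagonal.antidiagonal (n + 1),
        transferSeries φ f ij.1 (proj φ (of k x)) (transferSeries φ f ij.2 (proj φ (of k q)) b) -
      transferSeries φ f n (f s) b := by
  rw [transferDefect_apply, Finset.sum_sub_distrib]
  congr 1
  -- The inner value is `β_j(x, q)` with `x q = s`, which is nonzero only for `j = 1`.
  rw [Finset.sum_eq_single (n, 1)]
  · rw [transferSeries_rel hprec hφ hc hf hf' 1 hx h, if_pos rfl]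
  · rintro ⟨i, j⟩ hij hne
    rw [transferSeries_rel hprec hφ hc hf hf' j hx h, if_neg, map_zero, LinearMap.zero_apply]
    rintro rfl
    rw [Finset.HasAntidiagonal.mem_antidiagonal] at hij
    exact hne (Prod.ext (by dsimp only at hij ⊢; omega) rfl)
  · intro hne
    refine absurd ?_ hne
    exact Finset.HasAntidiagonal.mem_antidiagonal.mpr rfl

omit hprec hφ hc hf hf' in
variable (φ f) in
/-- The coefficients of the deformed multiplication `a b + β_1(a, b) t + β_2(a, b) t^2 + ⋯`. -/
def starSeries (n : ℕ) : C2 k (QuotAlg φ) :=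
  (if n = 0 then LinearMap.mul k (QuotAlg φ) else 0) + transferSeries φ f n

omit hprec hφ hc hf hf' in
theorem starSeries_apply (n : ℕ) (a b : QuotAlg φ) : starSeries φ f n a b =
    (if n = 0 then a * b else 0) + transferSeries φ f n a b := by
  rw [starSeries]
  split_ifs <;> rfl

omit hprec hφ hc hf hf' in
theorem sum_starSeries (n : ℕ) (a b c : QuotAlg φ) :
    ∑ ij ∈ Finset.HasAntidiagonal.antidiagonal n,
      starSeries φ f ij.1 a (starSeries φ f ij.2 b c) =
    (if n = 0 then a * (b * c) else 0) + transferSeries φ f n a (b * c) +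
      a * transferSeries φ f n b c +
      ∑ ij ∈ Finset.HasAntidiagonal.antidiagonal n,
        transferSeries φ f ij.1 a (transferSeries φ f ij.2 b c) := by
  have h : ∀ ij ∈ Finset.HasAntidiagonal.antidiagonal n,
      starSeries φ f ij.1 a (starSeries φ f ij.2 b c) =
        (if ij.1 = 0 then a * starSeries φ f ij.2 b c else 0) +
        ((if ij.2 = 0 then transferSeries φ f ij.1 a (b * c) else 0) +
          transferSeries φ f ij.1 a (transferSeries φ f ij.2 b c)) := fun ij _ => by
    rw [starSeries_apply ij.1, starSeries_apply ij.2, map_add]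
    split_ifs <;> simp only [map_zero]
  rw [Finset.sum_congr rfl h, Finset.sum_add_distrib, Finset.sum_add_distrib,
    sum_antidiagonal_left n fun j => a * starSeries φ f j b c,
    sum_antidiagonal_right n fun i => transferSeries φ f i a (b * c), starSeries_apply, mul_add,
    mul_ite, mul_zero]
  abel

/-- In terms of series, `x ⋆ v = (φ_s + t f_s) ⋆ r`. The defect `γ_(n+1)` evaluated on the
derivation of `s` supplies the term with `f_s`, one degree lower. -/
theorem starSeries_head (n : ℕ) {x v p r : QPath V} {s : S} (hx : x.length = 1) (hv : v ∈ Irr S)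
    (h : QPath.Factors x v p) (hs : QPath.Factors s r p) :
    starSeries φ f (n + 1) (proj φ (of k x)) (proj φ (of k v)) =
      starSeries φ f (n + 1) (proj φ (φ s)) (proj φ (of k r)) +
      starSeries φ f n (f s) (proj φ (of k r)) := by
  obtain ⟨y, q, hy, hq⟩ := QPath.exists_head (s : QPath V) (hc.isReductionSet.arrows_ne_nil s.2)
  obtain ⟨z, hz1, hz2⟩ := hq.assoc hs
  obtain ⟨rfl, rfl⟩ := hz2.unique h (hy.trans hx.symm)
  have hxi : y ∈ Irr S := hc.isReductionSet.irr_of_length_le_one hx.le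
  have h1 := evalF1_fox_head (Normalized₃.transferDefect hprec hφ hc f (n + 1)) hy hq
    (proj φ (of k r))
  rw [evalF1_fox_of_irr hprec hφ hc f _ hv hz1, mul_zero, add_zero,
    transferDefect_rel hprec hφ hc hf hf' n hy hq, Finset.sum_eq_zero, zero_sub] at h1
  · rw [starSeries_apply, starSeries_apply, starSeries_apply,
      transferSeries_proj hprec hφ hc f _ (of_mem_spanOn (X := Irr S) hxi),
      transferExt_arrow_of_head hprec hφ hc hf _ hx hv h hs, h1,
      transferSeries_proj hprec hφ hc f _ (coch_mem_irr hc.mem_coch s), if_neg n.succ_ne_zero,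
      if_neg n.succ_ne_zero, sub_neg_eq_add]
    have e : (n + 1 = 1) = (n = 0) := by simp
    simp only [e, zero_add]
    abel
  · intro ij _
    rw [transferSeries_of_irr hprec hφ hc f _ hv hz1, map_zero]

-- The identity `p ⋆ b = x ⋆ (q ⋆ b)`. The Leibniz rule produces `γ_n(x, q, b)`, which by definition
-- is the difference of the two bracketings, and the bracketing that contains `β_j(x, q)` vanishes
-- because `x q` is irreducible. Full associativity is not claimed.
omit hf hf' in
theorem starSeries_assoc (n : ℕ) {x q p : QPath V} (hx : x.length = 1) (hp : p ∈ Irr S)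
    (h : QPath.Factors x q p) (b : QuotAlg φ) :
    starSeries φ f n (proj φ (of k p)) b =
      ∑ ij ∈ Finset.HasAntidiagonal.antidiagonal n,
        starSeries φ f ij.1 (proj φ (of k x)) (starSeries φ f ij.2 (proj φ (of k q)) b) := by
  have hxi := Irr.left hp h
  have hqi := Irr.right hp h
  rw [sum_starSeries, starSeries_apply,
    transferSeries_proj hprec hφ hc f _ (of_mem_spanOn (X := Irr S) hp),
    transferExt_head hprec hφ hc f n hx h, transferDefect_apply, Finset.sum_sub_distrib,
    ← transferSeries_proj hprec hφ hc f _ (of_mem_spanOn (X := Irr S) hxi),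
    ← transferSeries_proj hprec hφ hc f _ (of_mem_spanOn (X := Irr S) hqi), ← mul_assoc,
    proj_mul_factors h]
  have : ∑ ij ∈ Finset.HasAntidiagonal.antidiagonal n, transferSeries φ f ij.1
      (transferSeries φ f ij.2 (proj φ (of k x)) (proj φ (of k q))) b = 0 := by
    refine Finset.sum_eq_zero fun ij _ => ?_
    rw [transferSeries_of_irr hprec hφ hc f _ hp h, map_zero, LinearMap.zero_apply]
  rw [this]
  abel

/-- The value of the degree `n` part of the Maurer-Cartan equation at an overlap. -/
theorem evalCochain_overlapDiff (n : ℕ) {x s' r w : QPath V} {s : S} (h : Overlap x s' s r w) :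
    (if n = 0 then evalCochain (k := k) (W := amb S 2) f (overlapDiff φ x s' s r) else 0) -
      evalF2 (transferDefect φ f (n + 1)) (overlapDiff φ x s' s r) =
    ∑ ij ∈ Finset.HasAntidiagonal.antidiagonal (n + 1),
        starSeries φ f ij.1 (proj φ (of k x)) (starSeries φ f ij.2 (proj φ (of k s'))
          (proj φ (of k r))) -
      starSeries φ f (n + 1) (proj φ (φ s)) (proj φ (of k r)) -
      starSeries φ f n (f s) (proj φ (of k r)) := by
  have hg := Normalized₃.transferDefect hprec hφ hc f (n + 1)
  have hx := h.length_eq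
  have hxi : x ∈ Irr S := hc.isReductionSet.irr_of_length_le_one hx.le
  have e1 : evalCochain (k := k) (W := amb S 2) f (tens φ (ambTwo s)
      (proj φ (of k (QPath.idPath (s : QPath V).src))) (proj φ (of k r))) =
      f s * proj φ (of k r) := (evalCochain_single _ _ _ _).trans (congrArg (· * _) (hf s))
  have e2 : evalCochain (k := k) (W := amb S 2) f (biact (proj φ (of k x)) 1
      (crossing φ (of k s') (proj φ (of k r)))) = proj φ (of k x) *
      evalCochain (k := k) (W := amb S 2) f (crossing φ (of k s') (proj φ (of k r))) :=
    (evalCochain_biact (W := amb S 2) f _ _ _).trans (mul_one _)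
  have e3 := evalF2_tens hc hg s (proj φ (of k (QPath.idPath (s : QPath V).src))) (proj φ (of k r))
  rw [← evalF1_biact hg,
    map_sub (biact (k := k) (W := amb S 1) (proj φ (of k (QPath.idPath (s : QPath V).src))) 1),
    biact_left_fox, biact_left_fox_coch hc.mem_coch, map_sub, LinearMap.sub_apply,
    evalF1_fox_head hg hx h.factors_left, transferDefect_rel hprec hφ hc hf hf' n hx h.factors_left]
    at e3
  have e4 : evalF1 (transferDefect φ f (n + 1)) (fox φ (of k x))
      (proj φ (of k s') * proj φ (of k r)) = 0 := evalF1_fox_arrow hg hx _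
  rw [sum_starSeries, starSeries_apply, starSeries_apply,
    transferSeries_proj hprec hφ hc f _ (of_mem_spanOn (X := Irr S) hxi),
    transferSeries_proj hprec hφ hc f _ (of_mem_spanOn (X := Irr S) h.irr_left),
    transferSeries_proj hprec hφ hc f _ (coch_mem_irr hc.mem_coch s),
    transferExt_apply, transferExt_apply, transferExt_apply, dualH2Ext_apply, dualH2Ext_apply,
    dualH2Ext_apply, overlapDiff, map_sub, map_sub, map_add, map_sub, map_sub, map_add, e1, e2, e3,
    evalF2_biact hc hg, e4, if_neg n.succ_ne_zero, if_neg n.succ_ne_zero]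
  have e : (n + 1 = 1) = (n = 0) := by simp
  simp only [e, mul_add, mul_sub]
  rw [mul_ite, mul_zero]
  -- After the values are named, what remains is an identity in an abelian group.
  generalize evalCochain (k := k) (W := amb S 2) f (crossing φ (of k x)
    (proj φ (of k s') * proj φ (of k r))) = a₁
  generalize proj φ (of k x) * evalCochain (k := k) (W := amb S 2) f (crossing φ (of k s')
    (proj φ (of k r))) = a₂
  generalize evalCochain (k := k) (W := amb S 2) f (crossing φ (φ s) (proj φ (of k r))) = a₃
  generalize f s * proj φ (of k r) = a₄
  generalize evalF2 (transferDefect φ f (n + 1)) (crossing φ (of k x)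
    (proj φ (of k s') * proj φ (of k r))) = b₁
  generalize proj φ (of k x) * evalF2 (transferDefect φ f (n + 1)) (crossing φ (of k s')
    (proj φ (of k r))) = b₂
  generalize evalF2 (transferDefect φ f (n + 1)) (crossing φ (φ s) (proj φ (of k r))) = b₃
  generalize proj φ (of k x) * evalF1 (transferDefect φ f (n + 1)) (fox φ (of k s'))
    (proj φ (of k r)) = c₁
  generalize evalF1 (transferDefect φ f (n + 1)) (fox φ (φ s)) (proj φ (of k r)) = c₂
  generalize transferSeries φ f n (f s) (proj φ (of k r)) = d
  generalize ∑ ij ∈ Finset.HasAntidiagonal.antidiagonal (n + 1), transferSeries φ f ij.1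
    (proj φ (of k x)) (transferSeries φ f ij.2 (proj φ (of k s')) (proj φ (of k r))) = t
  split_ifs <;> abel

end StarSeries

/-! ### Extension of scalars for normal forms -/

section Scalars

variable {k : Type*} [CommRing k] {B : Type*} [CommRing B] {V : Type v} [Quiver.{w} V]
  {S : Set (QPath V)}

/-- The map of path algebras that is given by a ring homomorphism on the coefficients. -/
def mapCoeff (σ : k →+* B) : PathAlgebra k V →+ PathAlgebra B V :=
  Finsupp.mapRange.addMonoidHom σ.toAddMonoidHom

theorem coeff_mapCoeff (σ : k →+* B) (p : QPath V) (x : PathAlgebra k V) :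
    coeff p (mapCoeff σ x) = σ (coeff p x) := rfl

theorem mapCoeff_of (σ : k →+* B) (p : QPath V) : mapCoeff σ (of k p) = of B p :=
  ext_coeff fun q => by
    rw [coeff_mapCoeff, coeff_of, coeff_of]
    split_ifs <;> simp

theorem mapCoeff_smul (σ : k →+* B) (c : k) (x : PathAlgebra k V) :
    mapCoeff σ (c • x) = σ c • mapCoeff σ x :=
  ext_coeff fun q => by
    rw [coeff_mapCoeff, map_smul (coeff q), map_smul (coeff q), coeff_mapCoeff, smul_eq_mul,
      smul_eq_mul, map_mul]

theorem mapCoeff_mem {σ : k →+* B} {X : Set (QPath V)} {x : PathAlgebra k V}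
    (hx : x ∈ spanOn k X) : mapCoeff σ x ∈ spanOn B X := fun p hp => hx p fun h => hp (by
  rw [coeff_mapCoeff, h, map_zero])

theorem mapCoeff_mapCoeff {C : Type*} [CommRing C] (σ : k →+* B) (τ : B →+* C)
    (x : PathAlgebra k V) : mapCoeff τ (mapCoeff σ x) = mapCoeff (τ.comp σ) x :=
  ext_coeff fun _ => rfl

theorem mapCoeff_pathMul (σ : k →+* B) (p q : QPath V) :
    mapCoeff σ (pathMul p q) = pathMul p q := by
  rw [pathMul, pathMul]
  split_ifs
  · exact mapCoeff_of σ _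
  · exact map_zero _

theorem mapCoeff_mul (σ : k →+* B) (x y : PathAlgebra k V) :
    mapCoeff σ (x * y) = mapCoeff σ x * mapCoeff σ y := by
  simp only [mul_def]
  induction x using induct with
  | h0 => simp
  | ha x x' h h' => simp only [map_add, LinearMap.add_apply, h, h']
  | hs c p =>
    induction y using induct with
    | h0 => simp
    | ha y y' h h' => simp only [map_add, h, h']
    | hs d q =>
      have e : mulMap (of k p) (of k q) = pathMul p q := of_mul_of p q
      have e' : mulMap (of B p) (of B q) = pathMul p q := of_mul_of p q
      simp only [map_smul, LinearMap.smul_apply, mapCoeff_smul, mapCoeff_of, e, e',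
        mapCoeff_pathMul]

theorem red_mapCoeff (σ : k →+* B) (ψ : S → PathAlgebra k V) (x : PathAlgebra k V) :
    red (fun s => mapCoeff σ (ψ s)) (mapCoeff σ x) = mapCoeff σ (red ψ x) := by
  induction x using induct with
  | h0 => simp
  | ha x x' h h' => simp only [map_add, h, h']
  | hs c p =>
    rw [mapCoeff_smul, map_smul, map_smul, mapCoeff_smul, mapCoeff_of, red, red, lin_of, lin_of]
    congr 1
    split_ifs
    · rw [mapCoeff_mul, mapCoeff_mul, mapCoeff_of, mapCoeff_of]
    · rw [mapCoeff_of]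

/-- The occurrence chosen by right-most reduction depends on the path and not on the scalars, and
irreducible elements stay irreducible after a change of coefficients. -/
theorem redInf_mapCoeff (σ : k →+* B) {ψ : S → PathAlgebra k V} (hT : RedTerminates ψ)
    (x : PathAlgebra k V) :
    redInf (fun s => mapCoeff σ (ψ s)) (mapCoeff σ x) = mapCoeff σ (redInf ψ x) := by
  obtain ⟨n, hn⟩ := hT x
  have h : (red fun s => mapCoeff σ (ψ s))^[n] (mapCoeff σ x) = mapCoeff σ ((red ψ)^[n] x) := by
    clear hn
    induction n with
    | zero => rfl
    | succ n ih => rw [Function.iterate_succ_apply', ih, red_mapCoeff, Function.iterate_succ_apply']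
  rw [redInf_eq ψ hn, redInf_eq (n := n), h]
  rw [h]
  exact mapCoeff_mem hn

end Scalars

/-! ### Normal forms for `φ + t f` over `k[t]` -/

section Deformation

open Polynomial

variable {k : Type u} [CommRing k] {V : Type v} [Quiver.{w} V] {S : Set (QPath V)}
  {prec : QPath V → QPath V → Prop}

/-- The coefficient of `t^n` in a linear combination of paths over `k[t]`. -/
def polyCoeff (n : ℕ) : PathAlgebra k[X] V →+ PathAlgebra k V :=
  Finsupp.mapRange.addMonoidHom (Polynomial.lcoeff k n).toAddMonoidHom

theorem coeff_polyCoeff (n : ℕ) (p : QPath V) (z : PathAlgebra k[X] V) :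
    coeff p (polyCoeff n z) = (coeff p z).coeff n := rfl

theorem polyCoeff_C_smul (n : ℕ) (c : k) (z : PathAlgebra k[X] V) :
    polyCoeff n (C c • z) = c • polyCoeff n z :=
  ext_coeff fun p => by
    rw [coeff_polyCoeff, map_smul, map_smul, coeff_polyCoeff, smul_eq_mul, smul_eq_mul,
      Polynomial.coeff_C_mul]

theorem polyCoeff_mapCoeff (n : ℕ) (y : PathAlgebra k V) :
    polyCoeff n (mapCoeff C y) = if n = 0 then y else 0 :=
  ext_coeff fun p => by
    rw [coeff_polyCoeff, coeff_mapCoeff, Polynomial.coeff_C]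
    split_ifs <;> simp

theorem polyCoeff_X_smul_succ (n : ℕ) (z : PathAlgebra k[X] V) :
    polyCoeff (n + 1) ((X : k[X]) • z) = polyCoeff n z :=
  ext_coeff fun p => by
    rw [coeff_polyCoeff, coeff_polyCoeff, map_smul, smul_eq_mul, Polynomial.coeff_X_mul]

theorem polyCoeff_X_smul_zero (z : PathAlgebra k[X] V) : polyCoeff 0 ((X : k[X]) • z) = 0 :=
  ext_coeff fun p => by
    rw [coeff_polyCoeff, map_smul, smul_eq_mul, Polynomial.coeff_X_mul_zero, map_zero]

theorem polyCoeff_smul_of (n : ℕ) (g : k[X]) (p : QPath V) :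
    polyCoeff n (g • of k[X] p) = g.coeff n • of k p :=
  ext_coeff fun q => by
    rw [coeff_polyCoeff, map_smul, map_smul, coeff_of, coeff_of, smul_eq_mul, smul_eq_mul]
    split_ifs <;> simp

theorem polyCoeff_mem {n : ℕ} {Y : Set (QPath V)} {z : PathAlgebra k[X] V}
    (hz : z ∈ spanOn k[X] Y) : polyCoeff n z ∈ spanOn k Y := fun p hp => hz p fun h => hp (by
  rw [coeff_polyCoeff, h, Polynomial.coeff_zero])

/-- The Cauchy product: expand `z` in powers of `t` and use linearity of `L` over `k[t]`. -/
theorem polyCoeff_linear (n : ℕ) (L : PathAlgebra k[X] V →ₗ[k[X]] PathAlgebra k[X] V)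
    (z : PathAlgebra k[X] V) : polyCoeff n (L z) =
      ∑ ij ∈ Finset.HasAntidiagonal.antidiagonal n,
        polyCoeff ij.1 (L (mapCoeff C (polyCoeff ij.2 z))) := by
  induction z using induct with
  | h0 => simp
  | ha x y hx hy => simp only [map_add, hx, hy, Finset.sum_add_distrib]
  | hs g p =>
    refine ext_coeff fun q => ?_
    rw [map_smul, coeff_polyCoeff, map_smul, smul_eq_mul, mul_comm, Polynomial.coeff_mul, map_sum]
    refine Finset.sum_congr rfl fun ij _ => ?_
    rw [polyCoeff_smul_of, mapCoeff_smul, map_smul, mapCoeff_of, polyCoeff_C_smul, map_smul,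
      coeff_polyCoeff, smul_eq_mul, mul_comm]

/-- The function `φ + t f` over the polynomial ring `k[t]`. -/
def deform (φ f : S → PathAlgebra k V) (s : S) : PathAlgebra k[X] V :=
  mapCoeff C (φ s) + (X : k[X]) • mapCoeff C (f s)

variable {φ f : S → PathAlgebra k V}

theorem deform_mem (hφ : φ ∈ cochPrec k S prec) (hf : f ∈ cochPrec k S prec) :
    deform φ f ∈ cochPrec k[X] S prec := fun s p hp => by
  by_cases h : coeff p (φ s) = 0
  · refine hf s p fun h' => hp ?_
    rw [deform, map_add, map_smul, coeff_mapCoeff, coeff_mapCoeff, h, h', map_zero, smul_zero,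
      add_zero]
  · exact hφ s p h

/-- The coefficient of `t^n` in the normal form with respect to `φ + t f`. -/
def deformCoeff (hT : RedTerminates (deform φ f)) (n : ℕ) : PathAlgebra k V →ₗ[k] PathAlgebra k V where
  toFun y := polyCoeff n (redInf (deform φ f) (mapCoeff C y))
  map_add' x y := by
    rw [map_add, ← redLin_apply _ hT, map_add, map_add]
    rfl
  map_smul' c x := by
    rw [mapCoeff_smul, ← redLin_apply _ hT, map_smul, polyCoeff_C_smul]
    rfl

theorem deformCoeff_apply (hT : RedTerminates (deform φ f)) (n : ℕ) (y : PathAlgebra k V) :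
    deformCoeff hT n y = polyCoeff n (redInf (deform φ f) (mapCoeff C y)) := rfl

theorem deformCoeff_of_irr (hT : RedTerminates (deform φ f)) (n : ℕ) {y : PathAlgebra k V}
    (hy : y ∈ irrMod k S) : deformCoeff hT n y = if n = 0 then y else 0 := by
  rw [deformCoeff_apply, redInf_of_irr _ (mapCoeff_mem hy), polyCoeff_mapCoeff]

theorem deformCoeff_mem (hT : RedTerminates (deform φ f)) (n : ℕ) (y : PathAlgebra k V) :
    deformCoeff hT n y ∈ irrMod k S := polyCoeff_mem (redInf_mem _ _)

theorem deformCoeff_mem_le (hS : IsReductionSet S) (hprec : IsAdmissible prec)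
    (hφ : φ ∈ cochPrec k S prec) (hf : f ∈ cochPrec k S prec) (hT : RedTerminates (deform φ f))
    (n : ℕ) (p : QPath V) : deformCoeff hT n (of k p) ∈
      spanOn k {p' | (p' = p ∨ prec p' p) ∧ p'.Parallel p ∧ p' ∈ Irr S} := by
  rw [deformCoeff_apply, mapCoeff_of]
  exact polyCoeff_mem (redInf_mem_le hS hprec (deform_mem hφ hf) p)

theorem polyCoeff_redInf_rel [Fintype V] (hT : RedTerminates (deform φ f)) (s : S) (r : QPath V)
    (n : ℕ) : polyCoeff n (redInf (deform φ f) (deform φ f s * of k[X] r)) =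
      deformCoeff hT n (φ s * of k r) + if n = 0 then 0 else deformCoeff hT (n - 1) (f s * of k r) := by
  have e : deform φ f s * of k[X] r =
      mapCoeff C (φ s * of k r) + (X : k[X]) • mapCoeff C (f s * of k r) := by
    rw [mapCoeff_mul, mapCoeff_mul, mapCoeff_of, deform, add_mul, smul_mul_assoc]
  rw [e, ← redLin_apply _ hT, map_add, map_smul, map_add]
  congr 1
  cases n with
  | zero => exact polyCoeff_X_smul_zero _
  | succ n => exact polyCoeff_X_smul_succ n _

theorem deformCoeff_head [Fintype V] (hS : IsReductionSet S) (hφ : φ ∈ coch k S S)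
    (hf : f ∈ coch k S S) (hT : RedTerminates (deform φ f)) (n : ℕ) {x v p r : QPath V} {s : S}
    (hx : x.length = 1) (hv : v ∈ Irr S) (hp : QPath.Factors x v p) (hs : QPath.Factors s r p) :
    deformCoeff hT n (of k p) =
      deformCoeff hT n (φ s * of k r) + if n = 0 then 0 else deformCoeff hT (n - 1) (f s * of k r) := by
  rw [← polyCoeff_redInf_rel, deformCoeff_apply, mapCoeff_of, redInf_head hS _ hT hx hv hp hs]
  rw [deform, mul_add, mul_smul_comm, ← mapCoeff_of C, ← mapCoeff_mul, ← mapCoeff_mul,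
    idPath_mul_coch hφ, idPath_mul_coch hf]

/-- The counterpart of `starSeries_assoc`, read off from `redInf_mul_redInf`; it holds whether or
not `φ + t f` is reduction unique. -/
theorem deformCoeff_mul [Fintype V] (hS : IsReductionSet S) (hT : RedTerminates (deform φ f))
    (n : ℕ) (x y : PathAlgebra k V) : deformCoeff hT n (x * y) =
      ∑ ij ∈ Finset.HasAntidiagonal.antidiagonal n,
        deformCoeff hT ij.1 (x * deformCoeff hT ij.2 y) := by
  rw [deformCoeff_apply, mapCoeff_mul, ← redInf_mul_redInf hS _ hT]
  refine (polyCoeff_linear n (redLin _ hT ∘ₗ LinearMap.mulLeft k[X] (mapCoeff C x)) _).trans ?_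
  refine Finset.sum_congr rfl fun ij _ => ?_
  rw [deformCoeff_apply, mapCoeff_mul]
  rfl

end Deformation

/-! ### The star product is the normal form of the product -/

section StarProduct

variable {k : Type u} [CommRing k] {V : Type v} [Quiver.{w} V] [Fintype V]
  {S : Set (QPath V)} {φ f : S → PathAlgebra k V} {prec : QPath V → QPath V → Prop}
  (hprec : IsAdmissible prec) (hφ : φ ∈ cochPrec k S prec) (hc : Convergent φ)
  (hf : f ∈ cochPrec k S prec) (hT : RedTerminates (deform φ f))

include hprec hφ hc hf

theorem starSeries_arrow_of_forall {x v p : QPath V} (hx : x.length = 1) (hv : v ∈ Irr S)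
    (h : QPath.Factors x v p)
    (ih : ∀ p', prec p' p → ∀ u v, u ∈ Irr S → v ∈ Irr S → QPath.Factors u v p' → ∀ n,
      starSeries φ (fun s => proj φ (f s)) n (proj φ (of k u)) (proj φ (of k v)) =
        proj φ (deformCoeff hT n (of k p'))) (n : ℕ) :
    starSeries φ (fun s => proj φ (f s)) n (proj φ (of k x)) (proj φ (of k v)) =
      proj φ (deformCoeff hT n (of k p)) := by
  have hS := hc.isReductionSet
  rcases hS.irr_or_factors hx hv h with hp | ⟨s, r, hs⟩
  · rw [deformCoeff_of_irr hT n (of_mem_spanOn (X := Irr S) hp), starSeries_apply,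
      transferSeries_of_irr hprec hφ hc _ n hp h, proj_mul_factors h, add_zero]
    split_ifs
    · rfl
    · exact (map_zero _).symm
  · have hr : r ∈ Irr S := by
      obtain ⟨y, q, hy, hq⟩ := QPath.exists_head (s : QPath V) (hS.arrows_ne_nil s.2)
      obtain ⟨z, hz1, hz2⟩ := hq.assoc hs
      obtain ⟨-, rfl⟩ := hz2.unique h (hy.trans hx.symm)
      exact Irr.right hv hz1
    -- Used for `g = φ` and `g = f`. The paths `q` in `g s` satisfy `q r ≺ s r`, which puts them
    -- within reach of the induction hypothesis.
    have key : ∀ g ∈ cochPrec k S prec, ∀ n,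
        starSeries φ (fun s => proj φ (f s)) n (proj φ (g s)) (proj φ (of k r)) =
          proj φ (deformCoeff hT n (g s * of k r)) := fun g hg n => by
      refine eq_of_spanOn (X := {q | prec q s ∧ q.Parallel s ∧ q ∈ Irr S})
        (fun q hq => ⟨(hg s q hq).2, (hg s q hq).1.2, (hg s q hq).1.1⟩)
        ((starSeries φ (fun s => proj φ (f s)) n).flip (proj φ (of k r)) ∘ₗ (proj φ).toLinearMap)
        ((proj φ).toLinearMap ∘ₗ deformCoeff hT n ∘ₗ LinearMap.mulRight k (of k r)) fun q hq => ?_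
      have hqr := QPath.factors_comp q r (hq.2.1.2.trans hs.mid)
      simp only [LinearMap.comp_apply, LinearMap.mulRight_apply, of_mul_factors hqr]
      exact ih _ (hprec.mul_right _ _ _ _ _ hqr hs hq.1) q r hq.2.2 hr hqr n
    rw [deformCoeff_head hS hc.mem_coch (mem_coch_of_cochPrec hf) hT n hx hv h hs, map_add,
      ← key φ hφ]
    cases n with
    | zero =>
      rw [if_pos rfl, map_zero, add_zero, starSeries_apply, starSeries_apply, if_pos rfl,
        if_pos rfl, transferSeries_zero, LinearMap.zero_apply, LinearMap.zero_apply,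
        LinearMap.zero_apply, LinearMap.zero_apply, add_zero, add_zero, proj_mul_factors h, ← proj_mul_factors hs,
        Convergent.proj_rel]
    | succ n =>
      rw [if_neg n.succ_ne_zero, Nat.add_sub_cancel, ← key f hf]
      refine starSeries_head hprec hφ hc (fun s => ?_) (fun s => ?_) n hx hv h hs
      · rw [← map_mul, idPath_mul_coch (mem_coch_of_cochPrec hf)]
      · rw [← map_mul, coch_mul_idPath (mem_coch_of_cochPrec hf)]

theorem starSeries_factors (p : QPath V) : ∀ u v, u ∈ Irr S → v ∈ Irr S →
    QPath.Factors u v p → ∀ n,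
      starSeries φ (fun s => proj φ (f s)) n (proj φ (of k u)) (proj φ (of k v)) =
        proj φ (deformCoeff hT n (of k p)) := by
  have hS := hc.isReductionSet
  induction p using hprec.wf.induction with
  | h p ih =>
    intro u v hu hv h n
    by_cases hu0 : u.arrows = []
    · have hup : v = p := h.eq_right (by rw [← QPath.length_arrows, hu0]; rfl)
      subst hup
      exact (congrArg (fun a => a) (by
        rw [deformCoeff_of_irr hT n (of_mem_spanOn (X := Irr S) hv), starSeries_apply,
          transferSeries_of_irr hprec hφ hc _ n hv h, proj_mul_factors h, add_zero]
        split_ifs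
        · rfl
        · exact (map_zero _).symm))
    · obtain ⟨x, q, hx, hq⟩ := QPath.exists_head u hu0
      obtain ⟨z, hz1, hz2⟩ := hq.assoc h
      have hzp : prec z p := hprec.of_factors_right hz2 (by omega)
      rw [starSeries_assoc hprec hφ hc n hx hu hq, ← of_mul_factors hz2, deformCoeff_mul hS, map_sum]
      refine Finset.sum_congr rfl fun ij _ => ?_
      rw [ih z hzp q v (Irr.right hu hq) hv hz1]
      -- The terms `v'` of the normal form of `z` are at most `z`, so `x v'` is at most `p` and
      -- everything below `x v'` is known. The case of an arrow therefore applies, even when `x v' =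
      -- p`.
      refine eq_of_spanOn (deformCoeff_mem_le hS hprec hφ hf hT ij.2 z)
        (starSeries φ (fun s => proj φ (f s)) ij.1 (proj φ (of k x)) ∘ₗ (proj φ).toLinearMap)
        ((proj φ).toLinearMap ∘ₗ deformCoeff hT ij.1 ∘ₗ LinearMap.mulLeft k (of k x))
        fun v' hv' => ?_
      obtain ⟨hle, hpar, hirr⟩ := hv'
      have hxv := QPath.factors_comp x v' (hz2.mid.trans hpar.1.symm)
      simp only [LinearMap.comp_apply, LinearMap.mulLeft_apply, of_mul_factors hxv]
      refine starSeries_arrow_of_forall hprec hφ hc hf hT hx hirr hxv (fun p' hp' => ih p' ?_) _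
      rcases hle with rfl | hlt
      · rwa [← QPath.eq_of_factors hxv hz2]
      · exact hprec.trans _ _ _ hp' (hprec.mul_left _ _ _ _ _ hxv hz2 hlt)

/-- For composable irreducible paths this is `starSeries_factors`; bilinearity does the rest, once
both sides are seen to vanish on paths that cannot be concatenated. -/
theorem starSeries_eq (n : ℕ) (a b : QuotAlg φ) :
    starSeries φ (fun s => proj φ (f s)) n a b =
      proj φ (deformCoeff hT n (irrSection φ a * irrSection φ b)) := by
  have hne : ∀ u v n, u ∈ Irr S → QPath.tgt u ≠ QPath.src v →
      starSeries φ (fun s => proj φ (f s)) n (proj φ (of k u)) (proj φ (of k v)) = 0 := by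
    intro u v n hu h
    induction u using QPath.head_induction generalizing n with
    | h0 i =>
      rw [starSeries_apply, (Normalized₂.transferSeries hprec hφ hc _ n).left,
        proj_mul_eq_zero h, ite_self, add_zero]
    | hs x q u hx hq ih =>
      rw [starSeries_assoc hprec hφ hc n hx hu hq]
      refine Finset.sum_eq_zero fun ij _ => ?_
      rw [ih _ (Irr.right hu hq) (hq.tgt ▸ h), map_zero]
  have h1 : ∀ u ∈ Irr S, starSeries φ (fun s => proj φ (f s)) n (proj φ (of k u)) b =
      proj φ (deformCoeff hT n (of k u * irrSection φ b)) := fun u hu => by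
    refine LinearMap.congr_fun (hc.quot_ext
      (g := (proj φ).toLinearMap ∘ₗ deformCoeff hT n ∘ₗ LinearMap.mulLeft k (of k u) ∘ₗ
        irrSection φ) fun v hv => ?_) b
    simp only [LinearMap.comp_apply, LinearMap.mulLeft_apply, hc.irrSection_of hv]
    by_cases h : u.tgt = v.src
    · have huv := QPath.factors_comp u v h
      rw [of_mul_factors huv]
      exact starSeries_factors hprec hφ hc hf hT _ u v hu hv huv n
    · rw [hne u v n hu h, of_mul_eq_zero h, map_zero, map_zero]
  refine LinearMap.congr_fun (hc.quot_ext (f := (starSeries φ (fun s => proj φ (f s)) n).flip b)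
    (g := (proj φ).toLinearMap ∘ₗ deformCoeff hT n ∘ₗ LinearMap.mulRight k (irrSection φ b) ∘ₗ
      irrSection φ) fun v hv => ?_) a
  simp only [LinearMap.comp_apply, LinearMap.mulRight_apply, hc.irrSection_of hv]
  exact h1 v hv

/-- The left side is the degree `n + 1` part of `x ⋆ (s' ⋆ r) - (φ_s + t f_s) ⋆ r`. By
`starSeries_eq` the two terms are the normal forms of `w` and of `(φ_s + t f_s) r`. -/
theorem mc_overlap (n : ℕ) {x s' r w : QPath V} {s : S} (h : Overlap x s' s r w) :
    (if n = 0 then evalCochain (k := k) (W := amb S 2) (fun s : S => proj φ (f s))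
      (overlapDiff φ x s' s r) else 0) -
      evalF2 (transferDefect φ (fun s => proj φ (f s)) (n + 1)) (overlapDiff φ x s' s r) =
    proj φ (polyCoeff (n + 1) (redInf (deform φ f) (of _ w) -
      redInf (deform φ f) (deform φ f s * of _ r))) := by
  have hS := hc.isReductionSet
  have hf' := mem_coch_of_cochPrec hf
  have hT : RedTerminates (deform φ f) := redTerminates_of_prec hS hprec (deform_mem hφ hf)
  have hrs : ∀ {y : PathAlgebra k V} {q : QPath V} (n : ℕ), y ∈ irrMod k S → q ∈ Irr S →
      starSeries φ (fun s => proj φ (f s)) n (proj φ y) (proj φ (of k q)) =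
        proj φ (deformCoeff hT n (y * of k q)) := fun n hy hq => by
    rw [starSeries_eq hprec hφ hc hf hT, hc.irrSection_proj_of_mem hy, hc.irrSection_of hq]
  obtain ⟨z, hz1, hz2⟩ := h.factors_left.assoc h.factors
  rw [evalCochain_overlapDiff hprec hφ hc
    (fun s => by rw [← map_mul, idPath_mul_coch hf'])
    (fun s => by rw [← map_mul, coch_mul_idPath hf']) n h, map_sub, polyCoeff_redInf_rel hT,
    if_neg n.succ_ne_zero, Nat.add_sub_cancel, map_sub, map_add, ← sub_sub]
  congr 1
  · congr 1
    · rw [← mapCoeff_of Polynomial.C, ← deformCoeff_apply hT, ← of_mul_factors hz2,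
        deformCoeff_mul hS, map_sum]
      refine Finset.sum_congr rfl fun ij _ => ?_
      rw [hrs _ (of_mem_spanOn (X := Irr S) h.irr_left) h.irr_right, of_mul_factors hz1,
        starSeries_eq hprec hφ hc hf hT, hc.irrSection_of (hS.irr_of_length_le_one h.length_eq.le),
        hc.irrSection_proj_of_mem (deformCoeff_mem hT _ _)]
    · exact hrs _ (coch_mem_irr hc.mem_coch s) h.irr_right
  · exact hrs _ (coch_mem_irr hf' s) h.irr_right

end StarProduct

/-! ### Counting unordered decompositions -/

section Halves

theorem mem_halves {n : ℕ} {X Y : Finset (Fin n)} :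
    Y ∈ halves X ↔ Y ⊆ X ∧ Y ≠ X ∧ ∃ i ∈ Y, ∀ j ∈ X, i ≤ j := by
  simp [halves]

theorem card_lt_of_mem_halves {n : ℕ} {X Y : Finset (Fin n)} (h : Y ∈ halves X) :
    Y.card < X.card := by
  obtain ⟨h1, h2, -⟩ := mem_halves.mp h
  exact Finset.card_lt_card (Finset.ssubset_iff_subset_ne.mpr ⟨h1, h2⟩)

theorem card_sdiff_lt_of_mem_halves {n : ℕ} {X Y : Finset (Fin n)} (h : Y ∈ halves X) :
    (X \ Y).card < X.card := by
  obtain ⟨h1, -, i, hi, -⟩ := mem_halves.mp h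
  refine Finset.card_lt_card (Finset.ssubset_iff_subset_ne.mpr ⟨Finset.sdiff_subset, fun e => ?_⟩)
  have := h1 hi
  rw [← e] at this
  exact (Finset.mem_sdiff.mp this).2 hi

/-- Removing the smallest element identifies the halves of `X` with the proper subsets of the
remaining `X.card - 1` elements. -/
theorem sum_halves {M : Type*} [AddCommMonoid M] {n : ℕ} (X : Finset (Fin n)) (F : ℕ → M) :
    ∑ Y ∈ halves X, F Y.card =
      ∑ i ∈ Finset.range (X.card - 1), (X.card - 1).choose i • F (i + 1) := by
  rcases X.eq_empty_or_nonempty with rfl | hX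
  · have : halves (∅ : Finset (Fin n)) = ∅ := Finset.eq_empty_of_forall_notMem fun Y hY =>
      absurd (card_lt_of_mem_halves hY) (by simp)
    rw [this]
    simp
  · set a := X.min' hX with ha
    have haX : a ∈ X := X.min'_mem hX
    have hcard : (X.erase a).card = X.card - 1 := Finset.card_erase_of_mem haX
    have h1 : ∑ Y ∈ halves X, F Y.card =
        ∑ Z ∈ (X.erase a).powerset.erase (X.erase a), F (Z.card + 1) := by
      refine Finset.sum_bij' (fun Y _ => Y.erase a) (fun Z _ => insert a Z) ?_ ?_ ?_ ?_ ?_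
      · intro Y hY
        obtain ⟨h1, h2, i, hi, hi'⟩ := mem_halves.mp hY
        have hia : i = a := le_antisymm (hi' a haX) (X.min'_le i (h1 hi))
        rw [hia] at hi
        rw [Finset.mem_erase, Finset.mem_powerset]
        refine ⟨fun e => h2 ?_, Finset.erase_subset_erase a h1⟩
        rw [← Finset.insert_erase hi, e, Finset.insert_erase haX]
      · intro Z hZ
        rw [Finset.mem_erase, Finset.mem_powerset] at hZ
        have haZ : a ∉ Z := fun h => (Finset.mem_erase.mp (hZ.2 h)).1 rfl
        refine mem_halves.mpr ⟨?_, ?_, a, Finset.mem_insert_self a Z, fun j hj => X.min'_le j hj⟩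
        · exact Finset.insert_subset haX (hZ.2.trans (Finset.erase_subset a X))
        · intro e
          exact hZ.1 (by rw [← e, Finset.erase_insert haZ])
      · intro Y hY
        obtain ⟨h1, h2, i, hi, hi'⟩ := mem_halves.mp hY
        have hia : i = a := le_antisymm (hi' a haX) (X.min'_le i (h1 hi))
        exact Finset.insert_erase (hia ▸ hi)
      · intro Z hZ
        rw [Finset.mem_erase, Finset.mem_powerset] at hZ
        exact Finset.erase_insert fun h => (Finset.mem_erase.mp (hZ.2 h)).1 rfl
      · intro Y hY
        obtain ⟨h1, h2, i, hi, hi'⟩ := mem_halves.mp hY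
        have hia : i = a := le_antisymm (hi' a haX) (X.min'_le i (h1 hi))
        rw [Finset.card_erase_add_one (hia ▸ hi)]
    rw [h1]
    have h3 : (X.erase a).powerset.erase (X.erase a) =
        (Finset.range (X.card - 1)).biUnion fun i => (X.erase a).powersetCard i := by
      ext Z
      simp only [Finset.mem_erase, Finset.mem_powerset, Finset.mem_biUnion, Finset.mem_range,
        Finset.mem_powersetCard]
      constructor
      · rintro ⟨h, h'⟩
        have := Finset.card_lt_card (Finset.ssubset_iff_subset_ne.mpr ⟨h', h⟩)
        exact ⟨_, hcard ▸ this, h', rfl⟩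
      · rintro ⟨i, hi, h', rfl⟩
        refine ⟨fun e => ?_, h'⟩
        rw [e, hcard] at hi
        exact lt_irrefl _ hi
    rw [h3, Finset.sum_biUnion]
    · refine Finset.sum_congr rfl fun i _ => ?_
      rw [Finset.sum_congr rfl fun Z hZ => by rw [(Finset.mem_powersetCard.mp hZ).2],
        Finset.sum_const, Finset.card_powersetCard, hcard]
    · intro i _ j _ hij
      exact Finset.disjoint_left.mpr fun Z hZ hZ' => hij
        ((Finset.mem_powersetCard.mp hZ).2.symm.trans (Finset.mem_powersetCard.mp hZ').2)

end Halves

/-! ### Transferred brackets on equal arguments -/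

section TransferG

variable {k : Type u} [CommRing k] {V : Type v} [Quiver.{w} V] [Fintype V]
  {S : Set (QPath V)} {φ : S → PathAlgebra k V}

theorem gerst_nsmul {A : Type*} [Ring A] [Algebra k A] (n m : ℕ) (f g : C2 k A) :
    gerst (n • f) (m • g) = (n * m) • gerst f g := by
  have h : ∀ (n m : ℕ) (f g : C2 k A), circ (n • f) (m • g) = (n * m) • circ f g := by
    intro n m f g
    ext a b c
    simp only [circ_apply, LinearMap.smul_apply, map_nsmul, smul_smul, smul_sub, mul_comm]
  rw [gerst, gerst, h, h, mul_comm m n, ← smul_add, smul_neg]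

theorem dualH2_nsmul (n : ℕ) (g : C3 k (QuotAlg φ)) : dualH2 φ (n • g) = n • dualH2 φ g := by
  ext a b
  change evalBar3 (n • g) (homotopy2 φ (insert2 φ (a ⊗ₜ b))) =
    n • evalBar3 g (homotopy2 φ (insert2 φ (a ⊗ₜ b)))
  rw [← Nat.cast_smul_eq_nsmul k, evalBar3_smul, LinearMap.smul_apply, Nat.cast_smul_eq_nsmul]

theorem dualH2_add (g h : C3 k (QuotAlg φ)) : dualH2 φ (g + h) = dualH2 φ g + dualH2 φ h := by
  ext a b
  change evalBar3 (g + h) (homotopy2 φ (insert2 φ (a ⊗ₜ b))) = _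
  rw [evalBar3_add]
  rfl

theorem dualH2_sum {ι : Type*} (I : Finset ι) (g : ι → C3 k (QuotAlg φ)) :
    dualH2 φ (∑ i ∈ I, g i) = ∑ i ∈ I, dualH2 φ (g i) :=
  map_sum (⟨⟨dualH2 φ, dualH2_zero⟩, dualH2_add⟩ : C3 k (QuotAlg φ) →+ C2 k (QuotAlg φ)) g I

theorem dualF3_sum {ι : Type*} (I : Finset ι) (g : ι → C3 k (QuotAlg φ)) (x : amb S 3) :
    dualF3 φ (∑ i ∈ I, g i) x = ∑ i ∈ I, dualF3 φ (g i) x := by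
  have h0 : evalBar3 (0 : C3 k (QuotAlg φ)) = 0 := by
    rw [← zero_smul k (0 : C3 k (QuotAlg φ)), evalBar3_smul, zero_smul]
  exact map_sum (⟨⟨fun g => dualF3 φ g x, by rw [dualF3, h0]; rfl⟩, fun g h => by
    simp only [dualF3, evalBar3_add, LinearMap.add_apply]⟩ :
      C3 k (QuotAlg φ) →+ QuotAlg φ) g I

theorem dualF3_nsmul (n : ℕ) (g : C3 k (QuotAlg φ)) (x : amb S 3) :
    dualF3 φ (n • g) x = n • dualF3 φ g x := by
  rw [dualF3, ← Nat.cast_smul_eq_nsmul k, evalBar3_smul, LinearMap.smul_apply,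
    Nat.cast_smul_eq_nsmul, dualF3]

/-- With `m = X.card`, the number of halves times the two factorials is `(m - 1)! (i + 1)`. The
symmetric bracket contributes each composition twice, from `i` and from its mirror image, with
weights `i + 1` and `m - 1 - i` that add up to `m`; this gives `m!`. -/
theorem sum_halves_gerst (f : S → QuotAlg φ) {n : ℕ} (X : Finset (Fin n)) :
    ∑ Y ∈ halves X, gerst (Y.card.factorial • transferSeries φ f Y.card)
      ((X \ Y).card.factorial • transferSeries φ f (X \ Y).card) =
    X.card.factorial • transferDefect φ f X.card := by
  set m := X.card with hm
  set β := transferSeries φ f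
  have h1 : ∀ Y ∈ halves X, gerst (Y.card.factorial • β Y.card)
      ((X \ Y).card.factorial • β (X \ Y).card) =
      (Y.card.factorial * (m - Y.card).factorial) • gerst (β Y.card) (β (m - Y.card)) := by
    intro Y hY
    rw [gerst_nsmul, Finset.card_sdiff_of_subset (mem_halves.mp hY).1]
  rw [Finset.sum_congr rfl h1, sum_halves X fun i => (i.factorial * (m - i).factorial) •
    gerst (β i) (β (m - i)), ← hm]
  have h2 : ∀ i ∈ Finset.range (m - 1), (m - 1).choose i •
      ((i + 1).factorial * (m - (i + 1)).factorial) • gerst (β (i + 1)) (β (m - (i + 1))) =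
      ((m - 1).factorial * (i + 1)) • gerst (β (i + 1)) (β (m - 1 - i)) := by
    intro i hi
    rw [Finset.mem_range] at hi
    rw [smul_smul, show m - (i + 1) = m - 1 - i by omega, Nat.factorial_succ,
      ← Nat.choose_mul_factorial_mul_factorial hi.le]
    congr 1
    ring
  rw [Finset.sum_congr rfl h2]
  simp only [gerst, smul_neg, smul_add, Finset.sum_neg_distrib, Finset.sum_add_distrib]
  rw [← Finset.sum_range_reflect (fun i => ((m - 1).factorial * (i + 1)) •
    circ (β (m - 1 - i)) (β (i + 1))), ← Finset.sum_add_distrib, transferDefect, smul_neg,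
    Finset.smul_sum, ← Finset.sum_range fun i =>
      m.factorial • circ (transferSeries φ f (i + 1)) (transferSeries φ f (m - 1 - i))]
  congr 1
  refine Finset.sum_congr rfl fun i hi => ?_
  rw [Finset.mem_range] at hi
  rw [show m - 1 - 1 - i + 1 = m - 1 - i by omega,
    show m - 1 - (m - 1 - 1 - i) = i + 1 by omega, ← add_smul, ← mul_add,
    show i + 1 + (m - 1 - i) = m by omega, mul_comm, Nat.mul_factorial_pred (by omega)]

theorem transferDefect_one (f : S → QuotAlg φ) : transferDefect φ f 1 = 0 :=
  neg_eq_zero.mpr Finset.sum_empty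

theorem transferGAux_const (f : S → QuotAlg φ) {n : ℕ} (m : ℕ) (X : Finset (Fin n))
    (hX : X.card ≤ m) : transferGAux φ (fun _ => f) m X =
      X.card.factorial • transferSeries φ f X.card := by
  induction m generalizing X with
  | zero =>
    rw [Nat.le_zero.mp hX, transferSeries_zero, smul_zero]
    rfl
  | succ m ih =>
    rw [transferGAux]
    split_ifs with h1
    · rw [Finset.sum_const, h1, transferSeries_eq, transferDefect_one, dualH2_zero, if_pos rfl,
        add_zero, Nat.factorial_one]
    · have h2 : ∀ Y ∈ halves X, dualH2 φ (gerst (transferGAux φ (fun _ => f) m Y)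
          (transferGAux φ (fun _ => f) m (X \ Y))) =
          dualH2 φ (gerst (Y.card.factorial • transferSeries φ f Y.card)
            ((X \ Y).card.factorial • transferSeries φ f (X \ Y).card)) := fun Y hY => by
        have e1 := card_lt_of_mem_halves hY
        have e2 := card_sdiff_lt_of_mem_halves hY
        rw [ih Y (by omega), ih (X \ Y) (by omega)]
      rw [Finset.sum_congr rfl h2, ← dualH2_sum, sum_halves_gerst, dualH2_nsmul, transferSeries_eq,
        if_neg h1, zero_add]

theorem bracket_const (f : S → QuotAlg φ) (n : ℕ) (hn : n ≠ 1) (x : amb S 3) :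
    bracket φ n (fun _ => f) x = n.factorial • dualF3 φ (transferDefect φ f n) x := by
  rw [bracket, if_neg hn]
  have h : ∀ Y ∈ halves (Finset.univ : Finset (Fin n)), dualF3 φ (gerst
      (transferG φ (fun _ => f) Y) (transferG φ (fun _ => f) Yᶜ)) x =
      dualF3 φ (gerst (Y.card.factorial • transferSeries φ f Y.card)
        ((Finset.univ \ Y).card.factorial • transferSeries φ f (Finset.univ \ Y).card)) x :=
    fun Y _ => by
      rw [transferG, transferG, transferGAux_const f _ _ le_rfl, transferGAux_const f _ _ le_rfl,
        Finset.compl_eq_univ_sdiff]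
  rw [Finset.sum_congr rfl h, ← dualF3_sum, sum_halves_gerst, Finset.card_univ, Fintype.card_fin]
  rw [dualF3_nsmul]

end TransferG

/-! ### Maurer-Cartan terms as coefficients of the obstruction -/

section MaurerCartanTerm

variable {k : Type u} [Field k] [CharZero k] {V : Type v} [Quiver.{w} V] [Fintype V]
  {S : Set (QPath V)} {φ f : S → PathAlgebra k V} {prec : QPath V → QPath V → Prop}

/-- The difference of two normal forms of the overlap `w = s r`. -/
def obstruction {B : Type*} [CommRing B] (ψ : S → PathAlgebra B V) (s : S) (r w : QPath V) :
    PathAlgebra B V :=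
  redInf ψ (of B w) - redInf ψ (ψ s * of B r)

theorem obstruction_mem {B : Type*} [CommRing B] (ψ : S → PathAlgebra B V) (s : S) (r w : QPath V) :
    obstruction ψ s r w ∈ irrMod B S := sub_mem (redInf_mem _ _) (redInf_mem _ _)

theorem obstruction_mem_parallel {B : Type*} [CommRing B] {ψ : S → PathAlgebra B V}
    (hS : IsReductionSet S) (hψ : ψ ∈ coch B S S) (hT : RedTerminates ψ) {s : S} {r w : QPath V}
    (h : QPath.Factors s r w) : obstruction ψ s r w ∈ spanOn B {p | p.Parallel w} := by
  refine sub_mem (redInf_mem_parallel hS hψ w) ?_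
  refine map_mem_of_spanOn (coch_mem_parallel hψ s) (redLin ψ hT ∘ₗ LinearMap.mulRight B (of B r))
    _ fun p hp => ?_
  have hpr := QPath.factors_comp p r (hp.2.trans h.mid)
  simp only [LinearMap.comp_apply, LinearMap.mulRight_apply, redLin_apply, of_mul_factors hpr]
  refine spanOn_mono (fun q hq => QPath.Parallel.trans hq ⟨?_, ?_⟩) (redInf_mem_parallel hS hψ _)
  · rw [hpr.src, hp.1, h.src]
  · rw [hpr.tgt, h.tgt]

/-- The unary bracket accounts for the first summand in `mc_overlap`, where `γ_1 = 0`. For higher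
`n` the factorials cancel and the sign of `F^3` matches. The idempotents of the generator act
trivially because the obstruction is parallel to `w`. -/
theorem mcTerm_eq (hprec : IsAdmissible prec) (hφ : φ ∈ cochPrec k S prec) (hc : Convergent φ)
    (hf : f ∈ cochPrec k S prec) (n : ℕ) {x s' r : QPath V} {s : S} (w : amb S 3)
    (h : Overlap x s' s r w) : mcTerm φ f w (n + 1) =
      proj φ (polyCoeff (n + 1) (obstruction (deform φ f) s r w)) := by
  have hS := hc.isReductionSet
  have hd := deform_mem hφ hf
  have h0 := mc_overlap hprec hφ hc hf n h
  have hpar : polyCoeff (n + 1) (obstruction (deform φ f) s r w) ∈ spanOn k {p | p.Parallel w} :=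
    polyCoeff_mem (obstruction_mem_parallel hS (mem_coch_of_cochPrec hd)
      (redTerminates_of_prec hS hprec hd) h.factors)
  have h1 : proj φ (polyCoeff (n + 1) (obstruction (deform φ f) s r w)) =
      proj φ (of k (QPath.idPath (w : QPath V).src)) *
        proj φ (polyCoeff (n + 1) (obstruction (deform φ f) s r w)) *
        proj φ (of k (QPath.idPath (w : QPath V).tgt)) := by
    rw [← map_mul, ← map_mul, idPath_mul_of_mem hpar fun _ hp => hp.1,
      mul_idPath_of_mem hpar fun _ hp => hp.2]
  rw [h1]
  change _ = _ * proj φ (polyCoeff (n + 1) (redInf (deform φ f) (of _ w) -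
      redInf (deform φ f) (deform φ f s * of _ r))) * _
  rw [← h0, mcTerm]
  cases n with
  | zero =>
    have e : evalF2 (transferDefect φ (fun s => proj φ (f s)) (0 + 1)) (overlapDiff φ x s' s r) =
        0 := by
      rw [zero_add, transferDefect_one, evalF2, ← zero_smul k (0 : C3 k (QuotAlg φ)),
        evalBar3_smul, zero_smul]
      rfl
    rw [e, sub_zero, if_pos rfl, bracket, if_pos rfl]
    have e2 : diff φ 2 (gen φ w) = _ := diff_two_tens hprec hφ hc w h
      (proj φ (of k (QPath.idPath (w : QPath V).src)))
      (proj φ (of k (QPath.idPath (w : QPath V).tgt)))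
    rw [Fin.sum_univ_one, zero_add, Nat.factorial_one, Nat.cast_one, inv_one, one_smul, e2]
    exact evalCochain_biact (k := k) (W := amb S 2) (fun s : S => proj φ (f s)) _ _ _
  | succ n =>
    rw [if_neg n.succ_ne_zero, zero_sub, bracket_const _ _ (by omega),
      ← Nat.cast_smul_eq_nsmul k, smul_smul, inv_mul_cancel₀, one_smul,
      dualF3_apply hprec hφ hc (Normalized₃.transferDefect hprec hφ hc _ _) w h, mul_neg, neg_mul]
    · rfl
    · exact Nat.cast_ne_zero.mpr (Nat.factorial_ne_zero _)

end MaurerCartanTerm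

/-! ### Multilinearity of the brackets -/

section Multilinear

variable {k : Type u} [CommRing k] {V : Type v} [Quiver.{w} V] [Fintype V]
  {S : Set (QPath V)} {φ : S → PathAlgebra k V}

theorem isLinearMap_sum {M M' ι : Type*} [AddCommGroup M] [Module k M] [AddCommGroup M']
    [Module k M'] (I : Finset ι) {F : ι → M → M'} (h : ∀ i ∈ I, IsLinearMap k (F i)) :
    IsLinearMap k fun x => ∑ i ∈ I, F i x :=
  ⟨fun x y => by
    rw [← Finset.sum_add_distrib]
    exact Finset.sum_congr rfl fun i hi => (h i hi).map_add x y,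
  fun c x => by
    rw [Finset.smul_sum]
    exact Finset.sum_congr rfl fun i hi => (h i hi).map_smul c x⟩

theorem isLinearMap_evalCochain {A W : Type*} [Ring A] [Algebra k A] (z : W →₀ A ⊗[k] A) :
    IsLinearMap k fun f : W → A => evalCochain f z := by
  have h : ∀ f : W → A, evalCochain f z = z.sum fun x y =>
      LinearMap.mul' k A (LinearMap.rTensor A (LinearMap.mulRight k (f x)) y) := fun _ => rfl
  simp only [h]
  refine isLinearMap_sum _ fun x _ => ⟨fun f g => ?_, fun c f => ?_⟩
  · beta_reduce
    rw [Pi.add_apply, ← LinearMap.comp_apply, ← LinearMap.comp_apply, ← LinearMap.comp_apply,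
      ← LinearMap.add_apply]
    refine LinearMap.congr_fun (TensorProduct.ext' fun a b => ?_) _
    simp [mul_add, add_mul]
  · beta_reduce
    rw [Pi.smul_apply, ← LinearMap.comp_apply, ← LinearMap.comp_apply, ← LinearMap.smul_apply]
    refine LinearMap.congr_fun (TensorProduct.ext' fun a b => ?_) _
    simp

theorem isLinearMap_dualG2 : IsLinearMap k (dualG2 φ) :=
  ⟨fun f g => by
    ext a b
    exact (isLinearMap_evalCochain (W := amb S 2) _).map_add f g,
  fun c f => by
    ext a b
    exact (isLinearMap_evalCochain (W := amb S 2) _).map_smul c f⟩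

theorem isLinearMap_dualH2 : IsLinearMap k (dualH2 φ) :=
  ⟨dualH2_add, fun c g => by
    ext a b
    change evalBar3 (c • g) (homotopy2 φ (insert2 φ (a ⊗ₜ b))) = _
    rw [evalBar3_smul]
    rfl⟩

theorem isLinearMap_dualF3 (x : amb S 3) : IsLinearMap k fun g => dualF3 φ g x :=
  ⟨fun g h => by simp only [dualF3, evalBar3_add, LinearMap.add_apply],
    fun c g => by simp only [dualF3, evalBar3_smul, LinearMap.smul_apply]⟩

theorem isLinearMap_gerst_left {A : Type*} [Ring A] [Algebra k A] (g : C2 k A) :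
    IsLinearMap k fun f => gerst f g :=
  ⟨fun f f' => by
    ext a b c
    simp only [gerst, LinearMap.neg_apply, LinearMap.add_apply, circ_apply, map_add]
    abel,
  fun c f => by
    ext a b d
    simp only [gerst, LinearMap.neg_apply, LinearMap.add_apply, circ_apply, map_smul,
      LinearMap.smul_apply, ← smul_sub, ← smul_add, smul_neg]⟩

theorem gerst_comm {A : Type*} [Ring A] [Algebra k A] (f g : C2 k A) : gerst f g = gerst g f := by
  rw [gerst, gerst, add_comm]

theorem transferGAux_congr {n : ℕ} {f g : Fin n → S → QuotAlg φ} (m : ℕ) (X : Finset (Fin n))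
    (h : ∀ i ∈ X, f i = g i) : transferGAux φ f m X = transferGAux φ g m X := by
  induction m generalizing X with
  | zero => rfl
  | succ m ih =>
    rw [transferGAux, transferGAux]
    split_ifs
    · exact Finset.sum_congr rfl fun i hi => by rw [h i hi]
    · refine Finset.sum_congr rfl fun Y hY => ?_
      rw [ih Y fun i hi => h i ((mem_halves.mp hY).1 hi),
        ih (X \ Y) fun i hi => h i (Finset.sdiff_subset hi)]

/-- The index `i` lies in exactly one of `Y` and `X \ Y`, so one argument of the bracket is linear
in `x` and the other one is constant. -/
theorem isLinearMap_gerst_halves {n : ℕ} {f : Fin n → S → QuotAlg φ} {i : Fin n}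
    {X : Finset (Fin n)} (hi : i ∈ X) (G : (Fin n → S → QuotAlg φ) → Finset (Fin n) → C2 k (QuotAlg φ))
    (hG : ∀ Y, (i ∈ Y → IsLinearMap k fun x => G (Function.update f i x) Y) ∧
      (i ∉ Y → ∀ x, G (Function.update f i x) Y = G f Y)) (Y : Finset (Fin n)) :
    IsLinearMap k fun x => gerst (G (Function.update f i x) Y) (G (Function.update f i x) (X \ Y)) := by
  by_cases h : i ∈ Y
  · have h' : i ∉ X \ Y := fun h' => (Finset.mem_sdiff.mp h').2 h
    simp only [(hG _).2 h']
    exact ((isLinearMap_gerst_left _).mk' _ ∘ₗ ((hG _).1 h).mk' _).isLinear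
  · have h' : i ∈ X \ Y := Finset.mem_sdiff.mpr ⟨hi, h⟩
    simp only [(hG _).2 h, gerst_comm (G f Y)]
    exact ((isLinearMap_gerst_left _).mk' _ ∘ₗ ((hG _).1 h').mk' _).isLinear

theorem isLinearMap_transferGAux {n : ℕ} (f : Fin n → S → QuotAlg φ) (i : Fin n) (m : ℕ)
    (X : Finset (Fin n)) (hi : i ∈ X) :
    IsLinearMap k fun x => transferGAux φ (Function.update f i x) m X := by
  induction m generalizing X with
  | zero => exact (0 : (S → QuotAlg φ) →ₗ[k] C2 k (QuotAlg φ)).isLinear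
  | succ m ih =>
    simp only [transferGAux]
    by_cases hX : X.card = 1
    · obtain ⟨j, rfl⟩ := Finset.card_eq_one.mp hX
      obtain rfl := Finset.mem_singleton.mp hi
      simp only [if_pos hX, Finset.sum_singleton, Function.update_self]
      exact isLinearMap_dualG2
    · simp only [if_neg hX]
      refine isLinearMap_sum _ fun Y _ => ?_
      have := isLinearMap_gerst_halves (f := f) hi (fun f Y => transferGAux φ f m Y)
        (fun Y => ⟨ih Y, fun h x => transferGAux_congr m Y fun j hj =>
          Function.update_of_ne (ne_of_mem_of_not_mem hj h) x f⟩) Y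
      exact (isLinearMap_dualH2.mk' _ ∘ₗ this.mk' _).isLinear

theorem isLinearMap_bracket {n : ℕ} (f : Fin n → S → QuotAlg φ) (i : Fin n) (x : amb S 3) :
    IsLinearMap k fun y => bracket φ n (Function.update f i y) x := by
  simp only [bracket]
  by_cases hn : n = 1
  · subst hn
    obtain rfl := Subsingleton.elim 0 i
    simp only [if_pos, Fin.sum_univ_one, Function.update_self]
    exact isLinearMap_evalCochain (W := amb S 2) _
  · simp only [if_neg hn, Finset.compl_eq_univ_sdiff]
    refine isLinearMap_sum _ fun Y _ => ?_
    have := isLinearMap_gerst_halves (f := f) (Finset.mem_univ i) (fun f Y => transferG φ f Y)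
      (fun Y => ⟨isLinearMap_transferGAux f i _ Y, fun h x => transferGAux_congr _ Y fun j hj =>
        Function.update_of_ne (ne_of_mem_of_not_mem hj h) x f⟩) Y
    exact ((isLinearMap_dualF3 x).mk' _ ∘ₗ this.mk' _).isLinear

/-- The bracket as a multilinear map. -/
def bracketMultilinear (φ : S → PathAlgebra k V) (n : ℕ) (x : amb S 3) :
    MultilinearMap k (fun _ : Fin n => S → QuotAlg φ) (QuotAlg φ) where
  toFun f := bracket φ n f x
  map_update_add' f i y z := by
    convert (isLinearMap_bracket f i x).map_add y z
  map_update_smul' f i c y := by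
    convert (isLinearMap_bracket f i x).map_smul c y

theorem bracket_sum_smul {N : ℕ} (b : Fin N → S → QuotAlg φ) (a : Fin N → k) (n : ℕ) (x : amb S 3) :
    bracket φ n (fun _ => ∑ i, a i • b i) x =
      ∑ r : Fin n → Fin N, (∏ j, a (r j)) • bracket φ n (fun j => b (r j)) x := by
  change bracketMultilinear φ n x (fun _ => ∑ i, a i • b i) = _
  rw [MultilinearMap.map_sum]
  exact Finset.sum_congr rfl fun r _ => MultilinearMap.map_smul_univ _ _ _

end Multilinear

/-! ### The generic point and its specialisations -/

section Universal

variable {k : Type u} [Field k] {V : Type v} [Quiver.{w} V] [Fintype V]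
  {S : Set (QPath V)} {φ : S → PathAlgebra k V} {prec : QPath V → QPath V → Prop}
  {N : ℕ} {b : Fin N → S → PathAlgebra k V}

omit [Fintype V] in
theorem baseChange_eq_mapCoeff (B : Type u) [CommRing B] [Algebra k B] (x : PathAlgebra k V) :
    baseChange B x = mapCoeff (algebraMap k B) x := rfl

theorem pointOver_mem (hφ : φ ∈ cochPrec k S prec) (hb : ∀ i, b i ∈ cochPrec k S prec)
    (B : Type u) [CommRing B] [Algebra k B] (x : Fin N → B) :
    pointOver φ b B x ∈ cochPrec B S prec := by
  have h : ∀ f ∈ cochPrec k S prec, (fun s => baseChange B (f s)) ∈ cochPrec B S prec :=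
    fun f hf s p hp => hf s p fun h => hp (by
      beta_reduce
      rw [baseChange_eq_mapCoeff, coeff_mapCoeff, h, map_zero])
  have e : pointOver φ b B x = (fun s => baseChange B (φ s)) +
      ∑ i, x i • fun s => baseChange B (b i s) := by
    ext1 s
    rw [pointOver, Pi.add_apply, Finset.sum_apply]
    rfl
  rw [e]
  exact add_mem (h φ hφ) (Submodule.sum_mem _ fun i _ => Submodule.smul_mem _ _ (h _ (hb i)))

theorem pointOver_self (a : Fin N → k) :
    pointOver φ b k a = φ + fun s => ∑ i, a i • b i s := by
  have h : ∀ x : PathAlgebra k V, baseChange k x = x := fun x => ext_coeff fun _ => rfl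
  ext1 s
  simp only [pointOver, h, Pi.add_apply]

theorem mapCoeff_pointOver {B C : Type u} [CommRing B] [Algebra k B] [CommRing C] [Algebra k C]
    (σ : B →ₐ[k] C) (x : Fin N → B) (s : S) :
    mapCoeff (σ : B →+* C) (pointOver φ b B x s) = pointOver φ b C (fun i => σ (x i)) s := by
  have h : ∀ y : PathAlgebra k V, mapCoeff (σ : B →+* C) (baseChange B y) = baseChange C y :=
    fun y => by
      rw [baseChange_eq_mapCoeff, baseChange_eq_mapCoeff, mapCoeff_mapCoeff, σ.comp_algebraMap]
  rw [pointOver, pointOver, map_add, map_sum, h]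
  simp only [mapCoeff_smul, h]
  rfl

theorem obstruction_mapCoeff {B C : Type*} [CommRing B] [CommRing C] (σ : B →+* C)
    {ψ : S → PathAlgebra B V} (hT : RedTerminates ψ) (s : S) (r w : QPath V) :
    obstruction (fun s => mapCoeff σ (ψ s)) s r w = mapCoeff σ (obstruction ψ s r w) := by
  rw [obstruction, obstruction, map_sub, ← redInf_mapCoeff σ hT, ← redInf_mapCoeff σ hT,
    mapCoeff_mul, mapCoeff_of, mapCoeff_of]

theorem systemUnique_iff_obstruction {B : Type*} [CommRing B] {ψ : S → PathAlgebra B V}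
    (hS : IsReductionSet S) (hprec : IsAdmissible prec) (hψ : ψ ∈ cochPrec B S prec) :
    SystemUnique ψ ↔ ∀ x s' s r w, Overlap x s' s r w → obstruction ψ s r w = 0 := by
  simp only [systemUnique_iff_overlaps hS hprec hψ, obstruction, sub_eq_zero]

theorem sum_smul_mem_cochPrec (hb : ∀ i, b i ∈ cochPrec k S prec) (a : Fin N → k) :
    (fun s => ∑ i, a i • b i s) ∈ cochPrec k S prec := by
  have : (fun s => ∑ i, a i • b i s) = ∑ i, a i • b i := by
    ext1 s
    rw [Finset.sum_apply]
    rfl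
  rw [this]
  exact Submodule.sum_mem _ fun i _ => Submodule.smul_mem _ _ (hb i)

theorem exists_polyCoeff_eq_zero (z : PathAlgebra (Polynomial k) V) :
    ∃ m, ∀ n ≥ m, polyCoeff n z = 0 := by
  induction z using induct with
  | h0 => exact ⟨0, fun n _ => map_zero _⟩
  | ha x y hx hy =>
    obtain ⟨m, hm⟩ := hx
    obtain ⟨m', hm'⟩ := hy
    exact ⟨max m m', fun n hn => by
      rw [map_add, hm n (le_of_max_le_left hn), hm' n (le_of_max_le_right hn), add_zero]⟩
  | hs g p =>
    exact ⟨g.natDegree + 1, fun n hn => by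
      rw [polyCoeff_smul_of, Polynomial.coeff_eq_zero_of_natDegree_lt hn, zero_smul]⟩

theorem obstruction_eq_zero (hc : Convergent φ) {x s' r w : QPath V} {s : S}
    (h : Overlap x s' s r w) : obstruction φ s r w = 0 := by
  rw [obstruction, sub_eq_zero, ← hc.proj_eq_iff, map_mul, ← Convergent.proj_rel, ← map_mul,
    of_mul_factors h.factors]

/-- Restricting a polynomial to the line through `0` and `a` separates its homogeneous components by
powers of the parameter. This relates the grading by `t` to the degree in the coordinates. -/
theorem coeff_aeval_C_mul_X (a : Fin N → k) (P : MvPolynomial (Fin N) k) (n : ℕ) :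
    (MvPolynomial.aeval (fun i => Polynomial.C (a i) * Polynomial.X) P).coeff n =
      MvPolynomial.eval a (MvPolynomial.homogeneousComponent n P) := by
  induction P using MvPolynomial.induction_on' with
  | monomial d c =>
    rw [MvPolynomial.homogeneousComponent_of_mem
      (MvPolynomial.isHomogeneous_monomial c (rfl : d.degree = d.degree)), MvPolynomial.aeval_monomial,
      Finsupp.prod]
    simp only [mul_pow, Finset.prod_mul_distrib, Finset.prod_pow_eq_pow_sum, ← Polynomial.C_pow,
      ← map_prod]
    rw [Polynomial.algebraMap_eq, ← mul_assoc, ← Polynomial.C_mul, Polynomial.coeff_C_mul_X_pow]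
    split_ifs with h1 h2 h2
    · rw [MvPolynomial.eval_monomial, Finsupp.prod]
    · exact absurd h1 h2
    · exact absurd h2 h1
    · rw [map_zero]
  | add p q hp hq => rw [map_add, Polynomial.coeff_add, hp, hq, map_add, map_add]

theorem deform_eq_pointOver (a : Fin N → k) :
    deform φ (fun s => ∑ i, a i • b i s) =
      pointOver φ b (Polynomial k) fun i => Polynomial.C (a i) * Polynomial.X := by
  ext1 s
  rw [deform, pointOver, map_sum, Finset.smul_sum]
  congr 1
  refine Finset.sum_congr rfl fun i _ => ?_
  rw [mapCoeff_smul, smul_smul, mul_comm]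
  rfl

theorem eval_mcPolyDeg (a : Fin N → k) (w : amb S 3) (p : QPath V) (n : ℕ) :
    MvPolynomial.eval a (mcPolyDeg φ b w p n) =
      coeff p (irrSection φ (mcTerm φ (fun s => ∑ i, a i • b i s) w n)) := by
  have h : toQuot φ (fun s => ∑ i, a i • b i s) = ∑ i, a i • toQuot φ (b i) := by
    ext1 s
    rw [toQuot, map_sum, Finset.sum_apply]
    exact Finset.sum_congr rfl fun i _ => map_smul _ _ _
  rw [mcTerm, h, bracket_sum_smul, mcPolyDeg]
  simp only [map_sum, map_smul, Finset.smul_sum, map_mul, MvPolynomial.eval_C, map_prod,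
    MvPolynomial.eval_X, smul_eq_mul]
  exact Finset.sum_congr rfl fun r _ => by ring

variable (hprec : IsAdmissible prec) (hφ : φ ∈ cochPrec k S prec) (hc : Convergent φ)
  (hb : ∀ i, b i ∈ cochPrec k S prec)
include hprec hφ hc hb

/-- Every `B`-point is the image of the generic point under the evaluation of the variables at its
coordinates, and normal forms commute with this evaluation. -/
theorem obstruction_pointOver (B : Type u) [CommRing B] [Algebra k B] (x : Fin N → B) (s : S)
    (r w : QPath V) : obstruction (pointOver φ b B x) s r w =
      mapCoeff (MvPolynomial.aeval (R := k) x : MvPolynomial (Fin N) k →+* B)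
        (obstruction (pointOver φ b (MvPolynomial (Fin N) k) MvPolynomial.X) s r w) := by
  rw [← obstruction_mapCoeff _ (redTerminates_of_prec hc.isReductionSet hprec
    (pointOver_mem hφ hb _ _))]
  congr 1
  ext1 s
  rw [mapCoeff_pointOver]
  simp only [MvPolynomial.aeval_X]

end Universal

/-! ### The Maurer-Cartan polynomials define the variety -/

section MaurerCartanScheme

variable {k : Type u} [Field k] [CharZero k] {V : Type v} [Quiver.{w} V] [Fintype V]
  {S : Set (QPath V)} {φ : S → PathAlgebra k V} {prec : QPath V → QPath V → Prop}
  {N : ℕ} {b : Fin N → S → PathAlgebra k V}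

theorem finite_support_mcTerm (hprec : IsAdmissible prec) (hφ : φ ∈ cochPrec k S prec)
    (hc : Convergent φ) {f : S → PathAlgebra k V} (hf : f ∈ cochPrec k S prec) (w : amb S 3) :
    (Function.support fun n => mcTerm φ f w (n + 1)).Finite := by
  obtain ⟨x, s', s, r, h⟩ := (hc.isReductionSet.mem_amb_three w).mp w.2
  obtain ⟨m, hm⟩ := exists_polyCoeff_eq_zero (obstruction (deform φ f) s r w)
  refine (Set.finite_lt_nat m).subset fun n hn => Set.mem_ofPred.mpr (not_le.mp fun hmn => hn ?_)
  change mcTerm φ f w (n + 1) = 0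
  rw [mcTerm_eq hprec hφ hc hf n w h, hm (n + 1) (hmn.trans n.le_succ), map_zero]

variable (hprec : IsAdmissible prec) (hφ : φ ∈ cochPrec k S prec) (hc : Convergent φ)
  (hb : ∀ i, b i ∈ cochPrec k S prec)
include hprec hφ hc hb

theorem mcPolyDeg_eq (p : QPath V) (n : ℕ) {x s' r : QPath V} {s : S} (w : amb S 3)
    (h : Overlap x s' s r w) : mcPolyDeg φ b w p (n + 1) =
      MvPolynomial.homogeneousComponent (n + 1) (coeff p
        (obstruction (pointOver φ b (MvPolynomial (Fin N) k) MvPolynomial.X) s r w)) := by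
  -- A field of characteristic zero is infinite, so equality of polynomials may be tested on values.
  refine MvPolynomial.funext fun a => ?_
  have hf := sum_smul_mem_cochPrec hb a
  rw [eval_mcPolyDeg, mcTerm_eq hprec hφ hc hf n w h, hc.irrSection_proj_of_mem
    (polyCoeff_mem (obstruction_mem _ _ _ _)), coeff_polyCoeff, deform_eq_pointOver,
    obstruction_pointOver hprec hφ hc hb, coeff_mapCoeff, ← coeff_aeval_C_mul_X]
  rfl

theorem finite_support_mcPolyDeg (w : amb S 3) (p : QPath V) :
    (Function.support fun n => mcPolyDeg φ b w p (n + 1)).Finite := by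
  obtain ⟨x, s', s, r, h⟩ := (hc.isReductionSet.mem_amb_three w).mp w.2
  refine (Set.finite_lt_nat (MvPolynomial.totalDegree (coeff p (obstruction
    (pointOver φ b (MvPolynomial (Fin N) k) MvPolynomial.X) s r w)))).subset fun n hn =>
      Set.mem_ofPred.mpr (not_le.mp fun hmn => hn ?_)
  change mcPolyDeg φ b w p (n + 1) = 0
  rw [mcPolyDeg_eq hprec hφ hc hb p n w h, MvPolynomial.homogeneousComponent_eq_zero]
  exact Nat.lt_succ_of_le hmn

theorem mcPoly_eq (p : QPath V) {x s' r : QPath V} {s : S} (w : amb S 3)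
    (h : Overlap x s' s r w) : mcPoly φ b w p = coeff p
      (obstruction (pointOver φ b (MvPolynomial (Fin N) k) MvPolynomial.X) s r w) := by
  set P := coeff p (obstruction (pointOver φ b (MvPolynomial (Fin N) k) MvPolynomial.X) s r w)
    with hP
  -- The generic system specialises at the origin to `φ`, whose obstructions vanish. The missing
  -- constant term is consistent with the sum of brackets starting at degree one.
  have h0 : MvPolynomial.homogeneousComponent 0 P = 0 := by
    have e1 := obstruction_pointOver hprec hφ hc hb k (fun _ => (0 : k)) s r w
    have e2 : pointOver φ b k (fun _ => (0 : k)) = φ := by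
      rw [pointOver_self]
      simp only [zero_smul, Finset.sum_const_zero]
      exact add_zero φ
    rw [e2, obstruction_eq_zero hc h] at e1
    have e3 := congrArg (coeff p) e1
    rw [map_zero, coeff_mapCoeff] at e3
    rw [MvPolynomial.homogeneousComponent_zero, ← MvPolynomial.constantCoeff_eq]
    have e4 : MvPolynomial.aeval (fun _ => (0 : k)) P = MvPolynomial.constantCoeff P :=
      MvPolynomial.aeval_zero' P
    rw [← e4]
    exact (congrArg MvPolynomial.C e3.symm).trans (map_zero _)
  have h1 := MvPolynomial.sum_homogeneousComponent P
  rw [Finset.sum_range_succ', h0, add_zero] at h1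
  rw [mcPoly, finsum_eq_sum_of_support_subset (s := Finset.range P.totalDegree)]
  · exact (Finset.sum_congr rfl fun n _ => mcPolyDeg_eq hprec hφ hc hb p n w h).trans h1
  · intro n hn
    rw [Finset.coe_range, Set.mem_Iio]
    refine not_le.mp fun hmn => hn ?_
    change mcPolyDeg φ b w p (n + 1) = 0
    rw [mcPolyDeg_eq hprec hφ hc hb p n w h, MvPolynomial.homogeneousComponent_eq_zero]
    exact Nat.lt_succ_of_le hmn

theorem eval_mcPoly (a : Fin N → k) (w : amb S 3) (p : QPath V) :
    MvPolynomial.eval a (mcPoly φ b w p) =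
      coeff p (irrSection φ (∑ᶠ n, mcTerm φ (fun s => ∑ i, a i • b i s) w (n + 1))) := by
  have hf := sum_smul_mem_cochPrec hb a
  rw [mcPoly]
  have h1 := (MvPolynomial.eval a : MvPolynomial (Fin N) k →+* k).toAddMonoidHom.map_finsum
    (finite_support_mcPolyDeg hprec hφ hc hb w p)
  have h2 := (coeff p ∘ₗ irrSection φ).toAddMonoidHom.map_finsum
    (finite_support_mcTerm hprec hφ hc hf w)
  refine h1.trans (Eq.trans ?_ h2.symm)
  exact finsum_congr fun n => eval_mcPolyDeg a w p (n + 1)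

/-- Overlaps and elements of `S_3` correspond, and by `mcPoly_eq` the coefficients of the
obstruction at the `B`-point are the values of the generating polynomials. -/
theorem systemUnique_pointOver_iff (B : Type u) [CommRing B] [Algebra k B] (x : Fin N → B) :
    SystemUnique (pointOver φ b B x) ↔
      ∀ g ∈ mcIdeal φ b, MvPolynomial.aeval x g = 0 := by
  have hS := hc.isReductionSet
  rw [systemUnique_iff_obstruction hS hprec (pointOver_mem hφ hb B x)]
  have key : (∀ w p, MvPolynomial.aeval x (mcPoly φ b w p) = 0) ↔
      ∀ g ∈ mcIdeal φ b, MvPolynomial.aeval x g = 0 := by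
    constructor
    · intro h g hg
      have : mcIdeal φ b ≤ RingHom.ker (MvPolynomial.aeval (R := k) x).toRingHom :=
        Ideal.span_le.mpr (by
          rintro _ ⟨w, p, rfl⟩
          exact h w p)
      exact this hg
    · exact fun h w p => h _ (Ideal.subset_span ⟨w, p, rfl⟩)
  rw [← key]
  constructor
  · intro h w p
    obtain ⟨y, s', s, r, ho⟩ := (hS.mem_amb_three w).mp w.2
    have := congrArg (coeff p) (h y s' s r w ho)
    rw [obstruction_pointOver hprec hφ hc hb, coeff_mapCoeff, map_zero] at this
    rw [mcPoly_eq hprec hφ hc hb p w ho]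
    exact this
  · intro h y s' s r w ho
    refine ext_coeff fun p => ?_
    rw [obstruction_pointOver hprec hφ hc hb, coeff_mapCoeff, map_zero,
      ← mcPoly_eq hprec hφ hc hb p ⟨w, (hS.mem_amb_three w).mpr ⟨y, s', s, r, ho⟩⟩ ho]
    exact h _ p

theorem maurerCartan_iff (a : Fin N → k) :
    MaurerCartan φ (fun s => ∑ i, a i • b i s) ↔
      ∀ g ∈ mcIdeal φ b, MvPolynomial.eval a g = 0 := by
  have hf := sum_smul_mem_cochPrec hb a
  constructor
  · intro h g hg
    have : mcIdeal φ b ≤ RingHom.ker (MvPolynomial.eval a) :=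
      Ideal.span_le.mpr (by
        rintro _ ⟨w, p, rfl⟩
        change MvPolynomial.eval a _ = 0
        rw [eval_mcPoly hprec hφ hc hb, (h w).2, map_zero, map_zero])
    exact this hg
  · intro h w
    refine ⟨finite_support_mcTerm hprec hφ hc hf w, ?_⟩
    rw [← hc.proj_irrSection (∑ᶠ n, mcTerm φ (fun s => ∑ i, a i • b i s) w (n + 1))]
    have : irrSection φ (∑ᶠ n, mcTerm φ (fun s => ∑ i, a i • b i s) w (n + 1)) = 0 :=
      ext_coeff fun p => by
        rw [← eval_mcPoly hprec hφ hc hb, map_zero]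
        exact h _ (Ideal.subset_span ⟨w, p, rfl⟩)
    rw [this, map_zero]

end MaurerCartanScheme

/-! ### Path algebras over the dual numbers -/

section DualCoefficients

variable {k : Type u} [CommRing k] {V : Type v} [Quiver.{w} V] {S : Set (QPath V)}

/-- The inclusion `kQ → k[ε]Q`. -/
def constDual : PathAlgebra k V →+ PathAlgebra (DualNumber k) V :=
  mapCoeff (algebraMap k (DualNumber k))

/-- The map `x + ε y ↦ x`. -/
def fstDual : PathAlgebra (DualNumber k) V →+ PathAlgebra k V :=
  mapCoeff (TrivSqZeroExt.fstHom k k k : DualNumber k →+* k)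

/-- The map `x + ε y ↦ y`. -/
def sndDual : PathAlgebra (DualNumber k) V →+ PathAlgebra k V :=
  Finsupp.mapRange.addMonoidHom (TrivSqZeroExt.sndHom k k).toAddMonoidHom

theorem coeff_fstDual (p : QPath V) (x : PathAlgebra (DualNumber k) V) :
    coeff p (fstDual x) = (coeff p x).fst := rfl

theorem coeff_sndDual (p : QPath V) (x : PathAlgebra (DualNumber k) V) :
    coeff p (sndDual x) = (coeff p x).snd := rfl

theorem coeff_constDual (p : QPath V) (x : PathAlgebra k V) :
    coeff p (constDual x) = TrivSqZeroExt.inl (coeff p x) := rfl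

theorem dual_ext {x y : PathAlgebra (DualNumber k) V} (h : fstDual x = fstDual y)
    (h' : sndDual x = sndDual y) : x = y :=
  ext_coeff fun p => TrivSqZeroExt.ext (congrArg (coeff p) h) (congrArg (coeff p) h')

theorem fstDual_constDual (x : PathAlgebra k V) : fstDual (constDual x) = x :=
  ext_coeff fun p => by rw [coeff_fstDual, coeff_constDual, TrivSqZeroExt.fst_inl]

theorem sndDual_constDual (x : PathAlgebra k V) : sndDual (constDual x) = 0 :=
  ext_coeff fun p => by rw [coeff_sndDual, coeff_constDual, TrivSqZeroExt.snd_inl, map_zero]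

theorem fstDual_smul (c : DualNumber k) (x : PathAlgebra (DualNumber k) V) :
    fstDual (c • x) = c.fst • fstDual x :=
  ext_coeff fun p => by
    rw [coeff_fstDual, map_smul, map_smul, coeff_fstDual, smul_eq_mul, TrivSqZeroExt.fst_mul,
      smul_eq_mul]

theorem sndDual_smul (c : DualNumber k) (x : PathAlgebra (DualNumber k) V) :
    sndDual (c • x) = c.fst • sndDual x + c.snd • fstDual x :=
  ext_coeff fun p => by
    rw [coeff_sndDual, map_smul, map_add, map_smul, map_smul, coeff_sndDual, coeff_fstDual,
      smul_eq_mul, TrivSqZeroExt.snd_mul, smul_eq_mul, smul_eq_mul]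
    rfl

theorem fstDual_eps_smul (x : PathAlgebra (DualNumber k) V) :
    fstDual ((DualNumber.eps : DualNumber k) • x) = 0 := by
  rw [fstDual_smul, DualNumber.fst_eps, zero_smul]

theorem sndDual_eps_smul (x : PathAlgebra (DualNumber k) V) :
    sndDual ((DualNumber.eps : DualNumber k) • x) = fstDual x := by
  rw [sndDual_smul, DualNumber.fst_eps, DualNumber.snd_eps, zero_smul, one_smul, zero_add]

theorem eq_constDual_add (x : PathAlgebra (DualNumber k) V) :
    x = constDual (fstDual x) + (DualNumber.eps : DualNumber k) • constDual (sndDual x) := by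
  refine dual_ext ?_ ?_
  · rw [map_add, fstDual_eps_smul, fstDual_constDual, add_zero]
  · rw [map_add, sndDual_eps_smul, fstDual_constDual, sndDual_constDual, zero_add]

theorem constDual_mul (x y : PathAlgebra k V) : constDual (x * y) = constDual x * constDual y :=
  mapCoeff_mul _ x y

theorem constDual_of (p : QPath V) : constDual (of k p) = of (DualNumber k) p := mapCoeff_of _ p

theorem fstDual_of (p : QPath V) : fstDual (of (DualNumber k) p) = of k p := by
  rw [← constDual_of, fstDual_constDual]

theorem sndDual_of (p : QPath V) : sndDual (of (DualNumber k) p) = 0 := by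
  rw [← constDual_of, sndDual_constDual]

theorem fstDual_mul (x y : PathAlgebra (DualNumber k) V) :
    fstDual (x * y) = fstDual x * fstDual y := mapCoeff_mul _ x y

theorem sndDual_mul [Fintype V] (x y : PathAlgebra (DualNumber k) V) :
    sndDual (x * y) = fstDual x * sndDual y + sndDual x * fstDual y := by
  conv_lhs => rw [eq_constDual_add x, eq_constDual_add y]
  rw [add_mul, mul_add, mul_add, mul_smul_comm, smul_mul_assoc, smul_mul_assoc, mul_smul_comm,
    smul_smul, DualNumber.eps_mul_eps, zero_smul, add_zero, map_add, map_add, ← constDual_mul,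
    ← constDual_mul, ← constDual_mul, sndDual_eps_smul, sndDual_eps_smul, fstDual_constDual,
    fstDual_constDual, sndDual_constDual, zero_add]

theorem constDual_smul (c : k) (x : PathAlgebra k V) :
    constDual (c • x) = algebraMap k (DualNumber k) c • constDual x := mapCoeff_smul _ c x

theorem constDual_mem {X : Set (QPath V)} {x : PathAlgebra k V} (hx : x ∈ spanOn k X) :
    constDual x ∈ spanOn (DualNumber k) X := mapCoeff_mem hx

theorem fstDual_mem {X : Set (QPath V)} {x : PathAlgebra (DualNumber k) V}
    (hx : x ∈ spanOn (DualNumber k) X) : fstDual x ∈ spanOn k X := mapCoeff_mem hx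

theorem sndDual_mem {X : Set (QPath V)} {x : PathAlgebra (DualNumber k) V}
    (hx : x ∈ spanOn (DualNumber k) X) : sndDual x ∈ spanOn k X := fun p hp => hx p fun h => hp (by
  rw [coeff_sndDual, h, TrivSqZeroExt.snd_zero])

theorem snd_aeval_eps (P : Polynomial k) :
    (Polynomial.aeval (DualNumber.eps : DualNumber k) P).snd = P.coeff 1 := by
  induction P using Polynomial.induction_on' with
  | add p q hp hq => rw [map_add, TrivSqZeroExt.snd_add, hp, hq, Polynomial.coeff_add]
  | monomial n c =>
    rw [Polynomial.aeval_monomial, Polynomial.coeff_monomial]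
    match n with
    | 0 => simp [TrivSqZeroExt.algebraMap_eq_inl]
    | 1 => simp [TrivSqZeroExt.algebraMap_eq_inl]
    | n + 2 => rw [pow_add, pow_two, DualNumber.eps_mul_eps, mul_zero, mul_zero, if_neg (by omega),
        TrivSqZeroExt.snd_zero]

/-- The homomorphism `k[t] → k[ε]` with `t ↦ ε`. -/
def truncate (k : Type u) [CommRing k] : Polynomial k →+* DualNumber k :=
  (Polynomial.aeval (DualNumber.eps : DualNumber k) : Polynomial k →ₐ[k] DualNumber k)

theorem sndDual_truncate (z : PathAlgebra (Polynomial k) V) :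
    sndDual (mapCoeff (truncate k) z) = polyCoeff 1 z := ext_coeff fun _ => snd_aeval_eps _

theorem truncate_constPoly (x : PathAlgebra k V) :
    mapCoeff (truncate k) (mapCoeff Polynomial.C x) = constDual x := by
  rw [mapCoeff_mapCoeff]
  congr 1
  exact congrArg _ (RingHom.ext fun c => Polynomial.aeval_C _ c)

end DualCoefficients

/-! ### First order deformations and Hochschild cocycles -/

section FirstOrder

variable {k : Type u} [Field k] {V : Type v} [Quiver.{w} V] [Fintype V]
  {S : Set (QPath V)} {φ f : S → PathAlgebra k V} {prec : QPath V → QPath V → Prop}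

theorem dualPoint_apply (φ f : S → PathAlgebra k V) (s : S) :
    dualPoint φ f s = constDual (φ s) + (DualNumber.eps : DualNumber k) • constDual (f s) := rfl

theorem dualPoint_eq_truncate (φ f : S → PathAlgebra k V) :
    dualPoint φ f = fun s => mapCoeff (truncate k) (deform φ f s) := by
  ext1 s
  rw [dualPoint_apply, deform, map_add, mapCoeff_smul, truncate_constPoly, truncate_constPoly]
  congr 2
  exact (Polynomial.aeval_X _).symm

theorem dualPoint_mem (hφ : φ ∈ cochPrec k S prec) (hf : f ∈ cochPrec k S prec) :
    dualPoint φ f ∈ cochPrec (DualNumber k) S prec := by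
  rw [dualPoint_eq_truncate]
  intro s p hp
  exact deform_mem hφ hf s p fun h => hp (by
    beta_reduce
    rw [coeff_mapCoeff, h, map_zero])

theorem fstDual_dualPoint (s : S) : fstDual (dualPoint φ f s) = φ s := by
  rw [dualPoint_apply, map_add, fstDual_eps_smul, fstDual_constDual, add_zero]

theorem sndDual_dualPoint (s : S) : sndDual (dualPoint φ f s) = f s := by
  rw [dualPoint_apply, map_add, sndDual_eps_smul, sndDual_constDual, fstDual_constDual, zero_add]

theorem fstDual_redInf (hT : RedTerminates (dualPoint φ f)) (x : PathAlgebra (DualNumber k) V) :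
    fstDual (redInf (dualPoint φ f) x) = redInf φ (fstDual x) := by
  have e : (fun s => fstDual (dualPoint φ f s)) = φ := funext fstDual_dualPoint
  conv_rhs => rw [← e]
  exact (redInf_mapCoeff _ hT x).symm

theorem sndDual_redInf_constDual (hT : RedTerminates (deform φ f)) (x : PathAlgebra k V) :
    sndDual (redInf (dualPoint φ f) (constDual x)) = deformCoeff hT 1 x := by
  rw [dualPoint_eq_truncate, ← truncate_constPoly, redInf_mapCoeff _ hT, sndDual_truncate,
    deformCoeff_apply]

theorem sndDual_redInf (hT : RedTerminates (deform φ f)) (hT' : RedTerminates (dualPoint φ f))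
    (x : PathAlgebra (DualNumber k) V) : sndDual (redInf (dualPoint φ f) x) =
      deformCoeff hT 1 (fstDual x) + redInf φ (sndDual x) := by
  conv_lhs => rw [eq_constDual_add x]
  rw [← redLin_apply _ hT', map_add, map_smul, map_add, sndDual_eps_smul, redLin_apply,
    redLin_apply, sndDual_redInf_constDual hT, fstDual_redInf hT', fstDual_constDual]

theorem isCocycle_iff_mcTerm : IsCocycle φ f ↔ ∀ w, mcTerm φ f w 1 = 0 := by
  refine forall_congr' fun w => ?_
  rw [mcTerm, bracket, if_pos rfl, Fin.sum_univ_one, Nat.factorial_one, Nat.cast_one, inv_one,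
    one_smul]

/-- Modulo `ε` the obstruction is that of `φ`, which vanishes. Its `ε`-part is the coefficient of
`t` for `φ + t f`, that is, the linear Maurer-Cartan term `f ∂_3`. -/
theorem systemUnique_dualPoint_iff [CharZero k] (hprec : IsAdmissible prec)
    (hφ : φ ∈ cochPrec k S prec) (hc : Convergent φ) (hf : f ∈ cochPrec k S prec) :
    SystemUnique (dualPoint φ f) ↔ IsCocycle φ f := by
  have hS := hc.isReductionSet
  have hT := redTerminates_of_prec hS hprec (deform_mem hφ hf)
  have hT' := redTerminates_of_prec hS hprec (dualPoint_mem hφ hf)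
  rw [systemUnique_iff_obstruction hS hprec (dualPoint_mem hφ hf), isCocycle_iff_mcTerm]
  have key : ∀ x s' s r w, Overlap x s' s r w → ∀ hw : w ∈ amb S 3,
      (obstruction (dualPoint φ f) s r w = 0 ↔ mcTerm φ f ⟨w, hw⟩ 1 = 0) := by
    intro x s' s r w ho hw
    have h1 : fstDual (obstruction (dualPoint φ f) s r w) = 0 := by
      rw [obstruction, map_sub, fstDual_redInf hT', fstDual_redInf hT', fstDual_mul,
        fstDual_dualPoint, fstDual_of, fstDual_of]
      exact obstruction_eq_zero hc ho
    have h2 : sndDual (obstruction (dualPoint φ f) s r w) =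
        polyCoeff 1 (obstruction (deform φ f) s r w) := by
      rw [dualPoint_eq_truncate, obstruction_mapCoeff _ hT, sndDual_truncate]
    rw [mcTerm_eq hprec hφ hc hf 0 ⟨w, hw⟩ ho]
    constructor
    · intro h
      rw [zero_add, ← h2, h, map_zero, map_zero]
    · intro h
      have h3 := hc.eq_of_proj_eq (polyCoeff_mem (obstruction_mem _ _ _ _)) (zero_mem _)
        (h.trans (map_zero _).symm)
      exact dual_ext (h1.trans (map_zero _).symm) ((h2.trans h3).trans (map_zero _).symm)
  constructor
  · intro h w
    obtain ⟨x, s', s, r, ho⟩ := (hS.mem_amb_three w).mp w.2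
    exact (key x s' s r w ho w.2).mp (h x s' s r w ho)
  · intro h x s' s r w ho
    have hw := (hS.mem_amb_three w).mpr ⟨x, s', s, r, ho⟩
    exact (key x s' s r w ho hw).mpr (h ⟨w, hw⟩)

theorem dualG2_eq (hprec : IsAdmissible prec) (hφ : φ ∈ cochPrec k S prec) (hc : Convergent φ)
    (hf : f ∈ cochPrec k S prec) (hT : RedTerminates (deform φ f)) (a b : QuotAlg φ) :
    dualG2 φ (toQuot φ f) a b = proj φ (deformCoeff hT 1 (irrSection φ a * irrSection φ b)) := by
  rw [← starSeries_eq hprec hφ hc hf hT, starSeries_apply, if_neg one_ne_zero, zero_add,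
    transferSeries_eq, transferDefect_one, dualH2_zero, if_pos rfl, add_zero]
  rfl

/-- For a cocycle the system `φ + ε f` is reduction unique, so the product of normal forms over
`k[ε]` is associative. Its `ε`-part is `G^2(f)`, and the `ε`-part of associativity is the cocycle
identity. -/
theorem dualG2_mem_hochCocycles [CharZero k] (hprec : IsAdmissible prec)
    (hφ : φ ∈ cochPrec k S prec) (hc : Convergent φ) (hf : f ∈ cochPrec k S prec)
    (h : IsCocycle φ f) : dualG2 φ (toQuot φ f) ∈ hochCocycles k (QuotAlg φ) := by
  have hS := hc.isReductionSet
  have hT := redTerminates_of_prec hS hprec (deform_mem hφ hf)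
  have hT' := redTerminates_of_prec hS hprec (dualPoint_mem hφ hf)
  have hD := convergent_of_systemUnique hS hprec (dualPoint_mem hφ hf)
    ((systemUnique_dualPoint_iff hprec hφ hc hf).mpr h)
  have hG := dualG2_eq hprec hφ hc hf hT
  have hm : ∀ a b : QuotAlg φ, redInf φ (irrSection φ a * irrSection φ b) = irrSection φ (a * b) :=
    fun a b => by
      rw [← hc.irrSection_proj, map_mul, hc.proj_irrSection, hc.proj_irrSection]
  have hf1 : ∀ a b : QuotAlg φ, fstDual (redInf (dualPoint φ f)
      (constDual (irrSection φ a) * constDual (irrSection φ b))) = irrSection φ (a * b) :=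
    fun a b => by
      rw [fstDual_redInf hT', fstDual_mul, fstDual_constDual, fstDual_constDual, hm]
  refine LinearMap.mem_ker.mpr (LinearMap.ext fun a => LinearMap.ext fun b => LinearMap.ext fun c => ?_)
  have e : redInf (dualPoint φ f) (redInf (dualPoint φ f)
      (constDual (irrSection φ a) * constDual (irrSection φ b)) * constDual (irrSection φ c)) =
      redInf (dualPoint φ f) (constDual (irrSection φ a) * redInf (dualPoint φ f)
        (constDual (irrSection φ b) * constDual (irrSection φ c))) := by
    rw [hD.redInf_redInf_mul, redInf_mul_redInf hS _ hT', mul_assoc]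
  have e1 := congrArg (fun z => proj φ (sndDual z)) e
  simp only [sndDual_redInf hT hT', map_add, hc.proj_redInf, sndDual_mul, fstDual_mul, map_mul,
    fstDual_constDual, sndDual_constDual, mul_zero, zero_mul, zero_add, add_zero, hf1,
    hc.proj_irrSection, ← hG] at e1
  simp only [map_zero, add_zero] at e1
  change a * dualG2 φ (toQuot φ f) b c - dualG2 φ (toQuot φ f) (a * b) c +
    dualG2 φ (toQuot φ f) a (b * c) - dualG2 φ (toQuot φ f) a b * c = 0
  have e2 := sub_eq_zero.mpr e1.symm
  rw [← e2]
  abel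

/-- The Kodaira-Spencer map on a space of cocycles. -/
def kodairaSpencer (φ : S → PathAlgebra k V) (W : Submodule k (cochPrec k S prec))
    (h : ∀ v ∈ W, dualG2 φ (toQuot φ v.1) ∈ hochCocycles k (QuotAlg φ)) :
    W →ₗ[k] HH2 k (QuotAlg φ) :=
  (hochCoboundaries k (QuotAlg φ)).mkQ ∘ₗ
    { toFun := fun v => ⟨dualG2 φ (toQuot φ v.1.1), h v.1 v.2⟩
      map_add' := fun v v' => Subtype.ext ((congrArg (dualG2 φ)
        (funext fun s => map_add (proj φ) (v.1.1 s) (v'.1.1 s))).trans (isLinearMap_dualG2.map_add _ _))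
      map_smul' := fun c v => Subtype.ext ((congrArg (dualG2 φ)
        (funext fun s => map_smul (proj φ) c (v.1.1 s))).trans (isLinearMap_dualG2.map_smul _ _)) }

end FirstOrder

/-! ### Zariski tangent vectors as points over the dual numbers -/

section Tangent

variable {k : Type u} [Field k] {V : Type v} [Quiver.{w} V] [Fintype V]
  {S : Set (QPath V)} {φ : S → PathAlgebra k V} {prec : QPath V → QPath V → Prop} {N : ℕ}

/-- The Taylor expansion, which stops after the linear term since `ε` has square zero. -/
theorem aeval_add_eps (a v : Fin N → k) (g : MvPolynomial (Fin N) k) :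
    MvPolynomial.aeval (fun i => (TrivSqZeroExt.inl (a i) + TrivSqZeroExt.inr (v i) : DualNumber k)) g =
      TrivSqZeroExt.inl (MvPolynomial.eval a g) +
        TrivSqZeroExt.inr (∑ i, MvPolynomial.eval a (MvPolynomial.pderiv i g) * v i) := by
  induction g using MvPolynomial.induction_on with
  | C c => simp [TrivSqZeroExt.algebraMap_eq_inl]
  | add p q hp hq =>
    simp only [map_add, hp, hq, add_mul, Finset.sum_add_distrib, TrivSqZeroExt.inl_add,
      TrivSqZeroExt.inr_add]
    abel
  | mul_X p j hp =>
    rw [map_mul, hp, MvPolynomial.aeval_X]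
    refine TrivSqZeroExt.ext ?_ ?_
    · simp
    · have h1 : ∀ i, MvPolynomial.eval a (if j = i then p else 0) * v i =
          if j = i then MvPolynomial.eval a p * v i else 0 := fun i => by
        split_ifs <;> simp
      simp [Derivation.leibniz, MvPolynomial.pderiv_X, Pi.single_apply, add_mul,
        Finset.sum_add_distrib, h1, Finset.sum_mul]
      exact Finset.sum_congr rfl fun i _ => by ring

theorem mem_zariskiTangent_iff (J : Ideal (MvPolynomial (Fin N) k)) (a v : Fin N → k)
    (ha : ∀ g ∈ J, MvPolynomial.eval a g = 0) : v ∈ zariskiTangent J a ↔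
      ∀ g ∈ J, MvPolynomial.aeval
        (fun i => (TrivSqZeroExt.inl (a i) + TrivSqZeroExt.inr (v i) : DualNumber k)) g = 0 := by
  rw [zariskiTangent]
  simp only [Submodule.mem_iInf, LinearMap.mem_ker, LinearMap.sum_apply, LinearMap.smul_apply,
    LinearMap.proj_apply, smul_eq_mul]
  refine forall₂_congr fun g hg => ?_
  rw [aeval_add_eps, ha g hg, TrivSqZeroExt.inl_zero, zero_add]
  exact ⟨fun h => by rw [h, TrivSqZeroExt.inr_zero], fun h => congrArg TrivSqZeroExt.snd h⟩

theorem pointOver_dual (b : Module.Basis (Fin N) k (cochPrec k S prec)) (f v : cochPrec k S prec) :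
    pointOver φ (fun i => (b i).1) (DualNumber k)
      (fun i => TrivSqZeroExt.inl (b.equivFun f i) + TrivSqZeroExt.inr (b.equivFun v i)) =
      dualPoint (φ + f.1) v.1 := by
  have h : ∀ g : cochPrec k S prec, ∀ s, g.1 s = ∑ i, b.equivFun g i • (b i).1 s := fun g s => by
    have := congrArg (fun g : cochPrec k S prec => g.1 s) (b.sum_equivFun g).symm
    simp only [Submodule.coe_sum, Finset.sum_apply] at this
    exact this
  ext1 s
  rw [dualPoint_apply, Pi.add_apply, map_add, h f, h v, map_sum, map_sum, Finset.smul_sum, add_assoc,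
    ← Finset.sum_add_distrib, pointOver]
  congr 1
  refine Finset.sum_congr rfl fun i _ => ?_
  rw [constDual_smul, constDual_smul, smul_smul, ← add_smul]
  congr 1
  refine TrivSqZeroExt.ext ?_ ?_ <;> simp [TrivSqZeroExt.algebraMap_eq_inl]

theorem mem_tangentSpace_iff [CharZero k] (hprec : IsAdmissible prec)
    (hφ : φ ∈ cochPrec k S prec) (hc : Convergent φ)
    (b : Module.Basis (Fin N) k (cochPrec k S prec)) (f v : cochPrec k S prec)
    (hf : ∀ g ∈ mcIdeal φ fun i => (b i).1, MvPolynomial.eval (b.equivFun f) g = 0) :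
    v ∈ tangentSpace φ b f ↔ SystemUnique (dualPoint (φ + f.1) v.1) := by
  rw [← pointOver_dual b, systemUnique_pointOver_iff hprec hφ hc fun i => (b i).2]
  exact mem_zariskiTangent_iff _ _ _ hf

end Tangent

/-! ### Derivations of the path algebra and 1-cochains -/

section Derivations

variable {k : Type u} [CommRing k] {V : Type v} [Quiver.{w} V] [Fintype V]
  {S : Set (QPath V)} {φ : S → PathAlgebra k V}

/-- Derivations of `kQ` with values in `A_φ` that vanish on the vertices. -/
structure IsPathDerivation (δ : PathAlgebra k V →ₗ[k] QuotAlg φ) : Prop where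
  map_idPath : ∀ i, δ (of k (QPath.idPath i)) = 0
  map_mul : ∀ x y, δ (x * y) = proj φ x * δ y + δ x * proj φ y

theorem mem_spanOn_of_idPath_mul (hc : Convergent φ) {i j : V} {a : QuotAlg φ}
    (h : proj φ (of k (QPath.idPath i)) * a * proj φ (of k (QPath.idPath j)) = a) :
    irrSection φ a ∈ spanOn k {q | q.src = i ∧ q.tgt = j} := by
  have h1 : of k (QPath.idPath i) * irrSection φ a * of k (QPath.idPath j) ∈
      spanOn k {q | q ∈ Irr S ∧ q.src = i ∧ q.tgt = j} := by
    refine mul_mem_spanOn (X := {q | q ∈ Irr S ∧ q.src = i}) (Y := {QPath.idPath j})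
      (mul_mem_spanOn (X := {QPath.idPath i}) (of_mem_spanOn rfl) (hc.irrSection_mem a) ?_)
      (of_mem_spanOn rfl) ?_
    · rintro _ rfl q hq r hr
      have : r = q := by
        obtain ⟨e, rfl⟩ := hr
        exact QPath.idPath_comp q i e
      exact this ▸ ⟨hq, hr.mid.symm⟩
    · rintro q hq _ rfl r hr
      have : r = q := by
        obtain ⟨e, rfl⟩ := hr
        exact QPath.comp_idPath q j e
      exact this ▸ ⟨hq.1, hq.2, hr.mid⟩
  have h2 : irrSection φ a = of k (QPath.idPath i) * irrSection φ a * of k (QPath.idPath j) := by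
    refine hc.eq_of_proj_eq (hc.irrSection_mem a) (spanOn_mono (fun q hq => hq.1) h1) ?_
    rw [map_mul, map_mul, hc.proj_irrSection, h]
  rw [h2]
  exact spanOn_mono (fun q hq => hq.2) h1

namespace IsPathDerivation

variable {δ : PathAlgebra k V →ₗ[k] QuotAlg φ} (h : IsPathDerivation δ)
include h

theorem idPath_mul (p : QPath V) :
    proj φ (of k (QPath.idPath p.src)) * δ (of k p) = δ (of k p) := by
  conv_rhs => rw [← PathAlgebra.idPath_mul p, h.map_mul, h.map_idPath, zero_mul, add_zero]

theorem mul_idPath (p : QPath V) :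
    δ (of k p) * proj φ (of k (QPath.idPath p.tgt)) = δ (of k p) := by
  conv_rhs => rw [← PathAlgebra.mul_idPath p, h.map_mul, h.map_idPath, mul_zero, zero_add]

theorem irrSection_mem_parallel (hc : Convergent φ) (p : QPath V) :
    irrSection φ (δ (of k p)) ∈ spanOn k {q | q.Parallel p} :=
  mem_spanOn_of_idPath_mul hc (by rw [h.idPath_mul, h.mul_idPath])

/-- Universality of `fox`: a derivation that vanishes on the vertices is determined by its values on
arrows. -/
theorem eq_evalCochain (x : PathAlgebra k V) :
    δ x = evalCochain (fun a : amb S 1 => δ (of k a)) (fox φ x) := by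
  refine LinearMap.congr_fun (g := evalCochain (fun a : amb S 1 => δ (of k a)) ∘ₗ fox φ)
    (lin_ext fun p => ?_) x
  rw [LinearMap.comp_apply]
  induction p using QPath.head_induction with
  | h0 i => rw [h.map_idPath, fox_idPath, map_zero]
  | hs a q p ha hp ih =>
    rw [fox_head ha hp, map_add, evalCochain_biact, ← ih, tens, evalCochain_single,
      ← of_mul_factors hp, h.map_mul, mul_one, add_comm]
    change _ = proj φ (of k (QPath.idPath a.src)) * δ (of k a) * _ + _
    rw [h.idPath_mul]

end IsPathDerivation

theorem isPathDerivation_evalCochain {η : amb S 1 → QuotAlg φ}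
    (hl : ∀ x : amb S 1, proj φ (of k (QPath.idPath (x : QPath V).src)) * η x = η x)
    (hr : ∀ x : amb S 1, η x * proj φ (of k (QPath.idPath (x : QPath V).tgt)) = η x) :
    IsPathDerivation (evalCochain η ∘ₗ fox φ) := by
  have h0 : ∀ i, (evalCochain η ∘ₗ fox φ) (of k (QPath.idPath i)) = 0 := fun i => by
    rw [LinearMap.comp_apply, fox_idPath, map_zero]
  have hsrc : ∀ p : QPath V, proj φ (of k (QPath.idPath p.src)) *
      (evalCochain η ∘ₗ fox φ) (of k p) = (evalCochain η ∘ₗ fox φ) (of k p) := fun p => by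
    conv_rhs => rw [LinearMap.comp_apply, ← biact_left_fox, evalCochain_biact, mul_one]
    rfl
  have h1 : ∀ (a : QPath V) (ha : a.length = 1) (y : PathAlgebra k V),
      (evalCochain η ∘ₗ fox φ) (of k a * y) =
        proj φ (of k a) * (evalCochain η ∘ₗ fox φ) y + η (ambOne S ha) * proj φ y := by
    intro a ha y
    refine LinearMap.congr_fun (f := evalCochain η ∘ₗ fox φ ∘ₗ LinearMap.mulLeft k (of k a))
      (g := LinearMap.mulLeft k (proj φ (of k a)) ∘ₗ evalCochain η ∘ₗ fox φ +
        LinearMap.mulLeft k (η (ambOne S ha)) ∘ₗ (proj φ).toLinearMap) (lin_ext fun q => ?_) y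
    change (evalCochain η ∘ₗ fox φ) (of k a * of k q) = proj φ (of k a) *
      (evalCochain η ∘ₗ fox φ) (of k q) + η (ambOne S ha) * proj φ (of k q)
    by_cases hq : a.tgt = q.src
    · have hp : QPath.Factors a q (a.comp q hq) := ⟨hq, rfl⟩
      rw [of_mul_factors hp, LinearMap.comp_apply, fox_head ha hp, map_add, evalCochain_biact,
        tens, evalCochain_single, mul_one, add_comm]
      congr 2
      exact hl (ambOne S ha)
    · rw [of_mul_eq_zero hq, map_zero, ← hsrc, ← mul_assoc,
        proj_mul_eq_zero (r := QPath.idPath q.src) hq, zero_mul, zero_add, ← hr, mul_assoc,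
        proj_mul_eq_zero (q := QPath.idPath (ambOne S ha : QPath V).tgt) (r := q) hq, mul_zero]
  refine ⟨h0, fun x y => ?_⟩
  refine LinearMap.congr_fun (f := evalCochain η ∘ₗ fox φ ∘ₗ LinearMap.mulRight k y)
    (g := LinearMap.mulRight k ((evalCochain η ∘ₗ fox φ) y) ∘ₗ (proj φ).toLinearMap +
      LinearMap.mulRight k (proj φ y) ∘ₗ evalCochain η ∘ₗ fox φ) (lin_ext fun p => ?_) x
  change (evalCochain η ∘ₗ fox φ) (of k p * y) = proj φ (of k p) * (evalCochain η ∘ₗ fox φ) y +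
    (evalCochain η ∘ₗ fox φ) (of k p) * proj φ y
  induction p using QPath.head_induction with
  | h0 i =>
    rw [h0, zero_mul, add_zero]
    refine LinearMap.congr_fun
      (f := evalCochain η ∘ₗ fox φ ∘ₗ LinearMap.mulLeft k (of k (QPath.idPath i)))
      (g := LinearMap.mulLeft k (proj φ (of k (QPath.idPath i))) ∘ₗ evalCochain η ∘ₗ fox φ)
      (lin_ext fun q => ?_) y
    change (evalCochain η ∘ₗ fox φ) (of k (QPath.idPath i) * of k q) =
      proj φ (of k (QPath.idPath i)) * (evalCochain η ∘ₗ fox φ) (of k q)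
    by_cases hq : i = q.src
    · rw [hq, hsrc, PathAlgebra.idPath_mul]
    · rw [of_mul_eq_zero (q := QPath.idPath i) hq, map_zero, ← hsrc, ← mul_assoc,
        proj_mul_eq_zero (q := QPath.idPath i) (r := QPath.idPath q.src) hq, zero_mul]
  | hs a q p ha hp ih =>
    rw [← of_mul_factors hp, mul_assoc, h1 a ha, ih, h1 a ha, map_mul, map_mul, mul_add, add_mul]
    simp only [mul_assoc, add_assoc]

end Derivations

/-! ### Coboundaries in terms of derivations -/

section Coboundaries

variable {k : Type u} [Field k] {V : Type v} [Quiver.{w} V] [Fintype V]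
  {S : Set (QPath V)} {φ v : S → PathAlgebra k V} {prec : QPath V → QPath V → Prop}

/-- 1-cochains are the same as derivations vanishing on vertices, and by `diff_one_tens` the
differential of such a cochain at `s` is the derivation at `s - φ_s`. -/
theorem isCoboundary_iff (hc : Convergent φ) : IsCoboundary φ v ↔
    ∃ δ : PathAlgebra k V →ₗ[k] QuotAlg φ, IsPathDerivation δ ∧
      ∀ s : S, δ (of k s - φ s) = proj φ (v s) := by
  have key : ∀ δ : PathAlgebra k V →ₗ[k] QuotAlg φ, IsPathDerivation δ → ∀ η : amb S 1 → QuotAlg φ,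
      (∀ x, δ x = evalCochain η (fox φ x)) → ∀ s : S,
        evalCochain η (diff φ 1 (gen φ (n := 2) s)) = δ (of k s - φ s) := by
    intro δ hδ η hη s
    have e : diff φ 1 (gen φ (n := 2) s) = _ := diff_one_tens hc s
      (proj φ (of k (QPath.idPath (s : QPath V).src)))
      (proj φ (of k (QPath.idPath (s : QPath V).tgt)))
    rw [e, evalCochain_biact, ← map_sub (fox φ), ← hη]
    have h1 : of k (QPath.idPath (s : QPath V).src) * (of k s - φ s) *
        of k (QPath.idPath (s : QPath V).tgt) = of k s - φ s := by
      rw [mul_sub, sub_mul, PathAlgebra.idPath_mul, PathAlgebra.mul_idPath,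
        idPath_mul_coch hc.mem_coch, coch_mul_idPath hc.mem_coch]
    conv_rhs => rw [← h1, hδ.map_mul, hδ.map_mul, hδ.map_idPath, hδ.map_idPath, mul_zero,
      zero_add, zero_mul, add_zero]
  constructor
  · rintro ⟨ψ, hψ, h⟩
    refine ⟨evalCochain (fun x : amb S 1 => proj φ (ψ x)) ∘ₗ fox φ, ?_, fun s => ?_⟩
    · refine isPathDerivation_evalCochain (fun x => ?_) (fun x => ?_)
      · rw [← map_mul, idPath_mul_coch hψ]
      · rw [← map_mul, coch_mul_idPath hψ]
    · refine Eq.trans ?_ (h s).symm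
      refine (key _ ?_ _ (fun _ => rfl) s).symm
      refine isPathDerivation_evalCochain (fun x => ?_) (fun x => ?_)
      · rw [← map_mul, idPath_mul_coch hψ]
      · rw [← map_mul, coch_mul_idPath hψ]
  · rintro ⟨δ, hδ, h⟩
    refine ⟨fun x => irrSection φ (δ (of k x)), fun x p hp =>
      ⟨hc.irrSection_mem _ p hp, hδ.irrSection_mem_parallel hc x p hp⟩, fun s => ?_⟩
    rw [key δ hδ _ fun x => ?_, h s]
    · rfl
    · simp only [hc.proj_irrSection]
      exact hδ.eq_evalCochain x

end Coboundaries

/-! ### Equivalences over the dual numbers -/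

section OrbitTangent

variable {k : Type u} [Field k] {V : Type v} [Quiver.{w} V] [Fintype V]
  {S : Set (QPath V)} {φ v : S → PathAlgebra k V} {prec : QPath V → QPath V → Prop}

omit [Fintype V] in
theorem redTerminates_constDual (hprec : IsAdmissible prec) (hS : IsReductionSet S)
    (hφ : φ ∈ cochPrec k S prec) :
    RedTerminates (fun s => (constDual (φ s) : PathAlgebra (DualNumber k) V)) :=
  redTerminates_of_prec hS hprec (prec := prec) fun s p hp => hφ s p fun h => hp (by
    rw [coeff_constDual, h, TrivSqZeroExt.inl_zero])

theorem redInf_constDual (hprec : IsAdmissible prec) (hS : IsReductionSet S)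
    (hφ : φ ∈ cochPrec k S prec) (x : PathAlgebra (DualNumber k) V) :
    redInf (fun s => constDual (φ s)) x = constDual (redInf φ (fstDual x)) +
      (DualNumber.eps : DualNumber k) • constDual (redInf φ (sndDual x)) := by
  have hT := redTerminates_constDual hprec hS hφ
  have h : ∀ y, redInf (fun s => constDual (φ s)) (constDual y) = constDual (redInf φ y) :=
    redInf_mapCoeff _ (redTerminates_of_prec hS hprec hφ)
  conv_lhs => rw [eq_constDual_add x]
  rw [← redLin_apply _ hT, map_add, map_smul, redLin_apply, redLin_apply, h, h]

theorem fstDual_ofIrr (T : irrMod (DualNumber k) S ≃ₗ[DualNumber k] irrMod (DualNumber k) S)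
    {x : PathAlgebra (DualNumber k) V} (hx : x ∈ irrMod (DualNumber k) S) :
    fstDual (ofIrr T x) = fstDual (ofIrr T (constDual (fstDual x))) := by
  have h1 : constDual (fstDual x) ∈ irrMod (DualNumber k) S := constDual_mem (fstDual_mem hx)
  have h2 : constDual (sndDual x) ∈ irrMod (DualNumber k) S := constDual_mem (sndDual_mem hx)
  conv_lhs => rw [eq_constDual_add x]
  rw [ofIrr_add T h1 (Submodule.smul_mem _ _ h2), ofIrr_smul T _ h2, map_add, fstDual_eps_smul,
    add_zero]

/-- The reduction modulo `ε` of an automorphism of `k[ε] Irr_S`, as an endomorphism of `A_φ`. -/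
def modEps (hc : Convergent φ)
    (T : irrMod (DualNumber k) S ≃ₗ[DualNumber k] irrMod (DualNumber k) S) :
    QuotAlg φ →ₗ[k] QuotAlg φ where
  toFun a := proj φ (fstDual (ofIrr T (constDual (irrSection φ a))))
  map_add' a b := by
    have h : ∀ a, constDual (irrSection φ a) ∈ irrMod (DualNumber k) S :=
      fun a => constDual_mem (hc.irrSection_mem a)
    rw [map_add, map_add, ofIrr_add T (h a) (h b), map_add, map_add]
  map_smul' c a := by
    have h : constDual (irrSection φ a) ∈ irrMod (DualNumber k) S :=
      constDual_mem (hc.irrSection_mem a)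
    rw [map_smul, constDual_smul, ofIrr_smul T _ h, fstDual_smul, map_smul]
    rfl

theorem modEps_apply (hc : Convergent φ)
    (T : irrMod (DualNumber k) S ≃ₗ[DualNumber k] irrMod (DualNumber k) S) (a : QuotAlg φ) :
    modEps hc T a = proj φ (fstDual (ofIrr T (constDual (irrSection φ a)))) := rfl

theorem modEps_symm_modEps (hc : Convergent φ)
    (T : irrMod (DualNumber k) S ≃ₗ[DualNumber k] irrMod (DualNumber k) S) (a : QuotAlg φ) :
    modEps hc T.symm (modEps hc T a) = a := by
  have h : constDual (irrSection φ a) ∈ irrMod (DualNumber k) S :=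
    constDual_mem (hc.irrSection_mem a)
  rw [modEps_apply hc T, modEps_apply, hc.irrSection_proj_of_mem (fstDual_mem (ofIrr_mem T _)),
    ← fstDual_ofIrr T.symm (ofIrr_mem T _), ofIrr_symm_ofIrr T h, fstDual_constDual,
    hc.proj_irrSection]

theorem modEps_modEps_symm (hc : Convergent φ)
    (T : irrMod (DualNumber k) S ≃ₗ[DualNumber k] irrMod (DualNumber k) S) (a : QuotAlg φ) :
    modEps hc T (modEps hc T.symm a) = a := modEps_symm_modEps hc T.symm a

/-- The `ε`-part `G` of the multiplicative extension of `T` is a derivation twisted by the algebra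
automorphism `modEps hc T`. Undoing the twist gives `δ`. -/
theorem exists_isPathDerivation (hprec : IsAdmissible prec) (hφ : φ ∈ cochPrec k S prec)
    (hc : Convergent φ) (hv : v ∈ cochPrec k S prec) (hu : SystemUnique (dualPoint φ v))
    {T : irrMod (DualNumber k) S ≃ₗ[DualNumber k] irrMod (DualNumber k) S}
    (h : IsEquivalence (fun s => constDual (φ s)) (dualPoint φ v) T) :
    ∃ δ : PathAlgebra k V →ₗ[k] QuotAlg φ, IsPathDerivation δ ∧
      ∀ s : S, δ (of k s - φ s) = proj φ (v s) := by
  have hS := hc.isReductionSet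
  have hD := convergent_of_systemUnique hS hprec (dualPoint_mem hφ hv) hu
  have hmap := h.map_redInf hS (redTerminates_constDual hprec hS hφ) hD.terminates
  set Θ := tensorHom hS h.preservesParallel with hΘ
  let G : PathAlgebra k V →ₗ[k] QuotAlg φ :=
    { toFun := fun y => proj φ (sndDual (Θ (constDual y)))
      map_add' := fun x y => by simp only [map_add]
      map_smul' := fun c x => by
        rw [constDual_smul, map_smul, sndDual_smul, TrivSqZeroExt.algebraMap_eq_inl,
          TrivSqZeroExt.fst_inl, TrivSqZeroExt.snd_inl, zero_smul, add_zero, map_smul]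
        rfl }
  have hG : ∀ y, G y = proj φ (sndDual (Θ (constDual y))) := fun _ => rfl
  have h0 : ∀ y, modEps hc T (proj φ y) = proj φ (fstDual (Θ (constDual y))) := by
    intro y
    have e := congrArg (fun z => proj φ (fstDual z)) (hmap (constDual y))
    beta_reduce at e
    rw [fstDual_ofIrr T (redInf_mem _ _), fstDual_redInf hD.terminates, fstDual_constDual,
      redInf_constDual hprec hS hφ, map_add, fstDual_eps_smul, add_zero, fstDual_constDual,
      hc.proj_redInf] at e
    rw [modEps_apply, hc.irrSection_proj, e]
  have hmul : ∀ a b, modEps hc T (a * b) = modEps hc T a * modEps hc T b := by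
    intro a b
    obtain ⟨x, rfl⟩ := Convergent.proj_surjective φ a
    obtain ⟨y, rfl⟩ := Convergent.proj_surjective φ b
    rw [← map_mul, h0, h0, h0, constDual_mul, map_mul, fstDual_mul, map_mul]
  have hinj : Function.Injective (modEps hc T) :=
    Function.LeftInverse.injective (modEps_symm_modEps hc T)
  refine ⟨modEps hc T.symm ∘ₗ G, ⟨fun i => ?_, fun x y => hinj ?_⟩, fun s => hinj ?_⟩
  · rw [LinearMap.comp_apply, hG, constDual_of, hΘ, tensorHom_idPath, sndDual_of, map_zero, map_zero]
  · rw [LinearMap.comp_apply, LinearMap.comp_apply, LinearMap.comp_apply, modEps_modEps_symm, map_add,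
      hmul, hmul, modEps_modEps_symm, modEps_modEps_symm, h0, h0, hG, hG, hG, constDual_mul, map_mul,
      sndDual_mul, map_add, map_mul, map_mul]
  · rw [LinearMap.comp_apply, modEps_modEps_symm, h0, hG]
    -- The relation of the second system has normal form zero there. The `ε`-part of its image is
    -- `G(s - φ_s)` minus the automorphism applied to `v_s`.
    have e := hmap (of _ s - dualPoint φ v s)
    have e1 : redInf (dualPoint φ v) (of _ s - dualPoint φ v s) = 0 := by
      rw [← redLin_apply _ hD.terminates, map_sub, redLin_apply, redLin_apply, hD.redInf_rel,
        redInf_of_irr _ (coch_mem_irr hD.mem_coch s), sub_self]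
    have e2 : ofIrr T 0 = 0 := by
      rw [ofIrr_of_mem T (zero_mem _)]
      exact congrArg Subtype.val (map_zero T)
    have e3 : of (DualNumber k) (s : QPath V) - dualPoint φ v s =
        constDual (of k s - φ s) - (DualNumber.eps : DualNumber k) • constDual (v s) := by
      rw [dualPoint_apply, map_sub, constDual_of, sub_add_eq_sub_sub]
    rw [e1, e2, redInf_constDual hprec hS hφ, e3, map_sub, map_smul] at e
    have e4 := congrArg (fun z => proj φ (sndDual z)) e
    beta_reduce at e4
    rw [map_add, sndDual_eps_smul, sndDual_constDual, fstDual_constDual, zero_add, hc.proj_redInf,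
      map_sub, sndDual_eps_smul, map_sub, map_zero, map_zero] at e4
    exact sub_eq_zero.mp e4.symm

/-- The map `x ↦ x + ε δ(x)`. -/
def expDerivation (δ : PathAlgebra k V →ₗ[k] QuotAlg φ) :
    PathAlgebra (DualNumber k) V →ₗ[DualNumber k] PathAlgebra (DualNumber k) V :=
  lin fun p => of _ p + (DualNumber.eps : DualNumber k) • constDual (irrSection φ (δ (of k p)))

theorem fstDual_expDerivation (δ : PathAlgebra k V →ₗ[k] QuotAlg φ)
    (x : PathAlgebra (DualNumber k) V) : fstDual (expDerivation δ x) = fstDual x := by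
  induction x using induct with
  | h0 => rw [map_zero]
  | ha x y hx hy => rw [map_add, map_add, hx, hy, map_add]
  | hs c p =>
    rw [map_smul, fstDual_smul, fstDual_smul, expDerivation, lin_of, map_add, fstDual_eps_smul,
      add_zero]

theorem sndDual_expDerivation (δ : PathAlgebra k V →ₗ[k] QuotAlg φ)
    (x : PathAlgebra (DualNumber k) V) :
    sndDual (expDerivation δ x) = sndDual x + irrSection φ (δ (fstDual x)) := by
  induction x using induct with
  | h0 => simp
  | ha x y hx hy =>
    simp only [map_add, hx, hy]
    abel
  | hs c p =>
    rw [map_smul, sndDual_smul, sndDual_smul, fstDual_expDerivation, fstDual_smul, expDerivation,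
      lin_of, map_add, sndDual_eps_smul, fstDual_constDual, map_smul, map_smul, fstDual_of,
      sndDual_of, zero_add, smul_zero, zero_add, add_comm]

omit [Fintype V] in
theorem mem_of_fstDual_of_sndDual {X : Set (QPath V)} {x : PathAlgebra (DualNumber k) V}
    (h : fstDual x ∈ spanOn k X) (h' : sndDual x ∈ spanOn k X) : x ∈ spanOn (DualNumber k) X := by
  rw [eq_constDual_add x]
  exact add_mem (constDual_mem h) (Submodule.smul_mem _ _ (constDual_mem h'))

theorem expDerivation_mem (hc : Convergent φ) (δ : PathAlgebra k V →ₗ[k] QuotAlg φ)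
    {x : PathAlgebra (DualNumber k) V} (hx : x ∈ irrMod (DualNumber k) S) :
    expDerivation δ x ∈ irrMod (DualNumber k) S := by
  refine mem_of_fstDual_of_sndDual ?_ ?_
  · rw [fstDual_expDerivation]
    exact fstDual_mem hx
  · rw [sndDual_expDerivation]
    exact add_mem (sndDual_mem hx) (hc.irrSection_mem _)

/-- The `ε`-part of the value depends on `δ` only through the part modulo `ε`, which is unchanged,
so the contributions of `δ` and `-δ` cancel. -/
theorem expDerivation_neg (δ : PathAlgebra k V →ₗ[k] QuotAlg φ) (x : PathAlgebra (DualNumber k) V) :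
    expDerivation δ (expDerivation (-δ) x) = x := by
  refine dual_ext ?_ ?_
  · rw [fstDual_expDerivation, fstDual_expDerivation]
  · rw [sndDual_expDerivation, sndDual_expDerivation, fstDual_expDerivation, LinearMap.neg_apply,
      map_neg, neg_add_cancel_right]

/-- The automorphism `x ↦ x + ε δ(x)` of `k[ε] Irr_S`. -/
def expEquiv (hc : Convergent φ) (δ : PathAlgebra k V →ₗ[k] QuotAlg φ) :
    irrMod (DualNumber k) S ≃ₗ[DualNumber k] irrMod (DualNumber k) S :=
  LinearEquiv.ofLinearMap
    ((expDerivation δ).restrict fun _ hx => expDerivation_mem hc δ hx)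
    ((expDerivation (-δ)).restrict fun _ hx => expDerivation_mem hc (-δ) hx)
    (LinearMap.ext fun x => Subtype.ext (expDerivation_neg δ x.1))
    (LinearMap.ext fun x => Subtype.ext (by
      have := expDerivation_neg (-δ) x.1
      rwa [neg_neg] at this))

theorem ofIrr_expEquiv (hc : Convergent φ) (δ : PathAlgebra k V →ₗ[k] QuotAlg φ)
    {x : PathAlgebra (DualNumber k) V} (hx : x ∈ irrMod (DualNumber k) S) :
    ofIrr (expEquiv hc δ) x = expDerivation δ x := ofIrr_of_mem _ hx

theorem preservesParallel_expEquiv (hc : Convergent φ) {δ : PathAlgebra k V →ₗ[k] QuotAlg φ}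
    (hδ : IsPathDerivation δ) : PreservesParallel (expEquiv hc δ) := by
  intro p hp q hq
  rw [ofIrr_expEquiv hc δ (of_mem_irrMod hp)] at hq
  refine (mem_of_fstDual_of_sndDual (X := {q | q.Parallel p}) ?_ ?_ :
    expDerivation δ (of (DualNumber k) p) ∈ _) q hq
  · rw [fstDual_expDerivation, fstDual_of]
    exact of_mem_spanOn (QPath.Parallel.refl p)
  · rw [sndDual_expDerivation, sndDual_of, fstDual_of, zero_add]
    exact hδ.irrSection_mem_parallel hc p

section Exponential

variable (hc : Convergent φ) {δ : PathAlgebra k V →ₗ[k] QuotAlg φ} (hδ : IsPathDerivation δ)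
include hδ

theorem proj_fstDual_tensorHom (x : PathAlgebra (DualNumber k) V) :
    proj φ (fstDual (tensorHom hc.isReductionSet (preservesParallel_expEquiv hc hδ) x)) =
      proj φ (fstDual x) := by
  induction x using induct with
  | h0 => rw [map_zero]
  | ha x y hx hy => simp only [map_add, hx, hy]
  | hs c p =>
    rw [map_smul, fstDual_smul, fstDual_smul, map_smul, map_smul]
    congr 1
    induction p using QPath.head_induction with
    | h0 i => rw [tensorHom_idPath]
    | hs a q p ha hp ih =>
      rw [← of_mul_factors hp, map_mul, fstDual_mul, fstDual_mul, map_mul, map_mul, ih,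
        tensorHom_arrow _ _ ha, ofIrr_expEquiv hc δ
          (of_mem_irrMod (hc.isReductionSet.irr_of_length_le_one ha.le)), fstDual_expDerivation]

/-- Both sides satisfy the same Leibniz rule when an arrow is split off, and they agree on arrows
and vertices. -/
theorem proj_sndDual_tensorHom (x : PathAlgebra (DualNumber k) V) :
    proj φ (sndDual (tensorHom hc.isReductionSet (preservesParallel_expEquiv hc hδ) x)) =
      proj φ (sndDual x) + δ (fstDual x) := by
  induction x using induct with
  | h0 => simp
  | ha x y hx hy =>
    simp only [map_add, hx, hy]
    abel
  | hs c p =>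
    have h1 : proj φ (sndDual (tensorHom hc.isReductionSet (preservesParallel_expEquiv hc hδ)
        (of (DualNumber k) p))) = δ (of k p) := by
      induction p using QPath.head_induction with
      | h0 i => rw [tensorHom_idPath, sndDual_of, map_zero, hδ.map_idPath]
      | hs a q p ha hp ih =>
        rw [← of_mul_factors hp, map_mul, sndDual_mul, map_add, map_mul, map_mul,
          ih, proj_fstDual_tensorHom hc hδ, proj_fstDual_tensorHom hc hδ,
          tensorHom_arrow _ _ ha, ofIrr_expEquiv hc δ
            (of_mem_irrMod (hc.isReductionSet.irr_of_length_le_one ha.le)),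
          sndDual_expDerivation, fstDual_of, fstDual_of, sndDual_of, zero_add, hc.proj_irrSection,
          ← of_mul_factors hp, hδ.map_mul]
    rw [map_smul, sndDual_smul, sndDual_smul, fstDual_smul, map_add, map_add, map_smul, map_smul,
      map_smul, map_smul, h1, proj_fstDual_tensorHom hc hδ, fstDual_of, sndDual_of, map_smul,
      map_zero, smul_zero, zero_add, add_comm]

variable (hprec : IsAdmissible prec) (hφ : φ ∈ cochPrec k S prec)
include hprec hφ

theorem redInf_tensorHom (x : PathAlgebra (DualNumber k) V) :
    redInf (fun s => constDual (φ s))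
      (tensorHom hc.isReductionSet (preservesParallel_expEquiv hc hδ) x) =
      constDual (irrSection φ (proj φ (fstDual x))) + (DualNumber.eps : DualNumber k) •
        constDual (irrSection φ (proj φ (sndDual x) + δ (fstDual x))) := by
  rw [redInf_constDual hprec hc.isReductionSet hφ, ← hc.irrSection_proj, ← hc.irrSection_proj,
    proj_fstDual_tensorHom hc hδ, proj_sndDual_tensorHom hc hδ]

variable (hv : ∀ s : S, δ (of k s - φ s) = proj φ (v s)) (hv' : v ∈ cochPrec k S prec)
include hv

-- Replacing `s` by `φ_s + ε v_s` inside a path does not change the class of its image under `1 + ε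
-- δ`: the condition on `δ` makes `v_s` compensate for `δ(s) - δ(φ_s)`.
omit hprec hφ in
theorem expDerivation_rel (q r : QPath V) (s : S) :
    proj φ (sndDual (of _ q * dualPoint φ v s * of _ r)) +
        δ (fstDual (of _ q * dualPoint φ v s * of _ r)) = δ (of k q * of k s * of k r) := by
  simp only [sndDual_mul, fstDual_mul, sndDual_of, fstDual_of, sndDual_dualPoint,
    fstDual_dualPoint, mul_zero, zero_mul, zero_add, add_zero, map_mul]
  rw [← hv s, map_sub, hδ.map_mul, hδ.map_mul, hδ.map_mul, hδ.map_mul, map_mul, map_mul,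
    Convergent.proj_rel φ s]
  simp only [mul_sub, sub_mul, add_mul]
  abel

theorem redInf_tensorHom_red (x : PathAlgebra (DualNumber k) V) :
    redInf (fun s => constDual (φ s))
      (tensorHom hc.isReductionSet (preservesParallel_expEquiv hc hδ) (red (dualPoint φ v) x)) =
    redInf (fun s => constDual (φ s))
      (tensorHom hc.isReductionSet (preservesParallel_expEquiv hc hδ) x) := by
  have hS := hc.isReductionSet
  refine LinearMap.congr_fun
    (f := redLin _ (redTerminates_constDual hprec hS hφ) ∘ₗ
      (tensorHom hS (preservesParallel_expEquiv hc hδ)).toLinearMap ∘ₗ red (dualPoint φ v))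
    (g := redLin _ (redTerminates_constDual hprec hS hφ) ∘ₗ
      (tensorHom hS (preservesParallel_expEquiv hc hδ)).toLinearMap) (lin_ext fun p => ?_) x
  change redInf _ (tensorHom hS (preservesParallel_expEquiv hc hδ) (red (dualPoint φ v) (of _ p))) =
    redInf _ (tensorHom hS (preservesParallel_expEquiv hc hδ) (of _ p))
  by_cases hp : p ∈ Irr S
  · rw [IsReductionSet.red_of_irr _ hp]
  · obtain ⟨⟨q, s, r⟩, ht⟩ := exists_isRightmost hp
    rw [hS.red_of_rightmost _ ht, redInf_tensorHom hc hδ hprec hφ, redInf_tensorHom hc hδ hprec hφ,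
      expDerivation_rel hδ hv, of_mul_factors3 ht.1, fstDual_of, sndDual_of, map_zero, zero_add]
    simp only [fstDual_mul, fstDual_of, fstDual_dualPoint]
    rw [Convergent.proj_basic φ ht.1]

include hv'

/-- Reductions for `φ + ε v` do not affect the normal form of the image, so `x` may be replaced by
its normal form; on irreducible elements the equivalence is `1 + ε δ` itself. -/
theorem ofIrr_expEquiv_redInf (x : PathAlgebra (DualNumber k) V) :
    ofIrr (expEquiv hc δ) (redInf (dualPoint φ v) x) =
      redInf (fun s => constDual (φ s))
        (tensorHom hc.isReductionSet (preservesParallel_expEquiv hc hδ) x) := by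
  have hS := hc.isReductionSet
  have h1 : redInf (fun s => constDual (φ s))
      (tensorHom hS (preservesParallel_expEquiv hc hδ) (redInf (dualPoint φ v) x)) =
    redInf (fun s => constDual (φ s)) (tensorHom hS (preservesParallel_expEquiv hc hδ) x) := by
    obtain ⟨n, hn⟩ := redTerminates_of_prec hS hprec (dualPoint_mem hφ hv') x
    rw [redInf_eq _ hn]
    clear hn
    induction n with
    | zero => rfl
    | succ n ih => rw [Function.iterate_succ_apply', redInf_tensorHom_red hc hδ hprec hφ hv, ih]
  rw [← h1, redInf_tensorHom hc hδ hprec hφ]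
  have hu := redInf_mem (dualPoint φ v) x
  rw [ofIrr_expEquiv hc δ hu]
  refine dual_ext ?_ ?_
  · rw [fstDual_expDerivation, map_add, fstDual_eps_smul, add_zero, fstDual_constDual,
      hc.irrSection_proj_of_mem (fstDual_mem hu)]
  · rw [sndDual_expDerivation, map_add, sndDual_eps_smul, fstDual_constDual, sndDual_constDual,
      zero_add, map_add, hc.irrSection_proj_of_mem (sndDual_mem hu)]

-- The two normal forms at an overlap have the same image under the automorphism `expEquiv hc δ`,
-- hence coincide. No prior cocycle condition is needed.
include hc in
theorem systemUnique_dualPoint_of_isPathDerivation : SystemUnique (dualPoint φ v) := by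
  have hS := hc.isReductionSet
  have hD := dualPoint_mem hφ hv'
  rw [systemUnique_iff_overlaps hS hprec hD]
  intro x s' s r w h
  have h1 : ofIrr (expEquiv hc δ) (redInf (dualPoint φ v) (of _ w)) =
      ofIrr (expEquiv hc δ) (redInf (dualPoint φ v) (dualPoint φ v s * of _ r)) := by
    have e1 := expDerivation_rel hδ hv (QPath.idPath (s : QPath V).src) r s
    rw [idPath_mul_coch (mem_coch_of_cochPrec hD), PathAlgebra.idPath_mul,
      of_mul_factors h.factors] at e1
    rw [ofIrr_expEquiv_redInf hc hδ hprec hφ hv hv', ofIrr_expEquiv_redInf hc hδ hprec hφ hv hv',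
      redInf_tensorHom hc hδ hprec hφ, redInf_tensorHom hc hδ hprec hφ, e1, sndDual_of, map_zero,
      zero_add, fstDual_mul, fstDual_of, fstDual_of, fstDual_dualPoint, map_mul,
      ← Convergent.proj_rel φ s, ← map_mul, of_mul_factors h.factors]
  rw [← ofIrr_symm_ofIrr (expEquiv hc δ) (redInf_mem _ _), h1, ofIrr_symm_ofIrr _ (redInf_mem _ _)]

theorem isEquivalence_expEquiv :
    IsEquivalence (fun s => constDual (φ s)) (dualPoint φ v) (expEquiv hc δ) where
  parallel := preservesParallel_expEquiv hc hδ
  map_idPath i := by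
    rw [ofIrr_expEquiv hc δ (of_mem_irrMod (hc.isReductionSet.idPath_mem i)), expDerivation, lin_of,
      hδ.map_idPath, map_zero, map_zero, smul_zero, add_zero]
  map_red p := by
    rw [ofIrr_expEquiv_redInf hc hδ hprec hφ hv hv', tensorHom_of]

end Exponential

theorem systemUnique_and_equivalent_iff (hprec : IsAdmissible prec) (hφ : φ ∈ cochPrec k S prec)
    (hc : Convergent φ) (hv : v ∈ cochPrec k S prec) :
    (SystemUnique (dualPoint φ v) ∧
      Equivalent (fun s => baseChange (DualNumber k) (φ s)) (dualPoint φ v)) ↔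
      IsCoboundary φ v := by
  rw [isCoboundary_iff hc]
  constructor
  · rintro ⟨hu, T, hT⟩
    exact exists_isPathDerivation hprec hφ hc hv hu hT
  · rintro ⟨δ, hδ, h⟩
    exact ⟨systemUnique_dualPoint_of_isPathDerivation hc hδ hprec hφ h hv,
      _, isEquivalence_expEquiv hc hδ hprec hφ h hv⟩

end OrbitTangent

end

end ReductionSystem

theorem theorem9p2 {k : Type u} [Field k] [CharZero k]
    {V : Type v} [Quiver.{w} V] [Fintype V] [∀ i j : V, Finite (i ⟶ j)]
    (prec : QPath V → QPath V → Prop) (hprec : IsAdmissible prec)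
    (S : Set (QPath V)) (hS : IsReductionSet S)
    (φ : S → PathAlgebra k V) (hφ : φ ∈ coch k S S)
    (I : TwoSidedIdeal (PathAlgebra k V)) (hI : Diamond φ I)
    (hG : IsGroebnerBasis prec I
      (Set.range fun s : S => PathAlgebra.of k (s : QPath V) - φ s))
    (htip : ∀ s : S, IsTip prec (PathAlgebra.of k (s : QPath V) - φ s) s)
    (N : ℕ) (b : Module.Basis (Fin N) k (cochPrec k S prec)) :
    -- (i) the Maurer-Cartan equation gives polynomial equations for the variety
    ((∀ x p, (Function.support fun n => mcPolyDeg φ (fun i => (b i).1) x p (n + 1)).Finite) ∧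
      (∀ f : cochPrec k S prec, ∀ x,
        (Function.support fun n => mcTerm φ f.1 x (n + 1)).Finite ∧
        ∀ p, MvPolynomial.eval (b.equivFun f) (mcPoly φ (fun i => (b i).1) x p) =
          PathAlgebra.coeff p (irrSection φ (∑ᶠ n, mcTerm φ f.1 x (n + 1)))) ∧
      (∀ f : cochPrec k S prec, f.1 ∈ redVariety φ prec ↔ MaurerCartan φ f.1) ∧
      (∀ f : cochPrec k S prec, f.1 ∈ redVariety φ prec ↔
        ∀ g ∈ mcIdeal φ (fun i => (b i).1), MvPolynomial.eval (b.equivFun f) g = 0) ∧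
      (∀ (B : Type u) [CommRing B] [Algebra k B] (x : Fin N → B),
        SystemUnique (pointOver φ (fun i => (b i).1) B x) ↔
          ∀ g ∈ mcIdeal φ (fun i => (b i).1), MvPolynomial.aeval x g = 0)) ∧
    -- (ii) the groupoid of reduction systems, its restriction to the variety, and its orbits
    ((∀ f ∈ uniqueSystems k S, IsEquivalence f f (LinearEquiv.refl k (irrMod k S))) ∧
      (∀ f ∈ uniqueSystems k S, ∀ f' ∈ uniqueSystems k S, ∀ f'' ∈ uniqueSystems k S,
        ∀ T T', IsEquivalence f f' T → IsEquivalence f' f'' T' →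
          IsEquivalence f f'' (T'.trans T)) ∧
      (∀ f ∈ uniqueSystems k S, ∀ f' ∈ uniqueSystems k S,
        ∀ T, IsEquivalence f f' T → IsEquivalence f' f T.symm) ∧
      (∀ f ∈ redVariety φ prec, φ + f ∈ uniqueSystems k S) ∧
      (∀ f ∈ redVariety φ prec, ∀ f' ∈ redVariety φ prec,
        (Equivalent (φ + f) (φ + f') ↔ f' ∈ orbit φ prec f) ∧
        (f' ∈ orbit φ prec f ↔
          ∃ e : QuotAlg (φ + f) ≃ₐ[k] QuotAlg (φ + f'), ∀ i : V,
            e (proj (φ + f) (PathAlgebra.of k (QPath.idPath i))) =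
              proj (φ + f') (PathAlgebra.of k (QPath.idPath i))))) ∧
    -- (iii) the Zariski tangent space and the Kodaira-Spencer map
    (∀ f : cochPrec k S prec, f.1 ∈ redVariety φ prec →
      (∀ v, v ∈ tangentSpace φ b f ↔ IsCocycle (φ + f.1) v.1) ∧
      (∀ v : cochPrec k S prec,
        SystemUnique (dualPoint (φ + f.1) v.1) ↔ IsCocycle (φ + f.1) v.1) ∧
      ∃ KS : tangentSpace φ b f →ₗ[k] HH2 k (QuotAlg (φ + f.1)),
        ∀ v, ∃ h : dualG2 (φ + f.1) (toQuot (φ + f.1) v.1.1) ∈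
            hochCocycles k (QuotAlg (φ + f.1)),
          KS v = hochClass _ h) ∧
    -- (iv) the tangent space to the orbit
    (∀ f : cochPrec k S prec, f.1 ∈ redVariety φ prec → ∀ v : cochPrec k S prec,
      v ∈ orbitTangent φ prec f.1 ↔ IsCoboundary (φ + f.1) v.1) := by
  -- The terms of `φ_s` are irreducible, hence different from `s`, and they lie below `s` because
  -- `s` is the tip of `s - φ_s`.
  have hφ' : φ ∈ cochPrec k S prec := fun s p hp => by
    obtain ⟨hirr, hpar⟩ := hφ s p hp
    refine ⟨⟨hirr, hpar⟩, ?_⟩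
    have hne : p ≠ s := fun e => hirr s s.2 (e ▸ QPath.isSubpath_left (QPath.factors_idPath_right p))
    refine (htip s).2 p ?_ hne
    rw [map_sub, PathAlgebra.coeff_of, if_neg hne.symm, zero_sub]
    exact neg_ne_zero.mpr hp
  have hc : Convergent φ := convergent_of_systemUnique hS hprec hφ' hI.2
  have hmem : ∀ f ∈ cochPrec k S prec, φ + f ∈ cochPrec k S prec := fun f hf => add_mem hφ' hf
  have hconv : ∀ f ∈ redVariety φ prec, Convergent (φ + f) := fun f hf =>
    convergent_of_systemUnique hS hprec (hmem f hf.1) hf.2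
  have hb : ∀ i, (b i).1 ∈ cochPrec k S prec := fun i => (b i).2
  have hsum : ∀ f : cochPrec k S prec, (fun s => ∑ i, b.equivFun f i • (b i).1 s) = f.1 := fun f =>
    funext fun s => by
      have := congrArg (fun g : cochPrec k S prec => g.1 s) (b.sum_equivFun f)
      simp only [Submodule.coe_sum, Finset.sum_apply] at this
      exact this
  have hpoint : ∀ f : cochPrec k S prec,
      pointOver φ (fun i => (b i).1) k (b.equivFun f) = φ + f.1 := fun f => by
    rw [pointOver_self, hsum]
  have hvar : ∀ f : cochPrec k S prec, f.1 ∈ redVariety φ prec ↔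
      ∀ g ∈ mcIdeal φ (fun i => (b i).1), MvPolynomial.eval (b.equivFun f) g = 0 := fun f => by
    have := systemUnique_pointOver_iff hprec hφ' hc hb k (b.equivFun f)
    rw [hpoint] at this
    exact (and_iff_right f.2).trans this
  refine ⟨⟨finite_support_mcPolyDeg hprec hφ' hc hb, fun f x => ⟨?_, fun p => ?_⟩, fun f => ?_, hvar,
    fun B _ _ x => systemUnique_pointOver_iff hprec hφ' hc hb B x⟩, ⟨?_, ?_, ?_, ?_, ?_⟩, ?_, ?_⟩
  · exact finite_support_mcTerm hprec hφ' hc f.2 x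
  · rw [eval_mcPoly hprec hφ' hc hb, hsum]
  · rw [hvar, ← maurerCartan_iff hprec hφ' hc hb, hsum]
  · exact fun f _ => IsEquivalence.refl hS f
  · exact fun f hf f' hf' f'' _ T T' h h' => h.trans h' (convergent_of_mem_uniqueSystems hS hf)
      (convergent_of_mem_uniqueSystems hS hf')
  · exact fun f hf f' hf' T h => h.symm (convergent_of_mem_uniqueSystems hS hf)
      (convergent_of_mem_uniqueSystems hS hf')
  · exact fun f hf => ⟨mem_coch_of_cochPrec (hmem f hf.1), hf.2⟩
  · intro f hf f' hf'
    refine ⟨⟨fun h => ⟨hf', h⟩, fun h => h.2⟩, ⟨?_, ?_⟩⟩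
    · rintro ⟨-, T, hT⟩
      exact hT.exists_algEquiv (hconv f hf) (hconv f' hf')
    · rintro ⟨e, he⟩
      exact ⟨hf', equivalent_of_algEquiv (hconv f hf) (hconv f' hf') e he⟩
  · intro f hf
    have hcf := hconv f.1 hf
    have h1 : ∀ v : cochPrec k S prec,
        SystemUnique (dualPoint (φ + f.1) v.1) ↔ IsCocycle (φ + f.1) v.1 := fun v =>
      systemUnique_dualPoint_iff hprec (hmem f.1 f.2) hcf v.2
    have h2 : ∀ v, v ∈ tangentSpace φ b f ↔ IsCocycle (φ + f.1) v.1 := fun v =>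
      (mem_tangentSpace_iff hprec hφ' hc b f v ((hvar f).mp hf)).trans (h1 v)
    have h3 : ∀ v ∈ tangentSpace φ b f, dualG2 (φ + f.1) (toQuot (φ + f.1) v.1) ∈
        hochCocycles k (QuotAlg (φ + f.1)) := fun v hv =>
      dualG2_mem_hochCocycles hprec (hmem f.1 f.2) hcf v.2 ((h2 v).mp hv)
    exact ⟨h2, h1, kodairaSpencer (φ + f.1) (tangentSpace φ b f) h3, fun v => ⟨h3 v.1 v.2, rfl⟩⟩
  · exact fun f hf v =>
      systemUnique_and_equivalent_iff hprec (hmem f.1 f.2) (hconv f.1 hf) v.2
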